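/- Let $\mathsf k$ be any field of characteristic zero (not necessarily algebraically closed), let $n\ge 0$, and let $U_n=U(\mathfrak{gl}_n(\mathsf k))$, with matrix units $E_{ij}$. Let $Z\subset U_n$ be the Gelfand–Tsetlin subalgebra, generated by the centers of $U(\mathfrak{gl}_1)\subset U(\mathfrak{gl}_2)\subset\dots\subset U(\mathfrak{gl}_n)$, where $\mathfrak{gl}_m$ is the upper left corner of $\mathfrak{gl}_n$. **Notation.** Let $\Lambda=\mathsf k[x_{mi}\mid 1\le i\le m\le n]$ and $L=\operatorname{Frac}\Lambda$. Let $G=S_1\times\dots\times S_n$, where $S_m$ permutes $x_{m1},\dots,x_{mm}$, and let $\mathcal M\cong\mathbb Z^{n(n-1)/2}$ be the group of automorphisms of $\Lambda$ generated by the shifts $\delta_{mi}$, $1\le i\le m\le n-1$, where $\delta_{mi}(x_{mi})=x_{mi}-1$ and $\delta_{mi}$ fixes the other variables. Put $\Gamma=\Lambda^G$, $K=\operatorname{Frac}\Gamma$, let $L*\mathcal M$ be the skew monoid ring, with $(a\mu)(b\nu)=a\,\mu(b)\,\mu\nu$, and let $\mathcal K=(L*\mathcal M)^G$, where $g\in G$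 acts by $a\mu\mapsto g(a)\,g\mu g^{-1}$. A subring $U$ of $\mathcal K$ that contains $\Gamma$ and is finitely generated over $\Gamma$ is called a Galois $\Gamma$-ring if $KU=UK=\mathcal K$. **Theorem.** (1) $\Lambda$ is integrally closed, $G$ is finite, $\mathcal M\mathcal M^{-1}\cap G=\{1\}$, $G$ normalizes $\mathcal M$, and $\Lambda$ is a Noetherian $\Lambda^G$-module. There is an injective homomorphism of $\mathsf k$-algebras $\varphi:U_n\to \mathcal K\subset L*\mathcal M$ given by the Gelfand–Tsetlin formulas $$\varphi(E_{mm})=\sum_{i=1}^m (x_{mi}+i-1)-\sum_{i=1}^{m-1}(x_{m-1,i}+i-1)\quad(1\le m\le n),$$ $$\varphi(E_{m,m+1})=-\sum_{i=1}^m\delta_{mi}\,\frac{\prod_{j=1}^{m+1}(x_{m+1,j}-x_{mi})}{\prod_{j\ne i}(x_{mj}-x_{mi})},\qquad \varphi(E_{m+1,m})=\sum_{i=1}^m\delta_{mi}^{-1}\,\frac{\prod_{j=1}^{m-1}(x_{m-1,j}-x_{mi})}{\prod_{j\ne i}(x_{mj}-x_{mi})}\quad(1\le m\le n-1),$$ such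 that $\varphi(Z)=\Gamma$ and $\varphi(U_n)$ is a Galois $\Gamma$-ring in $\mathcal K$. That is, $U_n$ is a Galois ring over its Gelfand–Tsetlin subalgebra. (2) The Gelfand–Kirillov conjecture holds for $U_n$ over $\mathsf k$: $U_n$ and $W_{n(n-1)/2}(\mathsf k)\otimes_{\mathsf k}\mathsf k(t_1,\dots,t_n)$ are (left and right) Ore domains, and their skew fields of fractions are isomorphic as $\mathsf k$-algebras, where $W_N(\mathsf k)$ is the $N$-th Weyl algebra, generated by $x_1,\dots,x_N,\partial_1,\dots,\partial_N$ with relations $[x_i,x_j]=[\partial_i,\partial_j]=0$, $[\partial_i,x_j]=\delta_{ij}$. -/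

import Mathlib

open scoped nonZeroDivisors TensorProduct

noncomputable section

/-! ## Ore domains and skew fields of fractions -/

/-- A left and right Ore domain. -/
class IsOreDomain (R : Type*) [Ring R] : Prop extends IsDomain R where
  left_ore : ∀ a s : R, s ≠ 0 → ∃ b t : R, t ≠ 0 ∧ t * a = b * s
  right_ore : ∀ a s : R, s ≠ 0 → ∃ b t : R, t ≠ 0 ∧ a * t = s * b

instance IsOreDomain.oreSet (R : Type*) [Ring R] [IsOreDomain R] : OreLocalization.OreSet R⁰ :=
  OreLocalization.oreSetOfNoZeroDivisors
    (fun r s => (IsOreDomain.left_ore r s (nonZeroDivisors.ne_zero s.2)).choose)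
    (fun r s => ⟨(IsOreDomain.left_ore r s (nonZeroDivisors.ne_zero s.2)).choose_spec.choose,
      mem_nonZeroDivisors_of_ne_zero
        (IsOreDomain.left_ore r s (nonZeroDivisors.ne_zero s.2)).choose_spec.choose_spec.1⟩)
    (fun r s => (IsOreDomain.left_ore r s
      (nonZeroDivisors.ne_zero s.2)).choose_spec.choose_spec.2)

/-- The skew field of fractions of an Ore domain. -/
abbrev SkewFrac (R : Type*) [Ring R] [IsOreDomain R] : Type _ := OreLocalization R⁰ R

/-! ## Weyl algebras -/

/-- The defining relations of the `N`-th Weyl algebra; `Sum.inl i` is `x_i`, `Sum.inr i` is `∂_i`. -/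
inductive WeylAlgebra.Rel (k : Type*) [Field k] (N : ℕ) :
    FreeAlgebra k (Fin N ⊕ Fin N) → FreeAlgebra k (Fin N ⊕ Fin N) → Prop
  | x_comm (i j : Fin N) : WeylAlgebra.Rel k N
      (FreeAlgebra.ι k (Sum.inl i) * FreeAlgebra.ι k (Sum.inl j))
      (FreeAlgebra.ι k (Sum.inl j) * FreeAlgebra.ι k (Sum.inl i))
  | d_comm (i j : Fin N) : WeylAlgebra.Rel k N
      (FreeAlgebra.ι k (Sum.inr i) * FreeAlgebra.ι k (Sum.inr j))
      (FreeAlgebra.ι k (Sum.inr j) * FreeAlgebra.ι k (Sum.inr i))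
  | d_x (i j : Fin N) : WeylAlgebra.Rel k N
      (FreeAlgebra.ι k (Sum.inr i) * FreeAlgebra.ι k (Sum.inl j))
      (FreeAlgebra.ι k (Sum.inl j) * FreeAlgebra.ι k (Sum.inr i) + if i = j then 1 else 0)

/-- The `N`-th Weyl algebra over `k`. -/
abbrev WeylAlgebra (k : Type*) [Field k] (N : ℕ) : Type _ := RingQuot (WeylAlgebra.Rel k N)

/-! ## Galois rings -/

namespace GaloisRing

variable {Λ : Type*} [CommRing Λ] [IsDomain Λ]

/-- Automorphisms of `Λ` act on the fraction field of `Λ`. -/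
instance autAction : MulSemiringAction (RingAut Λ) (FractionRing Λ) :=
  IsFractionRing.mulSemiringAction (RingAut Λ) Λ (FractionRing Λ)

/-- The standing assumptions on `Λ`, a finite group `G` and a monoid `M` of automorphisms of `Λ`. -/
structure Setting (G : Subgroup (RingAut Λ)) (M : Submonoid (RingAut Λ)) : Prop where
  integrallyClosed : IsIntegrallyClosed Λ
  finite : Finite G
  separated : ∀ μ ∈ M, ∀ ν ∈ M, μ * ν⁻¹ ∈ G → μ * ν⁻¹ = 1
  conj_mem : ∀ g ∈ G, ∀ μ ∈ M, g * μ * g⁻¹ ∈ M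
  noetherian : IsNoetherian (FixedPoints.subring Λ G) Λ

/-- The skew monoid ring `L * M`, where `L = Frac Λ`, with `(a μ) (b ν) = (a μ(b)) (μ ν)`. -/
abbrev SkewRing (M : Submonoid (RingAut Λ)) : Type _ := SkewMonoidAlgebra (FractionRing Λ) M

/-- The inclusion of `L` in `L * M`. -/
abbrev coeffHom (M : Submonoid (RingAut Λ)) : FractionRing Λ →+* SkewRing M :=
  SkewMonoidAlgebra.singleOneRingHom

theorem coeffHom_apply (M : Submonoid (RingAut Λ)) (a : FractionRing Λ) :
    coeffHom M a = SkewMonoidAlgebra.single 1 a := rfl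

/-- Conjugation of `M` by an element of `G`. -/
def conjHom {G : Subgroup (RingAut Λ)} {M : Submonoid (RingAut Λ)} (h : Setting G M) (g : G) :
    M →* M where
  toFun μ := ⟨g * μ * (g : RingAut Λ)⁻¹, h.conj_mem g g.2 μ μ.2⟩
  map_one' := by ext; simp
  map_mul' μ ν := by ext; simp

/-- The action of `g ∈ G` on `L * M`: `a μ ↦ g(a) (g μ g⁻¹)`. -/
def twist {G : Subgroup (RingAut Λ)} {M : Submonoid (RingAut Λ)} (h : Setting G M) (g : G) :
    SkewRing M →+* SkewRing M :=
  SkewMonoidAlgebra.liftNCRingHom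
    ((coeffHom M).comp (MulSemiringAction.toRingHom (RingAut Λ) (FractionRing Λ) g))
    ((SkewMonoidAlgebra.of (FractionRing Λ) M).comp (conjHom h g))
    (by
      intro a μ
      simp only [RingHom.comp_apply, MonoidHom.comp_apply, MulSemiringAction.toRingHom_apply,
        SkewMonoidAlgebra.of_apply, coeffHom_apply,
        SkewMonoidAlgebra.single_mul_single, one_mul, mul_one, one_smul]
      congr 1
      rw [Submonoid.smul_def, Submonoid.smul_def, smul_smul, smul_smul]
      simp [conjHom])

theorem twist_single {G : Subgroup (RingAut Λ)} {M : Submonoid (RingAut Λ)} (h : Setting G M)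
    (g : G) (μ : M) (a : FractionRing Λ) :
    twist h g (SkewMonoidAlgebra.single μ a) =
      SkewMonoidAlgebra.single (conjHom h g μ) ((g : RingAut Λ) • a) := by
  change SkewMonoidAlgebra.liftNC _ _ _ = _
  rw [SkewMonoidAlgebra.liftNC_single]
  simp [coeffHom_apply, SkewMonoidAlgebra.single_mul_single]

/-- The ring `𝒦 = (L * M)^G`. -/
def invariants {G : Subgroup (RingAut Λ)} {M : Submonoid (RingAut Λ)} (h : Setting G M) :
    Subring (SkewRing M) :=
  ⨅ g : G, (twist h g).eqLocus (RingHom.id (SkewRing M))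

/-- The ring `Γ = Λ^G`, as a subring of `L * M`. -/
def baseRing (G : Subgroup (RingAut Λ)) (M : Submonoid (RingAut Λ)) : Subring (SkewRing M) :=
  (FixedPoints.subring Λ G).map ((coeffHom M).comp (algebraMap Λ (FractionRing Λ)))

/-- The field `K = Frac Γ`, as a subring of `L * M`. -/
def baseField (G : Subgroup (RingAut Λ)) (M : Submonoid (RingAut Λ)) : Subring (SkewRing M) :=
  (Subfield.closure (algebraMap Λ (FractionRing Λ) '' (FixedPoints.subring Λ G))).toSubring.map
    (coeffHom M)

/-- `U` is a Galois `Γ`-ring in `𝒦 = (L * M)^G`: a subring of `𝒦` that contains `Γ`, is finitely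
generated over `Γ`, and satisfies `K U = U K = 𝒦`. -/
structure IsGaloisRing {G : Subgroup (RingAut Λ)} {M : Submonoid (RingAut Λ)} (h : Setting G M)
    (U : Subring (SkewRing M)) : Prop where
  le_invariants : U ≤ invariants h
  baseRing_le : baseRing G M ≤ U
  finitelyGenerated : ∃ s : Finset (SkewRing M), Subring.closure (baseRing G M ∪ s) = U
  field_mul : AddSubgroup.closure {z | ∃ a ∈ baseField G M, ∃ u ∈ U, z = a * u} =
    (invariants h).toAddSubgroup
  mul_field : AddSubgroup.closure {z | ∃ a ∈ baseField G M, ∃ u ∈ U, z = u * a} =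
    (invariants h).toAddSubgroup

end GaloisRing

/-! ## The enveloping algebra of `gl_n` and its Gelfand-Tsetlin realization -/

namespace GelfandTsetlin

attribute [local instance] LieRing.ofAssociativeRing

variable (k : Type*) [Field k] (n : ℕ)

/-- The enveloping algebra of `gl_n(k)`. -/
abbrev Ugl : Type _ := UniversalEnvelopingAlgebra k (Matrix (Fin n) (Fin n) k)

variable {n} in
/-- The matrix unit `E_ij` in `U(gl_n)`. -/
def E (i j : Fin n) : Ugl k n := UniversalEnvelopingAlgebra.ι k (Matrix.single i j 1)

/-- `U(gl_m)`, for `m ≤ n`, as the subalgebra of `U(gl_n)` generated by the upper left corner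
`gl_m` of `gl_n`. -/
def corner (m : ℕ) : Subalgebra k (Ugl k n) :=
  Algebra.adjoin k {u | ∃ i j : Fin n, i.val < m ∧ j.val < m ∧ u = E k i j}

/-- The Gelfand-Tsetlin subalgebra: it is generated by the centers of `U(gl_1), …, U(gl_n)`. -/
def gtSubalgebra : Subalgebra k (Ugl k n) :=
  ⨆ m : Fin n, (Subalgebra.center k (corner k n (m + 1))).map (corner k n (m + 1)).val

/-- The positions in a triangular array with rows of lengths `1, …, n`; the position `⟨r, j⟩`
(counted from `0`) is the `j`-th entry of the `r`-th row. -/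
abbrev Pos : Type := Σ r : Fin n, Fin (r.val + 1)

/-- The polynomial ring in the `n (n + 1) / 2` variables `x_p`. -/
abbrev PolyRing : Type _ := MvPolynomial (Pos n) k

/-- `S_1 × ⋯ × S_n` acts on the polynomial ring, where `S_m` permutes the variables of the row of
length `m`. -/
def permHom : (∀ r : Fin n, Equiv.Perm (Fin (r.val + 1))) →* RingAut (PolyRing k n) where
  toFun σ := (MvPolynomial.renameEquiv k (Equiv.sigmaCongrRight σ)).toRingEquiv
  map_one' := RingEquiv.ext fun f =>
    (congrArg (fun e => MvPolynomial.renameEquiv k e f) Equiv.sigmaCongrRight_refl).trans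
      (by simp)
  map_mul' σ τ := RingEquiv.ext fun f => by
    change MvPolynomial.rename _ f = MvPolynomial.rename _ (MvPolynomial.rename _ f)
    rw [MvPolynomial.rename_rename]
    rfl

/-- The group `S_1 × ⋯ × S_n` of automorphisms of the polynomial ring. -/
def permGroup : Subgroup (RingAut (PolyRing k n)) := (permHom k n).range

variable {n} in
/-- The shift `x_p ↦ x_p - 1`, `x_q ↦ x_q` for `q ≠ p`. -/
def shift (p : Pos n) : RingAut (PolyRing k n) :=
  (AlgEquiv.ofAlgHom
    (MvPolynomial.aeval fun q => MvPolynomial.X q - if q = p then 1 else 0)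
    (MvPolynomial.aeval fun q => MvPolynomial.X q + if q = p then 1 else 0)
    (by ext q; simp) (by ext q; simp)).toRingEquiv

/-- The group of automorphisms of the polynomial ring that is generated by the shifts of the
variables outside the last row; it is free abelian of rank `n (n - 1) / 2`. -/
def shiftMonoid : Submonoid (RingAut (PolyRing k n)) :=
  (Subgroup.closure {δ | ∃ p : Pos n, p.1.val + 1 < n ∧ δ = shift k p}).toSubmonoid

/-- The skew ring `k(x_p) * ℤ^{n (n - 1) / 2}` of shift operators. -/
abbrev ShiftRing : Type _ := GaloisRing.SkewRing (shiftMonoid k n)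

variable {n} in
/-- The shift at a position outside the last row, as an element of the skew ring. -/
def δ (p : Pos n) (hp : p.1.val + 1 < n) : ShiftRing k n :=
  SkewMonoidAlgebra.of _ _ ⟨shift k p, Subgroup.subset_closure ⟨p, hp, rfl⟩⟩

variable {n} in
/-- The inverse of `δ`. -/
def δInv (p : Pos n) (hp : p.1.val + 1 < n) : ShiftRing k n :=
  SkewMonoidAlgebra.of _ _
    ⟨(shift k p)⁻¹, Subgroup.inv_mem _ (Subgroup.subset_closure ⟨p, hp, rfl⟩)⟩

variable {n} in
/-- The variable `x_p` in the field of rational functions. -/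
def x (p : Pos n) : FractionRing (PolyRing k n) := algebraMap (PolyRing k n) _ (MvPolynomial.X p)

/-- The row of length `m` of the array (empty if `m = 0` or `m > n`). -/
def row (m : ℕ) : Finset (Pos n) := {p | p.1.val + 1 = m}

variable {n} in
/-- `A_p^+ = - ∏_q (x_q - x_p) / ∏_{q'} (x_{q'} - x_p)`, where `q` runs through the row below
that of `p` (it is longer by one), and `q' ≠ p` runs through the row of `p`. -/
def Aplus (p : Pos n) : FractionRing (PolyRing k n) :=
  -(∏ q ∈ row n (p.1.val + 2), (x k q - x k p)) /
    ∏ q ∈ (row n (p.1.val + 1)).erase p, (x k q - x k p)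

variable {n} in
/-- `A_p^- = ∏_q (x_q - x_p) / ∏_{q'} (x_{q'} - x_p)`, where `q` runs through the row above
that of `p` (it is shorter by one), and `q' ≠ p` runs through the row of `p`. -/
def Aminus (p : Pos n) : FractionRing (PolyRing k n) :=
  (∏ q ∈ row n p.1.val, (x k q - x k p)) /
    ∏ q ∈ (row n (p.1.val + 1)).erase p, (x k q - x k p)

/-- The Gelfand-Tsetlin formulas for a homomorphism from `U(gl_n)` to the skew ring of shift
operators, on the generators `E_ii`, `E_{i,i+1}`, `E_{i+1,i}`. -/
structure GTFormulas (φ : Ugl k n →+* ShiftRing k n) : Prop where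
  diag (i : Fin n) : φ (E k i i) = GaloisRing.coeffHom (shiftMonoid k n)
    (∑ p ∈ row n (i.val + 1), (x k p + (p.2.val : FractionRing (PolyRing k n))) -
      ∑ p ∈ row n i.val, (x k p + (p.2.val : FractionRing (PolyRing k n))))
  raising (i : Fin n) (hi : i.val + 1 < n) : φ (E k i ⟨i.val + 1, hi⟩) =
    ∑ j : Fin (i.val + 1), δ k ⟨i, j⟩ hi * GaloisRing.coeffHom (shiftMonoid k n) (Aplus k ⟨i, j⟩)
  lowering (i : Fin n) (hi : i.val + 1 < n) : φ (E k ⟨i.val + 1, hi⟩ i) =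
    ∑ j : Fin (i.val + 1),
      δInv k ⟨i, j⟩ hi * GaloisRing.coeffHom (shiftMonoid k n) (Aminus k ⟨i, j⟩)

end GelfandTsetlin

end

/-!
# The enveloping algebra of `gl_n` as a Galois ring, and the Gelfand-Kirillov conjecture

Write `L` for the field of rational functions in the variables `x_p`, where the position `p` runs
over a triangular pattern with rows of lengths `1, …, n`, and `L * M` for the ring of shift
operators.

**The homomorphism.** The formulas define the images of the generators of `gl_n`, and it is enough
to check the Serre relations (`SerreRelations.linearMap_lie`, `serreRelations`). The main one is the
commutator of the raising and the lowering element of a row: its coefficients are the residues of a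
rational function `N / D` whose poles are the points `x_p` and `x_p + 1`, for `p` in the row, so it
is read off from the top coefficients of `N` (`lie_ePow_fRow`, `eRow_ef`).

**The Gelfand-Tsetlin subalgebra.** The elements `∑_p x_p ^ l e_p`, where `e_p` are the terms of the
raising element, are obtained from it by commutators with the quadratic power sum of the row. Their
commutators with the lowering element are the sums of residues of `u ^ l N / D`, and these determine
the coefficients of `N`; by induction the symmetric functions of all rows lie in the image
(`rowPoly_mem_polyOver_cornerFun`). Conversely, the image acts from the right on the rational
functions and preserves the invariant polynomials, because a sum of residues of a rational function
is a polynomial expression in the coefficients of numerator and denominator (`fold_mem_gammaAlg`).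
So a rational function in the image is an invariant polynomial. The images of central elements are
rational functions, because these are their own centralizer (`exists_eq_cf_of_commute`). Together
this identifies the image of the Gelfand-Tsetlin subalgebra (`map_gtSubalgebra`).

**Galois ring.** The shifts of a row take distinct values on its quadratic power sum, so Lagrange
interpolation separates the terms of the raising and the lowering elements. Hence the image spans
`L * M` over `L` (`single_mem_span_filtration`, `span_cornerImage`), and averages over the
permutation group `G` give `K U = (L * M)^G` (`closure_field_mul`). The anti-automorphism `rev` of
`L * M`, which inverts the shifts, gives `U K = (L * M)^G`.

**Injectivity.** The previous argument is quantitative: the dimension of the part of degree at most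
`d` of the image is at least of the order of `d ^ (n²)` (`exists_pow_le_finrank`). The enveloping
algebra is spanned by the ordered monomials in the `n²` matrix units, and an element of the kernel
would be a relation between their images, which lowers the degree of growth
(`finrank_wordSpan_le_of_relation`). This also replaces the Poincaré-Birkhoff-Witt theorem.

**The skew field of fractions.** All rings in question are domains of polynomial growth, hence Ore
domains (`isOreDomain_of_growth`). Let `Q` be the skew field of fractions of `L * M`. The skew field
of `U(gl_n)` is `Q^G` (`FractionModel.mem_closure_gtHom_iff`), by the general fact that a skew
subfield of `Q^G` is all of `Q^G` if its span with a copy of `L` on which `G` acts as on `L` is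
stable under multiplication by generators of `Q` (`FractionModel.mem_of_perm_fixed`). For the Weyl
algebra, the shifts of each row outside the last one are taken as commuting variables, on which `x_p`
acts by the Euler derivation. The power sums of the shifts of each row are invariant coordinates,
since their Jacobian matrix is a Vandermonde matrix up to nonzero factors. The dual coordinates,
combinations of the `x_p` with the entries of the inverse Jacobian matrix as coefficients, commute
with each other and are invariant as well
(`DualCoordinates.dual_comm`, `FractionModel.exists_dualCoordinates`). Together with the symmetric
rational functions of the last row, which are central, they define a homomorphism from the Weyl
algebra; it is injective, since a Weyl algebra over a field of characteristic zero is simple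
(`WeylAlgebra.tensor_hom_injective`), and its image generates `Q^G`
(`FractionModel.exists_weylHom`).
-/

/-! ### Growth and the Ore condition -/

/-- An exponential function is not bounded by a polynomial. -/
theorem exists_polynomial_lt_two_pow (C N c : ℕ) : ∃ j : ℕ, C * (c * j + 1) ^ N < 2 ^ j := by
  have h := (isLittleO_pow_const_const_pow_of_one_lt (R := ℝ) N (r := 2) (by norm_num)).def
    (c := (1 / (2 * ((C : ℝ) + 1) * (c + 1) ^ N))) (by positivity)
  obtain ⟨a, ha⟩ := Filter.eventually_atTop.1 h
  refine ⟨a, ?_⟩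
  have h1 := ha (a + 1) (by omega)
  rw [Real.norm_of_nonneg (by positivity), Real.norm_of_nonneg (by positivity), div_mul_eq_mul_div,
    one_mul, le_div_iff₀ (by positivity), pow_succ] at h1
  have h2 : (C : ℝ) * (c * a + 1) ^ N < 2 ^ a := by
    have h3 : ((c : ℝ) * a + 1) ^ N ≤ ((c + 1) * (a + 1)) ^ N := by
      gcongr
      nlinarith [(Nat.cast_nonneg a : (0 : ℝ) ≤ a), (Nat.cast_nonneg c : (0 : ℝ) ≤ c)]
    rw [mul_pow] at h3
    have h4 : (0 : ℝ) < (c + 1) ^ N * (a + 1) ^ N := by positivity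
    push_cast at h1
    have h5 : (C : ℝ) * (c * a + 1) ^ N ≤ C * ((c + 1) ^ N * (a + 1) ^ N) := by gcongr
    nlinarith
  exact_mod_cast h2

/-- Two linear maps that raise a filtration of polynomial growth by a bounded amount have a common
value, apart from the trivial one. -/
theorem exists_map_eq_map_of_growth {D V : Type*} [DivisionRing D] [AddCommGroup V] [Module D V]
    (F : ℕ → Submodule D V) [∀ d, FiniteDimensional D (F d)] (C N : ℕ)
    (hF : ∀ d, Module.finrank D (F d) ≤ C * (d + 1) ^ N) (h0 : F 0 ≠ ⊥) (f g : V →ₗ[D] V) (c : ℕ)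
    (hf : ∀ d, ∀ v ∈ F d, f v ∈ F (d + c)) (hg : ∀ d, ∀ v ∈ F d, g v ∈ F (d + c)) :
    ∃ t b : V, (t ≠ 0 ∨ b ≠ 0) ∧ f t = g b := by
  by_contra! hcon
  have key : ∀ d, 2 * Module.finrank D (F d) ≤ Module.finrank D (F (d + c)) := by
    intro d
    let φ : (F d × F d) →ₗ[D] F (d + c) :=
      LinearMap.coprod (f.restrict (hf d)) (-(g.restrict (hg d)))
    have hφ : Function.Injective φ := by
      rw [← LinearMap.ker_eq_bot, LinearMap.ker_eq_bot']
      rintro ⟨t, b⟩ h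
      have h1 : f t = g b := by
        have := congrArg Subtype.val h
        simpa [φ, LinearMap.restrict_apply, ← sub_eq_add_neg, sub_eq_zero] using this
      by_contra h2
      refine hcon t b ?_ h1
      by_contra! h3
      exact h2 (Prod.ext (Subtype.ext h3.1) (Subtype.ext h3.2))
    have := LinearMap.finrank_le_finrank_of_injective hφ
    rw [Module.finrank_prod] at this
    omega
  have hpow : ∀ j, 2 ^ j ≤ Module.finrank D (F (c * j)) := by
    intro j
    induction j with
    | zero =>
      rw [pow_zero, mul_zero, Nat.one_le_iff_ne_zero]
      intro h
      exact h0 (Submodule.finrank_eq_zero.1 h)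
    | succ j ih =>
      have := key (c * j)
      rw [pow_succ, mul_add, mul_one]
      omega
  obtain ⟨j, hj⟩ := exists_polynomial_lt_two_pow C N c
  have := (hpow j).trans (hF (c * j))
  omega

/-- A domain that is filtered by subspaces of polynomially growing dimension over a division ring
acting on the left satisfies the left Ore condition. -/
theorem left_ore_of_growth {D R : Type*} [DivisionRing D] [Ring R] [IsDomain R] [Module D R]
    [IsScalarTower D R R] (F : ℕ → Submodule D R) [∀ d, FiniteDimensional D (F d)] (C N : ℕ)
    (hF : ∀ d, Module.finrank D (F d) ≤ C * (d + 1) ^ N) (h0 : F 0 ≠ ⊥)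
    (hmul : ∀ a : R, ∃ c, ∀ e, c ≤ e → ∀ d, ∀ v ∈ F d, v * a ∈ F (d + e))
    (a s : R) (hs : s ≠ 0) : ∃ b t : R, t ≠ 0 ∧ t * a = b * s := by
  obtain ⟨c₁, h₁⟩ := hmul a
  obtain ⟨c₂, h₂⟩ := hmul s
  let r (x : R) : R →ₗ[D] R :=
    { toFun := fun v => v * x, map_add' := fun _ _ => add_mul _ _ _,
      map_smul' := fun d v => smul_mul_assoc d v x }
  obtain ⟨t, b, h, hab⟩ := exists_map_eq_map_of_growth F C N hF h0 (r a) (r s) (max c₁ c₂)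
    (h₁ _ (le_max_left _ _)) (h₂ _ (le_max_right _ _))
  refine ⟨b, t, ?_, hab⟩
  rintro rfl
  have h3 : b * s = 0 := by simpa [r] using hab.symm
  rcases mul_eq_zero.1 h3 with h4 | h4
  · simp [h4] at h
  · exact hs h4

/-- An algebra over a field that is a domain with a filtration of polynomial growth, with
`F_d a ⊆ F_{d + c}` and `a F_d ⊆ F_{d + c}`, is an Ore domain. -/
theorem isOreDomain_of_growth {D R : Type*} [Field D] [Ring R] [IsDomain R] [Algebra D R]
    (F : ℕ → Submodule D R) [∀ d, FiniteDimensional D (F d)] (C N : ℕ)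
    (hF : ∀ d, Module.finrank D (F d) ≤ C * (d + 1) ^ N) (h0 : F 0 ≠ ⊥)
    (hmul : ∀ a : R, ∃ c, ∀ e, c ≤ e → ∀ d, ∀ v ∈ F d, v * a ∈ F (d + e))
    (hmul' : ∀ a : R, ∃ c, ∀ e, c ≤ e → ∀ d, ∀ v ∈ F d, a * v ∈ F (d + e)) : IsOreDomain R where
  left_ore := left_ore_of_growth F C N hF h0 hmul
  right_ore a s hs := by
    obtain ⟨c₁, h₁⟩ := hmul' a
    obtain ⟨c₂, h₂⟩ := hmul' s
    obtain ⟨t, b, h, hab⟩ := exists_map_eq_map_of_growth F C N hF h0 (LinearMap.mulLeft D a)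
      (LinearMap.mulLeft D s) (max c₁ c₂) (h₁ _ (le_max_left _ _)) (h₂ _ (le_max_right _ _))
    refine ⟨b, t, ?_, hab⟩
    rintro rfl
    have h3 : s * b = 0 := by simpa using hab.symm
    rcases mul_eq_zero.1 h3 with h4 | h4
    · exact hs h4
    · simp [h4] at h

/-! ### Skew fields of fractions inside a division ring -/

namespace SkewFrac

variable {R Q : Type*} [Ring R] [IsOreDomain R] [DivisionRing Q]

/-- The extension to the skew field of fractions of an injective homomorphism into a division
ring. -/
noncomputable def lift (f : R →+* Q) (hf : Function.Injective f) : SkewFrac R →+* Q :=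
  OreLocalization.universalHom f
    { toFun := fun s => Units.mk0 (f s) fun h =>
        nonZeroDivisors.ne_zero s.2 (hf (h.trans (map_zero f).symm))
      map_one' := Units.ext (by simp)
      map_mul' := fun a b => Units.ext (by simp) } (fun _ => rfl)

theorem lift_numerator (f : R →+* Q) (hf : Function.Injective f) (r : R) :
    lift f hf (OreLocalization.numeratorRingHom r) = f r :=
  OreLocalization.universalHom_commutes _ _ _

theorem ringHom_ext {S : Type*} [DivisionRing S] {f g : SkewFrac R →+* S}
    (h : ∀ r : R, f (OreLocalization.numeratorRingHom r) =
      g (OreLocalization.numeratorRingHom r)) : f = g := by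
  have hf : Function.Injective (f.comp OreLocalization.numeratorRingHom) :=
    f.injective.comp (OreLocalization.numeratorHom_inj inf_le_left)
  have key : ∀ g : SkewFrac R →+* S, (∀ r : R, g (OreLocalization.numeratorRingHom r) =
      f (OreLocalization.numeratorRingHom r)) →
      g = lift (f.comp OreLocalization.numeratorRingHom) hf := fun g hg =>
    OreLocalization.universalHom_unique _ _ _ g hg
  rw [key f fun _ => rfl, key g fun r => (h r).symm]

theorem fieldRange_lift (f : R →+* Q) (hf : Function.Injective f) :
    (lift f hf).fieldRange = Subfield.closure (Set.range f) := by
  apply le_antisymm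
  · rintro _ ⟨q, rfl⟩
    induction q using OreLocalization.ind with | _ r s
    have h : lift f hf (r /ₒ s) = (f s)⁻¹ * f r := by
      refine (OreLocalization.universalHom_apply _ _ _).trans ?_
      rw [Units.val_inv_eq_inv_val]
      rfl
    change lift f hf (r /ₒ s) ∈ _
    rw [h]
    exact mul_mem (inv_mem (Subfield.subset_closure ⟨s, rfl⟩)) (Subfield.subset_closure ⟨r, rfl⟩)
  · rw [Subfield.closure_le]
    rintro _ ⟨r, rfl⟩
    exact ⟨_, lift_numerator f hf r⟩

theorem closure_range_numerator :
    Subfield.closure (Set.range (OreLocalization.numeratorRingHom : R →+* SkewFrac R)) = ⊤ := by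
  have hinj : Function.Injective (OreLocalization.numeratorRingHom : R →+* SkewFrac R) :=
    OreLocalization.numeratorHom_inj inf_le_left
  rw [← fieldRange_lift _ hinj, eq_top_iff]
  rintro q -
  have : lift _ hinj = RingHom.id (SkewFrac R) := ringHom_ext fun r => lift_numerator _ hinj r
  exact ⟨q, by rw [this]; rfl⟩

variable {k R' : Type*} [Field k] [Algebra k R] [Ring R'] [IsOreDomain R'] [Algebra k R']
  [Algebra k Q]

/-- Ore domains whose images in a division ring generate the same division subring have isomorphic
skew fields of fractions. -/
theorem nonempty_algEquiv (f : R →ₐ[k] Q) (hf : Function.Injective f) (g : R' →ₐ[k] Q)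
    (hg : Function.Injective g)
    (h : Subfield.closure (Set.range f) = Subfield.closure (Set.range g)) :
    Nonempty (SkewFrac R ≃ₐ[k] SkewFrac R') := by
  let F : SkewFrac R →ₐ[k] Q :=
    { lift (f : R →+* Q) hf with
      commutes' := fun c => (lift_numerator (f : R →+* Q) hf _).trans (f.commutes c) }
  let F' : SkewFrac R' →ₐ[k] Q :=
    { lift (g : R' →+* Q) hg with
      commutes' := fun c => (lift_numerator (g : R' →+* Q) hg _).trans (g.commutes c) }
  have hr : F.range = F'.range := by
    ext q
    have h1 := fieldRange_lift (f : R →+* Q) hf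
    have h2 := fieldRange_lift (g : R' →+* Q) hg
    have h3 : (lift (f : R →+* Q) hf).fieldRange = (lift (g : R' →+* Q) hg).fieldRange :=
      h1.trans (h.trans h2.symm)
    exact SetLike.ext_iff.1 h3 q
  exact ⟨(AlgEquiv.ofInjective F (RingHom.injective (F : SkewFrac R →+* Q))).trans
    ((Subalgebra.equivOfEq _ _ hr).trans
      (AlgEquiv.ofInjective F' (RingHom.injective (F' : SkewFrac R' →+* Q))).symm)⟩

end SkewFrac

/-! ### Invariants of a finite family of endomorphisms of a division ring -/

/-- A division subring `D` of the invariants in `Q` contains every invariant, if there is a ring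
`χ(Λ)` that is finite over `D`, whose traces lie in `D`, and such that `D χ(Λ)` is stable under
right multiplication by generators of `Q`. The elements `q` with `D χ(Λ) q ⊆ D χ(Λ)` form a
division ring, as `D χ(Λ)` is finite-dimensional, so that `D χ(Λ) = Q`; then take traces. -/
theorem mem_of_forall_fixed {Q Λ ι β : Type*} [DivisionRing Q] [CharZero Q] [CommRing Λ]
    [Fintype ι] [Nonempty ι] [Finite β] (σ : ι → Q →+* Q) (D : Subfield Q)
    (hfix : ∀ d ∈ D, ∀ i, σ i d = d) (χ : Λ →+* Q) (b : β → Λ)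
    (hb : ∀ f, χ f ∈ Submodule.span D (Set.range fun i => χ (b i)))
    (htr : ∀ f, ∑ i, σ i (χ f) ∈ D) (T : Set Q) (hT : Subfield.closure T = ⊤)
    (hTD : ∀ t ∈ T, ∀ f, χ f * t ∈ Submodule.span D (Set.range χ))
    {q : Q} (hq : ∀ i, σ i q = q) : q ∈ D := by
  set V : Submodule D Q := Submodule.span D (Set.range χ) with hV
  have hfin : FiniteDimensional D V := by
    have : V = Submodule.span D (Set.range fun i => χ (b i)) := by
      apply le_antisymm
      · rw [hV, Submodule.span_le]
        rintro _ ⟨f, rfl⟩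
        exact hb f
      · apply Submodule.span_mono
        rintro _ ⟨i, rfl⟩
        exact ⟨_, rfl⟩
    rw [this]
    exact FiniteDimensional.span_of_finite D (Set.finite_range _)
  let r (x : Q) : Q →ₗ[D] Q :=
    { toFun := fun v => v * x, map_add' := fun _ _ => add_mul _ _ _,
      map_smul' := fun d v => smul_mul_assoc d v x }
  let S : Subfield Q :=
    { carrier := {x | ∀ v ∈ V, v * x ∈ V}
      mul_mem' := fun {x y} hx hy v hv => by rw [← mul_assoc]; exact hy _ (hx _ hv)
      one_mem' := fun v hv => by rwa [mul_one]
      add_mem' := fun {x y} hx hy v hv => by rw [mul_add]; exact add_mem (hx _ hv) (hy _ hv)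
      zero_mem' := fun v _ => by rw [mul_zero]; exact zero_mem _
      neg_mem' := fun {x} hx v hv => by rw [mul_neg]; exact neg_mem (hx _ hv)
      inv_mem' := fun x hx v hv => by
        by_cases h0 : x = 0
        · simp [h0]
        have hinj : Function.Injective ((r x).restrict hx) := by
          intro v w h
          exact Subtype.ext (mul_right_cancel₀ h0 (congrArg Subtype.val h))
        obtain ⟨w, hw⟩ := LinearMap.surjective_of_injective hinj ⟨v, hv⟩
        have hw' : (w : Q) * x = v := congrArg Subtype.val hw
        rw [← hw', mul_assoc, mul_inv_cancel₀ h0, mul_one]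
        exact w.2 }
  have hS : S = ⊤ := by
    rw [eq_top_iff, ← hT, Subfield.closure_le]
    intro t ht v hv
    rw [hV] at hv
    induction hv using Submodule.span_induction with
    | mem v hv =>
      obtain ⟨f, rfl⟩ := hv
      exact hTD t ht f
    | zero => rw [zero_mul]; exact zero_mem _
    | add v w _ _ h1 h2 => rw [add_mul]; exact add_mem h1 h2
    | smul d v _ h1 => rw [smul_mul_assoc]; exact V.smul_mem d h1
  have hqV : q ∈ V := by
    have h1 : (1 : Q) ∈ V := Submodule.subset_span ⟨1, map_one χ⟩
    have h2 : q ∈ S := by rw [hS]; trivial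
    simpa using h2 1 h1
  have htrV : ∀ v ∈ V, ∑ i, σ i v ∈ D := by
    intro v hv
    rw [hV] at hv
    induction hv using Submodule.span_induction with
    | mem v hv =>
      obtain ⟨f, rfl⟩ := hv
      exact htr f
    | zero => simp
    | add v w _ _ h1 h2 => simp only [map_add, Finset.sum_add_distrib]; exact add_mem h1 h2
    | smul d v _ h1 =>
      have : ∀ i, σ i (d • v) = (d : Q) * σ i v := fun i => by
        rw [Subfield.smul_def, smul_eq_mul, map_mul, hfix _ d.2]
      simp only [this, ← Finset.mul_sum]
      exact mul_mem d.2 h1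
  have h := htrV q hqV
  simp only [hq, Finset.sum_const, Finset.card_univ, nsmul_eq_mul] at h
  have hc : (Fintype.card ι : Q) ≠ 0 := Nat.cast_ne_zero.2 Fintype.card_ne_zero
  have h2 := mul_mem (inv_mem (natCast_mem D (Fintype.card ι))) h
  rwa [inv_mul_cancel_left₀ hc] at h2

/-! ### Filtrations by word length -/

section Words

variable {k R ι : Type*} [Field k] [Ring R] [Algebra k R]

/-- The span of the products of at most `d` of the elements `y i`. -/
def wordSpan (k : Type*) {R ι : Type*} [Field k] [Ring R] [Algebra k R] (y : ι → R) (d : ℕ) :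
    Submodule k R :=
  Submodule.span k {z | ∃ l : List ι, l.length ≤ d ∧ z = (l.map y).prod}

variable {y : ι → R}

theorem prod_map_mem_wordSpan {d : ℕ} {l : List ι} (h : l.length ≤ d) :
    (l.map y).prod ∈ wordSpan k y d :=
  Submodule.subset_span ⟨l, h, rfl⟩

theorem wordSpan_mono {d e : ℕ} (h : d ≤ e) : wordSpan k y d ≤ wordSpan k y e := by
  apply Submodule.span_mono
  rintro _ ⟨l, hl, rfl⟩
  exact ⟨l, hl.trans h, rfl⟩

theorem one_mem_wordSpan (d : ℕ) : (1 : R) ∈ wordSpan k y d :=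
  prod_map_mem_wordSpan (l := []) (Nat.zero_le d)

theorem mem_wordSpan_one (i : ι) : y i ∈ wordSpan k y 1 := by
  simpa using prod_map_mem_wordSpan (k := k) (y := y) (l := [i]) le_rfl

theorem mul_mem_wordSpan {d e : ℕ} {a b : R} (ha : a ∈ wordSpan k y d) (hb : b ∈ wordSpan k y e) :
    a * b ∈ wordSpan k y (d + e) := by
  have h : a * b ∈ wordSpan k y d * wordSpan k y e := Submodule.mul_mem_mul ha hb
  rw [wordSpan, wordSpan, Submodule.span_mul_span] at h
  refine Submodule.span_mono ?_ h
  rintro _ ⟨_, ⟨l, hl, rfl⟩, _, ⟨m, hm, rfl⟩, rfl⟩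
  exact ⟨l ++ m, by simp; omega, by simp⟩

theorem exists_mem_wordSpan {a : R} (ha : a ∈ Algebra.adjoin k (Set.range y)) :
    ∃ d, a ∈ wordSpan k y d := by
  induction ha using Algebra.adjoin_induction with
  | mem x hx =>
    obtain ⟨i, rfl⟩ := hx
    exact ⟨1, mem_wordSpan_one i⟩
  | algebraMap r =>
    exact ⟨0, by rw [Algebra.algebraMap_eq_smul_one]; exact Submodule.smul_mem _ _ (one_mem_wordSpan 0)⟩
  | add a b _ _ ha hb =>
    obtain ⟨d, hd⟩ := ha
    obtain ⟨e, he⟩ := hb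
    exact ⟨max d e, add_mem (wordSpan_mono (le_max_left _ _) hd)
      (wordSpan_mono (le_max_right _ _) he)⟩
  | mul a b _ _ ha hb =>
    obtain ⟨d, hd⟩ := ha
    obtain ⟨e, he⟩ := hb
    exact ⟨d + e, mul_mem_wordSpan hd he⟩

theorem wordSpan_map {S : Type*} [Ring S] [Algebra k S] (f : R →ₐ[k] S) (d : ℕ) :
    (wordSpan k y d).map f.toLinearMap = wordSpan k (fun i => f (y i)) d := by
  rw [wordSpan, wordSpan, Submodule.map_span]
  congr 1
  ext z
  constructor
  · rintro ⟨_, ⟨l, hl, rfl⟩, rfl⟩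
    exact ⟨l, hl, by simp [map_list_prod, Function.comp_def]⟩
  · rintro ⟨l, hl, rfl⟩
    exact ⟨_, ⟨l, hl, rfl⟩, by simp [map_list_prod, Function.comp_def]⟩

theorem card_toMultiset_eq_degree (a : ι →₀ ℕ) :
    Multiset.card (Finsupp.toMultiset a) = a.degree := by
  rw [Finsupp.card_toMultiset]
  rfl

/-- If the commutators of the `y i` have word length at most one, then the factors of a word may be
permuted up to shorter words. -/
theorem prod_sub_prod_mem_wordSpan (hy : ∀ i j, y i * y j - y j * y i ∈ wordSpan k y 1)
    {l m : List ι} (h : l.Perm m) :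
    (l.map y).prod - (m.map y).prod ∈ wordSpan k y (l.length - 1) := by
  induction h with
  | nil => simp
  | @cons i l m h ih =>
    rcases Nat.eq_zero_or_pos l.length with h0 | h0
    · have h1 : l = [] := List.length_eq_zero_iff.1 h0
      subst h1
      simp [List.nil_perm.1 h]
    · have := mul_mem_wordSpan (mem_wordSpan_one (k := k) (y := y) i) ih
      simp only [List.map_cons, List.prod_cons, ← mul_sub, List.length_cons]
      exact wordSpan_mono (by omega) this
  | swap i j l =>
    have := mul_mem_wordSpan (hy j i) (prod_map_mem_wordSpan (k := k) (y := y) (le_refl l.length))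
    simp only [List.map_cons, List.prod_cons, ← mul_assoc, ← sub_mul, List.length_cons]
    exact wordSpan_mono (by omega) this
  | @trans l m n h1 _ ih1 ih2 =>
    have := add_mem ih1 (by rw [h1.length_eq]; exact ih2)
    simpa using this

section Ordered

variable (y) [LinearOrder ι]

/-- The ordered monomial with given exponents in the elements `y i`. -/
noncomputable def orderedMonomial (a : ι →₀ ℕ) : R :=
  (((Finsupp.toMultiset a).sort (· ≤ ·)).map y).prod

variable {y}

theorem prod_sub_orderedMonomial_mem (hy : ∀ i j, y i * y j - y j * y i ∈ wordSpan k y 1)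
    {l : List ι} {a : ι →₀ ℕ} (h : Finsupp.toMultiset a = (l : Multiset ι)) :
    (l.map y).prod - orderedMonomial y a ∈ wordSpan k y (a.degree - 1) := by
  have hp : l.Perm ((Finsupp.toMultiset a).sort (· ≤ ·)) := by
    rw [← Multiset.coe_eq_coe, Multiset.sort_eq, h]
  have := prod_sub_prod_mem_wordSpan (k := k) hy hp
  rwa [hp.length_eq, Multiset.length_sort, card_toMultiset_eq_degree] at this

theorem orderedMonomial_mul_sub_mem (hy : ∀ i j, y i * y j - y j * y i ∈ wordSpan k y 1)
    (a b : ι →₀ ℕ) : orderedMonomial y a * orderedMonomial y b - orderedMonomial y (a + b) ∈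
      wordSpan k y ((a + b).degree - 1) := by
  rw [orderedMonomial, orderedMonomial, ← List.prod_append, ← List.map_append]
  apply prod_sub_orderedMonomial_mem hy
  rw [map_add, ← Multiset.coe_add, Multiset.sort_eq, Multiset.sort_eq]

theorem wordSpan_le_span_orderedMonomial
    (hy : ∀ i j, y i * y j - y j * y i ∈ wordSpan k y 1) (d : ℕ) :
    wordSpan k y d ≤ Submodule.span k {z | ∃ a : ι →₀ ℕ, a.degree ≤ d ∧ z = orderedMonomial y a} := by
  induction d with
  | zero =>
    rw [wordSpan, Submodule.span_le]
    rintro _ ⟨l, hl, rfl⟩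
    refine Submodule.subset_span ⟨0, by simp, ?_⟩
    rw [List.length_eq_zero_iff.1 (Nat.le_zero.1 hl)]
    simp [orderedMonomial]
  | succ d ih =>
    rw [wordSpan, Submodule.span_le]
    rintro _ ⟨l, hl, rfl⟩
    set a := Multiset.toFinsupp (l : Multiset ι) with ha
    have hm : Finsupp.toMultiset a = (l : Multiset ι) := by simp [ha]
    have hdeg : a.degree = l.length := by
      rw [← card_toMultiset_eq_degree, hm, Multiset.coe_card]
    have h1 := prod_sub_orderedMonomial_mem (k := k) hy hm
    have h2 := ih (wordSpan_mono (by omega) h1)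
    have h3 : orderedMonomial y a ∈ Submodule.span k
        {z | ∃ a : ι →₀ ℕ, a.degree ≤ d + 1 ∧ z = orderedMonomial y a} :=
      Submodule.subset_span ⟨a, by omega, rfl⟩
    have h4 : Submodule.span k {z | ∃ a : ι →₀ ℕ, a.degree ≤ d ∧ z = orderedMonomial y a} ≤
        Submodule.span k {z | ∃ a : ι →₀ ℕ, a.degree ≤ d + 1 ∧ z = orderedMonomial y a} := by
      apply Submodule.span_mono
      rintro _ ⟨a, ha, rfl⟩
      exact ⟨a, by omega, rfl⟩
    simpa using add_mem (h4 h2) h3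

variable [Fintype ι]

theorem wordSpan_le_span_range (hy : ∀ i j, y i * y j - y j * y i ∈ wordSpan k y 1) (d : ℕ) :
    wordSpan k y d ≤ Submodule.span k (Set.range fun g : ι → Fin (d + 1) =>
      orderedMonomial y (Finsupp.equivFunOnFinite.symm fun i => (g i : ℕ))) := by
  refine (wordSpan_le_span_orderedMonomial hy d).trans (Submodule.span_mono ?_)
  rintro _ ⟨a, ha, rfl⟩
  refine ⟨fun i => ⟨a i, Nat.lt_succ_of_le ((Finsupp.le_degree i a).trans ha)⟩, ?_⟩
  simp only
  congr 1
  ext i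
  rfl

theorem finiteDimensional_wordSpan (hy : ∀ i j, y i * y j - y j * y i ∈ wordSpan k y 1) (d : ℕ) :
    FiniteDimensional k (wordSpan k y d) :=
  have := FiniteDimensional.span_of_finite k (Set.finite_range fun g : ι → Fin (d + 1) =>
    orderedMonomial y (Finsupp.equivFunOnFinite.symm fun i => (g i : ℕ)))
  Submodule.finiteDimensional_of_le (wordSpan_le_span_range hy d)

theorem finrank_wordSpan_le (hy : ∀ i j, y i * y j - y j * y i ∈ wordSpan k y 1) (d : ℕ) :
    Module.finrank k (wordSpan k y d) ≤ (d + 1) ^ Fintype.card ι := by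
  have := FiniteDimensional.span_of_finite k (Set.finite_range fun g : ι → Fin (d + 1) =>
    orderedMonomial y (Finsupp.equivFunOnFinite.symm fun i => (g i : ℕ)))
  refine (Submodule.finrank_mono (wordSpan_le_span_range hy d)).trans ?_
  refine (finrank_range_le_card _).trans ?_
  simp

/-- If the ordered monomials are linearly dependent, then the monomials that are divisible by the
leading monomial of a relation are redundant. -/
theorem wordSpan_le_span_of_relation (hy : ∀ i j, y i * y j - y j * y i ∈ wordSpan k y 1)
    {p : MvPolynomial ι k} (hp : p ≠ 0)
    (hrel : ∑ a ∈ p.support, p.coeff a • orderedMonomial y a = 0) (d : ℕ) :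
    wordSpan k y d ≤ Submodule.span k {z | ∃ a : ι →₀ ℕ, a.degree ≤ d ∧
      ¬ (MonomialOrder.degLex (σ := ι)).degree p ≤ a ∧ z = orderedMonomial y a} := by
  classical
  set m := MonomialOrder.degLex (σ := ι) with hm
  set b := m.degree p with hb
  set S : ℕ → Submodule k R := fun d => Submodule.span k {z | ∃ a : ι →₀ ℕ, a.degree ≤ d ∧
      ¬ b ≤ a ∧ z = orderedMonomial y a} with hS
  have hSmono : ∀ {d e}, d ≤ e → S d ≤ S e := by
    intro d e h
    apply Submodule.span_mono
    rintro _ ⟨a, ha, hab, rfl⟩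
    exact ⟨a, ha.trans h, hab, rfl⟩
  have hdeg : ∀ {a c : ι →₀ ℕ}, m.toSyn a ≤ m.toSyn c → a.degree ≤ c.degree := by
    intro a c h
    exact Finsupp.DegLex.monotone_degree (MonomialOrder.degLex_le_iff.1 h)
  have hlt : ∀ {a c : ι →₀ ℕ}, a.degree < c.degree → m.toSyn a < m.toSyn c := by
    intro a c h
    by_contra! h2
    exact absurd (hdeg h2) (by omega)
  -- induction in the degree-lexicographic order: a monomial divisible by the leading exponent `b` of
  -- the relation is a combination of smaller ones, modulo words of smaller degree
  have key : ∀ s : m.syn, ∀ a : ι →₀ ℕ, m.toSyn a = s → orderedMonomial y a ∈ S a.degree := by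
    intro s
    induction s using WellFoundedLT.induction with
    | ind s ih =>
    rintro a rfl
    by_cases hab : b ≤ a
    swap
    · exact Submodule.subset_span ⟨a, le_rfl, hab, rfl⟩
    have ih' : ∀ c : ι →₀ ℕ, m.toSyn c < m.toSyn a → orderedMonomial y c ∈ S a.degree :=
      fun c hc => hSmono (hdeg hc.le) (ih _ hc c rfl)
    have hW : ∀ e, e < a.degree → wordSpan k y e ≤ S a.degree := by
      intro e he
      refine (wordSpan_le_span_orderedMonomial hy e).trans ?_
      rw [Submodule.span_le]
      rintro _ ⟨c, hc, rfl⟩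
      exact ih' c (hlt (by omega))
    obtain ⟨c, rfl⟩ := exists_add_of_le hab
    have hterm : ∀ e : ι →₀ ℕ, e.degree ≤ b.degree → m.toSyn e ≤ m.toSyn b →
        orderedMonomial y e * orderedMonomial y c - orderedMonomial y (e + c) ∈
          S (b + c).degree := by
      intro e he _
      rcases Nat.eq_zero_or_pos (e + c).degree with h0 | h0
      · have h1 : e + c = 0 := (Finsupp.degree_eq_zero_iff _).1 h0
        have h2 : e = 0 := by
          have := le_self_add (a := e) (b := c)
          rw [h1] at this
          exact le_antisymm this (by simp)
        subst h2
        simp [orderedMonomial]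
      · refine hW _ ?_ (orderedMonomial_mul_sub_mem hy e c)
        simp only [map_add] at h0 ⊢
        omega
    have hbs : b ∈ p.support := (MonomialOrder.degree_mem_support_iff (m := m) p).2 hp
    have h1 : ∑ e ∈ p.support, p.coeff e • (orderedMonomial y e * orderedMonomial y c) = 0 := by
      have := congrArg (· * orderedMonomial y c) hrel
      simpa [Finset.sum_mul] using this
    have h2 : ∑ e ∈ p.support, p.coeff e • orderedMonomial y (e + c) ∈ S (b + c).degree := by
      have h3 : ∑ e ∈ p.support, p.coeff e • orderedMonomial y (e + c) =
          - ∑ e ∈ p.support, p.coeff e • (orderedMonomial y e * orderedMonomial y c -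
            orderedMonomial y (e + c)) := by
        simp only [smul_sub, Finset.sum_sub_distrib, h1]
        abel
      rw [h3]
      refine neg_mem (sum_mem fun e he => Submodule.smul_mem _ _ ?_)
      have := m.le_degree he
      exact hterm e (hdeg this) this
    rw [← Finset.add_sum_erase _ _ hbs] at h2
    have h3 : ∑ e ∈ p.support.erase b, p.coeff e • orderedMonomial y (e + c) ∈
        S (b + c).degree := by
      refine sum_mem fun e he => Submodule.smul_mem _ _ (ih' _ ?_)
      rw [map_add, map_add]
      refine add_lt_add_left (lt_of_le_of_ne (m.le_degree (Finset.mem_of_mem_erase he)) ?_) _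
      exact fun h => Finset.ne_of_mem_erase he (m.toSyn.injective h)
    have h4 : p.coeff b • orderedMonomial y (b + c) ∈ S (b + c).degree := by
      simpa using sub_mem h2 h3
    exact ((S _).smul_mem_iff ((MonomialOrder.coeff_degree_ne_zero_iff (m := m)).2 hp)).1 h4
  refine (wordSpan_le_span_orderedMonomial hy d).trans ?_
  rw [Submodule.span_le]
  rintro _ ⟨a, ha, rfl⟩
  exact hSmono ha (key _ a rfl)

/-- A relation between the ordered monomials lowers the degree of growth. -/
theorem finrank_wordSpan_le_of_relation (hy : ∀ i j, y i * y j - y j * y i ∈ wordSpan k y 1)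
    {p : MvPolynomial ι k} (hp : p ≠ 0)
    (hrel : ∑ a ∈ p.support, p.coeff a • orderedMonomial y a = 0) :
    ∃ C : ℕ, ∀ d, Module.finrank k (wordSpan k y d) ≤ C * (d + 1) ^ (Fintype.card ι - 1) := by
  classical
  set b := (MonomialOrder.degLex (σ := ι)).degree p with hb
  refine ⟨∑ i, b i, fun d => ?_⟩
  let v : (Σ i : ι, Fin (b i) × ({j // j ≠ i} → Fin (d + 1))) → R := fun s =>
    orderedMonomial y (Finsupp.equivFunOnFinite.symm fun j =>
      if h : j = s.1 then (s.2.1 : ℕ) else s.2.2 ⟨j, h⟩)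
  have hle : wordSpan k y d ≤ Submodule.span k (Set.range v) := by
    refine (wordSpan_le_span_of_relation hy hp hrel d).trans (Submodule.span_mono ?_)
    rintro _ ⟨a, ha, hab, rfl⟩
    have : ∃ i, a i < b i := by
      by_contra! h
      exact hab h
    obtain ⟨i, hi⟩ := this
    refine ⟨⟨i, ⟨a i, hi⟩, fun j => ⟨a j, Nat.lt_succ_of_le ((Finsupp.le_degree _ a).trans ha)⟩⟩, ?_⟩
    simp only [v]
    congr 1
    ext j
    by_cases h : j = i
    · subst h; simp
    · simp [h]
  have := FiniteDimensional.span_of_finite k (Set.finite_range v)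
  refine (Submodule.finrank_mono hle).trans ((finrank_range_le_card _).trans ?_)
  rw [Fintype.card_sigma, Finset.sum_mul]
  refine Finset.sum_le_sum fun i _ => ?_
  simp [Fintype.card_subtype_compl]

end Ordered

end Words

/-! ### Polynomials in commuting elements and Weyl relations -/

section CommutingElements

open scoped IsMulCommutative in
/-- Pairwise commuting elements of an algebra are values of the variables under a homomorphism. -/
theorem exists_algHom_of_commute {k R σ : Type*} [Field k] [Ring R] [Algebra k R] (y : σ → R)
    (hy : ∀ i j, y i * y j = y j * y i) :
    ∃ f : MvPolynomial σ k →ₐ[k] R, ∀ i, f (MvPolynomial.X i) = y i := by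
  have hc : ∀ a ∈ Set.range y, ∀ b ∈ Set.range y, a * b = b * a := by
    rintro _ ⟨i, rfl⟩ _ ⟨j, rfl⟩
    exact hy i j
  have := Algebra.isMulCommutative_adjoin k hc
  let z : σ → Algebra.adjoin k (Set.range y) := fun i => ⟨y i, Algebra.subset_adjoin ⟨i, rfl⟩⟩
  exact ⟨(Algebra.adjoin k (Set.range y)).val.comp (MvPolynomial.aeval z), fun i => by simp [z]⟩

/-- An element whose commutators with the values of the variables are values of a derivation acts by
this derivation. -/
theorem commutator_eq_derivation {k R σ : Type*} [Field k] [Ring R] [Algebra k R]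
    (f : MvPolynomial σ k →ₐ[k] R) (D : Derivation k (MvPolynomial σ k) (MvPolynomial σ k)) (u : R)
    (h : ∀ i, u * f (MvPolynomial.X i) - f (MvPolynomial.X i) * u = f (D (MvPolynomial.X i)))
    (p : MvPolynomial σ k) : u * f p - f p * u = f (D p) := by
  induction p using MvPolynomial.induction_on with
  | C a =>
    rw [← MvPolynomial.algebraMap_eq, AlgHom.commutes, D.map_algebraMap, map_zero,
      Algebra.commutes, sub_self]
  | add p q hp hq => rw [map_add, map_add, map_add, ← hp, ← hq]; noncomm_ring
  | mul_X p i hp =>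
    rw [D.leibniz, map_add, map_mul, smul_eq_mul, smul_eq_mul, map_mul, map_mul, ← hp, ← h i]
    have : f (MvPolynomial.X i) * (u * f p - f p * u) =
        (u * f p - f p * u) * f (MvPolynomial.X i) := by
      rw [hp, ← map_mul, mul_comm, map_mul]
    rw [this]
    noncomm_ring

variable {F A σ : Type*} [Field F] [Ring A] [Algebra F A]

theorem MvPolynomial.exists_pderiv_ne_zero {R : Type*} [CommRing R] [IsDomain R] [CharZero R]
    {p : MvPolynomial σ R} (hp : p.totalDegree ≠ 0) :
    ∃ i, pderiv i p ≠ 0 ∧ (pderiv i p).totalDegree < p.totalDegree := by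
  classical
  have hlt : ∀ i, (pderiv i p).totalDegree < p.totalDegree := by
    intro i
    rw [totalDegree, Finset.sup_lt_iff (by simpa using Nat.pos_of_ne_zero hp)]
    intro m hm
    rw [mem_support_iff, coeff_pderiv] at hm
    have h1 := le_totalDegree (mem_support_iff.2 (left_ne_zero_of_mul hm))
    rw [Finsupp.sum_add_index' (by simp) (by simp)] at h1
    simp at h1
    exact h1
  by_contra! h
  have h0 : ∀ i, pderiv i p = 0 := fun i => by
    by_contra h2
    exact absurd (hlt i) (not_lt.2 (h i h2))
  apply hp
  rw [totalDegree_eq_zero_iff]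
  intro m hm i
  by_contra hmi
  have h1 := congrArg (coeff (m - Finsupp.single i 1)) (h0 i)
  have h2 : m - Finsupp.single i 1 + Finsupp.single i 1 = m :=
    tsub_add_cancel_of_le (by simpa using Nat.one_le_iff_ne_zero.2 hmi)
  rw [coeff_pderiv, h2, coeff_zero] at h1
  rcases mul_eq_zero.1 h1 with h3 | h3
  · exact mem_support_iff.1 hm h3
  · exact Nat.cast_add_one_ne_zero _ h3

/-- The normally ordered value, with values of polynomials in the `x`'s on the left. -/
theorem exists_normal_form (X Y : MvPolynomial σ F →ₐ[F] A) :
    ∃ N : MvPolynomial σ (MvPolynomial σ F) →+ A, ∀ b c,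
      N (MvPolynomial.monomial b c) = X c * Y (MvPolynomial.monomial b 1) := by
  let : Module (MvPolynomial σ F) A := Module.compHom A (X : MvPolynomial σ F →+* A)
  let N := (MvPolynomial.basisMonomials σ (MvPolynomial σ F)).constr (MvPolynomial σ F)
    fun b => Y (MvPolynomial.monomial b 1)
  refine ⟨N.toAddMonoidHom, fun b c => ?_⟩
  have h1 : MvPolynomial.monomial b c =
      c • MvPolynomial.basisMonomials σ (MvPolynomial σ F) b := by
    rw [MvPolynomial.coe_basisMonomials, MvPolynomial.smul_monomial, smul_eq_mul, mul_one]
  rw [h1]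
  change N _ = _
  rw [map_smul, Module.Basis.constr_basis]
  rfl

/-- In a nonzero algebra over a field of characteristic zero, the monomials `x^a ∂^b` in elements
that satisfy the relations of the Weyl algebra are linearly independent: a polynomial `p` in the
`∂`'s with coefficients that are polynomials in the `x`'s is zero, if its normally ordered value is
zero. Commutators with the `x`'s and `∂`'s act as partial derivatives, and reduce `p` to a constant.
-/
theorem injective_of_weyl_relations [CharZero F] [Nontrivial A] [DecidableEq σ] (x d : σ → A)
    (hdx : ∀ i j, d i * x j - x j * d i = if i = j then 1 else 0)
    (X : MvPolynomial σ F →ₐ[F] A) (hX : ∀ i, X (MvPolynomial.X i) = x i)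
    (Y : MvPolynomial σ F →ₐ[F] A) (hY : ∀ i, Y (MvPolynomial.X i) = d i)
    (N : MvPolynomial σ (MvPolynomial σ F) →+ A)
    (hN : ∀ b c, N (MvPolynomial.monomial b c) = X c * Y (MvPolynomial.monomial b 1)) :
    Function.Injective N := by
  have hXd : ∀ i q, d i * X q - X q * d i = X (MvPolynomial.pderiv i q) := by
    intro i q
    refine commutator_eq_derivation X (MvPolynomial.pderiv i) (d i) (fun j => ?_) q
    rw [hX, hdx, MvPolynomial.pderiv_X, Pi.single_apply]
    simp only [eq_comm]
    split_ifs <;> simp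
  have hYx : ∀ i q, Y q * x i - x i * Y q = Y (MvPolynomial.pderiv i q) := by
    intro i q
    have h := commutator_eq_derivation Y (-MvPolynomial.pderiv i) (x i) (fun j => ?_) q
    · rw [← neg_sub, h, Derivation.neg_apply, map_neg, neg_neg]
    · rw [hY, ← neg_sub, hdx, Derivation.neg_apply, map_neg, MvPolynomial.pderiv_X, Pi.single_apply]
      split_ifs <;> simp
  have hNx : ∀ i q, N q * x i - x i * N q = N (MvPolynomial.pderiv i q) := by
    intro i q
    induction q using MvPolynomial.induction_on' with
    | add p q hp hq => rw [map_add, map_add, map_add, ← hp, ← hq]; noncomm_ring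
    | monomial b c =>
      have h1 : x i * X c = X c * x i := by rw [← hX, ← map_mul, mul_comm, map_mul]
      have h2 := hYx i (MvPolynomial.monomial b 1)
      have h3 : MvPolynomial.monomial (b - Finsupp.single i 1) (c * (b i : MvPolynomial σ F)) =
          (b i) • MvPolynomial.monomial (b - Finsupp.single i 1) c := by
        rw [← map_nsmul, nsmul_eq_mul, mul_comm]
      have h4 : MvPolynomial.monomial (b - Finsupp.single i 1) ((1 : F) * (b i : F)) =
          (b i) • MvPolynomial.monomial (b - Finsupp.single i 1) (1 : F) := by
        rw [← map_nsmul, nsmul_eq_mul, mul_comm]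
      rw [MvPolynomial.pderiv_monomial, h3, map_nsmul, hN, hN]
      rw [MvPolynomial.pderiv_monomial, h4, map_nsmul] at h2
      rw [← mul_smul_comm, ← h2, mul_sub, ← mul_assoc, ← mul_assoc, ← mul_assoc, h1]
  rw [injective_iff_map_eq_zero]
  have key : ∀ m, ∀ q : MvPolynomial σ (MvPolynomial σ F), q.totalDegree = m → N q = 0 → q = 0 := by
    intro m
    induction m using Nat.strong_induction_on with
    | _ m ih =>
    intro q hqm hq
    by_cases h0 : q.totalDegree = 0
    · rw [MvPolynomial.totalDegree_eq_zero_iff_eq_C] at h0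
      set c := MvPolynomial.coeff 0 q with hc
      have hXc : X c = 0 := by
        rw [h0, ← MvPolynomial.monomial_zero', hN, MvPolynomial.monomial_zero', MvPolynomial.C_1,
          map_one, mul_one] at hq
        exact hq
      have key' : ∀ m, ∀ q : MvPolynomial σ F, q.totalDegree = m → X q = 0 → q = 0 := by
        intro m
        induction m using Nat.strong_induction_on with
        | _ m ih =>
        intro q hqm hq
        by_cases h0 : q.totalDegree = 0
        · rw [MvPolynomial.totalDegree_eq_zero_iff_eq_C] at h0
          rw [h0, ← MvPolynomial.algebraMap_eq, AlgHom.commutes] at hq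
          rw [h0, (FaithfulSMul.algebraMap_eq_zero_iff F A).1 hq, MvPolynomial.C_0]
        · obtain ⟨i, hi, hlt⟩ := MvPolynomial.exists_pderiv_ne_zero h0
          exact absurd (ih _ (hqm ▸ hlt) _ rfl (by rw [← hXd, hq]; simp)) hi
      rw [h0, key' _ c rfl hXc, MvPolynomial.C_0]
    · obtain ⟨i, hi, hlt⟩ := MvPolynomial.exists_pderiv_ne_zero h0
      exact absurd (ih _ (hqm ▸ hlt) _ rfl (by rw [← hNx, hq]; simp)) hi
  exact fun q hq => key _ q rfl hq

end CommutingElements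

/-! ### Relations between simple root vectors that define the general linear Lie algebra -/

section SerreTheory

attribute [local instance] LieRing.ofAssociativeRing

/-- Elements `h i`, `e i`, `f i` of an associative algebra that satisfy the Serre relations of
`gl_n`, where `e i` and `f i` stand for `E_{i,i+1}` and `E_{i+1,i}`. All indices are natural
numbers, and `e i`, `f i` matter for `i + 1 < n` only. -/
structure SerreRelations {A : Type*} [Ring A] (n : ℕ) (h e f : ℕ → A) : Prop where
  hh (i j : ℕ) : ⁅h i, h j⁆ = 0
  he (i j : ℕ) : ⁅h i, e j⁆ = (if i = j then e j else 0) - if i = j + 1 then e j else 0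
  hf (i j : ℕ) : ⁅h i, f j⁆ = (if i = j + 1 then f j else 0) - if i = j then f j else 0
  ef (i j : ℕ) (hi : i + 1 < n) (hj : j + 1 < n) :
    ⁅e i, f j⁆ = if i = j then h i - h (i + 1) else 0
  ee (i j : ℕ) (hij : i + 1 < j) (hj : j + 1 < n) : ⁅e i, e j⁆ = 0
  ff (i j : ℕ) (hij : i + 1 < j) (hj : j + 1 < n) : ⁅f i, f j⁆ = 0
  eee (i : ℕ) (hi : i + 2 < n) : ⁅e i, ⁅e i, e (i + 1)⁆⁆ = 0
  eee' (i : ℕ) (hi : i + 2 < n) : ⁅e (i + 1), ⁅e i, e (i + 1)⁆⁆ = 0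
  fff (i : ℕ) (hi : i + 2 < n) : ⁅f i, ⁅f i, f (i + 1)⁆⁆ = 0
  fff' (i : ℕ) (hi : i + 2 < n) : ⁅f (i + 1), ⁅f i, f (i + 1)⁆⁆ = 0

namespace SerreRelations

variable {A : Type*} [Ring A]

/-- The root vector `E_{i, i + d + 1}`, as an iterated commutator. -/
def raise (e : ℕ → A) (i : ℕ) : ℕ → A
  | 0 => e i
  | d + 1 => ⁅raise e i d, e (i + d + 1)⁆

/-- The root vector `E_{i + d + 1, i}`, as an iterated commutator. -/
def lower (f : ℕ → A) (i : ℕ) : ℕ → A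
  | 0 => f i
  | d + 1 => ⁅f (i + d + 1), lower f i d⁆

/-- The elements that correspond to the matrix units `E_{ij}`. -/
def unit (h e f : ℕ → A) (i j : ℕ) : A :=
  if i < j then raise e i (j - i - 1) else if j < i then lower f j (i - j - 1) else h i

variable {n : ℕ} {h e f : ℕ → A}

theorem lie_lie_eq (x y z : A) : ⁅x, ⁅y, z⁆⁆ = ⁅⁅x, y⁆, z⁆ + ⁅y, ⁅x, z⁆⁆ := leibniz_lie x y z

/-- Exchanging `e` and `f` and changing the sign of `h`, as by the Chevalley involution. -/
theorem swap (H : SerreRelations n h e f) :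
    SerreRelations n (fun i => -h i) (fun i => -f i) (fun i => -e i) where
  hh i j := by simp [H.hh]
  he i j := by
    have := H.hf i j
    simp only [neg_lie, lie_neg, neg_neg, this]
    split_ifs <;> simp
  hf i j := by
    have := H.he i j
    simp only [neg_lie, lie_neg, neg_neg, this]
    split_ifs <;> simp
  ef i j hi hj := by
    have := H.ef j i hj hi
    rw [neg_lie, lie_neg, neg_neg, ← lie_skew, this]
    simp only [eq_comm (a := j)]
    split_ifs with h1
    · subst h1; abel
    · simp
  ee i j hij hj := by simp [H.ff i j hij hj]
  ff i j hij hj := by simp [H.ee i j hij hj]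
  eee i hi := by simp [H.fff i hi]
  eee' i hi := by simp [H.fff' i hi]
  fff i hi := by simp [H.eee i hi]
  fff' i hi := by simp [H.eee' i hi]

theorem lower_neg (f : ℕ → A) (i d : ℕ) : lower f i d = -raise (fun j => -f j) i d := by
  induction d with
  | zero => simp [lower, raise]
  | succ d ih => rw [lower, raise, ih, lie_neg, lie_neg, neg_neg, lie_skew]

theorem unit_swap (h e f : ℕ → A) (i j : ℕ) :
    unit (fun i => -h i) (fun i => -f i) (fun i => -e i) i j = -unit h e f j i := by
  have h1 : ∀ i d, lower (fun j => -e j) i d = -raise e i d := fun i d => by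
    simp only [lower_neg, neg_neg]
  simp only [unit, h1, lower_neg f]
  split_ifs <;> first | rfl | (exfalso; omega) | simp
  have : i = j := by omega
  rw [this]

theorem lie_h_raise (H : SerreRelations n h e f) (l i d : ℕ) :
    ⁅h l, raise e i d⁆ =
      (if l = i then raise e i d else 0) - if l = i + d + 1 then raise e i d else 0 := by
  induction d with
  | zero => exact H.he l i
  | succ d ih =>
    rw [raise, lie_lie_eq, ih, H.he]
    split_ifs <;> first | (exfalso; omega) | skip
    all_goals simp
    rw [← lie_skew, neg_add_cancel]

/-- A root vector that is disjoint from `e k` commutes with it. -/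
theorem lie_e_raise_of_lt (H : SerreRelations n h e f) {k i d : ℕ} (hk : k + 1 < i)
    (hd : i + d + 1 < n) : ⁅e k, raise e i d⁆ = 0 := by
  induction d with
  | zero => exact H.ee k i hk (by omega)
  | succ d ih =>
    rw [raise, lie_lie_eq, ih (by omega), H.ee k _ (by omega) (by omega)]
    simp

theorem lie_e_raise_of_gt (H : SerreRelations n h e f) {k i d : ℕ} (hk : i + d + 1 < k)
    (hk' : k + 1 < n) : ⁅e k, raise e i d⁆ = 0 := by
  induction d with
  | zero => rw [← lie_skew, raise, H.ee i k (by omega) hk', neg_zero]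
  | succ d ih =>
    rw [raise, lie_lie_eq, ih (by omega), ← lie_skew (e k), H.ee _ k (by omega) hk']
    simp

theorem lie_e_raise_succ (H : SerreRelations n h e f) {i d : ℕ} (hd : i + 1 + d + 1 < n) :
    ⁅e i, raise e (i + 1) d⁆ = raise e i (d + 1) := by
  induction d with
  | zero => rfl
  | succ d ih =>
    rw [raise, lie_lie_eq, ih (by omega), H.ee i _ (by omega) (by omega), lie_zero, add_zero]
    rw [raise.eq_2 e i (d + 1)]
    congr 2
    omega

theorem lie_e_raise_self (H : SerreRelations n h e f) {i d : ℕ} (hd : i + d + 1 < n) :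
    ⁅e i, raise e i d⁆ = 0 := by
  induction d with
  | zero => simp [raise]
  | succ d ih =>
    rw [raise, lie_lie_eq, ih (by omega), zero_lie, zero_add]
    cases d with
    | zero => exact H.eee i (by omega)
    | succ d => rw [H.ee i _ (by omega) (by omega), lie_zero]

theorem lie_e_raise_last (H : SerreRelations n h e f) {i d : ℕ} (hd : i + d + 2 < n) :
    ⁅e (i + d + 1), raise e i (d + 1)⁆ = 0 := by
  cases d with
  | zero => exact H.eee' i (by omega)
  | succ d =>
    -- the last two factors of the commutator are `e (i+d+1)` and `e (i+d+2)`
    rw [raise, raise]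
    have h1 : ⁅e (i + (d + 1) + 1), raise e i d⁆ = 0 := H.lie_e_raise_of_gt (by omega) (by omega)
    have h2 : ⁅raise e i d, e (i + (d + 1) + 1)⁆ = 0 := by rw [← lie_skew, h1, neg_zero]
    have h3 : ⁅⁅raise e i d, e (i + d + 1)⁆, e (i + (d + 1) + 1)⁆ =
        ⁅raise e i d, ⁅e (i + d + 1), e (i + (d + 1) + 1)⁆⁆ := by
      rw [lie_lie_eq (raise e i d), h2, lie_zero, add_zero]
    rw [h3, lie_lie_eq, h1, zero_lie, zero_add]
    have h4 := H.eee' (i + d + 1) (by omega)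
    rw [show i + (d + 1) + 1 = i + d + 1 + 1 by omega, h4, lie_zero]

/-- A simple root vector inside the interval of a longer root vector commutes with it. -/
theorem lie_e_raise_inner [IsAddTorsionFree A] (H : SerreRelations n h e f) {i d m : ℕ}
    (hd : i + d + m + 2 < n) : ⁅e (i + d + 1), raise e i (d + 1 + m)⁆ = 0 := by
  induction m with
  | zero => exact H.lie_e_raise_last (by omega)
  | succ m ih =>
    rw [← add_assoc, raise, lie_lie_eq, ih (by omega), zero_lie, zero_add]
    rcases Nat.eq_zero_or_pos m with h0 | h0
    · subst h0
      rw [add_zero, raise]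
      have hac : ⁅raise e i d, e (i + (d + 1) + 1)⁆ = 0 := by
        rw [← lie_skew, H.lie_e_raise_of_gt (by omega) (by omega), neg_zero]
      have hb := H.lie_e_raise_last (i := i) (d := d) (by omega)
      have hbc := H.eee (i + d + 1) (by omega)
      rw [raise] at hb
      rw [show i + (d + 1) + 1 = i + d + 1 + 1 by omega] at hac ⊢
      generalize raise e i d = a at *
      generalize e (i + d + 1 + 1) = c at *
      generalize e (i + d + 1) = b at *
      -- the Jacobi identity shows that the commutator is its own negative
      have h1 : ⁅⁅a, b⁆, ⁅b, c⁆⁆ = -⁅b, ⁅a, ⁅b, c⁆⁆⁆ := by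
        have := lie_lie_eq a b ⁅b, c⁆
        rw [hbc, lie_zero] at this
        exact eq_neg_of_add_eq_zero_left this.symm
      have h2 : ⁅a, ⁅b, c⁆⁆ = ⁅⁅a, b⁆, c⁆ := by rw [lie_lie_eq a b c, hac, lie_zero, add_zero]
      have h3 : ⁅b, ⁅⁅a, b⁆, c⁆⁆ = ⁅⁅a, b⁆, ⁅b, c⁆⁆ := by
        rw [lie_lie_eq b ⁅a, b⁆ c, hb, zero_lie, zero_add]
      rw [h2, h3] at h1
      exact self_eq_neg.1 h1
    · rw [H.ee _ _ (by omega) (by omega), lie_zero]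

theorem lie_e_lower_of_gt (H : SerreRelations n h e f) {k i d : ℕ} (hk : i + d < k)
    (hk' : k + 1 < n) : ⁅e k, lower f i d⁆ = 0 := by
  induction d with
  | zero => rw [lower, H.ef _ _ hk' (by omega), if_neg (by omega)]
  | succ d ih =>
    rw [lower, lie_lie_eq, ih (by omega), H.ef _ _ hk' (by omega), if_neg (by omega)]
    simp

theorem lie_e_lower_of_lt (H : SerreRelations n h e f) {k i d : ℕ} (hk : k < i)
    (hk' : i + d + 1 < n) : ⁅e k, lower f i d⁆ = 0 := by
  induction d with
  | zero => rw [lower, H.ef _ _ (by omega) (by omega), if_neg (by omega)]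
  | succ d ih =>
    rw [lower, lie_lie_eq, ih (by omega), H.ef _ _ (by omega) (by omega), if_neg (by omega)]
    simp

theorem lie_h_lower (H : SerreRelations n h e f) (l i d : ℕ) :
    ⁅h l, lower f i d⁆ =
      (if l = i + d + 1 then lower f i d else 0) - if l = i then lower f i d else 0 := by
  have := H.swap.lie_h_raise l i d
  rw [neg_lie, ← lie_neg, ← lower_neg] at this
  rw [this, lower_neg f]
  split_ifs <;> simp

theorem lie_f_lower_of_gt (H : SerreRelations n h e f) {k i d : ℕ} (hk : i + d + 1 < k)
    (hk' : k + 1 < n) : ⁅f k, lower f i d⁆ = 0 := by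
  have := H.swap.lie_e_raise_of_gt hk hk'
  rw [lower_neg, lie_neg, ← neg_lie, this]

theorem lie_e_lower_last (H : SerreRelations n h e f) {i d : ℕ} (hd : i + d + 2 < n) :
    ⁅e (i + d + 1), lower f i (d + 1)⁆ = lower f i d := by
  rw [lower, lie_lie_eq, H.lie_e_lower_of_gt (by omega) (by omega), lie_zero, add_zero,
    H.ef _ _ (by omega) (by omega), if_pos rfl, sub_lie, H.lie_h_lower, H.lie_h_lower,
    if_pos rfl, if_neg (by omega), if_neg (by omega), if_neg (by omega)]
  simp

theorem lie_e_lower_first (H : SerreRelations n h e f) {i d : ℕ} (hd : i + d + 2 < n) :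
    ⁅e i, lower f i (d + 1)⁆ = -lower f (i + 1) d := by
  induction d with
  | zero =>
    rw [lower, lower, lower, lie_lie_eq, H.ef _ _ (by omega) (by omega), if_neg (by omega),
      H.ef _ _ (by omega) (by omega), if_pos rfl, zero_lie, zero_add, ← lie_skew, sub_lie, H.hf,
      H.hf]
    simp only [↓reduceIte]
    rw [if_neg (by omega), if_neg (by omega)]
    simp
  | succ d ih =>
    rw [lower, lie_lie_eq, ih (by omega), H.ef _ _ (by omega) (by omega), if_neg (by omega),
      zero_lie, zero_add, lie_neg, lower]
    congr 4
    omega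

theorem lie_e_lower_inner (H : SerreRelations n h e f) {i d m : ℕ} (hd : i + d + m + 3 < n) :
    ⁅e (i + d + 1), lower f i (d + 2 + m)⁆ = 0 := by
  induction m with
  | zero =>
    rw [add_zero, lower, lie_lie_eq, H.ef _ _ (by omega) (by omega), if_neg (by omega), zero_lie,
      zero_add, H.lie_e_lower_last (by omega), H.lie_f_lower_of_gt (by omega) (by omega)]
  | succ m ih =>
    rw [← add_assoc, lower, lie_lie_eq, ih (by omega), H.ef _ _ (by omega) (by omega),
      if_neg (by omega)]
    simp

theorem unit_lt {i d : ℕ} : unit h e f i (i + d + 1) = raise e i d := by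
  rw [unit, if_pos (by omega)]
  congr 1
  omega

theorem unit_gt {i d : ℕ} : unit h e f (i + d + 1) i = lower f i d := by
  rw [unit, if_neg (by omega), if_pos (by omega)]
  congr 1
  omega

theorem unit_self {i : ℕ} : unit h e f i i = h i := by
  rw [unit, if_neg (by omega), if_neg (by omega)]

/-- The commutators of the simple raising vectors with all the `E_{ij}`. -/
theorem lie_e_unit [IsAddTorsionFree A] (H : SerreRelations n h e f) {k i j : ℕ} (hk : k + 1 < n)
    (hi : i < n) (hj : j < n) : ⁅e k, unit h e f i j⁆ =
      (if k + 1 = i then unit h e f k j else 0) - if j = k then unit h e f i (k + 1) else 0 := by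
  rcases lt_trichotomy i j with hij | rfl | hij
  · obtain ⟨d, rfl⟩ := Nat.exists_eq_add_of_lt hij
    rw [unit_lt]
    rcases lt_trichotomy (k + 1) i with h1 | rfl | h1
    · rw [H.lie_e_raise_of_lt h1 hj, if_neg (by omega), if_neg (by omega), sub_zero]
    · rw [H.lie_e_raise_succ hj, if_pos rfl, if_neg (by omega), sub_zero,
        show k + 1 + d + 1 = k + (d + 1) + 1 by omega, unit_lt]
    · rw [if_neg (by omega)]
      by_cases h2 : i + d + 1 = k
      · rw [if_pos h2, ← h2, show i + d + 1 + 1 = i + (d + 1) + 1 by omega, unit_lt, raise, zero_sub,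
          lie_skew]
      · rw [if_neg h2, sub_zero]
        by_cases h3 : i + d + 1 < k
        · exact H.lie_e_raise_of_gt h3 hk
        · by_cases h4 : k = i
          · subst h4
            exact H.lie_e_raise_self hj
          · obtain ⟨c, rfl⟩ := Nat.exists_eq_add_of_lt (show i < k by omega)
            obtain ⟨m, rfl⟩ := Nat.exists_eq_add_of_le (show c + 1 ≤ d by omega)
            exact H.lie_e_raise_inner (by omega)
  · rw [unit_self, ← lie_skew, H.he]
    have h1 : unit h e f k (k + 1) = e k := unit_lt (d := 0)
    by_cases h2 : i = k
    · subst h2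
      simp [h1]
    · by_cases h3 : i = k + 1
      · subst h3
        simp [h1]
      · simp [h2, h3, Ne.symm h3]
  · obtain ⟨d, rfl⟩ := Nat.exists_eq_add_of_lt hij
    rw [unit_gt]
    rcases lt_trichotomy k j with h1 | rfl | h1
    · rw [H.lie_e_lower_of_lt h1 hi, if_neg (by omega), if_neg (by omega), sub_zero]
    · rw [if_pos rfl]
      cases d with
      | zero => rw [lower, H.ef _ _ hk hk, if_pos rfl, if_pos rfl, unit_self, add_zero, unit_self]
      | succ d =>
        rw [H.lie_e_lower_first (by omega), if_neg (by omega), zero_sub,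
          show k + (d + 1) + 1 = k + 1 + d + 1 by omega, unit_gt]
    · rw [if_neg (by omega : ¬ j = k), sub_zero]
      by_cases h2 : k = j + d
      · rw [if_pos (by omega)]
        obtain ⟨d, rfl⟩ := Nat.exists_eq_succ_of_ne_zero (show d ≠ 0 by omega)
        subst h2
        rw [Nat.succ_eq_add_one, ← add_assoc, H.lie_e_lower_last (by omega), unit_gt]
      · rw [if_neg (by omega)]
        by_cases h3 : j + d < k
        · exact H.lie_e_lower_of_gt h3 hk
        · obtain ⟨c, rfl⟩ := Nat.exists_eq_add_of_lt h1
          obtain ⟨m, rfl⟩ := Nat.exists_eq_add_of_le (show c + 2 ≤ d by omega)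
          exact H.lie_e_lower_inner (by omega)

theorem lie_f_unit [IsAddTorsionFree A] (H : SerreRelations n h e f) {k i j : ℕ} (hk : k + 1 < n)
    (hi : i < n) (hj : j < n) : ⁅f k, unit h e f i j⁆ =
      (if k = i then unit h e f (k + 1) j else 0) - if j = k + 1 then unit h e f i k else 0 := by
  have := H.swap.lie_e_unit hk hj hi
  rw [unit_swap, unit_swap, unit_swap, neg_lie, lie_neg, neg_neg] at this
  rw [this]
  simp only [eq_comm (a := k + 1), eq_comm (a := k)]
  split_ifs <;> first | (simp; done) | (simp; abel)

theorem lie_h_unit (H : SerreRelations n h e f) (k i j : ℕ) : ⁅h k, unit h e f i j⁆ =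
      (if k = i then unit h e f i j else 0) - if j = k then unit h e f i j else 0 := by
  rcases lt_trichotomy i j with hij | rfl | hij
  · obtain ⟨d, rfl⟩ := Nat.exists_eq_add_of_lt hij
    rw [unit_lt, H.lie_h_raise]
    simp only [eq_comm (a := k)]
  · rw [unit_self, H.hh]
    simp only [eq_comm (a := k)]
    simp
  · obtain ⟨d, rfl⟩ := Nat.exists_eq_add_of_lt hij
    rw [unit_gt, H.lie_h_lower]
    simp only [eq_comm (a := k)]

variable {k : Type*} [Field k] [Algebra k A]

/-- The linear map with `E_{ij} ↦ unit h e f i j`. -/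
noncomputable def linearMap (k : Type*) [Field k] [Algebra k A] (n : ℕ) (h e f : ℕ → A) :
    Matrix (Fin n) (Fin n) k →ₗ[k] A :=
  (Matrix.stdBasis k (Fin n) (Fin n)).constr k fun p => unit h e f p.1 p.2

theorem linearMap_single (i j : Fin n) :
    linearMap k n h e f (Matrix.single i j 1) = unit h e f i j := by
  rw [linearMap, ← Matrix.stdBasis_eq_single, Module.Basis.constr_basis]

theorem lie_single (i j a b : Fin n) :
    ⁅(Matrix.single i j 1 : Matrix (Fin n) (Fin n) k), (Matrix.single a b 1 : Matrix _ _ k)⁆ =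
      (if j = a then Matrix.single i b (1 : k) else 0) - if b = i then Matrix.single a j 1 else 0 := by
  rw [Ring.lie_def]
  split_ifs with h1 h2 h2 <;> simp [*]

/-- The matrices whose commutators are preserved by a linear map are closed under commutators. -/
theorem preserves_lie {L : Type*} [LieRing L] [Module k L] (ρ : L →ₗ[k] A) {X Y : L}
    (hX : ∀ Z, ρ ⁅X, Z⁆ = ⁅ρ X, ρ Z⁆) (hY : ∀ Z, ρ ⁅Y, Z⁆ = ⁅ρ Y, ρ Z⁆) (Z : L) :
    ρ ⁅⁅X, Y⁆, Z⁆ = ⁅ρ ⁅X, Y⁆, ρ Z⁆ := by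
  rw [lie_lie, map_sub, hX, hY, hY, hX, hX, lie_lie]

theorem linearMap_lie_of_single (X : Matrix (Fin n) (Fin n) k)
    (hX : ∀ i j, linearMap k n h e f ⁅X, Matrix.single i j 1⁆ =
      ⁅linearMap k n h e f X, linearMap k n h e f (Matrix.single i j 1)⁆)
    (Z : Matrix (Fin n) (Fin n) k) :
    linearMap k n h e f ⁅X, Z⁆ = ⁅linearMap k n h e f X, linearMap k n h e f Z⁆ := by
  induction Z using Matrix.induction_on' with
  | h_zero => simp
  | h_add p q hp hq => simp only [lie_add, map_add, hp, hq]
  | h_std_basis i j c =>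
    have : (Matrix.single i j c : Matrix (Fin n) (Fin n) k) = c • Matrix.single i j 1 := by simp
    rw [this, map_smul, Ring.lie_def, Ring.lie_def, mul_smul_comm, smul_mul_assoc, ← smul_sub,
      map_smul, mul_smul_comm, smul_mul_assoc, ← smul_sub, ← Ring.lie_def, hX, Ring.lie_def]

/-- Elements that satisfy the Serre relations define a homomorphism from `gl_n`. -/
theorem linearMap_lie [CharZero k] (H : SerreRelations n h e f) (X Z : Matrix (Fin n) (Fin n) k) :
    linearMap k n h e f ⁅X, Z⁆ = ⁅linearMap k n h e f X, linearMap k n h e f Z⁆ := by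
  have : IsAddTorsionFree A := ⟨fun m hm x y hxy => by
    have h1 : (m : k) • x = (m : k) • y := by
      rw [Nat.cast_smul_eq_nsmul, Nat.cast_smul_eq_nsmul]
      exact hxy
    exact smul_right_injective A (Nat.cast_ne_zero.2 hm) h1⟩
  set ρ := linearMap k n h e f with hρ
  set P : Matrix (Fin n) (Fin n) k → Prop := fun X => ∀ Z, ρ ⁅X, Z⁆ = ⁅ρ X, ρ Z⁆ with hP
  have hh : ∀ i : Fin n, P (Matrix.single i i 1) := by
    intro i
    refine linearMap_lie_of_single _ fun a b => ?_
    rw [lie_single, linearMap_single, linearMap_single, unit_self, H.lie_h_unit]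
    simp only [map_sub, Fin.ext_iff, apply_ite (linearMap k n h e f), map_zero, linearMap_single]
    split_ifs with h1 h2 h2 <;> simp [*]
  have he : ∀ (i : ℕ) (hi : i + 1 < n), P (Matrix.single ⟨i, by omega⟩ ⟨i + 1, hi⟩ 1) := by
    intro i hi
    refine linearMap_lie_of_single _ fun a b => ?_
    rw [lie_single, linearMap_single, linearMap_single]
    have h1 : unit h e f i (i + 1) = e i := unit_lt (d := 0)
    rw [h1, H.lie_e_unit hi a.2 b.2]
    simp only [map_sub, Fin.ext_iff, apply_ite (linearMap k n h e f), map_zero, linearMap_single]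
  have hf : ∀ (i : ℕ) (hi : i + 1 < n), P (Matrix.single ⟨i + 1, hi⟩ ⟨i, by omega⟩ 1) := by
    intro i hi
    refine linearMap_lie_of_single _ fun a b => ?_
    rw [lie_single, linearMap_single, linearMap_single]
    have h1 : unit h e f (i + 1) i = f i := unit_gt (d := 0)
    rw [h1, H.lie_f_unit hi a.2 b.2]
    simp only [map_sub, Fin.ext_iff, apply_ite (linearMap k n h e f), map_zero, linearMap_single]
  have hup : ∀ (i d : ℕ) (hi : i + d + 1 < n),
      P (Matrix.single ⟨i, by omega⟩ ⟨i + d + 1, hi⟩ 1) := by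
    intro i d
    induction d with
    | zero => exact fun hi => he i hi
    | succ d ih =>
      intro hi
      have h1 := preserves_lie ρ (ih (by omega)) (he (i + d + 1) hi)
      rw [lie_single, if_pos rfl, if_neg (by simp [Fin.ext_iff]; omega), sub_zero] at h1
      exact h1
  have hlow : ∀ (i d : ℕ) (hi : i + d + 1 < n),
      P (Matrix.single ⟨i + d + 1, hi⟩ ⟨i, by omega⟩ 1) := by
    intro i d
    induction d with
    | zero => exact fun hi => hf i hi
    | succ d ih =>
      intro hi
      have h1 := preserves_lie ρ (hf (i + d + 1) hi) (ih (by omega))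
      rw [lie_single, if_pos rfl, if_neg (by simp [Fin.ext_iff]; omega), sub_zero] at h1
      exact h1
  have hall : ∀ i j : Fin n, P (Matrix.single i j 1) := by
    rintro ⟨i, hi⟩ ⟨j, hj⟩
    rcases lt_trichotomy i j with hij | rfl | hij
    · obtain ⟨d, rfl⟩ := Nat.exists_eq_add_of_lt hij
      exact hup i d hj
    · exact hh _
    · obtain ⟨d, rfl⟩ := Nat.exists_eq_add_of_lt hij
      exact hlow j d hi
  refine (Matrix.induction_on' (P := P) X ?_ ?_ ?_) Z
  · intro Z; simp
  · intro p q hp hq Z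
    rw [add_lie, map_add, hp, hq, map_add, add_lie]
  · intro i j c Z
    have : (Matrix.single i j c : Matrix (Fin n) (Fin n) k) = c • Matrix.single i j 1 := by simp
    rw [this, map_smul, Ring.lie_def, Ring.lie_def, mul_smul_comm, smul_mul_assoc, ← smul_sub,
      map_smul, mul_smul_comm, smul_mul_assoc, ← smul_sub, ← Ring.lie_def, hall, Ring.lie_def]

end SerreRelations

end SerreTheory

/-! ### Symmetric polynomials in the rows of the array -/

section SymmetricPolynomials

open MvPolynomial

theorem symmetric_mem_adjoin_esymm {k : Type*} [Field k] {m : ℕ} {p : MvPolynomial (Fin m) k}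
    (hp : p.IsSymmetric) :
    p ∈ Algebra.adjoin k (Set.range fun i : Fin m => esymm (Fin m) k (i + 1)) := by
  obtain ⟨q, hq⟩ := (esymmAlgHom_surjective (σ := Fin m) k (n := m) (by simp)) ⟨p, hp⟩
  have h1 : aeval (fun i : Fin m => esymm (Fin m) k (i + 1)) q = p := by
    rw [← esymmAlgHom_apply, hq]
  rw [← h1, Algebra.adjoin_range_eq_range_aeval]
  exact ⟨q, rfl⟩

/-- Newton's identities: elementary symmetric polynomials are polynomials in the power sums of the
degrees `1, …, m`. -/
theorem esymm_mem_adjoin_psum {k : Type*} [Field k] [CharZero k] {m : ℕ} (i : ℕ) (hi : i ≤ m) :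
    esymm (Fin m) k i ∈
      Algebra.adjoin k (Set.range fun l : Fin m => psum (Fin m) k (l.val + 1)) := by
  induction i using Nat.strong_induction_on with
  | _ i ih =>
  rcases Nat.eq_zero_or_pos i with rfl | h0
  · rw [esymm_zero]; exact one_mem _
  have h1 := mul_esymm_eq_sum (Fin m) k i
  have h2 : (i : MvPolynomial (Fin m) k) = C (i : k) := by simp
  have h3 : esymm (Fin m) k i = (i : k)⁻¹ • ((i : MvPolynomial (Fin m) k) * esymm (Fin m) k i) := by
    rw [h2, ← smul_eq_C_mul, inv_smul_smul₀ (by simpa using h0.ne')]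
  rw [h3, h1]
  refine Subalgebra.smul_mem _ (mul_mem (pow_mem (neg_mem (one_mem _)) _) (sum_mem fun a ha => ?_)) _
  obtain ⟨ha, hlt⟩ := Finset.mem_filter.1 ha
  have hsum := Finset.HasAntidiagonal.mem_antidiagonal.1 ha
  refine mul_mem (mul_mem (pow_mem (neg_mem (one_mem _)) _) (ih _ hlt (by omega)))
    (Algebra.subset_adjoin ⟨⟨a.2 - 1, by omega⟩, ?_⟩)
  change psum (Fin m) k (a.2 - 1 + 1) = _
  rw [Nat.sub_add_cancel (by omega)]

theorem symmetric_mem_adjoin_psum {k : Type*} [Field k] [CharZero k] {m : ℕ}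
    {p : MvPolynomial (Fin m) k} (hp : p.IsSymmetric) :
    p ∈ Algebra.adjoin k (Set.range fun l : Fin m => psum (Fin m) k (l.val + 1)) := by
  refine (Algebra.adjoin_le ?_ : _ ≤ _) (symmetric_mem_adjoin_esymm hp)
  rintro _ ⟨i, rfl⟩
  exact esymm_mem_adjoin_psum _ i.2

theorem isSymmetric_sum_rename {k : Type*} [Field k] {m : ℕ} (q : MvPolynomial (Fin m) k) :
    (∑ τ : Equiv.Perm (Fin m), rename τ q).IsSymmetric := by
  intro e
  rw [map_sum]
  refine Eq.trans ?_ (Equiv.sum_comp (Equiv.mulLeft e) _)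
  refine Finset.sum_congr rfl fun τ _ => ?_
  rw [rename_rename]
  rfl

end SymmetricPolynomials

namespace GelfandTsetlin

variable {k : Type*} [Field k] {n : ℕ}

open MvPolynomial

/-- The inclusion of the polynomials in a single row of variables. -/
noncomputable def rowHom (k : Type*) [Field k] {n : ℕ} (r : Fin n) :
    MvPolynomial (Fin (r.val + 1)) k →ₐ[k] PolyRing k n :=
  rename fun j => (⟨r, j⟩ : Pos n)

/-- The power sum `∑_j x_{rj} ^ l`. -/
noncomputable def rowPsum (k : Type*) [Field k] {n : ℕ} (r : Fin n) (l : ℕ) : PolyRing k n :=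
  ∑ j : Fin (r.val + 1), X (⟨r, j⟩ : Pos n) ^ l

theorem rowHom_psum (r : Fin n) (l : ℕ) : rowHom k r (psum _ k l) = rowPsum k r l := by
  simp [rowHom, rowPsum, psum]

theorem permHom_X (σ : ∀ r : Fin n, Equiv.Perm (Fin (r.val + 1))) (p : Pos n) :
    permHom k n σ (X p) = X ⟨p.1, σ p.1 p.2⟩ := by
  change rename _ (X p) = _
  rw [rename_X]
  rfl

theorem permHom_apply (σ : ∀ r : Fin n, Equiv.Perm (Fin (r.val + 1))) (f : PolyRing k n) :
    permHom k n σ f = rename (Equiv.sigmaCongrRight σ) f := rfl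

theorem permHom_C (σ : ∀ r : Fin n, Equiv.Perm (Fin (r.val + 1))) (c : k) :
    permHom k n σ (C c) = C c := by
  rw [permHom_apply, rename_C]

theorem permHom_rowHom (σ : ∀ r : Fin n, Equiv.Perm (Fin (r.val + 1))) (r : Fin n)
    (q : MvPolynomial (Fin (r.val + 1)) k) :
    permHom k n σ (rowHom k r q) = rowHom k r (rename (σ r) q) := by
  rw [permHom_apply, rowHom, rename_rename, rename_rename]
  rfl

theorem rowHom_mem_fixedPoints (r : Fin n) {q : MvPolynomial (Fin (r.val + 1)) k}
    (hq : q.IsSymmetric) :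
    rowHom k r q ∈ FixedPoints.subring (PolyRing k n) (permGroup k n) := by
  rintro ⟨_, σ, rfl⟩
  change permHom k n σ _ = _
  rw [permHom_rowHom, hq]

theorem rowPsum_mem_fixedPoints (r : Fin n) (l : ℕ) :
    rowPsum k r l ∈ FixedPoints.subring (PolyRing k n) (permGroup k n) := by
  rw [← rowHom_psum]
  exact rowHom_mem_fixedPoints r (psum_isSymmetric _ _ _)

theorem mem_fixedPoints_iff {f : PolyRing k n} :
    f ∈ FixedPoints.subring (PolyRing k n) (permGroup k n) ↔ ∀ σ, permHom k n σ f = f := by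
  constructor
  · intro h σ
    exact h ⟨_, σ, rfl⟩
  · rintro h ⟨_, σ, rfl⟩
    exact h σ

/-- The sum of the images of a monomial under `S_1 × ⋯ × S_n` is a product of sums over the single
symmetric groups. -/
theorem sum_permHom_monomial (a : Pos n →₀ ℕ) (c : k) :
    ∑ σ, permHom k n σ (monomial a c) = C c * ∏ r : Fin n, rowHom k r
      (∑ τ : Equiv.Perm (Fin (r.val + 1)), rename τ (∏ j : Fin (r.val + 1), X j ^ a ⟨r, j⟩)) := by
  simp only [map_sum]
  rw [Finset.prod_univ_sum, Finset.mul_sum, Fintype.piFinset_univ]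
  refine Finset.sum_congr rfl fun σ _ => ?_
  rw [monomial_eq, Finsupp.prod_fintype _ _ (by simp), Fintype.prod_sigma, map_mul, permHom_C]
  congr 1
  rw [map_prod]
  refine Finset.prod_congr rfl fun r _ => ?_
  simp [rowHom, permHom_X]

/-- The invariants of `S_1 × ⋯ × S_n` are polynomials in the power sums of the rows: average the
monomials, and apply the fundamental theorem on symmetric polynomials in each row. -/
theorem mem_adjoin_rowPsum [CharZero k] {f : PolyRing k n}
    (hf : f ∈ FixedPoints.subring (PolyRing k n) (permGroup k n)) :
    f ∈ Algebra.adjoin k {g | ∃ (r : Fin n) (l : ℕ), g = rowPsum k r l} := by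
  set S := Algebra.adjoin k {g | ∃ (r : Fin n) (l : ℕ), g = rowPsum k r l} with hS
  rw [mem_fixedPoints_iff] at hf
  have hrow : ∀ (r : Fin n) (q : MvPolynomial (Fin (r.val + 1)) k), q.IsSymmetric →
      rowHom k r q ∈ S := by
    intro r q hq
    have h1 : (Algebra.adjoin k (Set.range fun l : Fin (r.val + 1) =>
        psum (Fin (r.val + 1)) k (l.val + 1))).map
        (rowHom k r) ≤ S := by
      rw [AlgHom.map_adjoin]
      apply Algebra.adjoin_mono
      rintro _ ⟨_, ⟨l, rfl⟩, rfl⟩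
      exact ⟨r, l.val + 1, rowHom_psum r _⟩
    exact h1 ⟨_, symmetric_mem_adjoin_psum hq, rfl⟩
  have hsum : ∀ g : PolyRing k n, ∑ σ, permHom k n σ g ∈ S := by
    intro g
    induction g using MvPolynomial.induction_on' with
    | add p q hp hq => simp only [map_add, Finset.sum_add_distrib]; exact add_mem hp hq
    | monomial a c =>
      rw [sum_permHom_monomial]
      refine mul_mem (Subalgebra.algebraMap_mem _ _) (prod_mem fun r _ => hrow r _ ?_)
      exact isSymmetric_sum_rename _
  have h1 := hsum f
  simp only [hf, Finset.sum_const, Finset.card_univ] at h1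
  have h2 : f = (Fintype.card (∀ r : Fin n, Equiv.Perm (Fin (r.val + 1))) : k)⁻¹ •
      (Fintype.card (∀ r : Fin n, Equiv.Perm (Fin (r.val + 1))) • f) := by
    rw [← Nat.cast_smul_eq_nsmul k, inv_smul_smul₀ (Nat.cast_ne_zero.2 Fintype.card_ne_zero)]
  rw [h2]
  exact Subalgebra.smul_mem _ h1 _

/-! ### Translations of the variables -/

/-- The automorphism `x_p ↦ x_p - a_p`. -/
noncomputable def translation (k : Type*) [Field k] {n : ℕ} (a : Pos n → ℤ) :
    RingAut (PolyRing k n) :=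
  (AlgEquiv.ofAlgHom
    (aeval fun q => X q - C (a q : k)) (aeval fun q => X q + C (a q : k))
    (by ext q; simp) (by ext q; simp)).toRingEquiv

theorem translation_X (a : Pos n → ℤ) (p : Pos n) :
    translation k a (X p) = X p - C (a p : k) := by
  change aeval _ (X p) = _
  rw [aeval_X]

theorem translation_C (a : Pos n → ℤ) (c : k) : translation k a (C c) = C c := by
  change aeval _ (C c) = _
  rw [aeval_C]
  rfl

theorem ringAut_ext {μ ν : RingAut (PolyRing k n)} (hC : ∀ c, μ (C c) = ν (C c))
    (hX : ∀ p, μ (X p) = ν (X p)) : μ = ν := by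
  have : (μ : PolyRing k n →+* PolyRing k n) = ν := MvPolynomial.ringHom_ext hC hX
  exact RingEquiv.ext fun f => RingHom.congr_fun this f

theorem translation_add (a b : Pos n → ℤ) :
    translation k (a + b) = translation k a * translation k b := by
  apply ringAut_ext
  · intro c
    rw [RingAut.mul_apply, translation_C, translation_C, translation_C]
  · intro p
    rw [RingAut.mul_apply, translation_X, translation_X, map_sub, translation_X, translation_C]
    simp
    ring

theorem translation_zero : translation k (0 : Pos n → ℤ) = 1 := by
  apply ringAut_ext
  · intro c; rw [translation_C]; rfl
  · intro p; rw [translation_X]; simp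

theorem translation_neg (a : Pos n → ℤ) : translation k (-a) = (translation k a)⁻¹ := by
  rw [eq_inv_iff_mul_eq_one, ← translation_add, neg_add_cancel, translation_zero]

theorem translation_eq_perm [CharZero k] {a : Pos n → ℤ}
    {σ : ∀ r : Fin n, Equiv.Perm (Fin (r.val + 1))} (h : translation k a = permHom k n σ) :
    a = 0 := by
  funext p
  have h1 := congrArg (fun μ : RingAut (PolyRing k n) => constantCoeff (μ (X p))) h
  simp only [translation_X, permHom_X] at h1
  simpa using h1

theorem translation_injective [CharZero k] :
    Function.Injective (translation k : (Pos n → ℤ) → RingAut (PolyRing k n)) := by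
  intro a b h
  have h1 : translation k (a - b) = permHom k n 1 := by
    rw [sub_eq_add_neg, translation_add, translation_neg, h, mul_inv_cancel, map_one]
  exact sub_eq_zero.1 (translation_eq_perm h1)

theorem shift_eq_translation (p : Pos n) : shift k p = translation k (Pi.single p 1) := by
  apply ringAut_ext
  · intro c
    rw [translation_C]
    change aeval _ (C c) = _
    rw [aeval_C]
    rfl
  · intro q
    rw [translation_X]
    change aeval _ (X q) = _
    rw [aeval_X, Pi.single_apply]
    split_ifs <;> simp

/-- The generated group consists of all translations by integral vectors that vanish on the last
row. -/
theorem mem_shiftMonoid_iff {μ : RingAut (PolyRing k n)} : μ ∈ shiftMonoid k n ↔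
    ∃ a : Pos n → ℤ, (∀ p, ¬ p.1.val + 1 < n → a p = 0) ∧ μ = translation k a := by
  constructor
  · intro h
    change μ ∈ Subgroup.closure _ at h
    induction h using Subgroup.closure_induction with
    | mem μ h =>
      obtain ⟨p, hp, rfl⟩ := h
      refine ⟨Pi.single p 1, fun q hq => ?_, shift_eq_translation p⟩
      rw [Pi.single_apply, if_neg]
      rintro rfl
      exact hq hp
    | one => exact ⟨0, fun _ _ => rfl, translation_zero.symm⟩
    | mul μ ν _ _ h1 h2 =>
      obtain ⟨a, ha, rfl⟩ := h1
      obtain ⟨b, hb, rfl⟩ := h2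
      exact ⟨a + b, fun p hp => by simp [ha p hp, hb p hp], (translation_add a b).symm⟩
    | inv μ _ h1 =>
      obtain ⟨a, ha, rfl⟩ := h1
      exact ⟨-a, fun p hp => by simp [ha p hp], (translation_neg a).symm⟩
  · rintro ⟨a, ha, rfl⟩
    change translation k a ∈ Subgroup.closure _
    let T : AddSubgroup (Pos n → ℤ) :=
      { carrier := {a | translation k a ∈
          Subgroup.closure {δ | ∃ p : Pos n, p.1.val + 1 < n ∧ δ = shift k p}}
        add_mem' := fun {a b} h1 h2 => by
          rw [Set.mem_ofPred_eq, translation_add]; exact mul_mem h1 h2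
        zero_mem' := by rw [Set.mem_ofPred_eq, translation_zero]; exact one_mem _
        neg_mem' := fun {a} h1 => by
          rw [Set.mem_ofPred_eq, translation_neg]; exact inv_mem h1 }
    change a ∈ T
    rw [← Finset.univ_sum_single a]
    refine sum_mem fun p _ => ?_
    by_cases hp : p.1.val + 1 < n
    · have h1 : Pi.single p (a p) = a p • (Pi.single p 1 : Pos n → ℤ) := by
        rw [← Pi.single_smul, smul_eq_mul, mul_one]
      rw [h1]
      refine zsmul_mem ?_ _
      change translation k _ ∈
        Subgroup.closure {δ | ∃ p : Pos n, p.1.val + 1 < n ∧ δ = shift k p}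
      rw [← shift_eq_translation]
      exact Subgroup.subset_closure ⟨p, hp, rfl⟩
    · rw [ha p hp, Pi.single_zero]
      exact zero_mem _

theorem permHom_conj_translation (σ : ∀ r : Fin n, Equiv.Perm (Fin (r.val + 1)))
    (a : Pos n → ℤ) : permHom k n σ * translation k a * (permHom k n σ)⁻¹ =
      translation k fun p => a ⟨p.1, (σ p.1).symm p.2⟩ := by
  rw [mul_inv_eq_iff_eq_mul]
  apply ringAut_ext
  · intro c
    rw [RingAut.mul_apply, RingAut.mul_apply, translation_C, permHom_C, translation_C]
  · intro p
    rw [RingAut.mul_apply, RingAut.mul_apply, translation_X, map_sub, permHom_C, permHom_X,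
      translation_X]
    simp

/-! ### The standing assumptions on the polynomial ring, the permutations and the shifts -/

instance finite_permGroup : Finite (permGroup k n) :=
  Finite.of_surjective (permHom k n).rangeRestrict (permHom k n).rangeRestrict_surjective

theorem isNoetherian_of_isInvariant (k Γ B G : Type*) [Field k] [CommRing Γ] [CommRing B]
    [Algebra k Γ] [Algebra k B] [Algebra Γ B] [IsScalarTower k Γ B] [Algebra.FiniteType k B]
    [Group G] [Finite G] [MulSemiringAction G B] [SMulCommClass G Γ B] [Algebra.IsInvariant Γ B G]
    (hinj : Function.Injective (algebraMap Γ B)) : IsNoetherian Γ B := by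
  have hint : Algebra.IsIntegral Γ B := Algebra.IsInvariant.isIntegral Γ B G
  have hft : Algebra.FiniteType Γ B := Algebra.FiniteType.of_restrictScalars_finiteType k _ _
  have hfin : Module.Finite Γ B := Algebra.IsIntegral.finite
  have h1 : (⊤ : Subalgebra k Γ).FG :=
    fg_of_fg_of_fg k Γ B Algebra.FiniteType.out hfin.fg_top hinj
  have h2 : Algebra.FiniteType k Γ := ⟨h1⟩
  have : IsNoetherianRing Γ := Algebra.FiniteType.isNoetherianRing k Γ
  infer_instance

theorem isNoetherian_fixedPoints (k : Type*) {B : Type*} [Field k] [CommRing B] [Algebra k B]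
    [Algebra.FiniteType k B] (G : Subgroup (RingAut B)) [Finite G]
    (hC : ∀ c : k, algebraMap k B c ∈ FixedPoints.subring B G) :
    IsNoetherian (FixedPoints.subring B G) B := by
  let : Algebra k (FixedPoints.subring B G) :=
    RingHom.toAlgebra ((algebraMap k B).codRestrict _ hC)
  have : IsScalarTower k (FixedPoints.subring B G) B := IsScalarTower.of_algebraMap_eq fun c => rfl
  have : SMulCommClass G (FixedPoints.subring B G) B := ⟨fun g a b => by
    change g • ((a : B) * b) = (a : B) * g • b
    rw [smul_mul', a.2 g]⟩
  have : Algebra.IsInvariant (FixedPoints.subring B G) B G := ⟨fun b hb => ⟨⟨b, hb⟩, rfl⟩⟩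
  exact isNoetherian_of_isInvariant k _ _ G Subtype.val_injective

theorem setting (k : Type*) [Field k] [CharZero k] (n : ℕ) :
    GaloisRing.Setting (permGroup k n) (shiftMonoid k n) where
  integrallyClosed := UniqueFactorizationMonoid.instIsIntegrallyClosed
  finite := finite_permGroup
  separated := by
    intro μ hμ ν hν h
    obtain ⟨a, -, rfl⟩ := mem_shiftMonoid_iff.1 hμ
    obtain ⟨b, -, rfl⟩ := mem_shiftMonoid_iff.1 hν
    rw [← translation_neg, ← translation_add] at h ⊢
    obtain ⟨σ, hσ⟩ := h
    rw [translation_eq_perm hσ.symm, translation_zero]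
  conj_mem := by
    rintro g hg μ hμ
    obtain ⟨σ, hσ⟩ := MonoidHom.mem_range.1 hg
    obtain ⟨a, ha, hμ'⟩ := mem_shiftMonoid_iff.1 hμ
    have h2 : g * μ * g⁻¹ = translation k fun p => a ⟨p.1, (σ p.1).symm p.2⟩ := by
      rw [← hσ, hμ']; exact permHom_conj_translation σ a
    rw [h2]
    exact mem_shiftMonoid_iff.2 ⟨_, fun p hp => ha ⟨p.1, (σ p.1).symm p.2⟩ hp, rfl⟩
  noetherian := isNoetherian_fixedPoints k (permGroup k n) fun c =>
    mem_fixedPoints_iff.2 fun σ => permHom_C σ c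

end GelfandTsetlin

/-! ### Skew group rings of free abelian groups -/

namespace SkewMonoidAlgebra

/-- The coefficient of a product at a group element that can be reached in only one way. -/
theorem coeff_mul_mul_of_uniqueMul {L M : Type*} [Semiring L] [Monoid M] [MulSemiringAction M L]
    {f g : SkewMonoidAlgebra L M} {a b : M} (h : UniqueMul f.support g.support a b) :
    (f * g).coeff (a * b) = f.coeff a * a • g.coeff b := by
  classical
  rw [coeff_mul, sum_def']
  simp only [sum_def']
  rw [← Finset.sum_product', Finset.sum_eq_single (a, b)]
  · simp
  · rintro ⟨c, d⟩ hcd hne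
    rw [Finset.mem_product] at hcd
    refine if_neg fun he => hne ?_
    exact Prod.ext (h hcd.1 hcd.2 he).1 (h hcd.1 hcd.2 he).2
  · intro hn
    rw [Finset.mem_product, not_and_or, notMem_support_iff, notMem_support_iff] at hn
    rcases hn with hn | hn <;> simp [hn]

theorem noZeroDivisors_of_uniqueProds {L M : Type*} [DivisionRing L] [Group M]
    [MulSemiringAction M L] [UniqueProds M] : NoZeroDivisors (SkewMonoidAlgebra L M) where
  eq_zero_or_eq_zero_of_mul_eq_zero {f g} h := by
    contrapose! h
    have h1 : f.support.Nonempty := by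
      rw [Finset.nonempty_iff_ne_empty, Ne, support_eq_empty]; exact h.1
    have h2 : g.support.Nonempty := by
      rw [Finset.nonempty_iff_ne_empty, Ne, support_eq_empty]; exact h.2
    obtain ⟨a, ha, b, hb, hab⟩ := UniqueProds.uniqueMul_of_nonempty h1 h2
    intro h0
    have h3 := coeff_mul_mul_of_uniqueMul hab
    rw [h0, coeff_zero, Finsupp.zero_apply, eq_comm, mul_eq_zero, smul_eq_zero_iff_eq] at h3
    rw [mem_support_iff] at ha hb
    exact h3.elim ha hb

/-- For an abelian group, `c g ↦ g⁻¹ c` is an anti-automorphism of the skew group ring. -/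
noncomputable def reverse (L M : Type*) [CommRing L] [CommGroup M] [MulSemiringAction M L] :
    SkewMonoidAlgebra L M →+* (SkewMonoidAlgebra L M)ᵐᵒᵖ :=
  liftNCRingHom
    { toFun := fun c => MulOpposite.op (single 1 c)
      map_one' := rfl
      map_zero' := by simp
      map_add' := fun c d => by simp
      map_mul' := fun c d => by
        rw [← MulOpposite.op_mul, single_mul_single, one_smul, one_mul, mul_comm] }
    { toFun := fun g => MulOpposite.op (single g⁻¹ 1)
      map_one' := by rw [inv_one]; rfl
      map_mul' := fun g h => by
        rw [← MulOpposite.op_mul, single_mul_single, smul_one, mul_one, mul_inv, mul_comm] }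
    (by
      intro c g
      change MulOpposite.op (single 1 (g • c)) * MulOpposite.op (single g⁻¹ 1) =
        MulOpposite.op (single g⁻¹ 1) * MulOpposite.op (single 1 c)
      rw [← MulOpposite.op_mul, ← MulOpposite.op_mul, single_mul_single, single_mul_single]
      simp)

theorem reverse_single {L M : Type*} [CommRing L] [CommGroup M] [MulSemiringAction M L] (g : M)
    (c : L) : reverse L M (single g c) = MulOpposite.op (single g⁻¹ (g⁻¹ • c)) := by
  change liftNC _ _ _ = _
  rw [liftNC_single]
  change MulOpposite.op (single 1 c) * MulOpposite.op (single g⁻¹ 1) = _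
  rw [← MulOpposite.op_mul, single_mul_single]
  simp

theorem unop_reverse_unop_reverse {L M : Type*} [CommRing L] [CommGroup M] [MulSemiringAction M L]
    (z : SkewMonoidAlgebra L M) :
    (reverse L M (reverse L M z).unop).unop = z := by
  induction z using induction_on' with
  | single g c => simp [reverse_single]
  | add f g hf hg => rw [map_add, MulOpposite.unop_add, map_add, MulOpposite.unop_add, hf, hg]

theorem reverse_injective {L M : Type*} [CommRing L] [CommGroup M] [MulSemiringAction M L] :
    Function.Injective (reverse L M) := fun z w h => by
  rw [← unop_reverse_unop_reverse z, h, unop_reverse_unop_reverse]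

section Ore

variable {L M ι : Type*} [Field L] [CommGroup M] [Fintype ι]

/-- The elements whose support lies in the box `|a_i| ≤ d` of the free abelian group `ℤ^ι`. -/
noncomputable def box (L : Type*) {M ι : Type*} [Field L] [CommGroup M] (e : Multiplicative (ι → ℤ) ≃* M) (d : ℕ) :
    Submodule L (SkewMonoidAlgebra L M) :=
  Submodule.span L (Set.range fun a : ι → Finset.Icc (-(d : ℤ)) d =>
    single (e (Multiplicative.ofAdd fun i => (a i : ℤ))) (1 : L))

instance (e : Multiplicative (ι → ℤ) ≃* M) (d : ℕ) : FiniteDimensional L (box L e d) := by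
  unfold box
  exact FiniteDimensional.span_of_finite L (Set.finite_range _)

theorem finrank_box_le (e : Multiplicative (ι → ℤ) ≃* M) (d : ℕ) :
    Module.finrank L (box L e d) ≤ 2 ^ Fintype.card ι * (d + 1) ^ Fintype.card ι := by
  classical
  refine (finrank_range_le_card _).trans ?_
  rw [Fintype.card_fun, ← mul_pow]
  refine Nat.pow_le_pow_left ?_ _
  rw [Fintype.card_coe, Int.card_Icc]
  omega

theorem single_mem_box {L M ι : Type*} [Field L] [CommGroup M] (e : Multiplicative (ι → ℤ) ≃* M) {d : ℕ} {a : ι → ℤ}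
    (ha : ∀ i, |a i| ≤ d) (c : L) : single (e (Multiplicative.ofAdd a)) c ∈ box L e d := by
  have h1 : single (e (Multiplicative.ofAdd a)) c =
      c • single (e (Multiplicative.ofAdd a)) (1 : L) := by rw [smul_single, smul_eq_mul, mul_one]
  rw [h1]
  exact Submodule.smul_mem _ _
    (Submodule.subset_span ⟨fun i => ⟨a i, Finset.mem_Icc.2 (abs_le.1 (ha i))⟩, rfl⟩)

/-- Multiplication on the right by a fixed element enlarges the box of exponents only by a constant.
-/
theorem exists_mul_mem_box [MulSemiringAction M L] (e : Multiplicative (ι → ℤ) ≃* M) (z : SkewMonoidAlgebra L M) :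
    ∃ c : ℕ, ∀ f, c ≤ f → ∀ d, ∀ v ∈ box L e d, v * z ∈ box L e (d + f) := by
  induction z using induction_on' with
  | add z w hz hw =>
    obtain ⟨c₁, h₁⟩ := hz
    obtain ⟨c₂, h₂⟩ := hw
    refine ⟨max c₁ c₂, fun f hf d v hv => ?_⟩
    rw [mul_add]
    exact add_mem (h₁ f (le_of_max_le_left hf) d v hv) (h₂ f (le_of_max_le_right hf) d v hv)
  | single g c =>
    obtain ⟨b, rfl⟩ := e.surjective g
    obtain ⟨b, rfl⟩ := Multiplicative.ofAdd.surjective b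
    refine ⟨∑ i, (b i).natAbs, fun f hf d v hv => ?_⟩
    induction hv using Submodule.span_induction with
    | zero => rw [zero_mul]; exact zero_mem _
    | add v w _ _ hv hw => rw [add_mul]; exact add_mem hv hw
    | smul r v _ hv => rw [smul_mul_assoc]; exact Submodule.smul_mem _ _ hv
    | mem v hv =>
      obtain ⟨a, rfl⟩ := hv
      simp only [single_mul_single, ← map_mul, ← ofAdd_add]
      refine single_mem_box e (fun i => ?_) _
      have h1 := Finset.mem_Icc.1 (a i).2
      have h2 : (b i).natAbs ≤ f :=
        (Finset.single_le_sum (f := fun i => (b i).natAbs) (fun _ _ => Nat.zero_le _)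
          (Finset.mem_univ i)).trans hf
      rw [Pi.add_apply, abs_le]
      push_cast
      omega

/-- A skew group ring of a free abelian group of finite rank over a field is an Ore domain: it has
polynomial growth over the field on the left, and the anti-automorphism exchanges the sides. -/
theorem isOreDomain [MulSemiringAction M L] (e : Multiplicative (ι → ℤ) ≃* M) : IsOreDomain (SkewMonoidAlgebra L M) := by
  have hu : UniqueProds M := e.uniqueProds_iff.1 inferInstance
  have h0 : NoZeroDivisors (SkewMonoidAlgebra L M) := noZeroDivisors_of_uniqueProds
  have hd : IsDomain (SkewMonoidAlgebra L M) := NoZeroDivisors.to_isDomain _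
  have hl := left_ore_of_growth (D := L) (R := SkewMonoidAlgebra L M) (box L e) _ _
    (finrank_box_le e) (fun h => by
      have h1 := single_mem_box (L := L) e (d := 0) (a := 0) (by simp) 1
      rw [h, Submodule.mem_bot, single_eq_zero] at h1
      exact one_ne_zero h1) (exists_mul_mem_box e)
  refine ⟨hl, fun a s hs => ?_⟩
  obtain ⟨b, t, ht, h⟩ := hl (reverse L M a).unop (reverse L M s).unop (by
    rw [Ne, MulOpposite.unop_eq_zero_iff, map_eq_zero_iff _ reverse_injective]; exact hs)
  refine ⟨(reverse L M b).unop, (reverse L M t).unop, ?_, ?_⟩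
  · rw [Ne, MulOpposite.unop_eq_zero_iff, map_eq_zero_iff _ reverse_injective]; exact ht
  · have h1 := congrArg (fun z => (reverse L M z).unop) h
    simpa only [map_mul, MulOpposite.unop_mul, unop_reverse_unop_reverse] using h1

end Ore

end SkewMonoidAlgebra

namespace GelfandTsetlin

open MvPolynomial

/-! ### The ring of shift operators -/

noncomputable instance (k : Type*) [Field k] (n : ℕ) : CommGroup (shiftMonoid k n) :=
  { (inferInstance : Monoid (shiftMonoid k n)) with
    inv := fun μ => ⟨(μ : RingAut (PolyRing k n))⁻¹, Subgroup.inv_mem _ μ.2⟩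
    inv_mul_cancel := fun μ => Subtype.ext (inv_mul_cancel (μ : RingAut (PolyRing k n)))
    mul_comm := fun μ ν => by
      obtain ⟨a, -, ha⟩ := mem_shiftMonoid_iff.1 μ.2
      obtain ⟨b, -, hb⟩ := mem_shiftMonoid_iff.1 ν.2
      apply Subtype.ext
      change (μ : RingAut (PolyRing k n)) * ν = (ν : RingAut (PolyRing k n)) * μ
      rw [ha, hb, ← translation_add, ← translation_add, add_comm] }

/-- The positions outside the last row. -/
abbrev Inner (n : ℕ) : Type := {p : Pos n // p.1.val + 1 < n}

/-- Extension by zero of a function on the positions outside the last row. -/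
def extend {n : ℕ} (a : Inner n → ℤ) (p : Pos n) : ℤ :=
  if hp : p.1.val + 1 < n then a ⟨p, hp⟩ else 0

theorem extend_inner {n : ℕ} (a : Inner n → ℤ) (p : Inner n) : extend a p.1 = a p :=
  dif_pos p.2

theorem extend_of_not {n : ℕ} (a : Inner n → ℤ) {p : Pos n} (hp : ¬ p.1.val + 1 < n) :
    extend a p = 0 :=
  dif_neg hp

theorem extend_add {n : ℕ} (a b : Inner n → ℤ) : extend (a + b) = extend a + extend b := by
  funext p
  by_cases hp : p.1.val + 1 < n <;> simp [extend, hp]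

theorem extend_single {n : ℕ} (p : Inner n) (c : ℤ) :
    extend (Pi.single p c) = Pi.single p.1 c := by
  funext q
  by_cases hq : q.1.val + 1 < n
  · simp [extend, hq, Pi.single_apply, Subtype.ext_iff]
  · rw [extend_of_not _ hq, Pi.single_apply, if_neg]
    rintro rfl
    exact hq p.2

variable {k : Type*} [Field k] {n : ℕ}

/-- The shift by an integer vector on the positions outside the last row. -/
noncomputable def shiftHom (k : Type*) [Field k] (n : ℕ) :
    Multiplicative (Inner n → ℤ) →* shiftMonoid k n where
  toFun a := ⟨translation k (extend a.toAdd),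
    mem_shiftMonoid_iff.2 ⟨_, fun _ hp => extend_of_not _ hp, rfl⟩⟩
  map_one' := Subtype.ext (by
    change translation k (extend (0 : Inner n → ℤ)) = 1
    rw [← translation_zero]
    congr 1
    funext p
    simp [extend])
  map_mul' a b := Subtype.ext (by
    change translation k (extend (a.toAdd + b.toAdd)) = _
    rw [extend_add, translation_add]
    rfl)

theorem shiftHom_bijective [CharZero k] : Function.Bijective (shiftHom k n) := by
  refine ⟨fun a b h => ?_, fun μ => ?_⟩
  · have h1 : extend a.toAdd = extend b.toAdd := translation_injective (congrArg Subtype.val h)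
    have h2 : a.toAdd = b.toAdd := by
      funext p
      rw [← extend_inner a.toAdd, h1, extend_inner]
    exact h2
  · obtain ⟨a, ha, h⟩ := mem_shiftMonoid_iff.1 μ.2
    refine ⟨Multiplicative.ofAdd fun p => a p.1, Subtype.ext ?_⟩
    rw [h]
    change translation k (extend fun p => a p.1) = _
    congr 1
    funext p
    by_cases hp : p.1.val + 1 < n
    · simp [extend, hp]
    · rw [extend_of_not _ hp, ha p hp]

/-- The group generated by the shifts is free abelian on the shifts. -/
noncomputable def shiftEquiv (k : Type*) [Field k] [CharZero k] (n : ℕ) :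
    Multiplicative (Inner n → ℤ) ≃* shiftMonoid k n :=
  MulEquiv.ofBijective (shiftHom k n) shiftHom_bijective

theorem coe_shiftEquiv [CharZero k] (a : Inner n → ℤ) :
    (shiftEquiv k n (Multiplicative.ofAdd a) : RingAut (PolyRing k n)) =
      translation k (extend a) := rfl

theorem shiftEquiv_single [CharZero k] (p : Inner n) :
    shiftEquiv k n (Multiplicative.ofAdd (Pi.single p 1)) =
      ⟨shift k p.1, Subgroup.subset_closure ⟨p.1, p.2, rfl⟩⟩ := by
  apply Subtype.ext
  rw [coe_shiftEquiv, extend_single]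
  exact (shift_eq_translation p.1).symm

theorem ringAut_smul_algebraMap (μ : RingAut (PolyRing k n)) (f : PolyRing k n) :
    μ • algebraMap (PolyRing k n) (FractionRing (PolyRing k n)) f = algebraMap _ _ (μ f) := by
  change IsFractionRing.ringEquivOfRingEquiv
    (MulSemiringAction.toRingEquiv (RingAut (PolyRing k n)) (PolyRing k n) μ) _ = _
  rw [IsFractionRing.ringEquivOfRingEquiv_algebraMap]
  rfl

theorem smul_algebraMap (μ : shiftMonoid k n) (f : PolyRing k n) :
    μ • algebraMap (PolyRing k n) (FractionRing (PolyRing k n)) f =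
      algebraMap _ _ ((μ : RingAut (PolyRing k n)) f) :=
  ringAut_smul_algebraMap _ _

theorem shiftMonoid_apply_C (μ : shiftMonoid k n) (c : k) :
    (μ : RingAut (PolyRing k n)) (C c) = C c := by
  obtain ⟨a, -, ha⟩ := mem_shiftMonoid_iff.1 μ.2
  rw [ha, translation_C]

instance : SMulCommClass (shiftMonoid k n) k (FractionRing (PolyRing k n)) where
  smul_comm μ c f := by
    rw [Algebra.smul_def, Algebra.smul_def, smul_mul',
      IsScalarTower.algebraMap_apply k (PolyRing k n) (FractionRing (PolyRing k n)),
      smul_algebraMap, MvPolynomial.algebraMap_eq, shiftMonoid_apply_C]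

theorem shiftEquiv_smul_x [CharZero k] (a : Inner n → ℤ) (p : Pos n) :
    shiftEquiv k n (Multiplicative.ofAdd a) • x k p = x k p - (extend a p : ℤ) := by
  rw [x, smul_algebraMap]
  rw [coe_shiftEquiv, translation_X, map_sub]
  simp

instance isOreDomain_shiftRing [CharZero k] : IsOreDomain (ShiftRing k n) :=
  SkewMonoidAlgebra.isOreDomain (shiftEquiv k n)

end GelfandTsetlin

namespace SkewMonoidAlgebra

variable {L M : Type*} [CommRing L] [CommGroup M] [MulSemiringAction M L]

/-- The element `g c` of a skew group ring, with the coefficient on the right. -/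
noncomputable def rsingle (g : M) (c : L) : SkewMonoidAlgebra L M := single g (g • c)

theorem of_mul_single_one (g : M) (c : L) : of L M g * single 1 c = rsingle g c := by
  rw [of_apply, single_mul_single, mul_one, one_mul, rsingle]

theorem rsingle_mul_rsingle (g h : M) (c d : L) :
    rsingle g c * rsingle h d = rsingle (g * h) (h⁻¹ • c * d) := by
  rw [rsingle, rsingle, rsingle, single_mul_single, smul_mul', smul_smul, smul_smul,
    mul_inv_cancel_right]

theorem single_one_mul_rsingle (g : M) (c d : L) :
    single 1 c * rsingle g d = rsingle g (g⁻¹ • c * d) := by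
  rw [rsingle, rsingle, single_mul_single, smul_mul', smul_inv_smul, one_mul, one_smul]

theorem rsingle_mul_single_one (g : M) (c d : L) :
    rsingle g c * single 1 d = rsingle g (c * d) := by
  rw [rsingle, rsingle, single_mul_single, smul_mul', mul_one]

theorem rsingle_one (c : L) : rsingle (1 : M) c = single 1 c := by
  rw [rsingle, one_smul]

/-- Two monomials commute up to coefficients as soon as their coefficients do. -/
theorem rsingle_exchange {g h : M} {c d r s : L} (H : h⁻¹ • c * d * r = g⁻¹ • d * c * s) :
    rsingle g c * rsingle h d * single 1 r = rsingle h d * rsingle g c * single 1 s := by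
  rw [rsingle_mul_rsingle, rsingle_mul_rsingle, rsingle_mul_single_one, rsingle_mul_single_one, H,
    mul_comm]

theorem rsingle_commute {g h : M} {c d : L} (H : h⁻¹ • c * d = g⁻¹ • d * c) :
    rsingle g c * rsingle h d = rsingle h d * rsingle g c := by
  rw [rsingle_mul_rsingle, rsingle_mul_rsingle, H, mul_comm]

end SkewMonoidAlgebra

namespace GelfandTsetlin

open MvPolynomial SkewMonoidAlgebra

/-! ### The coefficients of the Gelfand-Tsetlin formulas -/

theorem prod_add_single_sub {ι L : Type*} [DecidableEq ι] [Field L] (S : Finset ι) (y : ι → L)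
    {s : ι} (hs : s ∈ S) (c t : L) :
    (∏ q ∈ S, ((y q + if q = s then c else 0) - t)) * (y s - t) =
      (∏ q ∈ S, (y q - t)) * (y s + c - t) := by
  rw [← Finset.mul_prod_erase _ _ hs, ← Finset.mul_prod_erase (a := s) _ (fun q => y q - t) hs,
    if_pos rfl]
  have h1 : ∏ q ∈ S.erase s, ((y q + if q = s then c else 0) - t) =
      ∏ q ∈ S.erase s, (y q - t) :=
    Finset.prod_congr rfl fun q hq => by rw [if_neg (Finset.ne_of_mem_erase hq), add_zero]
  rw [h1]
  ring

theorem prod_add_single_sub_of_notMem {ι L : Type*} [DecidableEq ι] [Field L] (S : Finset ι)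
    (y : ι → L) {s : ι} (hs : s ∉ S) (c t : L) :
    ∏ q ∈ S, ((y q + if q = s then c else 0) - t) = ∏ q ∈ S, (y q - t) :=
  Finset.prod_congr rfl fun q hq => by
    rw [if_neg (fun h : q = s => hs (h ▸ hq)), add_zero]

variable {k : Type*} [Field k] {n : ℕ}

theorem mem_row {m : ℕ} {p : Pos n} : p ∈ row n m ↔ p.1.val + 1 = m := by simp [row]

theorem x_sub_x_add_intCast_ne_zero {p q : Pos n} (h : q ≠ p) (c : ℤ) :
    x k q - x k p + (c : FractionRing (PolyRing k n)) ≠ 0 := by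
  have h1 : x k q - x k p + (c : FractionRing (PolyRing k n)) =
      algebraMap (PolyRing k n) _ (X q - X p + C (c : k)) := by
    simp [x]
  rw [h1]
  refine fun h0 => ?_
  have h2 := (map_eq_zero_iff _ (IsFractionRing.injective (PolyRing k n) _)).1 h0
  have h3 := congrArg (aeval fun r => if r = q then (1 : k) - c else 0) h2
  simp [h.symm] at h3

theorem x_sub_x_ne_zero {p q : Pos n} (h : q ≠ p) : x k q - x k p ≠ 0 := by
  simpa using x_sub_x_add_intCast_ne_zero (k := k) h 0

/-- The common shape of the coefficients in the Gelfand-Tsetlin formulas. -/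
noncomputable def ratio (k : Type*) [Field k] {n : ℕ} (S T : Finset (Pos n)) (p : Pos n) :
    FractionRing (PolyRing k n) :=
  (∏ q ∈ S, (x k q - x k p)) / ∏ q ∈ T, (x k q - x k p)

theorem Aplus_eq (p : Pos n) : Aplus k p =
    -ratio k (row n (p.1.val + 2)) ((row n (p.1.val + 1)).erase p) p :=
  neg_div _ _

section Coefficients

variable {g : FractionRing (PolyRing k n) →+* FractionRing (PolyRing k n)} {s : Pos n} {c : ℤ}
  (hg : ∀ q, g (x k q) = x k q + if q = s then (c : FractionRing (PolyRing k n)) else 0)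

include hg

theorem map_ratio_of_notMem {S T : Finset (Pos n)} {p : Pos n} (hsp : s ≠ p) (hS : s ∉ S)
    (hT : s ∉ T) : g (ratio k S T p) = ratio k S T p := by
  simp only [ratio, map_div₀, map_prod, map_sub, hg, if_neg hsp.symm, add_zero]
  rw [prod_add_single_sub_of_notMem _ _ hS, prod_add_single_sub_of_notMem _ _ hT]

theorem map_ratio_of_mem_left {S T : Finset (Pos n)} {p : Pos n} (hsp : s ≠ p) (hS : s ∈ S)
    (hT : s ∉ T) :
    g (ratio k S T p) * (x k s - x k p) = ratio k S T p * (x k s - x k p + c) := by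
  simp only [ratio, map_div₀, map_prod, map_sub, hg, if_neg hsp.symm, add_zero]
  rw [prod_add_single_sub_of_notMem _ _ hT, div_mul_eq_mul_div, prod_add_single_sub _ _ hS,
    div_mul_eq_mul_div, add_sub_right_comm]

theorem map_ratio_of_mem_right {S T : Finset (Pos n)} {p : Pos n} (hsp : s ≠ p) (hS : s ∉ S)
    (hT : s ∈ T) (hp : p ∉ T) :
    g (ratio k S T p) * (x k s - x k p + c) = ratio k S T p * (x k s - x k p) := by
  have h2 := x_sub_x_add_intCast_ne_zero (k := k) hsp c
  have h3 := prod_add_single_sub T (x k) hT (c : FractionRing (PolyRing k n)) (x k p)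
  have h5 : ∏ q ∈ T, (x k q - x k p) ≠ 0 :=
    Finset.prod_ne_zero_iff.2 fun q hq => x_sub_x_ne_zero fun h : q = p => hp (h ▸ hq)
  have h6 : ∏ q ∈ T,
      ((x k q + if q = s then (c : FractionRing (PolyRing k n)) else 0) - x k p) ≠ 0 := by
    intro h0
    rw [h0, zero_mul, eq_comm, add_sub_right_comm] at h3
    exact mul_ne_zero h5 h2 h3
  simp only [ratio, map_div₀, map_prod, map_sub, hg, if_neg hsp.symm, add_zero]
  rw [prod_add_single_sub_of_notMem _ _ hS, div_mul_eq_mul_div, div_mul_eq_mul_div,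
    div_eq_div_iff h6 h5, mul_assoc, mul_assoc, mul_comm (x k s - x k p) _, h3]
  ring

theorem map_Aplus_same {p : Pos n} (hsp : s ≠ p) (hr : s.1.val = p.1.val) :
    g (Aplus k p) * (x k s - x k p + c) = Aplus k p * (x k s - x k p) := by
  have h := map_ratio_of_mem_right hg (S := row n (p.1.val + 2))
    (T := (row n (p.1.val + 1)).erase p) hsp (by rw [mem_row]; omega)
    (Finset.mem_erase.2 ⟨hsp, mem_row.2 (by rw [hr])⟩) (Finset.notMem_erase _ _)
  rw [Aplus_eq, map_neg, neg_mul, neg_mul, h]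

theorem map_Aplus_below {p : Pos n} (hr : s.1.val = p.1.val + 1) :
    g (Aplus k p) * (x k s - x k p) = Aplus k p * (x k s - x k p + c) := by
  have hsp : s ≠ p := by rintro rfl; omega
  have h := map_ratio_of_mem_left hg (S := row n (p.1.val + 2))
    (T := (row n (p.1.val + 1)).erase p) hsp (mem_row.2 (by omega))
    (fun h => by have := mem_row.1 (Finset.mem_of_mem_erase h); omega)
  rw [Aplus_eq, map_neg, neg_mul, neg_mul, h]

theorem map_Aplus_other {p : Pos n} (h₁ : s.1.val ≠ p.1.val) (h₂ : s.1.val ≠ p.1.val + 1) :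
    g (Aplus k p) = Aplus k p := by
  have hsp : s ≠ p := by rintro rfl; omega
  rw [Aplus_eq, map_neg, map_ratio_of_notMem hg hsp (by rw [mem_row]; omega)
    (fun h => by have := mem_row.1 (Finset.mem_of_mem_erase h); omega)]

theorem map_Aminus_same {p : Pos n} (hsp : s ≠ p) (hr : s.1.val = p.1.val) :
    g (Aminus k p) * (x k s - x k p + c) = Aminus k p * (x k s - x k p) :=
  map_ratio_of_mem_right hg hsp (by rw [mem_row]; omega)
    (Finset.mem_erase.2 ⟨hsp, mem_row.2 (by rw [hr])⟩) (Finset.notMem_erase _ _)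

theorem map_Aminus_above {p : Pos n} (hr : s.1.val + 1 = p.1.val) :
    g (Aminus k p) * (x k s - x k p) = Aminus k p * (x k s - x k p + c) :=
  map_ratio_of_mem_left hg (by rintro rfl; omega) (mem_row.2 (by omega))
    (fun h => by have := mem_row.1 (Finset.mem_of_mem_erase h); omega)

theorem map_Aminus_other {p : Pos n} (h₁ : s.1.val ≠ p.1.val) (h₂ : s.1.val + 1 ≠ p.1.val) :
    g (Aminus k p) = Aminus k p :=
  map_ratio_of_notMem hg (by rintro rfl; omega) (by rw [mem_row]; omega)
    (fun h => by have := mem_row.1 (Finset.mem_of_mem_erase h); omega)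

end Coefficients

/-! ### Exchange relations between the terms of the Gelfand-Tsetlin formulas -/

/-- The shift at a position outside the last row, as an element of the group of shifts. -/
noncomputable def sft (k : Type*) [Field k] {n : ℕ} (p : Inner n) : shiftMonoid k n :=
  ⟨shift k p.1, Subgroup.subset_closure ⟨p.1, p.2, rfl⟩⟩

/-- The coefficients, as elements of the ring of shift operators. -/
noncomputable abbrev cf (k : Type*) [Field k] (n : ℕ) :
    FractionRing (PolyRing k n) →+* ShiftRing k n := GaloisRing.coeffHom (shiftMonoid k n)

/-- The term of `E_{i,i+1}` at a position in the row of length `i`. -/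
noncomputable def ep (k : Type*) [Field k] {n : ℕ} (p : Inner n) : ShiftRing k n :=
  rsingle (sft k p) (Aplus k p.1)

/-- The term of `E_{i+1,i}` at a position in the row of length `i`. -/
noncomputable def fp (k : Type*) [Field k] {n : ℕ} (p : Inner n) : ShiftRing k n :=
  rsingle (sft k p)⁻¹ (Aminus k p.1)

theorem ep_eq (p : Inner n) : δ k p.1 p.2 * cf k n (Aplus k p.1) = ep k p :=
  of_mul_single_one _ _

theorem fp_eq (p : Inner n) : δInv k p.1 p.2 * cf k n (Aminus k p.1) = fp k p :=
  of_mul_single_one _ _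

/-- The action of a group element on the field of fractions, as a ring homomorphism. -/
noncomputable abbrev act (μ : shiftMonoid k n) :
    FractionRing (PolyRing k n) →+* FractionRing (PolyRing k n) :=
  MulSemiringAction.toRingHom _ _ μ

theorem sft_smul_x (p : Inner n) (q : Pos n) :
    sft k p • x k q = x k q + if q = p.1 then ((-1 : ℤ) : FractionRing (PolyRing k n)) else 0 := by
  rw [x, smul_algebraMap]
  change algebraMap _ _ (shift k p.1 (X q)) = _
  rw [shift_eq_translation, translation_X, map_sub, Pi.single_apply]
  split_ifs <;> simp [sub_eq_add_neg]

theorem sft_inv_smul_x (p : Inner n) (q : Pos n) :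
    (sft k p)⁻¹ • x k q = x k q + if q = p.1 then ((1 : ℤ) : FractionRing (PolyRing k n)) else 0 := by
  rw [inv_smul_eq_iff, smul_add, sft_smul_x]
  split_ifs <;> simp

theorem cf_mul_ep (p : Inner n) (c : FractionRing (PolyRing k n)) :
    cf k n c * ep k p = ep k p * cf k n ((sft k p)⁻¹ • c) := by
  change single 1 _ * rsingle _ _ = rsingle _ _ * single 1 _
  rw [single_one_mul_rsingle, rsingle_mul_single_one, mul_comm]

theorem cf_mul_fp (p : Inner n) (c : FractionRing (PolyRing k n)) :
    cf k n c * fp k p = fp k p * cf k n (sft k p • c) := by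
  change single 1 _ * rsingle _ _ = rsingle _ _ * single 1 _
  rw [single_one_mul_rsingle, rsingle_mul_single_one, mul_comm, inv_inv]

theorem ep_mul_ep_same {p q : Inner n} (hpq : p ≠ q) (hr : p.1.1.val = q.1.1.val) :
    ep k p * ep k q * cf k n (x k q.1 - x k p.1 + 1) =
      ep k q * ep k p * cf k n (x k q.1 - x k p.1 - 1) := by
  have hpq' : p.1 ≠ q.1 := fun h => hpq (Subtype.ext h)
  have h1 := map_Aplus_same (g := act (sft k q)⁻¹) (sft_inv_smul_x q) hpq'.symm hr.symm
  have h2 := map_Aplus_same (g := act (sft k p)⁻¹) (sft_inv_smul_x p) hpq' hr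
  simp only [MulSemiringAction.toRingHom_apply, Int.cast_one] at h1 h2
  refine rsingle_exchange ?_
  linear_combination Aplus k q.1 * h1 + Aplus k p.1 * h2

theorem fp_mul_fp_same {p q : Inner n} (hpq : p ≠ q) (hr : p.1.1.val = q.1.1.val) :
    fp k p * fp k q * cf k n (x k q.1 - x k p.1 - 1) =
      fp k q * fp k p * cf k n (x k q.1 - x k p.1 + 1) := by
  have hpq' : p.1 ≠ q.1 := fun h => hpq (Subtype.ext h)
  have h1 := map_Aminus_same (g := act (sft k q)) (sft_smul_x q) hpq'.symm hr.symm
  have h2 := map_Aminus_same (g := act (sft k p)) (sft_smul_x p) hpq' hr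
  simp only [MulSemiringAction.toRingHom_apply, Int.cast_one, Int.cast_neg] at h1 h2
  refine rsingle_exchange ?_
  rw [inv_inv, inv_inv]
  linear_combination Aminus k q.1 * h1 + Aminus k p.1 * h2

/-- Here `q` lies in the row below that of `p`. -/
theorem ep_mul_ep_below {p q : Inner n} (hr : q.1.1.val = p.1.1.val + 1) :
    ep k p * ep k q * cf k n (x k q.1 - x k p.1) =
      ep k q * ep k p * cf k n (x k q.1 - x k p.1 + 1) := by
  have h1 := map_Aplus_below (g := act (sft k q)⁻¹) (sft_inv_smul_x q) hr
  have h2 := map_Aplus_other (g := act (sft k p)⁻¹) (sft_inv_smul_x p) (p := q.1)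
    (by omega) (by omega)
  simp only [MulSemiringAction.toRingHom_apply, Int.cast_one] at h1 h2
  refine rsingle_exchange ?_
  linear_combination Aplus k q.1 * h1 - Aplus k p.1 * (x k q.1 - x k p.1 + 1) * h2

/-- Here `q` lies in the row below that of `p`. -/
theorem fp_mul_fp_below {p q : Inner n} (hr : q.1.1.val = p.1.1.val + 1) :
    fp k p * fp k q * cf k n (x k q.1 - x k p.1 + 1) =
      fp k q * fp k p * cf k n (x k q.1 - x k p.1) := by
  have h1 := map_Aminus_other (g := act (sft k q)) (sft_smul_x q) (p := p.1)
    (by omega) (by omega)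
  have h2 := map_Aminus_above (g := act (sft k p)) (sft_smul_x p) hr.symm
  simp only [MulSemiringAction.toRingHom_apply, Int.cast_one, Int.cast_neg] at h1 h2
  refine rsingle_exchange ?_
  rw [inv_inv, inv_inv]
  linear_combination Aminus k q.1 * (x k q.1 - x k p.1 + 1) * h1 + Aminus k p.1 * h2

theorem ep_mul_ep_far {p q : Inner n} (hr : p.1.1.val + 1 < q.1.1.val) :
    ep k p * ep k q = ep k q * ep k p := by
  have h1 := map_Aplus_other (g := act (sft k q)⁻¹) (sft_inv_smul_x q) (p := p.1)
    (by omega) (by omega)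
  have h2 := map_Aplus_other (g := act (sft k p)⁻¹) (sft_inv_smul_x p) (p := q.1)
    (by omega) (by omega)
  simp only [MulSemiringAction.toRingHom_apply] at h1 h2
  refine rsingle_commute ?_
  rw [h1, h2, mul_comm]

theorem fp_mul_fp_far {p q : Inner n} (hr : p.1.1.val + 1 < q.1.1.val) :
    fp k p * fp k q = fp k q * fp k p := by
  have h1 := map_Aminus_other (g := act (sft k q)) (sft_smul_x q) (p := p.1)
    (by omega) (by omega)
  have h2 := map_Aminus_other (g := act (sft k p)) (sft_smul_x p) (p := q.1)
    (by omega) (by omega)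
  simp only [MulSemiringAction.toRingHom_apply] at h1 h2
  refine rsingle_commute ?_
  rw [inv_inv, inv_inv, h1, h2, mul_comm]

theorem ep_mul_fp {p q : Inner n} (hpq : p ≠ q) : ep k p * fp k q = fp k q * ep k p := by
  have hpq' : p.1 ≠ q.1 := fun h => hpq (Subtype.ext h)
  refine rsingle_commute ?_
  rw [inv_inv]
  by_cases hs : p.1.1.val = q.1.1.val
  · have h1 := map_Aplus_same (g := act (sft k q)) (sft_smul_x q) hpq'.symm hs.symm
    have h2 := map_Aminus_same (g := act (sft k p)⁻¹) (sft_inv_smul_x p) hpq' hs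
    simp only [MulSemiringAction.toRingHom_apply, Int.cast_one, Int.cast_neg] at h1 h2
    have h3 := x_sub_x_add_intCast_ne_zero (k := k) hpq' 1
    rw [Int.cast_one] at h3
    refine mul_right_cancel₀ h3 ?_
    linear_combination -Aminus k q.1 * h1 - Aplus k p.1 * h2
  by_cases hb : q.1.1.val = p.1.1.val + 1
  · have h1 := map_Aplus_below (g := act (sft k q)) (sft_smul_x q) hb
    have h2 := map_Aminus_above (g := act (sft k p)⁻¹) (sft_inv_smul_x p) hb.symm
    simp only [MulSemiringAction.toRingHom_apply, Int.cast_one, Int.cast_neg] at h1 h2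
    refine mul_right_cancel₀ (x_sub_x_ne_zero (k := k) hpq') ?_
    linear_combination -Aminus k q.1 * h1 - Aplus k p.1 * h2
  · have h1 := map_Aplus_other (g := act (sft k q)) (sft_smul_x q) (p := p.1)
      (fun h => hs h.symm) hb
    have h2 := map_Aminus_other (g := act (sft k p)⁻¹) (sft_inv_smul_x p) (p := q.1)
      hs (fun h => hb h.symm)
    simp only [MulSemiringAction.toRingHom_apply] at h1 h2
    rw [h1, h2, mul_comm]

end GelfandTsetlin

namespace GelfandTsetlin

open MvPolynomial

attribute [local instance] LieRing.ofAssociativeRing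

/-! ### The Serre relations for the Gelfand-Tsetlin formulas -/

/-- The Serre relation `[E, [E, Q]] = 0` for a sum `E` of terms that commute with each other and
with `Q` up to rational coefficients: the terms of `[E, [E, Q]]` cancel in pairs. -/
theorem lie_lie_sum_eq_zero {L A ι : Type*} [Field L] [CharZero L] [Ring A] [DecidableEq ι] (c : L →+* A)
    (s : Finset ι) (E : ι → A) (Q : A) (u : ι → L) (σ : ι → L →+* L)
    (hE : ∀ i ∈ s, ∀ a, c a * E i = E i * c (σ i a))
    (hσ : ∀ i ∈ s, ∀ j ∈ s, σ i (u j) = u j - if j = i then 1 else 0)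
    (hu : ∀ i ∈ s, u i ≠ 0) (hu' : ∀ i ∈ s, u i - 1 ≠ 0)
    (hQ : ∀ i ∈ s, E i * Q * c (u i) = Q * E i * c (u i + 1))
    (hEE : ∀ i ∈ s, ∀ j ∈ s, i ≠ j → E i * E j * c (u i - u j + 1) = E j * E i * c (u i - u j - 1)) :
    ⁅∑ i ∈ s, E i, ⁅∑ i ∈ s, E i, Q⁆⁆ = 0 := by
  have h1 : ∀ i ∈ s, E i * Q = Q * E i * c ((u i + 1) / u i) := fun i hi => by
    rw [div_eq_mul_inv, map_mul, ← mul_assoc, ← hQ i hi, mul_assoc, ← map_mul,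
      mul_inv_cancel₀ (hu i hi), map_one, mul_one]
  have h2 : ∀ i ∈ s, ⁅E i, Q⁆ = Q * E i * c (u i)⁻¹ := fun i hi => by
    have h : (u i + 1) / u i = 1 + (u i)⁻¹ := by rw [add_div, div_self (hu i hi), one_div]
    rw [Ring.lie_def, h1 i hi, h, map_add, map_one, mul_add, mul_one, add_sub_cancel_left]
  have h3 : ∀ i ∈ s, ∀ j ∈ s, ⁅E j, ⁅E i, Q⁆⁆ =
      Q * (E j * E i * c (σ i ((u j + 1) / u j) * (u i)⁻¹) - E i * E j * c (σ j (u i)⁻¹)) := by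
    intro i hi j hj
    rw [h2 i hi, Ring.lie_def, mul_sub]
    congr 1
    · rw [← mul_assoc, ← mul_assoc, h1 j hj, mul_assoc (Q * E j), hE i hi, map_mul]
      simp only [mul_assoc]
    · rw [mul_assoc, hE j hj]
      simp only [mul_assoc]
  have h4 : ⁅∑ i ∈ s, E i, ⁅∑ i ∈ s, E i, Q⁆⁆ = ∑ i ∈ s, ∑ j ∈ s, ⁅E j, ⁅E i, Q⁆⁆ := by
    rw [sum_lie, Finset.sum_congr rfl fun i _ => by rw [sum_lie, lie_sum], Finset.sum_comm]
  rw [h4, Finset.sum_congr rfl fun i hi => Finset.sum_congr rfl fun j hj => h3 i hi j hj]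
  simp only [← Finset.mul_sum, Finset.sum_sub_distrib]
  rw [Finset.sum_comm (f := fun i j => E i * E j * c (σ j (u i)⁻¹)), ← Finset.sum_sub_distrib]
  simp only [← Finset.sum_sub_distrib, ← mul_sub, ← map_sub]
  have h5 : ∑ i ∈ s, ∑ j ∈ s,
      E j * E i * c (σ i ((u j + 1) / u j) * (u i)⁻¹ - σ i (u j)⁻¹) = 0 := by
    set T : ι → ι → A := fun i j =>
      E j * E i * c (σ i ((u j + 1) / u j) * (u i)⁻¹ - σ i (u j)⁻¹) with hT
    have h6 : ∀ i ∈ s, ∀ j ∈ s, T i j + T j i = 0 := by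
      intro i hi j hj
      simp only [hT]
      by_cases hij : i = j
      · subst hij
        have h7 : σ i ((u i + 1) / u i) * (u i)⁻¹ - σ i (u i)⁻¹ = 0 := by
          rw [map_div₀, map_add, map_one, map_inv₀, hσ i hi i hi, if_pos rfl]
          field_simp [hu i hi, hu' i hi]
          ring
        rw [h7, map_zero, mul_zero, add_zero]
      · rw [map_div₀, map_add, map_one, map_inv₀, map_div₀, map_add, map_one, map_inv₀,
          hσ i hi j hj, hσ j hj i hi, if_neg hij, if_neg (Ne.symm hij), sub_zero, sub_zero]
        have h8 : (u j + 1) / u j * (u i)⁻¹ - (u j)⁻¹ =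
            (-(u i - u j - 1)) * ((u i)⁻¹ * (u j)⁻¹) := by
          field_simp [hu i hi, hu j hj]
          ring
        have h9 : (u i + 1) / u i * (u j)⁻¹ - (u i)⁻¹ =
            (u i - u j + 1) * ((u i)⁻¹ * (u j)⁻¹) := by
          field_simp [hu i hi, hu j hj]
          ring
        rw [h8, h9, map_mul c (-_), map_mul c (_ + _), ← mul_assoc, ← mul_assoc, ← add_mul, map_neg, mul_neg,
          hEE i hi j hj hij, neg_add_cancel, zero_mul]
    -- the terms of `(i, j)` and of `(j, i)` cancel
    have h10 : ∑ i ∈ s, ∑ j ∈ s, T i j + ∑ i ∈ s, ∑ j ∈ s, T i j = 0 := by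
      nth_rewrite 2 [Finset.sum_comm]
      rw [← Finset.sum_add_distrib]
      refine Finset.sum_eq_zero fun i hi => ?_
      rw [← Finset.sum_add_distrib]
      exact Finset.sum_eq_zero fun j hj => h6 i hi j hj
    have h11 : ∀ z : A, z + z = 0 → z = 0 := fun z hz => by
      have h12 : c (2 : L)⁻¹ * (z + z) = z := by
        rw [← two_mul, ← mul_assoc, ← map_ofNat c 2, ← map_mul, inv_mul_cancel₀ two_ne_zero,
          map_one, one_mul]
      rw [← h12, hz, mul_zero]
    exact h11 _ h10
  rw [h5, mul_zero]

variable {k : Type*} [Field k] {n : ℕ}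

/-- The positions in the row with index `i`, if this is not the last row. -/
def innerRow (n i : ℕ) : Finset (Inner n) := {p | p.1.1.val = i}

theorem mem_innerRow {i : ℕ} {p : Inner n} : p ∈ innerRow n i ↔ p.1.1.val = i := by
  simp [innerRow]

/-- The image of `E_{ii}`. -/
noncomputable def hRow (k : Type*) [Field k] (n i : ℕ) : ShiftRing k n :=
  cf k n (∑ p ∈ row n (i + 1), (x k p + (p.2.val : FractionRing (PolyRing k n))) -
    ∑ p ∈ row n i, (x k p + (p.2.val : FractionRing (PolyRing k n))))

/-- The image of `E_{i,i+1}`. -/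
noncomputable def eRow (k : Type*) [Field k] (n i : ℕ) : ShiftRing k n :=
  ∑ p ∈ innerRow n i, ep k p

/-- The image of `E_{i+1,i}`. -/
noncomputable def fRow (k : Type*) [Field k] (n i : ℕ) : ShiftRing k n :=
  ∑ p ∈ innerRow n i, fp k p

instance [CharZero k] : CharZero (FractionRing (PolyRing k n)) :=
  charZero_of_injective_algebraMap (algebraMap k (FractionRing (PolyRing k n))).injective

theorem eRow_eee [CharZero k] (i : ℕ) :
    ⁅eRow k n i, ⁅eRow k n i, eRow k n (i + 1)⁆⁆ = 0 := by
  conv_lhs => rw [eRow, eRow, lie_sum, lie_sum]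
  refine Finset.sum_eq_zero fun q hq => ?_
  rw [mem_innerRow] at hq
  refine lie_lie_sum_eq_zero (cf k n) _ _ _ (fun p => x k q.1 - x k p.1)
    (fun p => act (sft k p)⁻¹) (fun p _ a => cf_mul_ep p a) (fun p hp r hr => ?_)
    (fun p hp => ?_) (fun p hp => ?_) (fun p hp => ?_) (fun p hp r hr hpr => ?_)
  all_goals simp only [mem_innerRow] at *
  · have h : q ≠ p := fun h => by rw [h] at hq; omega
    simp only [map_sub, MulSemiringAction.toRingHom_apply, sft_inv_smul_x, if_neg h,
      ← Subtype.ext_iff]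
    split_ifs <;> simp
    ring
  · exact x_sub_x_ne_zero fun h => by rw [h] at hq; omega
  · have h := x_sub_x_add_intCast_ne_zero (k := k) (p := p.1) (q := q.1)
      (fun h => by rw [h] at hq; omega) (-1)
    rwa [Int.cast_neg, Int.cast_one, ← sub_eq_add_neg] at h
  · exact ep_mul_ep_below (by omega)
  · have h := ep_mul_ep_same (k := k) hpr (by omega)
    rwa [sub_sub_sub_cancel_left]

theorem mul_map_neg_iff {L A : Type*} [Ring L] [Ring A] (f : L →+* A) {a b : A} {r s : L} :
    a * f (-r) = b * f (-s) ↔ a * f r = b * f s := by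
  rw [map_neg, map_neg, mul_neg, mul_neg, neg_inj]

theorem eRow_eee' [CharZero k] (i : ℕ) :
    ⁅eRow k n (i + 1), ⁅eRow k n i, eRow k n (i + 1)⁆⁆ = 0 := by
  rw [← lie_skew (eRow k n i), lie_neg, neg_eq_zero]
  conv_lhs => rw [eRow, eRow, lie_sum, lie_sum]
  refine Finset.sum_eq_zero fun q hq => ?_
  rw [mem_innerRow] at hq
  refine lie_lie_sum_eq_zero (cf k n) _ _ _ (fun p => x k q.1 - x k p.1 - 1)
    (fun p => act (sft k p)⁻¹) (fun p _ a => cf_mul_ep p a) (fun p hp r hr => ?_)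
    (fun p hp => ?_) (fun p hp => ?_) (fun p hp => ?_) (fun p hp r hr hpr => ?_)
  all_goals simp only [mem_innerRow] at *
  · have h : q ≠ p := fun h => by rw [h] at hq; omega
    simp only [map_sub, map_one, MulSemiringAction.toRingHom_apply, sft_inv_smul_x, if_neg h,
      ← Subtype.ext_iff]
    split_ifs <;> simp
    ring
  · have h := x_sub_x_add_intCast_ne_zero (k := k) (p := p.1) (q := q.1)
      (fun h => by rw [h] at hq; omega) (-1)
    rwa [Int.cast_neg, Int.cast_one, ← sub_eq_add_neg] at h
  · have h := x_sub_x_add_intCast_ne_zero (k := k) (p := p.1) (q := q.1)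
      (fun h => by rw [h] at hq; omega) (-2)
    convert h using 1
    push_cast
    ring
  · refine (mul_map_neg_iff (cf k n)).1 ?_
    convert (ep_mul_ep_below (k := k) (p := q) (q := p) (by omega)).symm using 3 <;> ring
  · convert ep_mul_ep_same (k := k) hpr (by omega) using 3 <;> ring

theorem fRow_fff [CharZero k] (i : ℕ) :
    ⁅fRow k n i, ⁅fRow k n i, fRow k n (i + 1)⁆⁆ = 0 := by
  conv_lhs => rw [fRow, fRow, lie_sum, lie_sum]
  refine Finset.sum_eq_zero fun q hq => ?_
  rw [mem_innerRow] at hq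
  refine lie_lie_sum_eq_zero (cf k n) _ _ _ (fun p => x k p.1 - x k q.1 - 1)
    (fun p => act (sft k p)) (fun p _ a => cf_mul_fp p a) (fun p hp r hr => ?_)
    (fun p hp => ?_) (fun p hp => ?_) (fun p hp => ?_) (fun p hp r hr hpr => ?_)
  all_goals simp only [mem_innerRow] at *
  · have h : q ≠ p := fun h => by rw [h] at hq; omega
    simp only [map_sub, map_one, MulSemiringAction.toRingHom_apply, sft_smul_x, if_neg h,
      ← Subtype.ext_iff]
    split_ifs <;> simp
    ring
  · have h := x_sub_x_add_intCast_ne_zero (k := k) (p := q.1) (q := p.1)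
      (fun h => by rw [← h] at hq; omega) (-1)
    rwa [Int.cast_neg, Int.cast_one, ← sub_eq_add_neg] at h
  · have h := x_sub_x_add_intCast_ne_zero (k := k) (p := q.1) (q := p.1)
      (fun h => by rw [← h] at hq; omega) (-2)
    convert h using 1
    push_cast
    ring
  · refine (mul_map_neg_iff (cf k n)).1 ?_
    convert fp_mul_fp_below (k := k) (p := p) (q := q) (by omega) using 3 <;> ring
  · refine (mul_map_neg_iff (cf k n)).1 ?_
    convert fp_mul_fp_same (k := k) hpr (by omega) using 3 <;> ring

theorem fRow_fff' [CharZero k] (i : ℕ) :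
    ⁅fRow k n (i + 1), ⁅fRow k n i, fRow k n (i + 1)⁆⁆ = 0 := by
  rw [← lie_skew (fRow k n i), lie_neg, neg_eq_zero]
  conv_lhs => rw [fRow, fRow, lie_sum, lie_sum]
  refine Finset.sum_eq_zero fun q hq => ?_
  rw [mem_innerRow] at hq
  refine lie_lie_sum_eq_zero (cf k n) _ _ _ (fun p => x k p.1 - x k q.1)
    (fun p => act (sft k p)) (fun p _ a => cf_mul_fp p a) (fun p hp r hr => ?_)
    (fun p hp => ?_) (fun p hp => ?_) (fun p hp => ?_) (fun p hp r hr hpr => ?_)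
  all_goals simp only [mem_innerRow] at *
  · have h : q ≠ p := fun h => by rw [h] at hq; omega
    simp only [map_sub, MulSemiringAction.toRingHom_apply, sft_smul_x, if_neg h,
      ← Subtype.ext_iff]
    split_ifs <;> simp
    ring
  · exact x_sub_x_ne_zero fun h => by rw [← h] at hq; omega
  · have h := x_sub_x_add_intCast_ne_zero (k := k) (p := q.1) (q := p.1)
      (fun h => by rw [← h] at hq; omega) (-1)
    rwa [Int.cast_neg, Int.cast_one, ← sub_eq_add_neg] at h
  · exact (fp_mul_fp_below (k := k) (p := q) (q := p) (by omega)).symm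
  · refine (mul_map_neg_iff (cf k n)).1 ?_
    convert fp_mul_fp_same (k := k) hpr (by omega) using 3 <;> ring

theorem eRow_ee (i j : ℕ) (hij : i + 1 < j) : ⁅eRow k n i, eRow k n j⁆ = 0 := by
  rw [eRow, eRow, sum_lie]
  refine Finset.sum_eq_zero fun p hp => ?_
  rw [lie_sum]
  refine Finset.sum_eq_zero fun q hq => ?_
  rw [mem_innerRow] at hp hq
  rw [Ring.lie_def, ep_mul_ep_far (by omega), sub_self]

theorem fRow_ff (i j : ℕ) (hij : i + 1 < j) : ⁅fRow k n i, fRow k n j⁆ = 0 := by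
  rw [fRow, fRow, sum_lie]
  refine Finset.sum_eq_zero fun p hp => ?_
  rw [lie_sum]
  refine Finset.sum_eq_zero fun q hq => ?_
  rw [mem_innerRow] at hp hq
  rw [Ring.lie_def, fp_mul_fp_far (by omega), sub_self]

theorem hRow_hh (i j : ℕ) : ⁅hRow k n i, hRow k n j⁆ = 0 := by
  rw [hRow, hRow, Ring.lie_def, ← map_mul, ← map_mul, mul_comm, sub_self]

theorem map_sum_row (g : FractionRing (PolyRing k n) →+* FractionRing (PolyRing k n)) {s : Pos n}
    {c : FractionRing (PolyRing k n)} (hg : ∀ q, g (x k q) = x k q + if q = s then c else 0)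
    (m : ℕ) : g (∑ p ∈ row n m, (x k p + (p.2.val : FractionRing (PolyRing k n)))) =
      ∑ p ∈ row n m, (x k p + (p.2.val : FractionRing (PolyRing k n))) +
        if s.1.val + 1 = m then c else 0 := by
  rw [map_sum]
  simp only [map_add, hg, map_natCast, add_right_comm (x k _) (ite _ _ _)]
  rw [Finset.sum_add_distrib, Finset.sum_ite_eq' (row n m) s fun _ => c]
  simp only [mem_row]

theorem mul_map_ite_sub_ite {L A : Type*} [Ring L] [Ring A] (f : L →+* A) (z : A) (P Q : Prop)
    [Decidable P] [Decidable Q] : z * f ((if P then 1 else 0) - if Q then 1 else 0) =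
      (if P then z else 0) - if Q then z else 0 := by
  split_ifs <;> simp

theorem hRow_he (i j : ℕ) : ⁅hRow k n i, eRow k n j⁆ =
    (if i = j then eRow k n j else 0) - if i = j + 1 then eRow k n j else 0 := by
  have h1 : ∀ p ∈ innerRow n j, ⁅hRow k n i, ep k p⁆ =
      (if i = j then ep k p else 0) - if i = j + 1 then ep k p else 0 := by
    intro p hp
    rw [mem_innerRow] at hp
    rw [Ring.lie_def, hRow, cf_mul_ep, ← mul_sub, ← map_sub]
    have h2 := map_sum_row (act (sft k p)⁻¹) (sft_inv_smul_x p)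
    simp only [MulSemiringAction.toRingHom_apply] at h2
    rw [smul_sub, h2, h2, hp, ← mul_map_ite_sub_ite (cf k n)]
    congr 2
    simp only [add_left_inj, eq_comm (a := j + 1)]
    split_ifs <;> simp
  rw [eRow, lie_sum, Finset.sum_congr rfl h1]
  split_ifs <;> simp

theorem hRow_hf (i j : ℕ) : ⁅hRow k n i, fRow k n j⁆ =
    (if i = j + 1 then fRow k n j else 0) - if i = j then fRow k n j else 0 := by
  have h1 : ∀ p ∈ innerRow n j, ⁅hRow k n i, fp k p⁆ =
      (if i = j + 1 then fp k p else 0) - if i = j then fp k p else 0 := by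
    intro p hp
    rw [mem_innerRow] at hp
    rw [Ring.lie_def, hRow, cf_mul_fp, ← mul_sub, ← map_sub]
    have h2 := map_sum_row (act (sft k p)) (sft_smul_x p)
    simp only [MulSemiringAction.toRingHom_apply] at h2
    rw [smul_sub, h2, h2, hp, ← mul_map_ite_sub_ite (cf k n)]
    congr 2
    simp only [add_left_inj, eq_comm (a := j + 1)]
    split_ifs <;> simp
  rw [fRow, lie_sum, Finset.sum_congr rfl h1]
  split_ifs <;> simp

end GelfandTsetlin

/-! ### Residues of rational functions -/

section Residues

open Polynomial

/-- The coefficient of `u⁻¹` in the expansion at infinity of `F(u) / ∏_i (u - v_i)`, as the sum of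
the residues at the simple poles `v_i`. -/
noncomputable def residueSum {L ι : Type*} [Field L] [DecidableEq ι] (s : Finset ι) (v : ι → L)
    (F : L[X]) : L :=
  ∑ i ∈ s, F.eval (v i) / ∏ j ∈ s.erase i, (v i - v j)

variable {L ι : Type*} [Field L] [DecidableEq ι] {s : Finset ι} {v : ι → L}

theorem residueSum_sub (F H : L[X]) :
    residueSum s v (F - H) = residueSum s v F - residueSum s v H := by
  simp only [residueSum, eval_sub, sub_div, Finset.sum_sub_distrib]

theorem residueSum_eq_coeff (hv : Set.InjOn v s) {F : L[X]} (hF : F.degree < s.card) :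
    residueSum s v F = F.coeff (s.card - 1) :=
  (Lagrange.coeff_eq_sum hv hF).symm

theorem residueSum_mul_nodal (F : L[X]) :
    residueSum s v (F * ∏ i ∈ s, (X - C (v i))) = 0 := by
  refine Finset.sum_eq_zero fun i hi => ?_
  rw [eval_mul, eval_prod, Finset.prod_eq_zero hi (by simp), mul_zero, zero_div]

/-- Two monic polynomials of degree equal to the number of poles differ in degree less by one. -/
theorem residueSum_of_monic (hv : Set.InjOn v s) {N : L[X]} (hN : N.Monic)
    (hd : N.natDegree = s.card) (hs : s.Nonempty) :
    residueSum s v N = N.nextCoeff + ∑ i ∈ s, v i := by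
  have hD : (∏ i ∈ s, (X - C (v i))).Monic := monic_prod_of_monic _ _ fun i _ => monic_X_sub_C _
  have hDd : (∏ i ∈ s, (X - C (v i))).natDegree = s.card := by simp [natDegree_prod_of_monic _ _ fun i _ => monic_X_sub_C (v i)]
  have h1 : N.degree = (∏ i ∈ s, (X - C (v i))).degree := by
    rw [degree_eq_natDegree hN.ne_zero, degree_eq_natDegree hD.ne_zero, hd, hDd]
  have h2 : (N - ∏ i ∈ s, (X - C (v i))).degree < s.card := by
    refine (degree_sub_lt_left h1 hN.ne_zero (by rw [hN.leadingCoeff, hD.leadingCoeff])).trans_eq ?_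
    rw [degree_eq_natDegree hN.ne_zero, hd]
  have h3 : residueSum s v (N - ∏ i ∈ s, (X - C (v i))) = residueSum s v N := by
    have h4 := residueSum_mul_nodal (s := s) (v := v) 1
    rw [one_mul] at h4
    rw [residueSum_sub, h4, sub_zero]
  have hpos : 0 < s.card := hs.card_pos
  rw [← h3, residueSum_eq_coeff hv h2, coeff_sub, nextCoeff_of_natDegree_pos (by omega), hd]
  have h5 := nextCoeff_of_natDegree_pos (p := ∏ i ∈ s, (X - C (v i))) (by omega)
  rw [prod_X_sub_C_nextCoeff, hDd] at h5
  rw [← h5, sub_neg_eq_add]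

end Residues

namespace GelfandTsetlin

open SkewMonoidAlgebra

attribute [local instance] LieRing.ofAssociativeRing

variable {k : Type*} [Field k] {n : ℕ}

theorem row_eq_map (r : Fin n) : row n (r.val + 1) =
    Finset.univ.map (Function.Embedding.sigmaMk (β := fun r : Fin n => Fin (r.val + 1)) r) := by
  ext ⟨s, j⟩
  simp only [mem_row, Finset.mem_map, Finset.mem_univ, true_and, Function.Embedding.sigmaMk_apply]
  constructor
  · intro h
    obtain rfl : r = s := Fin.ext (by simpa using h.symm)
    exact ⟨j, rfl⟩
  · rintro ⟨i, h⟩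
    exact (congrArg (fun p : Pos n => p.1.val + 1) h).symm

theorem card_row {m : ℕ} (hm : m ≤ n) : (row n m).card = m := by
  rcases m with - | m
  · rw [Finset.card_eq_zero, Finset.eq_empty_iff_forall_notMem]
    intro p hp
    have := mem_row.1 hp
    omega
  · rw [row_eq_map ⟨m, hm⟩, Finset.card_map, Finset.card_univ, Fintype.card_fin]

theorem sum_row_offset {m : ℕ} (hm : m ≤ n) :
    (∑ p ∈ row n m, (p.2.val : FractionRing (PolyRing k n))) * 2 = m * (m - 1) := by
  rcases m with - | m
  · have h : row n 0 = ∅ := by rw [← Finset.card_eq_zero, card_row hm]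
    simp [h]
  · rw [row_eq_map ⟨m, hm⟩, Finset.sum_map]
    change (∑ j : Fin (m + 1), (j.val : FractionRing (PolyRing k n))) * 2 = _
    have h1 := Finset.sum_range_id_mul_two (m + 1)
    rw [Finset.sum_range] at h1
    have h2 := congrArg (Nat.cast : ℕ → FractionRing (PolyRing k n)) h1
    push_cast at h2 ⊢
    simpa using h2

theorem sum_innerRow {M : Type*} [AddCommMonoid M] {i : ℕ} (hi : i + 1 < n) (F : Pos n → M) :
    ∑ p ∈ innerRow n i, F p.1 = ∑ p ∈ row n (i + 1), F p := by
  refine Finset.sum_bij (fun p _ => p.1) (fun p hp => ?_) (fun p _ q _ h => Subtype.ext h)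
    (fun p hp => ?_) (fun _ _ => rfl)
  · rw [mem_innerRow] at hp
    rw [mem_row, hp]
  · rw [mem_row] at hp
    exact ⟨⟨p, by omega⟩, mem_innerRow.2 (by change p.1.val = i; omega), rfl⟩

/-! ### The commutators of raising and lowering terms -/

/-- The poles in the residue formula: `x_p` and `x_p + 1`, where `p` runs through a row. -/
noncomputable def node (k : Type*) [Field k] {n : ℕ} (z : Pos n × Bool) :
    FractionRing (PolyRing k n) :=
  x k z.1 + if z.2 then 1 else 0

/-- The numerator in the residue formula, for the row with index `i`. -/
noncomputable def numer (k : Type*) [Field k] (n i : ℕ) :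
    Polynomial (FractionRing (PolyRing k n)) :=
  (∏ q ∈ row n (i + 2), (Polynomial.X - Polynomial.C (x k q + 1))) *
    ∏ q ∈ row n i, (Polynomial.X - Polynomial.C (x k q))

theorem node_injective [CharZero k] : Function.Injective (node k : Pos n × Bool → _) := by
  rintro ⟨p, a⟩ ⟨q, b⟩ h
  have h0 : x k p - x k q + ((if a then 1 else 0) - (if b then 1 else 0) : ℤ) = 0 := by
    simp only [node] at h
    push_cast
    linear_combination h
  have hpq : p = q := by
    by_contra hpq
    exact x_sub_x_add_intCast_ne_zero hpq _ h0
  subst hpq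
  rw [sub_self, zero_add, Int.cast_eq_zero] at h0
  cases a <;> cases b <;> simp_all

theorem prod_erase_node (S : Finset (Pos n)) {p : Pos n} (hp : p ∈ S) (b : Bool)
    (F : Pos n × Bool → FractionRing (PolyRing k n)) :
    ∏ z ∈ (S ×ˢ Finset.univ).erase (p, b), F z =
      F (p, !b) * ∏ q ∈ S.erase p, (F (q, true) * F (q, false)) := by
  have h1 : (S ×ˢ (Finset.univ : Finset Bool)).erase (p, b) =
      insert (p, !b) (S.erase p ×ˢ Finset.univ) := by
    ext ⟨q, c⟩
    simp only [Finset.mem_erase, Finset.mem_product, Finset.mem_univ, and_true, Finset.mem_insert,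
      Prod.mk.injEq, ne_eq]
    by_cases hq : q = p
    · subst hq
      cases b <;> cases c <;> simp [hp]
    · simp [hq]
  rw [h1, Finset.prod_insert (by simp), Finset.prod_product]
  simp

theorem ep_mul_fp_self (p : Inner n) :
    ep k p * fp k p = cf k n (sft k p • Aplus k p.1 * Aminus k p.1) := by
  rw [ep, fp, rsingle_mul_rsingle, mul_inv_cancel, inv_inv, rsingle_one]
  rfl

theorem fp_mul_ep_self (p : Inner n) :
    fp k p * ep k p = cf k n ((sft k p)⁻¹ • Aminus k p.1 * Aplus k p.1) := by
  rw [ep, fp, rsingle_mul_rsingle, inv_mul_cancel, rsingle_one]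
  rfl

theorem prod_mul_prod_sub_comm {ι L : Type*} [Field L] (S R : Finset ι) (y z : ι → L) (t : L)
    (h : Even (S.card + R.card)) :
    (∏ q ∈ S, (t - y q)) * ∏ q ∈ R, (t - z q) = (∏ q ∈ S, (y q - t)) * ∏ q ∈ R, (z q - t) := by
  have h1 : ∀ (S : Finset ι) (y : ι → L),
      ∏ q ∈ S, (t - y q) = (-1) ^ S.card * ∏ q ∈ S, (y q - t) := fun S y => by
    rw [← Finset.prod_neg]
    exact Finset.prod_congr rfl fun q _ => (neg_sub _ _).symm
  rw [h1, h1 R]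
  have h2 : (-1 : L) ^ S.card * (-1) ^ R.card = 1 := by rw [← pow_add, h.neg_one_pow]
  linear_combination (∏ q ∈ S, (y q - t)) * (∏ q ∈ R, (z q - t)) * h2

/-- The coefficient at a position of the product of the raising and the lowering element is a
residue of `N(u) / D(u)`, at the point `x_p`. -/
theorem residue_at_x [CharZero k] (p : Inner n) :
    sft k p • Aplus k p.1 * Aminus k p.1 =
      (numer k n p.1.1.val).eval (node k (p.1, false)) /
        ∏ z ∈ (row n (p.1.1.val + 1) ×ˢ Finset.univ).erase (p.1, false),
          (node k (p.1, false) - node k z) := by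
  set T := (row n (p.1.1.val + 1)).erase p.1 with hT
  have h1 : sft k p • Aplus k p.1 =
      -(∏ q ∈ row n (p.1.1.val + 2), (x k q + 1 - x k p.1)) / ∏ q ∈ T, (x k q + 1 - x k p.1) := by
    change act (sft k p) (Aplus k p.1) = _
    simp only [Aplus, map_div₀, map_neg, map_prod, map_sub, MulSemiringAction.toRingHom_apply,
      sft_smul_x, if_true]
    congr 1
    · refine congrArg Neg.neg (Finset.prod_congr rfl fun q hq => ?_)
      have hqp : q ≠ p.1 := fun h => by rw [h, mem_row] at hq; omega
      rw [if_neg hqp]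
      push_cast
      ring
    · refine Finset.prod_congr rfl fun q hq => ?_
      rw [if_neg (Finset.ne_of_mem_erase hq)]
      push_cast
      ring
  have hp : p.1 ∈ row n (p.1.1.val + 1) := mem_row.2 rfl
  have hc : Even ((row n (p.1.1.val + 2)).card + (row n p.1.1.val).card) := by
    rw [card_row (by have := p.2; omega), card_row (by have := p.2; omega)]
    exact ⟨p.1.1.val + 1, by ring⟩
  rw [h1, prod_erase_node _ hp, Aminus, numer, Polynomial.eval_mul, Polynomial.eval_prod,
    Polynomial.eval_prod]
  simp only [node, Polynomial.eval_sub, Polynomial.eval_X, Polynomial.eval_C, Bool.not_false,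
    if_true, Bool.false_eq_true, if_false, add_zero]
  have h2 : ∏ q ∈ T, ((x k p.1 - (x k q + 1)) * (x k p.1 - x k q)) =
      (∏ q ∈ T, (x k q + 1 - x k p.1)) * ∏ q ∈ T, (x k q - x k p.1) := by
    rw [← Finset.prod_mul_distrib]
    exact Finset.prod_congr rfl fun q _ => by ring
  rw [prod_mul_prod_sub_comm _ _ _ _ _ hc, h2, sub_add_cancel_left, neg_one_mul, div_neg,
    div_mul_div_comm, neg_mul, neg_div]

/-- The coefficient at a position of the product in the other order is, up to sign, the residue at
`x_p + 1`: both products together give the residues at all the nodes. -/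
theorem residue_at_x_add_one [CharZero k] (p : Inner n) :
    -((sft k p)⁻¹ • Aminus k p.1 * Aplus k p.1) =
      (numer k n p.1.1.val).eval (node k (p.1, true)) /
        ∏ z ∈ (row n (p.1.1.val + 1) ×ˢ Finset.univ).erase (p.1, true),
          (node k (p.1, true) - node k z) := by
  set T := (row n (p.1.1.val + 1)).erase p.1 with hT
  have h1 : (sft k p)⁻¹ • Aminus k p.1 =
      (∏ q ∈ row n p.1.1.val, (x k q - (x k p.1 + 1))) / ∏ q ∈ T, (x k q - (x k p.1 + 1)) := by
    change act (sft k p)⁻¹ (Aminus k p.1) = _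
    simp only [Aminus, map_div₀, map_prod, map_sub, MulSemiringAction.toRingHom_apply,
      sft_inv_smul_x, if_true, Int.cast_one]
    congr 1
    · refine Finset.prod_congr rfl fun q hq => ?_
      have hqp : q ≠ p.1 := fun h => by rw [h, mem_row] at hq; omega
      rw [if_neg hqp, add_zero]
    · refine Finset.prod_congr rfl fun q hq => ?_
      rw [if_neg (Finset.ne_of_mem_erase hq), add_zero]
  have hp : p.1 ∈ row n (p.1.1.val + 1) := mem_row.2 rfl
  have hc : Even ((row n (p.1.1.val + 2)).card + (row n p.1.1.val).card) := by
    rw [card_row (by have := p.2; omega), card_row (by have := p.2; omega)]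
    exact ⟨p.1.1.val + 1, by ring⟩
  rw [h1, prod_erase_node _ hp, Aplus, numer, Polynomial.eval_mul, Polynomial.eval_prod,
    Polynomial.eval_prod]
  simp only [node, Polynomial.eval_sub, Polynomial.eval_X, Polynomial.eval_C, Bool.not_true,
    if_true, Bool.false_eq_true, if_false, add_zero]
  have h2 : ∏ q ∈ T, ((x k p.1 + 1 - (x k q + 1)) * (x k p.1 + 1 - x k q)) =
      (∏ q ∈ T, (x k q - (x k p.1 + 1))) * ∏ q ∈ T, (x k q - x k p.1) := by
    rw [← Finset.prod_mul_distrib]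
    exact Finset.prod_congr rfl fun q _ => by ring
  have h3 : ∏ q ∈ row n (p.1.1.val + 2), (x k q + 1 - (x k p.1 + 1)) =
      ∏ q ∈ row n (p.1.1.val + 2), (x k q - x k p.1) :=
    Finset.prod_congr rfl fun q _ => by ring
  rw [prod_mul_prod_sub_comm _ _ _ _ _ hc, h2, h3, add_sub_cancel_left, one_mul,
    div_mul_div_comm, mul_neg, neg_div, neg_neg, mul_comm (∏ q ∈ row n p.1.1.val, _)]

/-- The terms of `E_{i,i+1}`, multiplied by the `l`-th powers of the variables. -/
noncomputable def ePow (k : Type*) [Field k] (n i l : ℕ) : ShiftRing k n :=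
  ∑ p ∈ innerRow n i, cf k n (x k p.1 ^ l) * ep k p

theorem ePow_zero (i : ℕ) : ePow k n i 0 = eRow k n i := by
  simp [ePow, eRow]

theorem lie_cf_mul_ep_fp {p q : Inner n} (hpq : p ≠ q) (c : FractionRing (PolyRing k n))
    (hc : sft k q • c = c) : ⁅cf k n c * ep k p, fp k q⁆ = 0 := by
  rw [Ring.lie_def, mul_assoc, ep_mul_fp hpq, ← mul_assoc, ← mul_assoc, cf_mul_fp, hc, sub_self]

theorem lie_cf_mul_ep_fp_self {L A : Type*} [Ring L] [Ring A] (f : L →+* A) {e f' : A}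
    {a b c c' : L} (h₁ : e * f' = f a) (h₂ : f' * e = f b) (h₃ : f' * f c = f c' * f') :
    ⁅f c * e, f'⁆ = f (c * a + c' * (-b)) := by
  rw [Ring.lie_def, mul_assoc, h₁, ← mul_assoc, h₃, mul_assoc, h₂, map_add, map_mul, map_mul,
    map_neg, mul_neg, sub_eq_add_neg]

/-- The commutator of a raising and a lowering element is a sum of residues. -/
theorem lie_ePow_fRow [CharZero k] {i : ℕ} (hi : i + 1 < n) (l : ℕ) :
    ⁅ePow k n i l, fRow k n i⁆ = cf k n (residueSum (row n (i + 1) ×ˢ Finset.univ) (node k)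
      (Polynomial.X ^ l * numer k n i)) := by
  have h1 : ∀ p ∈ innerRow n i, ⁅cf k n (x k p.1 ^ l) * ep k p, fRow k n i⁆ =
      cf k n (∑ b : Bool, (Polynomial.X ^ l * numer k n i).eval (node k (p.1, b)) /
        ∏ z ∈ (row n (i + 1) ×ˢ Finset.univ).erase (p.1, b), (node k (p.1, b) - node k z)) := by
    intro p hp
    rw [fRow, lie_sum, Finset.sum_eq_single p]
    · rw [mem_innerRow] at hp
      subst hp
      rw [lie_cf_mul_ep_fp_self (cf k n) (c' := (x k p.1 + 1) ^ l) (ep_mul_fp_self p)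
        (fp_mul_ep_self p)]
      · rw [Fintype.sum_bool, Polynomial.eval_mul, Polynomial.eval_mul, mul_div_assoc,
          mul_div_assoc, ← residue_at_x, ← residue_at_x_add_one, add_comm]
        simp [node]
      · rw [cf_mul_fp]
        congr 2
        rw [smul_pow', smul_add, smul_one, sft_smul_x, if_pos rfl]
        simp
    · intro q _ hqp
      refine lie_cf_mul_ep_fp hqp.symm _ ?_
      rw [smul_pow', sft_smul_x, if_neg fun h => hqp (Subtype.ext h.symm), add_zero]
    · exact fun h => absurd hp h
  rw [ePow, sum_lie, Finset.sum_congr rfl h1, ← _root_.map_sum]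
  refine congrArg _ ((sum_innerRow hi fun p => ∑ b : Bool,
    (Polynomial.X ^ l * numer k n i).eval (node k (p, b)) /
      ∏ z ∈ (row n (i + 1) ×ˢ Finset.univ).erase (p, b), (node k (p, b) - node k z)).trans ?_)
  rw [residueSum, Finset.sum_product]

theorem numer_monic (i : ℕ) : (numer k n i).Monic :=
  (Polynomial.monic_prod_of_monic _ _ fun _ _ => Polynomial.monic_X_sub_C _).mul
    (Polynomial.monic_prod_of_monic _ _ fun _ _ => Polynomial.monic_X_sub_C _)

theorem natDegree_numer {i : ℕ} (hi : i + 1 < n) : (numer k n i).natDegree = 2 * (i + 1) := by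
  rw [numer, Polynomial.Monic.natDegree_mul
    (Polynomial.monic_prod_of_monic _ _ fun _ _ => Polynomial.monic_X_sub_C _)
    (Polynomial.monic_prod_of_monic _ _ fun _ _ => Polynomial.monic_X_sub_C _),
    Polynomial.natDegree_prod_of_monic _ _ fun _ _ => Polynomial.monic_X_sub_C _,
    Polynomial.natDegree_prod_of_monic _ _ fun _ _ => Polynomial.monic_X_sub_C _]
  simp only [Polynomial.natDegree_X_sub_C, Finset.sum_const, smul_eq_mul, mul_one]
  rw [card_row (by omega), card_row (by omega)]
  ring

theorem card_nodes {i : ℕ} (hi : i + 1 < n) :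
    (row n (i + 1) ×ˢ (Finset.univ : Finset Bool)).card = 2 * (i + 1) := by
  rw [Finset.card_product, card_row (by omega), Finset.card_univ, Fintype.card_bool, mul_comm]

/-- For `l = 0` the sum of the residues of `N / D` is read off from the second coefficients of `N`
and `D`, since both are monic of the same degree. -/
theorem eRow_ef [CharZero k] (i j : ℕ) (hi : i + 1 < n) :
    ⁅eRow k n i, fRow k n j⁆ = if i = j then hRow k n i - hRow k n (i + 1) else 0 := by
  split_ifs with hij
  · subst hij
    have hs : (row n (i + 1) ×ˢ (Finset.univ : Finset Bool)).Nonempty := by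
      rw [← Finset.card_pos, card_nodes hi]; omega
    rw [← ePow_zero, lie_ePow_fRow hi, pow_zero, one_mul, residueSum_of_monic
      (node_injective.injOn) (numer_monic i) (by rw [natDegree_numer hi, card_nodes hi]) hs,
      hRow, hRow, ← map_sub]
    congr 1
    rw [numer, Polynomial.Monic.nextCoeff_mul
      (Polynomial.monic_prod_of_monic _ _ fun _ _ => Polynomial.monic_X_sub_C _)
      (Polynomial.monic_prod_of_monic _ _ fun _ _ => Polynomial.monic_X_sub_C _),
      Polynomial.prod_X_sub_C_nextCoeff, Polynomial.prod_X_sub_C_nextCoeff, Finset.sum_product]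
    simp only [node, Fintype.sum_bool, if_true, Bool.false_eq_true, if_false, add_zero,
      Finset.sum_add_distrib, Finset.sum_const, nsmul_eq_mul, mul_one, Finset.card_univ,
      Fintype.card_bool, ← Finset.mul_sum]
    rw [card_row (show i + 2 ≤ n by omega), card_row (show i + 1 ≤ n by omega)]
    have h1 := sum_row_offset (k := k) (show i ≤ n by omega)
    have h2 := sum_row_offset (k := k) (show i + 1 ≤ n by omega)
    have h3 := sum_row_offset (k := k) (show i + 2 ≤ n by omega)
    push_cast at h1 h2 h3 ⊢
    linear_combination (1 / 2) * h1 - h2 + (1 / 2) * h3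
  · rw [eRow, fRow, sum_lie]
    refine Finset.sum_eq_zero fun p hp => ?_
    rw [lie_sum]
    refine Finset.sum_eq_zero fun q hq => ?_
    rw [mem_innerRow] at hp hq
    rw [Ring.lie_def, ep_mul_fp (by rintro rfl; omega), sub_self]

theorem serreRelations [CharZero k] :
    SerreRelations n (hRow k n) (eRow k n) (fRow k n) where
  hh := hRow_hh
  he := hRow_he
  hf := hRow_hf
  ef i j hi _ := eRow_ef i j hi
  ee i j hij _ := eRow_ee i j hij
  ff i j hij _ := fRow_ff i j hij
  eee i _ := eRow_eee i
  eee' i _ := eRow_eee' i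
  fff i _ := fRow_fff i
  fff' i _ := fRow_fff' i

/-! ### The Gelfand-Tsetlin homomorphism -/

/-- The Gelfand-Tsetlin homomorphism from `U(gl_n)` to the ring of shift operators. -/
noncomputable def gtHom (k : Type*) [Field k] [CharZero k] (n : ℕ) :
    Ugl k n →ₐ[k] ShiftRing k n :=
  UniversalEnvelopingAlgebra.lift k
    { SerreRelations.linearMap k n (hRow k n) (eRow k n) (fRow k n) with
      map_lie' := fun {X Y} => serreRelations.linearMap_lie X Y }

theorem gtHom_E [CharZero k] (i j : Fin n) :
    gtHom k n (E k i j) = SerreRelations.unit (hRow k n) (eRow k n) (fRow k n) i j := by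
  rw [gtHom, E, UniversalEnvelopingAlgebra.lift_ι_apply]
  exact SerreRelations.linearMap_single i j

theorem gtHom_diag [CharZero k] (i : Fin n) : gtHom k n (E k i i) = hRow k n i := by
  rw [gtHom_E, SerreRelations.unit_self]

theorem gtHom_raising [CharZero k] (i : Fin n) (hi : i.val + 1 < n) :
    gtHom k n (E k i ⟨i.val + 1, hi⟩) = eRow k n i := by
  rw [gtHom_E, SerreRelations.unit, if_pos (Nat.lt_succ_self _)]
  simp [SerreRelations.raise]

theorem gtHom_lowering [CharZero k] (i : Fin n) (hi : i.val + 1 < n) :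
    gtHom k n (E k ⟨i.val + 1, hi⟩ i) = fRow k n i := by
  rw [gtHom_E, SerreRelations.unit, if_neg (by simp), if_pos (Nat.lt_succ_self _)]
  simp [SerreRelations.lower]

theorem sum_innerRow_eq_sum_fin {M : Type*} [AddCommMonoid M] (i : Fin n) (hi : i.val + 1 < n)
    (F : Inner n → M) : ∑ p ∈ innerRow n i, F p = ∑ j : Fin (i.val + 1), F ⟨⟨i, j⟩, hi⟩ := by
  symm
  refine Finset.sum_bij (fun j _ => ⟨⟨i, j⟩, hi⟩) (fun j _ => mem_innerRow.2 rfl)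
    (fun j _ l _ h => by simpa using h) ?_ (fun _ _ => rfl)
  rintro ⟨⟨r, j⟩, hr⟩ h
  obtain rfl : r = i := Fin.ext (mem_innerRow.1 h)
  exact ⟨j, Finset.mem_univ _, rfl⟩

theorem gtFormulas [CharZero k] : GTFormulas k n (gtHom k n : Ugl k n →+* ShiftRing k n) where
  diag i := gtHom_diag i
  raising i hi := by
    refine (gtHom_raising i hi).trans ?_
    rw [eRow, sum_innerRow_eq_sum_fin i hi]
    exact Finset.sum_congr rfl fun j _ => (ep_eq ⟨⟨i, j⟩, hi⟩).symm
  lowering i hi := by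
    refine (gtHom_lowering i hi).trans ?_
    rw [fRow, sum_innerRow_eq_sum_fin i hi]
    exact Finset.sum_congr rfl fun j _ => (fp_eq ⟨⟨i, j⟩, hi⟩).symm

end GelfandTsetlin

/-! ### Residues and subrings -/

section ResiduesSubring

open Polynomial

variable {L ι : Type*} [Field L] [DecidableEq ι] {s : Finset ι} {v : ι → L}

/-- The polynomials with coefficients in a subring. -/
noncomputable def polyOver (B : Subring L) : Subring L[X] := (mapRingHom B.subtype).range

theorem mem_polyOver {B : Subring L} {F : L[X]} : F ∈ polyOver B ↔ ∀ j, F.coeff j ∈ B := by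
  rw [polyOver, mem_map_range]
  simp

theorem X_mem_polyOver (B : Subring L) : (X : L[X]) ∈ polyOver B := ⟨X, by simp⟩

theorem C_mem_polyOver {B : Subring L} {a : L} (ha : a ∈ B) : C a ∈ polyOver B :=
  ⟨C ⟨a, ha⟩, by simp⟩

theorem comp_mem_polyOver {B : Subring L} {F H : L[X]} (hF : F ∈ polyOver B)
    (hH : H ∈ polyOver B) : F.comp H ∈ polyOver B := by
  obtain ⟨F, rfl⟩ := hF
  obtain ⟨H, rfl⟩ := hH
  exact ⟨F.comp H, map_comp _ _ _⟩

theorem exists_monic_of_mem_polyOver {B : Subring L} {D : L[X]} (hD : D ∈ polyOver B)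
    (hm : D.Monic) : ∃ D' : B[X], D'.Monic ∧ D'.map B.subtype = D := by
  obtain ⟨D', rfl⟩ := hD
  exact ⟨D', monic_of_injective Subtype.val_injective hm, rfl⟩

theorem divByMonic_mem_polyOver {B : Subring L} {F D : L[X]} (hF : F ∈ polyOver B)
    (hD : D ∈ polyOver B) (hm : D.Monic) : F /ₘ D ∈ polyOver B := by
  obtain ⟨D', hm', rfl⟩ := exists_monic_of_mem_polyOver hD hm
  obtain ⟨F', rfl⟩ := hF
  exact ⟨F' /ₘ D', map_divByMonic _ hm'⟩

theorem modByMonic_mem_polyOver {B : Subring L} {F D : L[X]} (hF : F ∈ polyOver B)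
    (hD : D ∈ polyOver B) (hm : D.Monic) : F %ₘ D ∈ polyOver B := by
  obtain ⟨D', hm', rfl⟩ := exists_monic_of_mem_polyOver hD hm
  obtain ⟨F', rfl⟩ := hF
  exact ⟨F' %ₘ D', map_modByMonic _ hm'⟩

/-- A sum of residues of a rational function is a rational expression in its coefficients. -/
theorem residueSum_mem {B : Subring L} (hv : Set.InjOn v s)
    (hD : ∏ i ∈ s, (X - C (v i)) ∈ polyOver B) {F : L[X]} (hF : F ∈ polyOver B) :
    residueSum s v F ∈ B := by
  have hm : (∏ i ∈ s, (X - C (v i))).Monic := monic_prod_of_monic _ _ fun i _ => monic_X_sub_C _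
  have hd : (∏ i ∈ s, (X - C (v i))).degree = (s.card : WithBot ℕ) := by
    rw [degree_eq_natDegree hm.ne_zero, natDegree_prod_of_monic _ _ fun i _ => monic_X_sub_C (v i)]
    simp
  have h1 : residueSum s v F = residueSum s v (F %ₘ ∏ i ∈ s, (X - C (v i))) := by
    have h2 := residueSum_mul_nodal (s := s) (v := v) (F /ₘ ∏ i ∈ s, (X - C (v i)))
    rw [modByMonic_eq_sub_mul_div F _, residueSum_sub, mul_comm, h2, sub_zero]
  rw [h1, residueSum_eq_coeff hv ((degree_modByMonic_lt _ hm).trans_eq hd)]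
  exact mem_polyOver.1 (modByMonic_mem_polyOver hF hD hm) _

/-- The coefficients of `N` can be recovered, from the top, from the residues of `u ^ l N / D`. -/
theorem mem_polyOver_of_residueSum {B : Subring L} (hv : Set.InjOn v s)
    (hD : ∏ i ∈ s, (X - C (v i)) ∈ polyOver B) {N : L[X]} (hd : N.natDegree ≤ s.card)
    (htop : N.coeff s.card ∈ B) (hN : ∀ l, residueSum s v (X ^ l * N) ∈ B) : N ∈ polyOver B := by
  -- descending induction on `j = s.card - t`; `T` collects the coefficients known already, and the
  -- residues of `u ^ t (N - T) / D` sum to the leading coefficient `N.coeff j` of `N - T`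
  have key : ∀ t, ∀ j, j ≤ s.card → s.card ≤ j + t → N.coeff j ∈ B := by
    intro t
    induction t with
    | zero =>
      intro j h1 h2
      rwa [show j = s.card by omega]
    | succ t ih =>
      intro j h1 h2
      rcases lt_or_eq_of_le h2 with h3 | h3
      · exact ih j h1 (by omega)
      set T : L[X] := ∑ i ∈ Finset.Ioc j s.card, C (N.coeff i) * X ^ i with hT
      have hTc : ∀ i, T.coeff i = if j < i ∧ i ≤ s.card then N.coeff i else 0 := by
        intro i
        rw [hT, finsetSum_coeff]
        simp only [coeff_C_mul, coeff_X_pow, mul_ite, mul_one, mul_zero]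
        rw [Finset.sum_ite_eq]
        simp only [Finset.mem_Ioc]
      have hTB : T ∈ polyOver B := mem_polyOver.2 fun i => by
        rw [hTc]
        split_ifs with h
        · exact ih i h.2 (by omega)
        · exact zero_mem _
      have hdeg : (X ^ t * (N - T)).degree < (s.card : WithBot ℕ) := by
        rw [degree_lt_iff_coeff_zero]
        intro i hi
        rw [coeff_X_pow_mul']
        split_ifs with h
        · rw [coeff_sub, hTc]
          split_ifs with h'
          · rw [sub_self]
          · rw [sub_zero]
            by_cases h4 : i - t ≤ s.card
            · exact absurd ⟨by omega, h4⟩ h'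
            · exact coeff_eq_zero_of_natDegree_lt (by omega)
        · rfl
      have h5 := residueSum_eq_coeff hv hdeg
      rw [mul_sub, residueSum_sub] at h5
      have h6 : (X ^ t * N - X ^ t * T).coeff (s.card - 1) = N.coeff j := by
        rw [← mul_sub, show s.card - 1 = j + t by omega, coeff_X_pow_mul, coeff_sub, hTc,
          if_neg (by omega), sub_zero]
      rw [h6] at h5
      rw [← h5]
      exact sub_mem (hN t) (residueSum_mem hv hD (mul_mem (pow_mem (X_mem_polyOver B) t) hTB))
  refine mem_polyOver.2 fun j => ?_
  by_cases h : j ≤ s.card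
  · exact key s.card j h (by omega)
  · rw [coeff_eq_zero_of_natDegree_lt (by omega)]
    exact zero_mem _

end ResiduesSubring

namespace GelfandTsetlin

open SkewMonoidAlgebra MvPolynomial

attribute [local instance] LieRing.ofAssociativeRing

variable {k : Type*} [Field k] {n : ℕ}

/-! ### Symmetric functions in the image of the Gelfand-Tsetlin homomorphism -/

/-- The monic polynomial whose roots are the variables of a row. -/
noncomputable def rowPoly (k : Type*) [Field k] (n m : ℕ) :
    Polynomial (FractionRing (PolyRing k n)) :=
  ∏ p ∈ row n m, (Polynomial.X - Polynomial.C (x k p))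

theorem rowPoly_monic (m : ℕ) : (rowPoly k n m).Monic :=
  Polynomial.monic_prod_of_monic _ _ fun _ _ => Polynomial.monic_X_sub_C _

theorem algebraMap_rowHom (r : Fin n) (q : MvPolynomial (Fin (r.val + 1)) k) :
    algebraMap (PolyRing k n) (FractionRing (PolyRing k n)) (rowHom k r q) =
      aeval (fun j => x k (⟨r, j⟩ : Pos n)) q := by
  have h : (IsScalarTower.toAlgHom k (PolyRing k n) (FractionRing (PolyRing k n))).comp
      (rowHom k r) = aeval (fun j => x k (⟨r, j⟩ : Pos n)) := by
    ext j
    simp [rowHom, x]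
  exact DFunLike.congr_fun h q

theorem rowPoly_eq_multiset (r : Fin n) : rowPoly k n (r.val + 1) =
    (((Finset.univ : Finset (Fin (r.val + 1))).val.map fun j => x k (⟨r, j⟩ : Pos n)).map
      fun t => Polynomial.X - Polynomial.C t).prod := by
  rw [rowPoly, row_eq_map, Finset.prod_map, Multiset.map_map]
  rfl

/-- Symmetric functions of a row are polynomials in the coefficients of the polynomial with these
roots. -/
theorem symmetric_mem_of_rowPoly {B : Subalgebra k (FractionRing (PolyRing k n))} {r : Fin n}
    (h : rowPoly k n (r.val + 1) ∈ polyOver B.toSubring) {q : MvPolynomial (Fin (r.val + 1)) k}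
    (hq : q.IsSymmetric) :
    algebraMap (PolyRing k n) (FractionRing (PolyRing k n)) (rowHom k r q) ∈ B := by
  rw [algebraMap_rowHom]
  have h1 : (Algebra.adjoin k (Set.range fun i : Fin (r.val + 1) =>
      esymm (Fin (r.val + 1)) k (i + 1))).map (aeval fun j => x k (⟨r, j⟩ : Pos n)) ≤ B := by
    rw [AlgHom.map_adjoin, Algebra.adjoin_le_iff]
    rintro _ ⟨_, ⟨i, rfl⟩, rfl⟩
    simp only [aeval_esymm_eq_multiset_esymm]
    set S := (Finset.univ : Finset (Fin (r.val + 1))).val.map fun j => x k (⟨r, j⟩ : Pos n) with hS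
    have hc : S.card = r.val + 1 := by simp [hS]
    have h2 := mem_polyOver.1 h (r.val + 1 - (i + 1))
    rw [rowPoly_eq_multiset, ← hS, Multiset.prod_X_sub_C_coeff _ (by omega), hc,
      show r.val + 1 - (r.val + 1 - (i.val + 1)) = i.val + 1 by omega] at h2
    have h3 : S.esymm (i.val + 1) = (-1) ^ (i.val + 1) * ((-1) ^ (i.val + 1) * S.esymm (i.val + 1)) := by
      rw [← mul_assoc, ← mul_pow, neg_one_mul, neg_neg, one_pow, one_mul]
    change S.esymm (i.val + 1) ∈ B
    rw [h3]
    exact mul_mem (pow_mem (neg_mem (one_mem _)) _) h2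
  exact h1 ⟨q, symmetric_mem_adjoin_esymm hq, rfl⟩

theorem rowPsum_mem_of_rowPoly {B : Subalgebra k (FractionRing (PolyRing k n))} {r : Fin n}
    (h : rowPoly k n (r.val + 1) ∈ polyOver B.toSubring) (l : ℕ) :
    algebraMap (PolyRing k n) (FractionRing (PolyRing k n)) (rowPsum k r l) ∈ B := by
  rw [← rowHom_psum]
  exact symmetric_mem_of_rowPoly h (psum_isSymmetric _ _ _)

/-- The coefficients, as a homomorphism of algebras. -/
noncomputable def cfAlg (k : Type*) [Field k] (n : ℕ) :
    FractionRing (PolyRing k n) →ₐ[k] ShiftRing k n :=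
  { cf k n with commutes' := fun _ => rfl }

theorem corner_mono {a b : ℕ} (h : a ≤ b) : corner k n a ≤ corner k n b :=
  Algebra.adjoin_mono fun _ ⟨i, j, hi, hj, hu⟩ => ⟨i, j, hi.trans_le h, hj.trans_le h, hu⟩

theorem E_mem_corner {m : ℕ} {i j : Fin n} (hi : i.val < m) (hj : j.val < m) :
    E k i j ∈ corner k n m :=
  Algebra.subset_adjoin ⟨i, j, hi, hj, rfl⟩

/-- The image of the enveloping algebra of a corner in the ring of shift operators. -/
noncomputable def cornerImage (k : Type*) [Field k] [CharZero k] (n m : ℕ) :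
    Subalgebra k (ShiftRing k n) :=
  (corner k n m).map (gtHom k n)

/-- The rational functions in the image of the enveloping algebra of a corner. -/
noncomputable def cornerFun (k : Type*) [Field k] [CharZero k] (n m : ℕ) :
    Subalgebra k (FractionRing (PolyRing k n)) :=
  (cornerImage k n m).comap (cfAlg k n)

theorem cornerImage_mono [CharZero k] {a b : ℕ} (h : a ≤ b) :
    cornerImage k n a ≤ cornerImage k n b :=
  Subalgebra.map_mono (corner_mono h)

theorem cornerFun_mono [CharZero k] {a b : ℕ} (h : a ≤ b) : cornerFun k n a ≤ cornerFun k n b :=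
  fun _ hc => cornerImage_mono h hc

theorem hRow_mem_cornerImage [CharZero k] {i m : ℕ} (hi : i < m) (hm : m ≤ n) :
    hRow k n i ∈ cornerImage k n m :=
  ⟨_, E_mem_corner (i := ⟨i, hi.trans_le hm⟩) hi hi, gtHom_diag _⟩

theorem eRow_mem_cornerImage [CharZero k] {i m : ℕ} (hi : i + 1 < m) (hm : m ≤ n) :
    eRow k n i ∈ cornerImage k n m :=
  ⟨_, E_mem_corner (i := ⟨i, by omega⟩) (j := ⟨i + 1, by omega⟩) (by change i < m; omega) hi,
    gtHom_raising ⟨i, by omega⟩ _⟩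

theorem fRow_mem_cornerImage [CharZero k] {i m : ℕ} (hi : i + 1 < m) (hm : m ≤ n) :
    fRow k n i ∈ cornerImage k n m :=
  ⟨_, E_mem_corner (i := ⟨i + 1, by omega⟩) (j := ⟨i, by omega⟩) hi (by change i < m; omega),
    gtHom_lowering ⟨i, by omega⟩ _⟩

theorem polyOver_mono {L : Type*} [Field L] {B C : Subring L} (h : B ≤ C) :
    polyOver B ≤ polyOver C := fun _ hF => mem_polyOver.2 fun j => h (mem_polyOver.1 hF j)

theorem map_rowPsum {g : FractionRing (PolyRing k n) →+* FractionRing (PolyRing k n)} {s : Pos n}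
    {c : FractionRing (PolyRing k n)} (hg : ∀ q, g (x k q) = x k q + if q = s then c else 0)
    (r : Fin n) (l : ℕ) :
    g (algebraMap (PolyRing k n) (FractionRing (PolyRing k n)) (rowPsum k r l)) =
      algebraMap (PolyRing k n) (FractionRing (PolyRing k n)) (rowPsum k r l) +
        if s.1 = r then (x k s + c) ^ l - x k s ^ l else 0 := by
  have h1 : algebraMap (PolyRing k n) (FractionRing (PolyRing k n)) (rowPsum k r l) =
      ∑ j : Fin (r.val + 1), x k (⟨r, j⟩ : Pos n) ^ l := by
    simp [rowPsum, x]
  rw [h1, _root_.map_sum]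
  simp only [map_pow, hg]
  split_ifs with hr
  · obtain ⟨s, i⟩ := s
    subst hr
    rw [← sub_eq_iff_eq_add', ← Finset.sum_sub_distrib, Finset.sum_eq_single i]
    · simp
    · intro j _ hj
      rw [if_neg (by simpa using hj), add_zero, sub_self]
    · simp
  · rw [add_zero]
    refine Finset.sum_congr rfl fun j _ => ?_
    rw [if_neg, add_zero]
    rintro rfl
    exact hr rfl

theorem lie_map_mul {L A : Type*} [CommRing L] [Ring A] (f : L →+* A) {e : A} {a a' b : L}
    (h : e * f a = f a' * e) : f a * (f b * e) - f b * e * f a = f (b * (a - a')) * e := by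
  rw [mul_assoc, h, ← mul_assoc, ← mul_assoc, ← map_mul, ← map_mul, ← sub_mul, ← map_sub]
  congr 2
  ring

theorem ep_mul_cf (p : Inner n) (c : FractionRing (PolyRing k n)) :
    ep k p * cf k n c = cf k n (sft k p • c) * ep k p := by
  rw [cf_mul_ep, inv_smul_smul]

/-- The commutator with the quadratic power sum of its row multiplies the terms of the raising
element by linear functions of `x_p`, so that all powers of `x_p` are obtained as coefficients. -/
theorem ePow_mem_cornerImage [CharZero k] {i : ℕ} (hi : i + 1 < n)
    (h2 : algebraMap (PolyRing k n) (FractionRing (PolyRing k n)) (rowPsum k ⟨i, by omega⟩ 2) ∈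
      cornerFun k n (i + 2)) (l : ℕ) : ePow k n i l ∈ cornerImage k n (i + 2) := by
  induction l with
  | zero =>
    rw [ePow_zero]
    exact eRow_mem_cornerImage (by omega) (by omega)
  | succ l ih =>
    set y := algebraMap (PolyRing k n) (FractionRing (PolyRing k n)) (rowPsum k ⟨i, by omega⟩ 2)
      with hy
    have h1 : cf k n y * ePow k n i l - ePow k n i l * cf k n y + ePow k n i l =
        ePow k n i (l + 1) + ePow k n i (l + 1) := by
      rw [ePow, ePow, Finset.mul_sum, Finset.sum_mul, ← Finset.sum_sub_distrib,
        ← Finset.sum_add_distrib, ← Finset.sum_add_distrib]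
      refine Finset.sum_congr rfl fun p hp => ?_
      rw [mem_innerRow] at hp
      have h3 := map_rowPsum (g := act (sft k p)) (sft_smul_x p) ⟨i, by omega⟩ 2
      rw [if_pos (Fin.ext hp), ← hy, MulSemiringAction.toRingHom_apply] at h3
      rw [lie_map_mul (cf k n) (ep_mul_cf p y), ← add_mul, ← map_add, ← add_mul,
        ← map_add, h3]
      congr 2
      push_cast
      ring
    have h4 : ePow k n i (l + 1) = (2 : k)⁻¹ • (ePow k n i (l + 1) + ePow k n i (l + 1)) := by
      rw [← two_smul k, inv_smul_smul₀ two_ne_zero]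
    rw [h4, ← h1]
    have h5 : cf k n y ∈ cornerImage k n (i + 2) := h2
    exact Subalgebra.smul_mem _ (add_mem (sub_mem (mul_mem h5 ih) (mul_mem ih h5)) ih) _

theorem prod_nodes (i : ℕ) :
    ∏ z ∈ row n (i + 1) ×ˢ (Finset.univ : Finset Bool),
      (Polynomial.X - Polynomial.C (node k z)) =
        (rowPoly k n (i + 1)).comp (Polynomial.X - 1) * rowPoly k n (i + 1) := by
  rw [Finset.prod_product, rowPoly, Polynomial.prod_comp, ← Finset.prod_mul_distrib]
  refine Finset.prod_congr rfl fun p _ => ?_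
  rw [Fintype.prod_bool]
  simp only [node, if_true, Bool.false_eq_true, if_false, add_zero, Polynomial.sub_comp,
    Polynomial.X_comp, Polynomial.C_comp, map_add, map_one]
  ring

theorem numer_eq (i : ℕ) :
    numer k n i = (rowPoly k n (i + 2)).comp (Polynomial.X - 1) * rowPoly k n i := by
  rw [numer, rowPoly, rowPoly, Polynomial.prod_comp]
  congr 1
  refine Finset.prod_congr rfl fun p _ => ?_
  simp only [Polynomial.sub_comp, Polynomial.X_comp, Polynomial.C_comp, map_add, map_one]
  ring

/-- The symmetric functions of the rows of length at most `m` lie in the image of `U(gl_m)`: the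
residues of `u ^ l N(u) / D(u)` are commutators, where the coefficients of `D` are symmetric
functions of the row of length `m - 1`, and `N` gives those of the next row. -/
theorem rowPoly_mem_polyOver_cornerFun [CharZero k] (m : ℕ) (hm : m ≤ n) (j : ℕ) (hj : j ≤ m) :
    rowPoly k n j ∈ polyOver (cornerFun k n m).toSubring := by
  induction m generalizing j with
  | zero =>
    have h : row n j = ∅ := by
      rw [← Finset.card_eq_zero, card_row (by omega)]
      omega
    rw [rowPoly, h, Finset.prod_empty]
    exact one_mem _
  | succ m ih =>
    have hprev : ∀ j, j ≤ m → rowPoly k n j ∈ polyOver (cornerFun k n (m + 1)).toSubring :=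
      fun j hj => polyOver_mono (fun _ hc => cornerFun_mono (Nat.le_succ m) hc)
        (ih (by omega) j hj)
    rcases lt_or_eq_of_le hj with h | rfl
    · exact hprev j (by omega)
    have hX1 : ∀ B : Subring (FractionRing (PolyRing k n)),
        (Polynomial.X - 1 : Polynomial (FractionRing (PolyRing k n))) ∈ polyOver B :=
      fun B => sub_mem (X_mem_polyOver B) (one_mem _)
    rcases m with - | i
    · have h1 : row n 1 = {(⟨⟨0, hm⟩, 0⟩ : Pos n)} :=
        (row_eq_map (⟨0, hm⟩ : Fin n)).trans rfl
      have h0 : row n 0 = ∅ := by rw [← Finset.card_eq_zero, card_row (by omega)]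
      have h2 : x k (⟨⟨0, hm⟩, 0⟩ : Pos n) ∈ (cornerFun k n 1).toSubring := by
        have h3 := hRow_mem_cornerImage (k := k) (i := 0) (m := 1) zero_lt_one hm
        rw [hRow, h0, zero_add, h1] at h3
        change cf k n _ ∈ cornerImage k n 1
        simpa using h3
      rw [rowPoly, zero_add, h1, Finset.prod_singleton]
      exact sub_mem (X_mem_polyOver _) (C_mem_polyOver h2)
    · have hi : i + 1 < n := hm
      have hP := hprev (i + 1) le_rfl
      have hN : numer k n i ∈ polyOver (cornerFun k n (i + 2)).toSubring := by
        refine mem_polyOver_of_residueSum (s := row n (i + 1) ×ˢ (Finset.univ : Finset Bool))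
          (v := node k) node_injective.injOn ?_ ?_ ?_ fun l => ?_
        · rw [prod_nodes]
          exact mul_mem (comp_mem_polyOver hP (hX1 _)) hP
        · rw [natDegree_numer hi, card_nodes hi]
        · rw [card_nodes hi, ← natDegree_numer (k := k) hi, ← Polynomial.leadingCoeff,
            numer_monic]
          exact one_mem _
        · change cf k n _ ∈ cornerImage k n (i + 2)
          rw [← lie_ePow_fRow hi, Ring.lie_def]
          have he := ePow_mem_cornerImage hi
            (rowPsum_mem_of_rowPoly (r := (⟨i, by omega⟩ : Fin n)) hP 2) l
          have hf := fRow_mem_cornerImage (k := k) (n := n) (i := i) (m := i + 2) (by omega) (by omega)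
          exact sub_mem (mul_mem he hf) (mul_mem hf he)
      -- `N(u)` is the product of the next row, translated, and the previous row: divide by the latter
      have hQ : (rowPoly k n (i + 2)).comp (Polynomial.X - 1) ∈
          polyOver (cornerFun k n (i + 2)).toSubring := by
        have h1 := divByMonic_mem_polyOver hN (hprev i (by omega)) (rowPoly_monic i)
        rwa [numer_eq, mul_comm, Polynomial.mul_divByMonic_cancel_left _ (rowPoly_monic i)] at h1
      have h2 := comp_mem_polyOver hQ (add_mem (X_mem_polyOver _) (one_mem _))
      rwa [Polynomial.comp_assoc, Polynomial.sub_comp, Polynomial.X_comp, Polynomial.one_comp,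
        add_sub_cancel_right, Polynomial.comp_X] at h2

theorem rowPsum_mem_cornerFun [CharZero k] (r : Fin n) {m : ℕ} (hr : r.val + 1 ≤ m) (hm : m ≤ n)
    (l : ℕ) : algebraMap (PolyRing k n) (FractionRing (PolyRing k n)) (rowPsum k r l) ∈
      cornerFun k n m :=
  rowPsum_mem_of_rowPoly (rowPoly_mem_polyOver_cornerFun m hm _ hr) l

end GelfandTsetlin

namespace GelfandTsetlin

open SkewMonoidAlgebra MvPolynomial

section Generation

attribute [local instance] LieRing.ofAssociativeRing

/-! ### Generators of the enveloping algebra -/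

theorem adjoin_range_ι {k g : Type*} [Field k] [LieRing g] [LieAlgebra k g] :
    Algebra.adjoin k (Set.range (UniversalEnvelopingAlgebra.ι k : g → _)) = ⊤ := by
  set S := Algebra.adjoin k (Set.range (UniversalEnvelopingAlgebra.ι k : g → _)) with hS
  let f : g →ₗ⁅k⁆ S :=
    { toFun := fun X => ⟨UniversalEnvelopingAlgebra.ι k X, Algebra.subset_adjoin ⟨X, rfl⟩⟩
      map_add' := fun X Y => Subtype.ext (map_add _ X Y)
      map_smul' := fun c X => Subtype.ext (map_smul _ c X)
      map_lie' := fun {X Y} => Subtype.ext (by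
        rw [Ring.lie_def]
        exact LieHom.map_lie (UniversalEnvelopingAlgebra.ι k) X Y) }
  have h : S.val.comp (UniversalEnvelopingAlgebra.lift k f) =
      AlgHom.id k (UniversalEnvelopingAlgebra k g) := by
    apply UniversalEnvelopingAlgebra.hom_ext
    ext X
    have h2 : S.val (UniversalEnvelopingAlgebra.lift k f (UniversalEnvelopingAlgebra.ι k X)) =
        UniversalEnvelopingAlgebra.ι k X := by
      rw [UniversalEnvelopingAlgebra.lift_ι_apply]
      rfl
    exact h2
  rw [eq_top_iff]
  intro u _
  have h1 := DFunLike.congr_fun h u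
  rw [AlgHom.id_apply] at h1
  rw [← h1]
  exact (UniversalEnvelopingAlgebra.lift k f u).2

variable {k : Type*} [Field k] {n : ℕ}

theorem corner_self : corner k n n = ⊤ := by
  rw [eq_top_iff, ← adjoin_range_ι, Algebra.adjoin_le_iff]
  rintro _ ⟨X, rfl⟩
  rw [Matrix.matrix_eq_sum_single X, _root_.map_sum]
  refine sum_mem fun i _ => ?_
  rw [_root_.map_sum]
  refine sum_mem fun j _ => ?_
  have h1 : Matrix.single i j (X i j) = X i j • (Matrix.single i j 1 : Matrix (Fin n) (Fin n) k) := by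
    rw [Matrix.smul_single, smul_eq_mul, mul_one]
  rw [h1, map_smul]
  exact Subalgebra.smul_mem _ (E_mem_corner i.2 j.2) _

theorem raise_mem {A : Type*} [Ring A] {S : Subring A} {e : ℕ → A} {i d : ℕ}
    (h : ∀ j, i ≤ j → j ≤ i + d → e j ∈ S) : SerreRelations.raise e i d ∈ S := by
  induction d with
  | zero => exact h i le_rfl le_rfl
  | succ d ih =>
    have h1 := ih fun j hj hj' => h j hj (by omega)
    have h2 := h (i + d + 1) (by omega) (by omega)
    rw [SerreRelations.raise, Ring.lie_def]
    exact sub_mem (mul_mem h1 h2) (mul_mem h2 h1)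

theorem lower_mem {A : Type*} [Ring A] {S : Subring A} {f : ℕ → A} {i d : ℕ}
    (h : ∀ j, i ≤ j → j ≤ i + d → f j ∈ S) : SerreRelations.lower f i d ∈ S := by
  induction d with
  | zero => exact h i le_rfl le_rfl
  | succ d ih =>
    have h1 := ih fun j hj hj' => h j hj (by omega)
    have h2 := h (i + d + 1) (by omega) (by omega)
    rw [SerreRelations.lower, Ring.lie_def]
    exact sub_mem (mul_mem h2 h1) (mul_mem h1 h2)

/-- The image of a corner is generated by the images of the simple root vectors and the diagonal
matrix units. -/
theorem cornerImage_le [CharZero k] {m : ℕ} {S : Subring (ShiftRing k n)}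
    (hc : ∀ c : k, algebraMap k (ShiftRing k n) c ∈ S) (hh : ∀ i, i < m → hRow k n i ∈ S)
    (he : ∀ i, i + 1 < m → eRow k n i ∈ S) (hf : ∀ i, i + 1 < m → fRow k n i ∈ S) :
    (cornerImage k n m).toSubring ≤ S := by
  let S' : Subalgebra k (ShiftRing k n) := { S with algebraMap_mem' := hc }
  have h : cornerImage k n m ≤ S' := by
    rw [cornerImage, corner, AlgHom.map_adjoin, Algebra.adjoin_le_iff]
    rintro _ ⟨_, ⟨i, j, hi, hj, rfl⟩, rfl⟩
    change gtHom k n (E k i j) ∈ S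
    rw [gtHom_E, SerreRelations.unit]
    split_ifs with h1 h2
    · exact raise_mem fun l hl hl' => he l (by omega)
    · exact lower_mem fun l hl hl' => hf l (by omega)
    · exact hh _ hi
  exact h

end Generation

variable {k : Type*} [Field k] {n : ℕ}

/-! ### Invariance under permutations of the rows -/

/-- The permutation of the positions that is given by permutations of the rows. -/
def permPos (σ : ∀ r : Fin n, Equiv.Perm (Fin (r.val + 1))) : Equiv.Perm (Pos n) :=
  Equiv.sigmaCongrRight σ

theorem permPos_fst (σ : ∀ r : Fin n, Equiv.Perm (Fin (r.val + 1))) (p : Pos n) :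
    (permPos σ p).1 = p.1 := rfl

theorem permHom_smul_x (σ : ∀ r : Fin n, Equiv.Perm (Fin (r.val + 1))) (p : Pos n) :
    permHom k n σ • x k p = x k (permPos σ p) := by
  rw [x, ringAut_smul_algebraMap, permHom_X]
  rfl

theorem prod_row_perm {M : Type*} [CommMonoid M] (σ : ∀ r : Fin n, Equiv.Perm (Fin (r.val + 1)))
    (m : ℕ) (F : Pos n → M) : ∏ p ∈ row n m, F (permPos σ p) = ∏ p ∈ row n m, F p :=
  Finset.prod_equiv (permPos σ) (fun p => by rw [mem_row, mem_row, permPos_fst]) fun _ _ => rfl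

theorem prod_row_erase_perm {M : Type*} [CommMonoid M]
    (σ : ∀ r : Fin n, Equiv.Perm (Fin (r.val + 1))) (m : ℕ) (p : Pos n) (F : Pos n → M) :
    ∏ q ∈ (row n m).erase p, F (permPos σ q) = ∏ q ∈ (row n m).erase (permPos σ p), F q :=
  Finset.prod_equiv (permPos σ) (fun q => by
    rw [Finset.mem_erase, Finset.mem_erase, mem_row, mem_row, permPos_fst, Ne, Ne,
      (permPos σ).injective.eq_iff]) fun _ _ => rfl

theorem permHom_smul_Aplus (σ : ∀ r : Fin n, Equiv.Perm (Fin (r.val + 1))) (p : Pos n) :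
    permHom k n σ • Aplus k p = Aplus k (permPos σ p) := by
  change MulSemiringAction.toRingHom _ _ (permHom k n σ) (Aplus k p) = _
  simp only [Aplus, map_div₀, map_neg, map_prod, map_sub, MulSemiringAction.toRingHom_apply,
    permHom_smul_x]
  rw [prod_row_perm σ _ fun q => x k q - x k (permPos σ p),
    prod_row_erase_perm σ _ _ fun q => x k q - x k (permPos σ p)]
  rfl

theorem permHom_smul_Aminus (σ : ∀ r : Fin n, Equiv.Perm (Fin (r.val + 1))) (p : Pos n) :
    permHom k n σ • Aminus k p = Aminus k (permPos σ p) := by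
  change MulSemiringAction.toRingHom _ _ (permHom k n σ) (Aminus k p) = _
  simp only [Aminus, map_div₀, map_prod, map_sub, MulSemiringAction.toRingHom_apply,
    permHom_smul_x]
  rw [prod_row_perm σ _ fun q => x k q - x k (permPos σ p),
    prod_row_erase_perm σ _ _ fun q => x k q - x k (permPos σ p)]
  rfl

/-- The action of a product of permutations on the ring of shift operators. -/
noncomputable def tw [CharZero k] (σ : ∀ r : Fin n, Equiv.Perm (Fin (r.val + 1))) :
    ShiftRing k n →+* ShiftRing k n :=
  GaloisRing.twist (setting k n) ⟨permHom k n σ, σ, rfl⟩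

theorem mem_invariants [CharZero k] {z : ShiftRing k n} :
    z ∈ GaloisRing.invariants (setting k n) ↔ ∀ σ, tw σ z = z := by
  rw [GaloisRing.invariants, Subring.mem_iInf]
  constructor
  · intro h σ
    exact h ⟨permHom k n σ, σ, rfl⟩
  · rintro h ⟨_, σ, rfl⟩
    exact h σ

theorem tw_cf [CharZero k] (σ : ∀ r : Fin n, Equiv.Perm (Fin (r.val + 1)))
    (c : FractionRing (PolyRing k n)) : tw σ (cf k n c) = cf k n (permHom k n σ • c) := by
  rw [tw, GaloisRing.coeffHom_apply, GaloisRing.twist_single, map_one]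
  rfl

/-- The permutation of the positions outside the last row. -/
def permInner (σ : ∀ r : Fin n, Equiv.Perm (Fin (r.val + 1))) : Equiv.Perm (Inner n) :=
  (permPos σ).subtypeEquiv fun p => by rw [permPos_fst]

theorem permHom_conj_shift [CharZero k] (σ : ∀ r : Fin n, Equiv.Perm (Fin (r.val + 1)))
    (p : Inner n) : permHom k n σ * shift k p.1 * (permHom k n σ)⁻¹ = shift k (permInner σ p).1 := by
  rw [shift_eq_translation, permHom_conj_translation, shift_eq_translation]
  congr 1
  funext q
  simp only [Pi.single_apply]
  congr 1
  rw [eq_iff_iff]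
  exact ((permPos σ).symm_apply_eq (x := q) (y := p.1))

theorem tw_rsingle [CharZero k] (σ : ∀ r : Fin n, Equiv.Perm (Fin (r.val + 1)))
    (μ : shiftMonoid k n) (c : FractionRing (PolyRing k n)) :
    tw σ (rsingle μ c) =
      rsingle (GaloisRing.conjHom (setting k n) ⟨permHom k n σ, σ, rfl⟩ μ) (permHom k n σ • c) := by
  rw [tw, rsingle, GaloisRing.twist_single, rsingle]
  congr 1
  rw [Submonoid.smul_def, Submonoid.smul_def, smul_smul, smul_smul]
  congr 1
  simp [GaloisRing.conjHom]

theorem tw_ep [CharZero k] (σ : ∀ r : Fin n, Equiv.Perm (Fin (r.val + 1))) (p : Inner n) :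
    tw σ (ep k p) = ep k (permInner σ p) := by
  rw [ep, tw_rsingle, permHom_smul_Aplus, ep]
  congr 1
  exact Subtype.ext (permHom_conj_shift σ p)

theorem tw_fp [CharZero k] (σ : ∀ r : Fin n, Equiv.Perm (Fin (r.val + 1))) (p : Inner n) :
    tw σ (fp k p) = fp k (permInner σ p) := by
  rw [fp, tw_rsingle, permHom_smul_Aminus, fp]
  congr 1
  refine Subtype.ext ?_
  change permHom k n σ * (shift k p.1)⁻¹ * (permHom k n σ)⁻¹ = (shift k (permInner σ p).1)⁻¹
  rw [← permHom_conj_shift]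
  group

theorem sum_innerRow_perm {M : Type*} [AddCommMonoid M]
    (σ : ∀ r : Fin n, Equiv.Perm (Fin (r.val + 1))) (i : ℕ) (F : Inner n → M) :
    ∑ p ∈ innerRow n i, F (permInner σ p) = ∑ p ∈ innerRow n i, F p :=
  Finset.sum_equiv (permInner σ) (fun p => by rw [mem_innerRow, mem_innerRow]; rfl) fun _ _ => rfl

/-! ### Invariant rational functions -/

/-- The algebra of invariant polynomials, inside the field of rational functions. -/
noncomputable def gammaAlg (k : Type*) [Field k] (n : ℕ) :
    Subalgebra k (FractionRing (PolyRing k n)) :=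
  Algebra.adjoin k {c | ∃ (r : Fin n) (l : ℕ),
    c = algebraMap (PolyRing k n) (FractionRing (PolyRing k n)) (rowPsum k r l)}

theorem rowPsum_mem_gammaAlg (r : Fin n) (l : ℕ) :
    algebraMap (PolyRing k n) (FractionRing (PolyRing k n)) (rowPsum k r l) ∈ gammaAlg k n :=
  Algebra.subset_adjoin ⟨r, l, rfl⟩

/-- The fundamental theorem on symmetric polynomials: the power sums of the rows generate all
invariant polynomials. -/
theorem mem_gammaAlg [CharZero k] {c : FractionRing (PolyRing k n)} :
    c ∈ gammaAlg k n ↔ ∃ f ∈ FixedPoints.subring (PolyRing k n) (permGroup k n),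
      algebraMap (PolyRing k n) (FractionRing (PolyRing k n)) f = c := by
  constructor
  · intro h
    induction h using Algebra.adjoin_induction with
    | mem c hc =>
      obtain ⟨r, l, rfl⟩ := hc
      exact ⟨_, rowPsum_mem_fixedPoints r l, rfl⟩
    | algebraMap c => exact ⟨C c, mem_fixedPoints_iff.2 fun σ => permHom_C σ c,
        (IsScalarTower.algebraMap_apply k (PolyRing k n) _ c).symm⟩
    | add a b _ _ ha hb =>
      obtain ⟨f, hf, rfl⟩ := ha
      obtain ⟨g, hg, rfl⟩ := hb
      exact ⟨f + g, add_mem hf hg, map_add _ _ _⟩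
    | mul a b _ _ ha hb =>
      obtain ⟨f, hf, rfl⟩ := ha
      obtain ⟨g, hg, rfl⟩ := hb
      exact ⟨f * g, mul_mem hf hg, map_mul _ _ _⟩
  · rintro ⟨f, hf, rfl⟩
    have h1 : (Algebra.adjoin k {g | ∃ (r : Fin n) (l : ℕ), g = rowPsum k r l}).map
        (IsScalarTower.toAlgHom k (PolyRing k n) (FractionRing (PolyRing k n))) ≤
          gammaAlg k n := by
      rw [AlgHom.map_adjoin, Algebra.adjoin_le_iff]
      rintro _ ⟨_, ⟨r, l, rfl⟩, rfl⟩
      exact rowPsum_mem_gammaAlg r l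
    exact h1 ⟨f, mem_adjoin_rowPsum hf, rfl⟩

theorem permHom_smul_of_mem_gammaAlg [CharZero k] {c : FractionRing (PolyRing k n)}
    (hc : c ∈ gammaAlg k n) (σ : ∀ r : Fin n, Equiv.Perm (Fin (r.val + 1))) :
    permHom k n σ • c = c := by
  obtain ⟨f, hf, rfl⟩ := mem_gammaAlg.1 hc
  rw [ringAut_smul_algebraMap, mem_fixedPoints_iff.1 hf]

theorem rowPoly_mem_polyOver_gammaAlg [CharZero k] (m : ℕ) :
    rowPoly k n m ∈ polyOver (gammaAlg k n).toSubring := by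
  have h1 : rowPoly k n m = (∏ p ∈ row n m, (Polynomial.X - Polynomial.C (X p : PolyRing k n))).map
      (algebraMap (PolyRing k n) (FractionRing (PolyRing k n))) := by
    rw [Polynomial.map_prod, rowPoly]
    simp [x]
  refine mem_polyOver.2 fun j => mem_gammaAlg.2 ⟨(∏ p ∈ row n m,
    (Polynomial.X - Polynomial.C (X p : PolyRing k n))).coeff j, ?_, by
      rw [h1, Polynomial.coeff_map]⟩
  rw [mem_fixedPoints_iff]
  intro σ
  have h2 : (∏ p ∈ row n m, (Polynomial.X - Polynomial.C (X p : PolyRing k n))).map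
      (permHom k n σ : PolyRing k n →+* PolyRing k n) =
        ∏ p ∈ row n m, (Polynomial.X - Polynomial.C (X p : PolyRing k n)) := by
    rw [Polynomial.map_prod]
    refine Eq.trans ?_ (prod_row_perm σ m fun p =>
      Polynomial.X - Polynomial.C (X p : PolyRing k n))
    refine Finset.prod_congr rfl fun p _ => ?_
    rw [Polynomial.map_sub, Polynomial.map_X, Polynomial.map_C]
    have h3 : (permHom k n σ : PolyRing k n →+* PolyRing k n) (X p) = X (permPos σ p) :=
      permHom_X σ p
    rw [h3]
  nth_rewrite 2 [← h2]
  rw [Polynomial.coeff_map]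
  rfl

theorem sum_row_mem_gammaAlg [CharZero k] (m : ℕ) :
    ∑ p ∈ row n m, (x k p + (p.2.val : FractionRing (PolyRing k n))) ∈ gammaAlg k n := by
  rw [Finset.sum_add_distrib]
  refine add_mem ?_ (sum_mem fun p _ => natCast_mem _ _)
  have h1 := neg_mem (mem_polyOver.1 (rowPoly_mem_polyOver_gammaAlg (k := k) (n := n) m)
    ((row n m).card - 1))
  rcases Nat.eq_zero_or_pos (row n m).card with h | h
  · rw [Finset.card_eq_zero.1 h, Finset.sum_empty]
    exact zero_mem _
  · rwa [rowPoly, Polynomial.prod_X_sub_C_coeff_card_pred _ _ h, neg_neg] at h1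

theorem algebraMap_eq_cf (c : k) : algebraMap k (ShiftRing k n) c =
    cf k n (algebraMap k (FractionRing (PolyRing k n)) c) := rfl

/-- The image of the Gelfand-Tsetlin homomorphism consists of invariants. -/
theorem gtHom_mem_invariants [CharZero k] (u : Ugl k n) :
    gtHom k n u ∈ GaloisRing.invariants (setting k n) := by
  have h : (cornerImage k n n).toSubring ≤ GaloisRing.invariants (setting k n) := by
    refine cornerImage_le (fun c => ?_) (fun i _ => ?_) (fun i _ => ?_) fun i _ => ?_
    all_goals refine mem_invariants.2 fun σ => ?_
    · rw [algebraMap_eq_cf, tw_cf, permHom_smul_of_mem_gammaAlg (Subalgebra.algebraMap_mem _ _)]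
    · rw [hRow, tw_cf, permHom_smul_of_mem_gammaAlg
        (sub_mem (sum_row_mem_gammaAlg _) (sum_row_mem_gammaAlg _))]
    · rw [eRow, _root_.map_sum]
      simp only [tw_ep]
      exact sum_innerRow_perm σ i (ep k)
    · rw [fRow, _root_.map_sum]
      simp only [tw_fp]
      exact sum_innerRow_perm σ i (fp k)
  exact h ⟨u, by rw [corner_self]; trivial, rfl⟩

end GelfandTsetlin

namespace GelfandTsetlin

open SkewMonoidAlgebra MvPolynomial

variable {k : Type*} [Field k] {n : ℕ}

/-! ### The image of the Gelfand-Tsetlin subalgebra -/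

/-- The rational functions form their own centralizer, because no shift other than the identity
fixes the quadratic power sums of all rows. -/
theorem exists_eq_cf_of_commute [CharZero k] {z : ShiftRing k n}
    (hz : ∀ r : Fin n, z * cf k n (algebraMap _ _ (rowPsum k r 2)) =
      cf k n (algebraMap _ _ (rowPsum k r 2)) * z) : ∃ c, z = cf k n c := by
  have h1 : ∀ μ : shiftMonoid k n, z.coeff μ ≠ 0 → μ = 1 := by
    intro μ hμ
    obtain ⟨a, rfl⟩ := (shiftEquiv k n).surjective μ
    obtain ⟨a, rfl⟩ := Multiplicative.ofAdd.surjective a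
    have h2 : ∀ r, translation k (extend a) (rowPsum k r 2) = rowPsum k r 2 := fun r => by
      have h3 := congrArg (fun w => w.coeff (shiftEquiv k n (Multiplicative.ofAdd a))) (hz r)
      change (z * single 1 _).coeff _ = (single 1 _ * z).coeff _ at h3
      rw [coeff_mul_single_one, coeff_single_one_mul, mul_comm, smul_algebraMap] at h3
      exact IsFractionRing.injective (PolyRing k n) _ (mul_right_cancel₀ hμ h3)
    have h4 : a = 0 := by
      funext p
      have h5 := congrArg (fun f => constantCoeff f) (h2 p.1.1)
      simp only [rowPsum, _root_.map_sum, map_pow, translation_X, map_sub, constantCoeff_X,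
        constantCoeff_C, zero_sub, neg_sq, zero_pow two_ne_zero, Finset.sum_const_zero] at h5
      have h6 : ∑ j, extend a (⟨p.1.1, j⟩ : Pos n) ^ 2 = 0 := by exact_mod_cast h5
      have h7 := (Finset.sum_eq_zero_iff_of_nonneg fun _ _ => sq_nonneg _).1 h6 p.1.2
        (Finset.mem_univ _)
      rw [← extend_inner a p]
      exact pow_eq_zero_iff two_ne_zero |>.1 h7
    rw [h4, ofAdd_zero, map_one]
  classical
  refine ⟨z.coeff 1, SkewMonoidAlgebra.ext fun μ => ?_⟩
  rw [GaloisRing.coeffHom_apply]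
  by_cases hμ : z.coeff μ = 0
  · by_cases h : μ = 1
    · subst h
      simp [coeff_single]
    · rw [hμ, coeff_single, Finsupp.single_apply, if_neg (Ne.symm h)]
  · rw [h1 μ hμ]
    simp [coeff_single]

/-- The symmetric functions of the rows of length at least `m` commute with the image of
`U(gl_m)`. -/
theorem commute_rowPsum_cornerImage [CharZero k] {r : Fin n} {m : ℕ} (hr : m ≤ r.val + 1) (l : ℕ)
    {z : ShiftRing k n} (hz : z ∈ cornerImage k n m) :
    z * cf k n (algebraMap _ _ (rowPsum k r l)) = cf k n (algebraMap _ _ (rowPsum k r l)) * z := by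
  set y := algebraMap (PolyRing k n) (FractionRing (PolyRing k n)) (rowPsum k r l) with hy
  have h : (cornerImage k n m).toSubring ≤ Subring.centralizer {cf k n y} := by
    refine cornerImage_le (fun c => ?_) (fun i hi => ?_) (fun i hi => ?_) fun i hi => ?_
    all_goals
      rw [Subring.mem_centralizer_iff]
      rintro _ rfl
    · exact (Algebra.commutes c _).symm
    · rw [hRow, ← map_mul, ← map_mul, mul_comm]
    · rw [eRow, Finset.mul_sum, Finset.sum_mul]
      refine Finset.sum_congr rfl fun p hp => ?_
      rw [mem_innerRow] at hp
      have h1 := map_rowPsum (g := act (sft k p)⁻¹) (sft_inv_smul_x p) r l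
      rw [if_neg (fun h => by rw [h] at hp; omega), add_zero, ← hy] at h1
      rw [cf_mul_ep]
      exact congrArg (fun w => ep k p * cf k n w) h1
    · rw [fRow, Finset.mul_sum, Finset.sum_mul]
      refine Finset.sum_congr rfl fun p hp => ?_
      rw [mem_innerRow] at hp
      have h1 := map_rowPsum (g := act (sft k p)) (sft_smul_x p) r l
      rw [if_neg (fun h => by rw [h] at hp; omega), add_zero, ← hy] at h1
      rw [cf_mul_fp]
      exact congrArg (fun w => fp k p * cf k n w) h1
  exact (Subring.mem_centralizer_iff.1 (h hz) _ rfl).symm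

/-- The additive map `μ c ↦ c`. Through it the ring of shift operators acts on the right on the
rational functions. -/
noncomputable def fold (k : Type*) [Field k] (n : ℕ) :
    ShiftRing k n →+ FractionRing (PolyRing k n) :=
  (Finsupp.liftAddHom fun μ : shiftMonoid k n => (act μ⁻¹).toAddMonoidHom).comp
    (coeffAddEquiv (k := FractionRing (PolyRing k n)) (G := shiftMonoid k n)).toAddMonoidHom

theorem fold_rsingle (μ : shiftMonoid k n) (c : FractionRing (PolyRing k n)) :
    fold k n (rsingle μ c) = c := by
  change Finsupp.liftAddHom _ (Finsupp.single μ (μ • c)) = c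
  rw [Finsupp.liftAddHom_apply_single]
  exact inv_smul_smul μ c

theorem fold_cf (c : FractionRing (PolyRing k n)) : fold k n (cf k n c) = c := by
  change fold k n (single 1 c) = c
  rw [← rsingle_one, fold_rsingle]

theorem single_eq_rsingle (μ : shiftMonoid k n) (c : FractionRing (PolyRing k n)) :
    (single μ c : ShiftRing k n) = rsingle μ (μ⁻¹ • c) := by
  rw [rsingle, smul_inv_smul]

theorem fold_cf_fold_mul (z w : ShiftRing k n) :
    fold k n (cf k n (fold k n z) * w) = fold k n (z * w) := by
  induction z using SkewMonoidAlgebra.induction_on' with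
  | add z z' hz hz' => rw [map_add, map_add, add_mul, map_add, hz, hz', add_mul, map_add]
  | single μ a =>
    induction w using SkewMonoidAlgebra.induction_on' with
    | add w w' hw hw' => rw [mul_add, map_add, hw, hw', mul_add, map_add]
    | single ν b =>
      rw [single_eq_rsingle, single_eq_rsingle, fold_rsingle, rsingle_mul_rsingle, fold_rsingle]
      change fold k n (single 1 _ * _) = _
      rw [single_one_mul_rsingle, fold_rsingle]

/-- The value at a shift of a single variable of a row of an invariant function is the value at
this variable of a polynomial with invariant coefficients. -/
theorem exists_eval_eq_of_mem_gammaAlg [CharZero k] (r : ℕ) (c : ℤ)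
    {f : FractionRing (PolyRing k n)} (hf : f ∈ gammaAlg k n) :
    ∃ F ∈ polyOver (gammaAlg k n).toSubring, ∀ (p : Pos n) (μ : shiftMonoid k n), p.1.val = r →
      (∀ q, μ • x k q = x k q + if q = p then (c : FractionRing (PolyRing k n)) else 0) →
        μ • f = F.eval (x k p) := by
  induction hf using Algebra.adjoin_induction with
  | mem f hf =>
    obtain ⟨s, l, rfl⟩ := hf
    refine ⟨Polynomial.C (algebraMap _ _ (rowPsum k s l)) +
      if r = s.val then (Polynomial.X + (c : Polynomial _)) ^ l - Polynomial.X ^ l else 0,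
        add_mem (C_mem_polyOver (rowPsum_mem_gammaAlg s l)) ?_, fun p μ hp hμ => ?_⟩
    · split_ifs
      · exact sub_mem (pow_mem (add_mem (X_mem_polyOver _) (intCast_mem _ _)) _)
          (pow_mem (X_mem_polyOver _) _)
      · exact zero_mem _
    · have h1 := map_rowPsum (g := act μ) hμ s l
      rw [MulSemiringAction.toRingHom_apply] at h1
      rw [h1]
      by_cases h : p.1 = s
      · rw [if_pos h, if_pos (by rw [← hp, h])]
        simp
      · rw [if_neg h, if_neg fun h' => h (Fin.ext (hp.trans h'))]
        simp
  | algebraMap a =>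
    refine ⟨Polynomial.C (algebraMap k _ a), C_mem_polyOver (Subalgebra.algebraMap_mem _ _),
      fun p μ _ _ => ?_⟩
    rw [Polynomial.eval_C, Algebra.algebraMap_eq_smul_one, smul_comm, smul_one]
  | add a b _ _ ha hb =>
    obtain ⟨F, hF, h⟩ := ha
    obtain ⟨H, hH, h'⟩ := hb
    refine ⟨F + H, add_mem hF hH, fun p μ hp hμ => ?_⟩
    rw [smul_add, h p μ hp hμ, h' p μ hp hμ, Polynomial.eval_add]
  | mul a b _ _ ha hb =>
    obtain ⟨F, hF, h⟩ := ha
    obtain ⟨H, hH, h'⟩ := hb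
    refine ⟨F * H, mul_mem hF hH, fun p μ hp hμ => ?_⟩
    rw [smul_mul', h p μ hp hμ, h' p μ hp hμ, Polynomial.eval_mul]

theorem x_injective [CharZero k] : Function.Injective (x k : Pos n → _) := fun p q h => by
  by_contra hpq
  exact x_sub_x_ne_zero hpq (sub_eq_zero.2 h)

theorem rowPoly_eval (m : ℕ) (t : FractionRing (PolyRing k n)) :
    (rowPoly k n m).eval t = (-1) ^ (row n m).card * ∏ q ∈ row n m, (x k q - t) := by
  rw [rowPoly, Polynomial.eval_prod, ← Finset.prod_neg]
  refine Finset.prod_congr rfl fun q _ => ?_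
  simp

theorem prod_erase_sub (m : ℕ) {p : Pos n} (hp : p ∈ row n m) :
    ∏ q ∈ (row n m).erase p, (x k p - x k q) =
      (-1) ^ ((row n m).card - 1) * ∏ q ∈ (row n m).erase p, (x k q - x k p) := by
  rw [← Finset.card_erase_of_mem hp, ← Finset.prod_neg]
  exact Finset.prod_congr rfl fun q _ => (neg_sub _ _).symm

theorem Aplus_eq_residue (p : Inner n) : Aplus k p.1 =
    (-rowPoly k n (p.1.1.val + 2)).eval (x k p.1) /
      ∏ q ∈ (row n (p.1.1.val + 1)).erase p.1, (x k p.1 - x k q) := by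
  have h1 := p.2
  rw [prod_erase_sub _ (mem_row.2 rfl), Polynomial.eval_neg, rowPoly_eval, card_row (by omega),
    card_row (by omega), Nat.add_sub_cancel, pow_add, neg_one_sq, mul_one, ← mul_neg,
    mul_div_mul_left _ _ (pow_ne_zero _ (neg_ne_zero.2 one_ne_zero))]
  rfl

theorem Aminus_eq_residue (p : Inner n) : Aminus k p.1 =
    (rowPoly k n p.1.1.val).eval (x k p.1) /
      ∏ q ∈ (row n (p.1.1.val + 1)).erase p.1, (x k p.1 - x k q) := by
  have h1 := p.2
  rw [prod_erase_sub _ (mem_row.2 rfl), rowPoly_eval, card_row (by omega),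
    card_row (by omega), Nat.add_sub_cancel,
    mul_div_mul_left _ _ (pow_ne_zero _ (neg_ne_zero.2 one_ne_zero))]
  rfl

theorem map_mul_neg_eq_neg {A L : Type*} [Ring A] [AddCommGroup L] (f : A →+ L) (a z : A) :
    f (a * -z) = -f (a * z) := by
  rw [mul_neg, map_neg]

/-- The right action of the image of `U(gl_n)` preserves the invariant polynomials. -/
theorem fold_mem_gammaAlg [CharZero k] {f : FractionRing (PolyRing k n)} (hf : f ∈ gammaAlg k n)
    (u : Ugl k n) : fold k n (cf k n f * gtHom k n u) ∈ gammaAlg k n := by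
  -- the elements that preserve the invariant polynomials form a subring, so that it suffices to
  -- treat the generators
  let S : Subring (ShiftRing k n) :=
    { carrier := {z | ∀ f ∈ gammaAlg k n, fold k n (cf k n f * z) ∈ gammaAlg k n}
      mul_mem' := fun {z w} hz hw f hf => by
        rw [← mul_assoc, ← fold_cf_fold_mul]
        exact hw _ (hz f hf)
      one_mem' := fun f hf => by rwa [mul_one, fold_cf]
      add_mem' := fun {z w} hz hw f hf => by
        rw [mul_add, map_add]
        exact add_mem (hz f hf) (hw f hf)
      zero_mem' := fun f hf => by
        rw [mul_zero, map_zero]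
        exact zero_mem _
      neg_mem' := fun {z} hz f hf => by
        rw [map_mul_neg_eq_neg]
        exact neg_mem (hz f hf) }
  have hcf : ∀ c ∈ gammaAlg k n, cf k n c ∈ S := fun c hc f hf => by
    rw [← map_mul, fold_cf]
    exact mul_mem hf hc
  -- for raising and lowering elements the result is a sum of residues at the variables of a row of
  -- a rational function with invariant coefficients
  have hres : ∀ (i : ℕ) (F N : Polynomial (FractionRing (PolyRing k n))), i + 1 < n →
      F ∈ polyOver (gammaAlg k n).toSubring → N ∈ polyOver (gammaAlg k n).toSubring →
      ∑ p ∈ innerRow n i, F.eval (x k p.1) * (N.eval (x k p.1) /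
        ∏ q ∈ (row n (i + 1)).erase p.1, (x k p.1 - x k q)) ∈ gammaAlg k n := by
    intro i F N hi hF hN
    have h1 := residueSum_mem (s := row n (i + 1)) (v := x k) x_injective.injOn
      (rowPoly_mem_polyOver_gammaAlg (i + 1)) (mul_mem hF hN)
    rw [sum_innerRow hi fun p => F.eval (x k p) * (N.eval (x k p) /
      ∏ q ∈ (row n (i + 1)).erase p, (x k p - x k q))]
    simp only [residueSum, Polynomial.eval_mul, mul_div_assoc] at h1
    exact h1
  have h : (cornerImage k n n).toSubring ≤ S := by
    refine cornerImage_le (fun c => ?_) (fun i _ => ?_) (fun i hi f hf => ?_) fun i hi f hf => ?_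
    · exact hcf _ (Subalgebra.algebraMap_mem _ _)
    · exact hcf _ (sub_mem (sum_row_mem_gammaAlg _) (sum_row_mem_gammaAlg _))
    · obtain ⟨F, hF, h1⟩ := exists_eval_eq_of_mem_gammaAlg i 1 hf
      have h2 := hres i F _ hi hF (neg_mem (rowPoly_mem_polyOver_gammaAlg (i + 2)))
      rw [eRow, Finset.mul_sum, _root_.map_sum]
      convert h2 using 1
      refine Finset.sum_congr rfl fun p hp => ?_
      rw [mem_innerRow] at hp
      subst hp
      rw [← Aplus_eq_residue, ← h1 p.1 (sft k p)⁻¹ rfl (sft_inv_smul_x p)]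
      change fold k n (single 1 f * rsingle _ _) = _
      rw [single_one_mul_rsingle, fold_rsingle]
    · obtain ⟨F, hF, h1⟩ := exists_eval_eq_of_mem_gammaAlg i (-1) hf
      have h2 := hres i F _ hi hF (rowPoly_mem_polyOver_gammaAlg i)
      rw [fRow, Finset.mul_sum, _root_.map_sum]
      convert h2 using 1
      refine Finset.sum_congr rfl fun p hp => ?_
      rw [mem_innerRow] at hp
      subst hp
      rw [← Aminus_eq_residue, ← h1 p.1 (sft k p) rfl (sft_smul_x p)]
      change fold k n (single 1 f * rsingle _ _) = _
      rw [single_one_mul_rsingle, fold_rsingle, inv_inv]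
  exact h ⟨u, by rw [corner_self]; trivial, rfl⟩ f hf

/-- A rational function in the image of `U(gl_n)` is an invariant polynomial. -/
theorem mem_gammaAlg_of_gtHom_eq_cf [CharZero k] {u : Ugl k n} {c : FractionRing (PolyRing k n)}
    (h : gtHom k n u = cf k n c) : c ∈ gammaAlg k n := by
  have h1 := fold_mem_gammaAlg (one_mem (gammaAlg k n)) u
  rwa [h, map_one, one_mul, fold_cf] at h1

theorem mem_baseRing [CharZero k] {z : ShiftRing k n} :
    z ∈ GaloisRing.baseRing (permGroup k n) (shiftMonoid k n) ↔
      ∃ c ∈ gammaAlg k n, cf k n c = z := by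
  constructor
  · rintro ⟨f, hf, rfl⟩
    exact ⟨_, mem_gammaAlg.2 ⟨f, hf, rfl⟩, rfl⟩
  · rintro ⟨c, hc, rfl⟩
    obtain ⟨f, hf, rfl⟩ := mem_gammaAlg.1 hc
    exact ⟨f, hf, rfl⟩

/-- The preimage of a power sum of a row in the enveloping algebra of the corner is central there,
since its image commutes with the image of the corner. -/
theorem exists_center_gtHom_eq [CharZero k] (hinj : Function.Injective (gtHom k n)) (r : Fin n)
    (l : ℕ) : ∃ u ∈ gtSubalgebra k n, gtHom k n u = cf k n (algebraMap _ _ (rowPsum k r l)) := by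
  obtain ⟨u, hu, h⟩ := rowPsum_mem_cornerFun (k := k) r le_rfl r.2 l
  refine ⟨u, ?_, h⟩
  have h1 : (Subalgebra.center k (corner k n (r.val + 1))).map (corner k n (r.val + 1)).val ≤
      gtSubalgebra k n := le_iSup (fun m : Fin n =>
        (Subalgebra.center k (corner k n (m + 1))).map (corner k n (m + 1)).val) r
  refine h1 ⟨⟨u, hu⟩, Subalgebra.mem_center_iff.2 fun v => Subtype.ext (hinj ?_), rfl⟩
  change gtHom k n (v.1 * u) = gtHom k n (u * v.1)
  have h' : gtHom k n u = cf k n (algebraMap _ _ (rowPsum k r l)) := h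
  rw [map_mul, map_mul, h']
  exact commute_rowPsum_cornerImage le_rfl l ⟨v.1, v.2, rfl⟩

/-- The image of a central element of a corner commutes with all quadratic power sums of the rows:
with those of the longer rows because it lies in the corner, and with the others because their
preimages lie in the corner. Hence it is a rational function. -/
theorem gtHom_mem_baseRing_of_center [CharZero k] {m : ℕ} (hm : m ≤ n) {u : Ugl k n}
    (hu : u ∈ (Subalgebra.center k (corner k n m)).map (corner k n m).val) :
    ∃ c ∈ gammaAlg k n, cf k n c = gtHom k n u := by
  obtain ⟨v, hv, rfl⟩ := hu
  obtain ⟨c, hc⟩ := exists_eq_cf_of_commute (z := gtHom k n v.1) fun r => by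
    rcases le_total m (r.val + 1) with h | h
    · exact commute_rowPsum_cornerImage h 2 ⟨v.1, v.2, rfl⟩
    · obtain ⟨w, hw, h1⟩ := rowPsum_mem_cornerFun (k := k) r h hm 2
      have h2 : gtHom k n w = cf k n (algebraMap _ _ (rowPsum k r 2)) := h1
      have h3 := congrArg Subtype.val (Subalgebra.mem_center_iff.1 hv ⟨w, hw⟩)
      rw [← h2, ← map_mul, ← map_mul]
      exact congrArg (gtHom k n) h3.symm
  exact ⟨c, mem_gammaAlg_of_gtHom_eq_cf hc, hc.symm⟩

/-- The Gelfand-Tsetlin homomorphism, if injective, maps the Gelfand-Tsetlin subalgebra onto the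
invariant polynomials. -/
theorem map_gtSubalgebra [CharZero k] (hinj : Function.Injective (gtHom k n)) :
    (gtSubalgebra k n).toSubring.map (gtHom k n : Ugl k n →+* ShiftRing k n) =
      GaloisRing.baseRing (permGroup k n) (shiftMonoid k n) := by
  apply le_antisymm
  · have h1 : gtSubalgebra k n ≤ ((gammaAlg k n).map (cfAlg k n)).comap (gtHom k n) :=
      iSup_le fun m u hu => gtHom_mem_baseRing_of_center m.2 hu
    rintro _ ⟨u, hu, rfl⟩
    exact mem_baseRing.2 (h1 hu)
  · intro z hz
    obtain ⟨c, hc, rfl⟩ := mem_baseRing.1 hz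
    have h1 : gammaAlg k n ≤ ((gtSubalgebra k n).map (gtHom k n)).comap (cfAlg k n) := by
      rw [gammaAlg, Algebra.adjoin_le_iff]
      rintro _ ⟨r, l, rfl⟩
      exact exists_center_gtHom_eq hinj r l
    exact h1 hc

end GelfandTsetlin

namespace SkewMonoidAlgebra

/-! ### Separating the terms of an element of a skew group ring -/

section Separation

variable {L M : Type*} [Field L] [CommGroup M] [MulSemiringAction M L]

theorem smul_eq_single_mul (c : L) (z : SkewMonoidAlgebra L M) : c • z = single 1 c * z := by
  induction z using induction_on' with
  | add z w hz hw => rw [smul_add, mul_add, hz, hw]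
  | single g a => rw [single_mul_single, smul_single, one_mul, one_smul, smul_eq_mul]

theorem single_mul_single_one_pow (g : M) (a c : L) (j : ℕ) :
    (single g a : SkewMonoidAlgebra L M) * single 1 c ^ j = (g • c) ^ j • single g a := by
  induction j with
  | zero => rw [pow_zero, pow_zero, mul_one, one_smul]
  | succ j ih =>
    rw [pow_succ, ← mul_assoc, ih, smul_mul_assoc, single_mul_single, mul_one, pow_succ,
      ← smul_smul, smul_single (g • c), smul_eq_mul, mul_comm a]

/-- The terms of `∑ a_p g_p` are linear combinations over `L` of the products with the powers of an
element of `L` on which the `g_p` take distinct values. -/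
theorem single_mem_of_sum_mul_pow_mem {ι : Type*} {s : Finset ι} {g : ι → M} {a : ι → L} {c : L}
    {W : Submodule L (SkewMonoidAlgebra L M)} (hg : Set.InjOn (fun p => g p • c) s)
    (hW : ∀ j < s.card, (∑ p ∈ s, single (g p) (a p)) * single 1 c ^ j ∈ W) {p : ι} (hp : p ∈ s)
    (ha : a p ≠ 0) : single (g p) 1 ∈ W := by
  classical
  set P := Lagrange.basis s (fun p => g p • c) p with hP
  have hd : P.natDegree < s.card := by
    have h1 := Finset.card_pos.2 ⟨p, hp⟩
    rw [Polynomial.natDegree_eq_of_degree_eq_some (Lagrange.degree_basis hg hp)]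
    omega
  have h1 : ∑ j ∈ Finset.range s.card, P.coeff j •
      ((∑ q ∈ s, single (g q) (a q)) * single 1 c ^ j) = single (g p) (a p) := by
    have h2 : ∀ j, P.coeff j • ((∑ q ∈ s, single (g q) (a q)) * single 1 c ^ j) =
        ∑ q ∈ s, (P.coeff j * (g q • c) ^ j) • single (g q) (a q) := fun j => by
      rw [Finset.sum_mul, Finset.smul_sum]
      refine Finset.sum_congr rfl fun q _ => ?_
      rw [single_mul_single_one_pow, smul_smul]
    simp only [h2]
    rw [Finset.sum_comm]
    simp only [← Finset.sum_smul, ← Polynomial.eval_eq_sum_range' hd]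
    rw [Finset.sum_eq_single p]
    · rw [hP, Lagrange.eval_basis_self hg hp, one_smul]
    · intro q hq hqp
      have h3 := Lagrange.eval_basis_of_ne (v := fun p => g p • c) hqp.symm hq
      rw [hP, h3, zero_smul]
    · exact fun h => absurd hp h
  have h3 : single (g p) 1 = (a p)⁻¹ • single (g p) (a p) := by
    rw [smul_single, smul_eq_mul, inv_mul_cancel₀ ha]
  rw [h3, ← h1]
  exact W.smul_mem _ (sum_mem fun j hj => W.smul_mem _ (hW j (Finset.mem_range.1 hj)))

variable {F : ℕ → Set (SkewMonoidAlgebra L M)}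

theorem mul_mem_span_filtration (hmul : ∀ d e, ∀ z ∈ F d, ∀ w ∈ F e, z * w ∈ F (d + e)) {d e : ℕ}
    {z w : SkewMonoidAlgebra L M} (hz : z ∈ Submodule.span L (F d)) (hw : w ∈ F e) :
    z * w ∈ Submodule.span L (F (d + e)) := by
  induction hz using Submodule.span_induction with
  | mem z hz => exact Submodule.subset_span (hmul d e z hz w hw)
  | zero => rw [zero_mul]; exact zero_mem _
  | add a b _ _ ha hb => rw [add_mul]; exact add_mem ha hb
  | smul c z _ hz => rw [smul_mul_assoc]; exact Submodule.smul_mem _ c hz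

/-- If a sum of terms with distinct shifts of `c`, and `c` itself, lie in a filtered set, then the
span over `L` contains each of the terms, up to a bounded increase of the degree. -/
theorem single_mul_mem_span (hF : Monotone F)
    (hmul : ∀ d e, ∀ z ∈ F d, ∀ w ∈ F e, z * w ∈ F (d + e)) {ι : Type*} {s : Finset ι}
    {g : ι → M} {a : ι → L} {c : L} (hg : Set.InjOn (fun p => g p • c) s) {e m : ℕ}
    (hm : s.card ≤ m) (hs : ∑ p ∈ s, single (g p) (a p) ∈ F e) (hc : single 1 c ∈ F e) {p : ι}
    (hp : p ∈ s) (ha : a p ≠ 0) {d : ℕ} {μ : M} (hμ : single μ 1 ∈ Submodule.span L (F d)) :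
    single (μ * g p) 1 ∈ Submodule.span L (F (d + e * (m + 1))) := by
  have h1 : ∀ j, (∑ p ∈ s, single (g p) (a p)) * single 1 c ^ j ∈ F (e * (j + 1)) := fun j => by
    induction j with
    | zero => rwa [pow_zero, mul_one, zero_add, mul_one]
    | succ j ih =>
      rw [pow_succ, ← mul_assoc, mul_add e (j + 1), mul_one]
      exact hmul _ _ _ ih _ hc
  have h2 : single μ 1 * ∑ p ∈ s, single (g p) (a p) = ∑ p ∈ s, single (μ * g p) (μ • a p) := by
    rw [Finset.mul_sum]
    exact Finset.sum_congr rfl fun q _ => by rw [single_mul_single, one_mul]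
  refine single_mem_of_sum_mul_pow_mem (s := s) (g := fun p => μ * g p) (a := fun p => μ • a p)
    (c := c) (fun q hq r hr h => hg hq hr ?_) (fun j hj => ?_) hp ((smul_ne_zero_iff_ne μ).2 ha)
  · simp only [mul_smul] at h
    exact smul_left_cancel μ h
  · rw [← h2, mul_assoc]
    have h3 : e * (j + 1) ≤ e * (m + 1) := Nat.mul_le_mul_left _ (by omega)
    exact mul_mem_span_filtration hmul hμ (hF h3 (h1 j))

end Separation

/-- A filtration of a skew group ring of a free abelian group, whose spans over `L` contain with a
group element its products with the generators and their inverses, after a bounded number of steps,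
exhausts the skew group ring at a linear rate. -/
theorem single_mem_span_of_step {L M ι : Type*} [Field L] [CommGroup M] [Fintype ι]
    [DecidableEq ι] {F : ℕ → Set (SkewMonoidAlgebra L M)}
    (e : Multiplicative (ι → ℤ) ≃* M) (h1 : single 1 1 ∈ F 0) {c : ℕ}
    (hstep : ∀ p d μ, single μ 1 ∈ Submodule.span L (F d) →
      single (μ * e (Multiplicative.ofAdd (Pi.single p 1))) 1 ∈ Submodule.span L (F (d + c)) ∧
      single (μ * (e (Multiplicative.ofAdd (Pi.single p 1)))⁻¹) 1 ∈
        Submodule.span L (F (d + c))) (m : ℕ) (a : ι → ℤ) (ha : ∑ i, (a i).natAbs = m) :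
    single (e (Multiplicative.ofAdd a)) 1 ∈ Submodule.span L (F (m * c)) := by
  induction m generalizing a with
  | zero =>
    have h2 : a = 0 := funext fun i => by
      have := (Finset.sum_eq_zero_iff.1 ha) i (Finset.mem_univ i)
      simpa using this
    rw [h2, ofAdd_zero, map_one, zero_mul]
    exact Submodule.subset_span h1
  | succ m ih =>
    obtain ⟨p, hp⟩ : ∃ p, a p ≠ 0 := by
      by_contra! h
      simp [h] at ha
    have key : ∀ b : ι → ℤ, (∀ i, i ≠ p → b i = a i) → (b p).natAbs + 1 = (a p).natAbs →
        single (e (Multiplicative.ofAdd b)) 1 ∈ Submodule.span L (F (m * c)) := fun b hb hbp => by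
      refine ih b ?_
      rw [← Finset.add_sum_erase _ _ (Finset.mem_univ p)] at ha ⊢
      rw [Finset.sum_congr rfl fun i hi => by rw [hb i (Finset.ne_of_mem_erase hi)]]
      omega
    rw [add_mul, one_mul]
    rcases lt_or_gt_of_ne hp with h | h
    · have h2 := (hstep p _ _ (key (a + Pi.single p 1) (fun i hi => by simp [hi])
        (by simp; omega))).2
      rwa [ofAdd_add, map_mul, mul_inv_cancel_right] at h2
    · have h2 := (hstep p _ _ (key (a - Pi.single p 1) (fun i hi => by simp [hi])
        (by simp; omega))).1
      rwa [ofAdd_sub, map_div, div_mul_cancel] at h2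

end SkewMonoidAlgebra

namespace GelfandTsetlin

open SkewMonoidAlgebra MvPolynomial

variable {k : Type*} [Field k] {n : ℕ}

/-- The quadratic power sum of the row of length `i + 1`. -/
noncomputable def quad (k : Type*) [Field k] (n i : ℕ) : FractionRing (PolyRing k n) :=
  ∑ q ∈ row n (i + 1), x k q ^ 2

theorem quad_eq (r : Fin n) : quad k n r.val =
    algebraMap (PolyRing k n) (FractionRing (PolyRing k n)) (rowPsum k r 2) := by
  rw [quad, row_eq_map, Finset.sum_map]
  simp [rowPsum, x]

/-- The shifts of a row take distinct values on its quadratic power sum, so that commuting with it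
separates the terms of the raising and of the lowering element. -/
theorem smul_quad_injOn [CharZero k] {g : Inner n → shiftMonoid k n} {c : ℤ} (hc : c ≠ 0)
    (hg : ∀ p q, g p • x k q = x k q + if q = p.1 then (c : FractionRing (PolyRing k n)) else 0)
    (i : ℕ) : Set.InjOn (fun p => g p • quad k n i) (innerRow n i) := by
  intro p hp q hq h
  have key : ∀ p ∈ innerRow n i, g p • quad k n i =
      quad k n i + (2 * c * x k p.1 + (c : FractionRing (PolyRing k n)) ^ 2) := by
    intro p hp
    rw [mem_innerRow] at hp
    subst hp
    rw [quad_eq]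
    refine (map_rowPsum (g := act (g p)) (hg p) p.1.1 2).trans ?_
    rw [if_pos rfl]
    ring
  simp only [key p hp, key q hq] at h
  by_contra hpq
  refine x_sub_x_ne_zero (k := k) (fun h : p.1 = q.1 => hpq (Subtype.ext h)) ?_
  have h0 : (c : FractionRing (PolyRing k n)) ≠ 0 := Int.cast_ne_zero.2 hc
  have h2 : 2 * (c : FractionRing (PolyRing k n)) * (x k p.1 - x k q.1) = 0 := by
    linear_combination h
  simpa [h0] using h2

/-- The Galois order property: a filtration of subspaces that contains sums of all the shifts of a
row and of their inverses, with nonzero coefficients, and the quadratic power sums of the rows,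
spans the ring of shift operators over the rational functions, at a linear rate. -/
theorem single_mem_span_filtration [CharZero k] {F : ℕ → Set (ShiftRing k n)} (hF : Monotone F)
    (h1 : 1 ∈ F 0) (hmul : ∀ d e, ∀ z ∈ F d, ∀ w ∈ F e, z * w ∈ F (d + e)) {e : ℕ}
    (u v : Inner n → FractionRing (PolyRing k n)) (hu : ∀ p, u p ≠ 0) (hv : ∀ p, v p ≠ 0)
    (hue : ∀ i, i + 1 < n → ∑ p ∈ innerRow n i, single (sft k p) (u p) ∈ F e)
    (hve : ∀ i, i + 1 < n → ∑ p ∈ innerRow n i, single (sft k p)⁻¹ (v p) ∈ F e)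
    (hq : ∀ i, i + 1 < n → cf k n (quad k n i) ∈ F e) (a : Inner n → ℤ) :
    single (shiftEquiv k n (Multiplicative.ofAdd a)) 1 ∈
      Submodule.span (FractionRing (PolyRing k n))
        (F ((∑ p, (a p).natAbs) * (e * (Fintype.card (Inner n) + 1)))) := by
  classical
  refine single_mem_span_of_step (shiftEquiv k n) h1 (fun p d μ hμ => ?_) _ a rfl
  have h2 : shiftEquiv k n (Multiplicative.ofAdd (Pi.single p 1)) = sft k p := shiftEquiv_single p
  have h3 : p ∈ innerRow n p.1.1.val := mem_innerRow.2 rfl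
  rw [h2]
  exact ⟨single_mul_mem_span hF hmul (smul_quad_injOn (by decide) sft_smul_x _)
      (Finset.card_le_univ _) (hue _ p.2) (hq _ p.2) h3 (hu p) hμ,
    single_mul_mem_span hF hmul
      (smul_quad_injOn (g := fun p => (sft k p)⁻¹) (c := 1) one_ne_zero sft_inv_smul_x _)
      (Finset.card_le_univ _) (hve _ p.2) (hq _ p.2) h3 (hv p) hμ⟩

end GelfandTsetlin

namespace GelfandTsetlin

open SkewMonoidAlgebra MvPolynomial

variable {k : Type*} [Field k] {n : ℕ}

/-! ### The image is a Galois ring -/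

theorem Aplus_ne_zero (p : Pos n) : Aplus k p ≠ 0 := by
  refine div_ne_zero (neg_ne_zero.2 (Finset.prod_ne_zero_iff.2 fun q hq => ?_))
    (Finset.prod_ne_zero_iff.2 fun q hq => x_sub_x_ne_zero (Finset.ne_of_mem_erase hq))
  refine x_sub_x_ne_zero fun h => ?_
  rw [mem_row, h] at hq
  omega

theorem Aminus_ne_zero (p : Pos n) : Aminus k p ≠ 0 := by
  refine div_ne_zero (Finset.prod_ne_zero_iff.2 fun q hq => ?_)
    (Finset.prod_ne_zero_iff.2 fun q hq => x_sub_x_ne_zero (Finset.ne_of_mem_erase hq))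
  refine x_sub_x_ne_zero fun h => ?_
  rw [mem_row, h] at hq
  omega

theorem span_eq_top_of_single_mem [CharZero k] {S : Set (ShiftRing k n)}
    (h : ∀ a : Inner n → ℤ, single (shiftEquiv k n (Multiplicative.ofAdd a)) 1 ∈
      Submodule.span (FractionRing (PolyRing k n)) S) :
    Submodule.span (FractionRing (PolyRing k n)) S = ⊤ := by
  rw [eq_top_iff]
  rintro z -
  induction z using SkewMonoidAlgebra.induction_on' with
  | add z w hz hw => exact add_mem hz hw
  | single μ c =>
    obtain ⟨a, rfl⟩ := (shiftEquiv k n).surjective μ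
    have h1 := Submodule.smul_mem _ c (h a.toAdd)
    rwa [smul_single, smul_eq_mul, mul_one] at h1

theorem quad_mem_cornerFun [CharZero k] {i : ℕ} (hi : i < n) :
    quad k n i ∈ cornerFun k n n := by
  have h1 := rowPsum_mem_cornerFun (k := k) ⟨i, hi⟩ (m := n) hi le_rfl 2
  rwa [← quad_eq] at h1

/-- The image of `U(gl_n)` spans the ring of shift operators over the rational functions on the
left. -/
theorem span_cornerImage [CharZero k] : Submodule.span (FractionRing (PolyRing k n))
    (cornerImage k n n : Set (ShiftRing k n)) = ⊤ := by
  refine span_eq_top_of_single_mem fun a => ?_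
  exact single_mem_span_filtration (F := fun _ => (cornerImage k n n : Set (ShiftRing k n)))
    (e := 0) monotone_const (one_mem (cornerImage k n n))
    (fun _ _ z hz w hw => mul_mem (S := Subalgebra k (ShiftRing k n)) hz hw)
    (fun p => sft k p • Aplus k p.1) (fun p => (sft k p)⁻¹ • Aminus k p.1)
    (fun p => (smul_ne_zero_iff_ne _).2 (Aplus_ne_zero _))
    (fun p => (smul_ne_zero_iff_ne _).2 (Aminus_ne_zero _))
    (fun i hi => eRow_mem_cornerImage hi le_rfl) (fun i hi => fRow_mem_cornerImage hi le_rfl)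
    (fun i hi => quad_mem_cornerFun (by omega)) a

/-- The anti-automorphism `c μ ↦ μ⁻¹ c` of the ring of shift operators. -/
noncomputable def rev (z : ShiftRing k n) : ShiftRing k n :=
  (reverse (FractionRing (PolyRing k n)) (shiftMonoid k n) z).unop

theorem rev_rev (z : ShiftRing k n) : rev (rev z) = z := unop_reverse_unop_reverse z

theorem rev_mul (z w : ShiftRing k n) : rev (z * w) = rev w * rev z := by
  rw [rev, map_mul, MulOpposite.unop_mul]
  rfl

theorem rev_add (z w : ShiftRing k n) : rev (z + w) = rev z + rev w := by
  rw [rev, map_add, MulOpposite.unop_add]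
  rfl

theorem rev_neg (z : ShiftRing k n) : rev (-z) = -rev z :=
  (congrArg MulOpposite.unop (map_neg (reverse _ _) z)).trans (MulOpposite.unop_neg _)

theorem rev_zero : rev (0 : ShiftRing k n) = 0 :=
  congrArg MulOpposite.unop (map_zero (reverse _ _))

theorem rev_one : rev (1 : ShiftRing k n) = 1 :=
  congrArg MulOpposite.unop (map_one (reverse _ _))

theorem rev_single (μ : shiftMonoid k n) (c : FractionRing (PolyRing k n)) :
    rev (single μ c) = single μ⁻¹ (μ⁻¹ • c) := by
  rw [rev, reverse_single, MulOpposite.unop_op]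

theorem rev_rsingle (μ : shiftMonoid k n) (c : FractionRing (PolyRing k n)) :
    rev (rsingle μ c) = single μ⁻¹ c := by
  rw [rsingle, rev_single, inv_smul_smul]

theorem rev_cf (c : FractionRing (PolyRing k n)) : rev (cf k n c) = cf k n c := by
  rw [GaloisRing.coeffHom_apply, ← rsingle_one, rev_rsingle, inv_one, rsingle_one]

theorem rev_sum {ι : Type*} (s : Finset ι) (F : ι → ShiftRing k n) :
    rev (∑ p ∈ s, F p) = ∑ p ∈ s, rev (F p) := by
  exact _root_.map_sum (⟨⟨rev, rev_zero⟩, rev_add⟩ : ShiftRing k n →+ ShiftRing k n) F s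

/-- The image of a subring under the anti-automorphism. -/
noncomputable def revSubring (R : Subring (ShiftRing k n)) : Subring (ShiftRing k n) where
  carrier := {z | rev z ∈ R}
  mul_mem' := fun {z w} hz hw => by
    rw [Set.mem_ofPred_eq, rev_mul]
    exact mul_mem hw hz
  one_mem' := by
    rw [Set.mem_ofPred_eq, rev_one]
    exact one_mem R
  add_mem' := fun {z w} hz hw => by
    rw [Set.mem_ofPred_eq, rev_add]
    exact add_mem hz hw
  zero_mem' := by
    rw [Set.mem_ofPred_eq, rev_zero]
    exact zero_mem R
  neg_mem' := fun {z} hz => by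
    rw [Set.mem_ofPred_eq, rev_neg]
    exact neg_mem hz

theorem mem_revSubring {R : Subring (ShiftRing k n)} {z : ShiftRing k n} :
    z ∈ revSubring R ↔ rev z ∈ R := Iff.rfl

/-- The statement of `span_cornerImage` for the image under the anti-automorphism `rev`, which gives
the span from the other side. -/
theorem span_revSubring_cornerImage [CharZero k] :
    Submodule.span (FractionRing (PolyRing k n))
      (revSubring (cornerImage k n n).toSubring : Set (ShiftRing k n)) = ⊤ := by
  refine span_eq_top_of_single_mem fun a => ?_
  refine single_mem_span_filtration
    (F := fun _ => (revSubring (cornerImage k n n).toSubring : Set (ShiftRing k n)))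
    (e := 0) monotone_const (one_mem (revSubring _))
    (fun _ _ z hz w hw => mul_mem (S := Subring (ShiftRing k n)) hz hw)
    (fun p => Aminus k p.1) (fun p => Aplus k p.1)
    (fun p => Aminus_ne_zero _) (fun p => Aplus_ne_zero _)
    (fun i hi => ?_) (fun i hi => ?_) (fun i hi => ?_) a
  · have h1 : rev (fRow k n i) = ∑ p ∈ innerRow n i, single (sft k p) (Aminus k p.1) := by
      rw [fRow, rev_sum]
      exact Finset.sum_congr rfl fun p _ => by rw [fp, rev_rsingle, inv_inv]
    rw [← h1, SetLike.mem_coe, mem_revSubring, rev_rev]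
    exact fRow_mem_cornerImage hi le_rfl
  · have h1 : rev (eRow k n i) = ∑ p ∈ innerRow n i, single (sft k p)⁻¹ (Aplus k p.1) := by
      rw [eRow, rev_sum]
      exact Finset.sum_congr rfl fun p _ => by rw [ep, rev_rsingle]
    rw [← h1, SetLike.mem_coe, mem_revSubring, rev_rev]
    exact eRow_mem_cornerImage hi le_rfl
  · rw [SetLike.mem_coe, mem_revSubring, rev_cf]
    exact quad_mem_cornerFun (by omega)

theorem tw_rev [CharZero k] (σ : ∀ r : Fin n, Equiv.Perm (Fin (r.val + 1))) (z : ShiftRing k n) :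
    tw σ (rev z) = rev (tw σ z) := by
  induction z using SkewMonoidAlgebra.induction_on' with
  | add z w hz hw => rw [rev_add, map_add, map_add, rev_add, hz, hw]
  | single μ c =>
    set ν := GaloisRing.conjHom (setting k n) ⟨permHom k n σ, σ, rfl⟩ with hν
    have h1 : ∀ d : FractionRing (PolyRing k n), ν μ • permHom k n σ • d = permHom k n σ • μ • d :=
      fun d => by
        rw [Submonoid.smul_def, Submonoid.smul_def, smul_smul, smul_smul]
        congr 1
        simp [hν, GaloisRing.conjHom]
    have h2 : ∀ (μ : shiftMonoid k n) (d : FractionRing (PolyRing k n)),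
        tw σ (single μ d) = single (ν μ) (permHom k n σ • d) := fun μ d => GaloisRing.twist_single _ _ _ _
    rw [rev_single, h2, h2, rev_single, map_inv]
    congr 1
    rw [eq_inv_smul_iff, h1, smul_inv_smul]

/-- The product of the conjugates of its denominator is an invariant denominator of a rational
function. -/
theorem exists_eq_div_fixedPoints (c : FractionRing (PolyRing k n)) :
    ∃ h : PolyRing k n, ∃ N ∈ FixedPoints.subring (PolyRing k n) (permGroup k n),
      algebraMap (PolyRing k n) (FractionRing (PolyRing k n)) N ≠ 0 ∧
      c = algebraMap (PolyRing k n) _ h / algebraMap (PolyRing k n) _ N := by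
  classical
  obtain ⟨f, g, hg, rfl⟩ := IsFractionRing.div_surjective (A := PolyRing k n) c
  have hg0 : g ≠ 0 := nonZeroDivisors.ne_zero hg
  set N := ∏ σ, permHom k n σ g with hN
  have hN0 : N ≠ 0 := Finset.prod_ne_zero_iff.2 fun σ _ =>
    (map_ne_zero_iff _ (permHom k n σ).injective).2 hg0
  refine ⟨f * ∏ σ ∈ Finset.univ.erase 1, permHom k n σ g, N, ?_,
    (map_ne_zero_iff _ (IsFractionRing.injective _ _)).2 hN0, ?_⟩
  · rw [mem_fixedPoints_iff]
    intro τ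
    rw [hN, map_prod]
    refine Eq.trans ?_ (Equiv.prod_comp (Equiv.mulLeft τ) _)
    refine Finset.prod_congr rfl fun σ _ => ?_
    rw [Equiv.coe_mulLeft, map_mul]
    rfl
  · have h2 : N = g * ∏ σ ∈ Finset.univ.erase 1, permHom k n σ g := by
      rw [hN, ← Finset.mul_prod_erase _ _ (Finset.mem_univ 1), map_one]
      rfl
    have h3 : ∏ σ ∈ Finset.univ.erase 1, permHom k n σ g ≠ 0 := right_ne_zero_of_mul (h2 ▸ hN0)
    rw [h2, map_mul, map_mul, mul_div_mul_right]
    exact (map_ne_zero_iff _ (IsFractionRing.injective _ _)).2 h3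

/-- An invariant rational function is a quotient of invariant polynomials. -/
theorem mem_closure_of_permHom_smul {c : FractionRing (PolyRing k n)}
    (hc : ∀ σ, permHom k n σ • c = c) :
    c ∈ Subfield.closure (algebraMap (PolyRing k n) (FractionRing (PolyRing k n)) ''
      (FixedPoints.subring (PolyRing k n) (permGroup k n))) := by
  obtain ⟨h, N, hNfix, hN0, rfl⟩ := exists_eq_div_fixedPoints c
  have hhfix : h ∈ FixedPoints.subring (PolyRing k n) (permGroup k n) := by
    rw [mem_fixedPoints_iff]
    intro τ
    have h4 := hc τ
    apply IsFractionRing.injective (PolyRing k n) (FractionRing (PolyRing k n))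
    have h5 : algebraMap (PolyRing k n) (FractionRing (PolyRing k n)) h =
        (algebraMap _ _ h / algebraMap _ _ N) * algebraMap _ _ N := (div_mul_cancel₀ _ hN0).symm
    rw [← ringAut_smul_algebraMap]
    nth_rewrite 1 [h5]
    rw [smul_mul', h4, ringAut_smul_algebraMap, mem_fixedPoints_iff.1 hNfix, ← h5]
  exact div_mem (Subfield.subset_closure ⟨h, hhfix, rfl⟩) (Subfield.subset_closure ⟨N, hNfix, rfl⟩)

theorem permHom_smul_of_mem_closure [CharZero k] {c : FractionRing (PolyRing k n)}
    (hc : c ∈ Subfield.closure (algebraMap (PolyRing k n) (FractionRing (PolyRing k n)) ''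
      (FixedPoints.subring (PolyRing k n) (permGroup k n))))
    (σ : ∀ r : Fin n, Equiv.Perm (Fin (r.val + 1))) : permHom k n σ • c = c := by
  let S : Subfield (FractionRing (PolyRing k n)) :=
    (MulSemiringAction.toRingHom (RingAut (PolyRing k n)) (FractionRing (PolyRing k n))
      (permHom k n σ)).eqLocusField (RingHom.id _)
  have h1 : Subfield.closure (algebraMap (PolyRing k n) (FractionRing (PolyRing k n)) ''
      (FixedPoints.subring (PolyRing k n) (permGroup k n))) ≤ S := by
    rw [Subfield.closure_le]
    rintro _ ⟨f, hf, rfl⟩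
    exact permHom_smul_of_mem_gammaAlg (mem_gammaAlg.2 ⟨f, hf, rfl⟩) σ
  exact h1 hc

theorem mem_baseField [CharZero k] {z : ShiftRing k n} :
    z ∈ GaloisRing.baseField (permGroup k n) (shiftMonoid k n) ↔
      ∃ c, (∀ σ, permHom k n σ • c = c) ∧ cf k n c = z := by
  constructor
  · rintro ⟨c, hc, rfl⟩
    exact ⟨c, permHom_smul_of_mem_closure hc, rfl⟩
  · rintro ⟨c, hc, rfl⟩
    exact ⟨c, mem_closure_of_permHom_smul hc, rfl⟩

theorem sum_permHom_smul (c : FractionRing (PolyRing k n))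
    (τ : ∀ r : Fin n, Equiv.Perm (Fin (r.val + 1))) :
    permHom k n τ • ∑ σ, permHom k n σ • c = ∑ σ, permHom k n σ • c := by
  rw [Finset.smul_sum]
  refine Eq.trans ?_ (Equiv.sum_comp (Equiv.mulLeft τ) _)
  refine Finset.sum_congr rfl fun σ _ => ?_
  rw [Equiv.coe_mulLeft, map_mul, mul_smul]

/-- A ring of invariants that spans the ring of shift operators over `L`, spans the invariants over
`L^G`: take averages over `G`. -/
theorem closure_field_mul [CharZero k] {R : Subring (ShiftRing k n)}
    (hR : R ≤ GaloisRing.invariants (setting k n))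
    (hspan : Submodule.span (FractionRing (PolyRing k n)) (R : Set (ShiftRing k n)) = ⊤) :
    AddSubgroup.closure {z | ∃ a ∈ GaloisRing.baseField (permGroup k n) (shiftMonoid k n),
      ∃ u ∈ R, z = a * u} = (GaloisRing.invariants (setting k n)).toAddSubgroup := by
  apply le_antisymm
  · rw [AddSubgroup.closure_le]
    rintro _ ⟨a, ha, u, hu, rfl⟩
    refine mul_mem (S := Subring (ShiftRing k n)) ?_ (hR hu)
    obtain ⟨c, hc, rfl⟩ := mem_baseField.1 ha
    exact mem_invariants.2 fun σ => by rw [tw_cf, hc]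
  · set C := AddSubgroup.closure {z | ∃ a ∈ GaloisRing.baseField (permGroup k n) (shiftMonoid k n),
      ∃ u ∈ R, z = a * u} with hC
    -- for invariant `u` the sum of the conjugates of `c * u` is the trace of `c`, times `u`
    have key : ∀ z ∈ Submodule.span (FractionRing (PolyRing k n)) (R : Set (ShiftRing k n)),
        ∀ c : FractionRing (PolyRing k n), ∑ σ, tw σ (cf k n c * z) ∈ C := by
      intro z hz
      induction hz using Submodule.span_induction with
      | mem u hu =>
        intro c
        have h1 : ∑ σ, tw σ (cf k n c * u) = cf k n (∑ σ, permHom k n σ • c) * u := by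
          rw [_root_.map_sum, Finset.sum_mul]
          refine Finset.sum_congr rfl fun σ _ => ?_
          rw [map_mul, tw_cf, mem_invariants.1 (hR hu)]
        rw [h1]
        exact AddSubgroup.subset_closure
          ⟨_, mem_baseField.2 ⟨_, sum_permHom_smul c, rfl⟩, u, hu, rfl⟩
      | zero =>
        intro c
        simp only [mul_zero, map_zero, Finset.sum_const_zero]
        exact zero_mem C
      | add z w _ _ hz hw =>
        intro c
        simp only [mul_add, map_add, Finset.sum_add_distrib]
        exact add_mem (hz c) (hw c)
      | smul d z _ hz =>
        intro c
        have h1 : _ = cf k n d * z := smul_eq_single_mul d z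
        have h2 := hz (c * d)
        rw [h1]
        simp only [map_mul, mul_assoc] at h2 ⊢
        exact h2
    intro z hz
    set m := Fintype.card (∀ r : Fin n, Equiv.Perm (Fin (r.val + 1))) with hm
    -- an invariant element is the average of its conjugates
    have h1 := key z (by rw [hspan]; trivial) (m : FractionRing (PolyRing k n))⁻¹
    have h2 : ∀ σ, tw σ (cf k n (m : FractionRing (PolyRing k n))⁻¹ * z) =
        cf k n (m : FractionRing (PolyRing k n))⁻¹ * z := fun σ => by
      have h3 : permHom k n σ • (m : FractionRing (PolyRing k n))⁻¹ =
          (m : FractionRing (PolyRing k n))⁻¹ := by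
        change MulSemiringAction.toRingHom _ _ (permHom k n σ) _ = _
        rw [map_inv₀, map_natCast]
      rw [map_mul, tw_cf, mem_invariants.1 hz, h3]
    simp only [h2, Finset.sum_const, Finset.card_univ, ← hm] at h1
    rwa [nsmul_eq_mul, ← mul_assoc, ← map_natCast (cf k n), ← map_mul, mul_inv_cancel₀, map_one,
      one_mul] at h1
    exact Nat.cast_ne_zero.2 Fintype.card_ne_zero

theorem gammaAlg_le_cornerFun [CharZero k] : gammaAlg k n ≤ cornerFun k n n := by
  rw [gammaAlg, Algebra.adjoin_le_iff]
  rintro _ ⟨r, l, rfl⟩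
  exact rowPsum_mem_cornerFun r r.2 le_rfl l

theorem toSubring_cornerImage [CharZero k] :
    (cornerImage k n n).toSubring = (gtHom k n : Ugl k n →+* ShiftRing k n).range := by
  ext z
  constructor
  · rintro ⟨u, -, rfl⟩
    exact ⟨u, rfl⟩
  · rintro ⟨u, rfl⟩
    exact ⟨u, by rw [corner_self]; trivial, rfl⟩

theorem cornerImage_le_invariants [CharZero k] :
    (cornerImage k n n).toSubring ≤ GaloisRing.invariants (setting k n) := by
  rintro _ ⟨u, -, rfl⟩
  exact gtHom_mem_invariants u

/-- The image of `U(gl_n)` is a Galois ring over the invariant polynomials. -/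
theorem isGaloisRing_cornerImage [CharZero k] :
    GaloisRing.IsGaloisRing (setting k n) (cornerImage k n n).toSubring where
  le_invariants := cornerImage_le_invariants
  baseRing_le z hz := by
    obtain ⟨c, hc, rfl⟩ := mem_baseRing.1 hz
    exact gammaAlg_le_cornerFun hc
  finitelyGenerated := by
    classical
    refine ⟨Finset.univ.image fun ij : Fin n × Fin n => gtHom k n (E k ij.1 ij.2),
      le_antisymm ?_ ?_⟩
    · rw [Subring.closure_le]
      rintro z (hz | hz)
      · obtain ⟨c, hc, rfl⟩ := mem_baseRing.1 hz
        exact gammaAlg_le_cornerFun hc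
      · obtain ⟨ij, -, rfl⟩ := Finset.mem_image.1 hz
        exact ⟨_, E_mem_corner ij.1.2 ij.2.2, rfl⟩
    · have h1 : ∀ i j, gtHom k n (E k i j) ∈ Subring.closure
          (↑(GaloisRing.baseRing (permGroup k n) (shiftMonoid k n)) ∪
            (↑(Finset.univ.image fun ij : Fin n × Fin n => gtHom k n (E k ij.1 ij.2)) :
              Set (ShiftRing k n))) := fun i j =>
        Subring.subset_closure (Or.inr (Finset.mem_image.2 ⟨(i, j), Finset.mem_univ _, rfl⟩))
      refine cornerImage_le (fun c => ?_) (fun i hi => ?_) (fun i hi => ?_) fun i hi => ?_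
      · exact Subring.subset_closure (Or.inl
          (mem_baseRing.2 ⟨_, Subalgebra.algebraMap_mem _ c, rfl⟩))
      · rw [← gtHom_diag ⟨i, hi⟩]
        exact h1 _ _
      · rw [← gtHom_raising ⟨i, by omega⟩ hi]
        exact h1 _ _
      · rw [← gtHom_lowering ⟨i, by omega⟩ hi]
        exact h1 _ _
  field_mul := closure_field_mul cornerImage_le_invariants span_cornerImage
  mul_field := by
    have hrev : revSubring (cornerImage k n n).toSubring ≤ GaloisRing.invariants (setting k n) :=
      fun z hz => mem_invariants.2 fun σ => by
        have h1 := mem_invariants.1 (cornerImage_le_invariants (mem_revSubring.1 hz)) σ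
        rw [← rev_rev z, tw_rev, h1]
    have h1 := closure_field_mul hrev span_revSubring_cornerImage
    apply le_antisymm
    · rw [AddSubgroup.closure_le]
      rintro _ ⟨a, ha, u, hu, rfl⟩
      refine mul_mem (S := Subring (ShiftRing k n)) (cornerImage_le_invariants hu) ?_
      obtain ⟨c, hc, rfl⟩ := mem_baseField.1 ha
      exact mem_invariants.2 fun σ => by rw [tw_cf, hc]
    · intro z hz
      have h2 : rev z ∈ (GaloisRing.invariants (setting k n)).toAddSubgroup :=
        mem_invariants.2 fun σ => by rw [tw_rev, mem_invariants.1 hz]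
      rw [← h1] at h2
      rw [← rev_rev z]
      generalize rev z = w at h2
      induction h2 using AddSubgroup.closure_induction with
      | mem w hw =>
        obtain ⟨a, ha, u, hu, rfl⟩ := hw
        refine AddSubgroup.subset_closure ⟨a, ha, rev u, hu, ?_⟩
        obtain ⟨c, hc, rfl⟩ := mem_baseField.1 ha
        rw [rev_mul, rev_cf]
      | zero => rw [rev_zero]; exact zero_mem _
      | add a b _ _ ha hb => rw [rev_add]; exact add_mem ha hb
      | neg a _ ha => rw [rev_neg]; exact neg_mem ha

end GelfandTsetlin

/-! ### Lower bounds for growth -/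

section LowerBound

variable {k L V : Type*} [Field k] [Field L] [Algebra k L] [AddCommGroup V] [Module k V]
  [Module L V] [IsScalarTower k L V]

/-- A linearly independent family in the `L`-span of a `k`-subspace `R` can be exchanged for one of
the same size in `R` itself. -/
theorem exists_linearIndependent_of_mem_span (R : Submodule k V) [FiniteDimensional k R]
    {B : Type*} [Fintype B] {v : B → V} (hv : LinearIndependent L v)
    (hvR : ∀ b, v b ∈ Submodule.span L (R : Set V)) :
    ∃ u : Fin (Fintype.card B) → V, (∀ i, u i ∈ R) ∧ LinearIndependent L u := by
  obtain ⟨T, hT⟩ := (Module.Finite.iff_fg (N := R)).1 inferInstance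
  have h1 : Submodule.span L (R : Set V) = Submodule.span L (T : Set V) := by
    rw [← hT, Submodule.span_span_of_tower]
  have : FiniteDimensional L (Submodule.span L (R : Set V)) := by
    rw [h1]
    exact FiniteDimensional.span_finset L T
  obtain ⟨u, hu, -, hli⟩ := Submodule.exists_fun_fin_finrank_span_eq L (R : Set V)
  have h2 : Fintype.card B ≤ Module.finrank L (Submodule.span L (R : Set V)) := by
    have h3 : LinearIndependent L fun b => (⟨v b, hvR b⟩ : Submodule.span L (R : Set V)) :=
      LinearIndependent.of_comp (Submodule.subtype _) hv
    exact h3.fintype_card_le_finrank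
  exact ⟨fun i => u (Fin.castLE h2 i), fun i => hu _, hli.comp _ (Fin.castLE_injective h2)⟩

/-- A subspace over the small field that contains the products of independent scalars of the large
field with vectors that span a large space over the large field is large. -/
theorem card_mul_card_le_finrank (R W : Submodule k V) [FiniteDimensional k R]
    [FiniteDimensional k W] {B P : Type*} [Fintype B] [Fintype P] {v : B → V}
    (hv : LinearIndependent L v) (hvR : ∀ b, v b ∈ Submodule.span L (R : Set V)) {m : P → L}
    (hm : LinearIndependent k m) (hW : ∀ p, ∀ r ∈ R, m p • r ∈ W) :
    Fintype.card P * Fintype.card B ≤ Module.finrank k W := by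
  obtain ⟨u, hu, hli⟩ := exists_linearIndependent_of_mem_span R hv hvR
  have h1 := linearIndependent_smul hm hli
  have h2 : LinearIndependent k fun z : P × Fin (Fintype.card B) =>
      (⟨m z.1 • u z.2, hW _ _ (hu _)⟩ : W) := LinearIndependent.of_comp W.subtype h1
  simpa using h2.fintype_card_le_finrank

/-- The sum of the subspaces `b_j R`. -/
def mulSpan {k A : Type*} [Field k] [Ring A] [Algebra k A] {s : ℕ} (b : Fin s → A)
    (R : Submodule k A) : Submodule k A :=
  LinearMap.range (LinearMap.lsum k (fun _ : Fin s => R) k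
    fun j => (LinearMap.mulLeft k (b j)).comp R.subtype)

variable {A : Type*} [Ring A] [Algebra k A] {s : ℕ} (b : Fin s → A)

theorem mul_mem_mulSpan {R : Submodule k A} (j : Fin s) {r : A} (hr : r ∈ R) :
    b j * r ∈ mulSpan b R := by
  classical
  exact ⟨Pi.single j ⟨r, hr⟩, by simp [Pi.single_apply, apply_ite]⟩

theorem exists_sum_of_mem_mulSpan {R : Submodule k A} {z : A} (hz : z ∈ mulSpan b R) :
    ∃ r : Fin s → A, (∀ j, r j ∈ R) ∧ z = ∑ j, b j * r j := by
  obtain ⟨r, rfl⟩ := hz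
  exact ⟨fun j => r j, fun j => (r j).2, by simp⟩

instance (R : Submodule k A) [FiniteDimensional k R] : FiniteDimensional k (mulSpan b R) := by
  unfold mulSpan
  infer_instance

theorem finrank_mulSpan_le (R : Submodule k A) [FiniteDimensional k R] :
    Module.finrank k (mulSpan b R) ≤ s * Module.finrank k R := by
  refine (LinearMap.finrank_range_le _).trans ?_
  rw [Module.finrank_pi_fintype]
  simp

end LowerBound

/-- A domain generated over a field by finitely many elements, whose commutators are linear
combinations of the generators and `1`, is an Ore domain. -/
theorem isOreDomain_of_wordSpan {k R : Type*} [Field k] [Ring R] [IsDomain R] [Algebra k R] {m : ℕ}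
    {y : Fin m → R} (hy : ∀ i j, y i * y j - y j * y i ∈ wordSpan k y 1)
    (hgen : Algebra.adjoin k (Set.range y) = ⊤) : IsOreDomain R := by
  have hfin : ∀ d, FiniteDimensional k (wordSpan k y d) := finiteDimensional_wordSpan hy
  have hmem : ∀ u : R, ∃ c, u ∈ wordSpan k y c := fun u =>
    exists_mem_wordSpan (by rw [hgen]; trivial)
  refine isOreDomain_of_growth (D := k) (wordSpan k y) 1 m (fun d => ?_) ?_
    (fun a => ?_) (fun a => ?_)
  · have h1 := finrank_wordSpan_le (k := k) hy d
    rwa [Fintype.card_fin, ← one_mul ((d + 1) ^ _)] at h1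
  · exact fun h => one_ne_zero ((Submodule.eq_bot_iff _).1 h _ (one_mem_wordSpan 0))
  · obtain ⟨c, hc⟩ := hmem a
    exact ⟨c, fun e he d v hv => mul_mem_wordSpan hv (wordSpan_mono he hc)⟩
  · obtain ⟨c, hc⟩ := hmem a
    refine ⟨c, fun e he d v hv => ?_⟩
    have h1 := mul_mem_wordSpan (wordSpan_mono he hc) hv
    rwa [add_comm] at h1

/-- A polynomial bound contradicts a lower bound of larger degree. -/
theorem not_forall_pow_le (K c e N : ℕ) (hN : 0 < N) :
    ¬ ∀ d : ℕ, (d + 1) ^ N ≤ K * (c * d + e + 1) ^ (N - 1) := by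
  intro h
  obtain ⟨M, rfl⟩ : ∃ M, N = M + 1 := ⟨N - 1, by omega⟩
  have h1 := h (K * (c + e + 1) ^ M)
  set d := K * (c + e + 1) ^ M with hd
  have h2 : K * (c * d + e + 1) ^ M ≤ d * (d + 1) ^ M := by
    have h3 : c * d + e + 1 ≤ (c + e + 1) * (d + 1) := by nlinarith
    calc K * (c * d + e + 1) ^ M ≤ K * ((c + e + 1) * (d + 1)) ^ M := by gcongr
      _ = d * (d + 1) ^ M := by rw [mul_pow, hd, mul_assoc]
  rw [Nat.add_sub_cancel, pow_succ] at h1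
  have h4 : 0 < (d + 1) ^ M := by positivity
  nlinarith

namespace SkewMonoidAlgebra

theorem card_mul_card_le_finrank {k L M : Type*} [Field k] [Field L] [Algebra k L] [CommGroup M]
    [MulSemiringAction M L] [SMulCommClass M k L] (R W : Submodule k (SkewMonoidAlgebra L M))
    [FiniteDimensional k R] [FiniteDimensional k W] {B P : Type*} [Fintype B] [Fintype P]
    {v : B → M} (hv : Function.Injective v)
    (hvR : ∀ b, single (v b) 1 ∈ Submodule.span L (R : Set (SkewMonoidAlgebra L M))) {m : P → L}
    (hm : LinearIndependent k m) (hW : ∀ p, ∀ r ∈ R, single 1 (m p) * r ∈ W) :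
    Fintype.card P * Fintype.card B ≤ Module.finrank k W := by
  have : IsScalarTower k L (SkewMonoidAlgebra L M) := inferInstance
  refine _root_.card_mul_card_le_finrank (L := L) R W (v := fun b => single (v b) (1 : L)) ?_ hvR hm
    fun p r hr => ?_
  · have h1 := (basisSingleOne (k := L) (G := M)).linearIndependent.comp v hv
    exact h1
  · rw [smul_eq_single_mul]
    exact hW p r hr

end SkewMonoidAlgebra

namespace GelfandTsetlin

open SkewMonoidAlgebra MvPolynomial

variable {k : Type*} [Field k] {n : ℕ}

theorem card_inner : Fintype.card (Inner n) = n * (n - 1) / 2 := by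
  have h2 : (Finset.univ.filter fun p : Pos n => ¬ p.1.val + 1 < n) = row n n := by
    ext p
    have := p.1.2
    rw [mem_row, Finset.mem_filter]
    simp
    omega
  have h1 := Finset.card_filter_add_card_filter_not (s := (Finset.univ : Finset (Pos n)))
    (fun p => p.1.val + 1 < n)
  rw [h2, card_row le_rfl, Finset.card_univ, Fintype.card_sigma] at h1
  simp only [Fintype.card_fin] at h1
  rw [Fin.sum_univ_eq_sum_range fun r => r + 1, Finset.sum_add_distrib, Finset.sum_const,
    Finset.card_range, smul_eq_mul, mul_one, Finset.sum_range_id] at h1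
  rw [Fintype.card_subtype]
  omega

theorem card_pos_add_card_inner : Fintype.card (Pos n) + Fintype.card (Inner n) = n * n := by
  rw [card_inner, Fintype.card_sigma]
  simp only [Fintype.card_fin]
  rw [Fin.sum_univ_eq_sum_range fun r => r + 1, Finset.sum_add_distrib, Finset.sum_const,
    Finset.card_range, smul_eq_mul, mul_one, Finset.sum_range_id]
  have h1 := Nat.div_mul_cancel (Nat.even_mul_pred_self n).two_dvd
  rcases n with _ | m
  · rfl
  · simp only [Nat.add_sub_cancel] at h1 ⊢
    nlinarith

end GelfandTsetlin

namespace GelfandTsetlin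

open SkewMonoidAlgebra MvPolynomial

variable {k : Type*} [Field k] {n : ℕ}

/-! ### Injectivity of the Gelfand-Tsetlin homomorphism -/

section Generators

attribute [local instance] LieRing.ofAssociativeRing

/-- The matrix units, in some linear order. -/
def gen (k : Type*) [Field k] (n : ℕ) (s : Fin (n * n)) : Ugl k n :=
  E k (finProdFinEquiv.symm s).1 (finProdFinEquiv.symm s).2

theorem E_eq_gen (i j : Fin n) : E k i j = gen k n (finProdFinEquiv (i, j)) := by
  rw [gen, Equiv.symm_apply_apply]

theorem ι_mem_wordSpan (X : Matrix (Fin n) (Fin n) k) :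
    UniversalEnvelopingAlgebra.ι k X ∈ wordSpan k (gen k n) 1 := by
  rw [Matrix.matrix_eq_sum_single X, _root_.map_sum]
  refine sum_mem fun i _ => ?_
  rw [_root_.map_sum]
  refine sum_mem fun j _ => ?_
  have h1 : Matrix.single i j (X i j) = X i j • (Matrix.single i j 1 : Matrix (Fin n) (Fin n) k) := by
    rw [Matrix.smul_single, smul_eq_mul, mul_one]
  rw [h1, map_smul]
  have h2 := E_eq_gen (k := k) i j
  rw [E] at h2
  rw [h2]
  exact Submodule.smul_mem _ _ (mem_wordSpan_one _)

theorem gen_commutator (s t : Fin (n * n)) :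
    gen k n s * gen k n t - gen k n t * gen k n s ∈ wordSpan k (gen k n) 1 := by
  have h1 := ι_mem_wordSpan (k := k) (n := n)
    ⁅Matrix.single (finProdFinEquiv.symm s).1 (finProdFinEquiv.symm s).2 (1 : k),
      Matrix.single (finProdFinEquiv.symm t).1 (finProdFinEquiv.symm t).2 (1 : k)⁆
  rw [LieHom.map_lie, Ring.lie_def] at h1
  exact h1

end Generators

theorem adjoin_gen : Algebra.adjoin k (Set.range (gen k n)) = ⊤ := by
  rw [eq_top_iff, ← corner_self, corner, Algebra.adjoin_le_iff]
  rintro _ ⟨i, j, -, -, rfl⟩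
  rw [E_eq_gen]
  exact Algebra.subset_adjoin ⟨_, rfl⟩

/-- The image of the elements of filtration degree at most `d`. -/
noncomputable def imageFiltration (k : Type*) [Field k] [CharZero k] (n d : ℕ) :
    Submodule k (ShiftRing k n) :=
  wordSpan k (fun s => gtHom k n (gen k n s)) d

theorem image_gen_commutator [CharZero k] (s t : Fin (n * n)) :
    gtHom k n (gen k n s) * gtHom k n (gen k n t) - gtHom k n (gen k n t) * gtHom k n (gen k n s) ∈
      wordSpan k (fun s => gtHom k n (gen k n s)) 1 := by
  rw [← wordSpan_map]
  exact ⟨_, gen_commutator s t, by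
    rw [AlgHom.toLinearMap_apply, map_sub, map_mul, map_mul]⟩

instance [CharZero k] (d : ℕ) : FiniteDimensional k (imageFiltration k n d) :=
  finiteDimensional_wordSpan image_gen_commutator d

theorem exists_mem_imageFiltration [CharZero k] {z : ShiftRing k n} (hz : z ∈ cornerImage k n n) :
    ∃ d, z ∈ imageFiltration k n d := by
  obtain ⟨u, -, rfl⟩ := hz
  obtain ⟨d, hd⟩ := exists_mem_wordSpan (k := k) (y := gen k n) (a := u)
    (by rw [adjoin_gen]; trivial)
  refine ⟨d, ?_⟩
  rw [imageFiltration, ← wordSpan_map]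
  exact ⟨u, hd, rfl⟩

theorem gtHom_E_mem_imageFiltration [CharZero k] (i j : Fin n) :
    gtHom k n (E k i j) ∈ imageFiltration k n 1 := by
  rw [E_eq_gen]
  exact mem_wordSpan_one (y := fun s => gtHom k n (gen k n s)) _

theorem exists_forall_mem_imageFiltration [CharZero k] {ι : Type*} [Finite ι]
    {z : ι → ShiftRing k n} (hz : ∀ i, z i ∈ cornerImage k n n) :
    ∃ d, ∀ i, z i ∈ imageFiltration k n d := by
  have := Fintype.ofFinite ι
  choose d hd using fun i => exists_mem_imageFiltration (hz i)
  exact ⟨Finset.univ.sup d, fun i =>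
    wordSpan_mono (Finset.le_sup (Finset.mem_univ i)) (hd i)⟩

/-- The number of factors in the image that are needed to reach a shift is linear in its exponents.
-/
theorem exists_single_mem_span_imageFiltration [CharZero k] : ∃ c : ℕ, ∀ a : Inner n → ℤ,
    single (shiftEquiv k n (Multiplicative.ofAdd a)) 1 ∈
      Submodule.span (FractionRing (PolyRing k n))
        (imageFiltration k n ((∑ p, (a p).natAbs) * c) : Set (ShiftRing k n)) := by
  obtain ⟨d, hd⟩ := exists_forall_mem_imageFiltration (k := k) (n := n)
    (z := fun i : Fin n => cf k n (quad k n i)) fun i => quad_mem_cornerFun i.2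
  refine ⟨(d + 1) * (Fintype.card (Inner n) + 1), fun a => ?_⟩
  refine single_mem_span_filtration (F := fun d => (imageFiltration k n d : Set (ShiftRing k n)))
    (fun _ _ h => wordSpan_mono h) (one_mem_wordSpan 0)
    (fun _ _ z hz w hw => mul_mem_wordSpan hz hw)
    (fun p => sft k p • Aplus k p.1) (fun p => (sft k p)⁻¹ • Aminus k p.1)
    (fun p => (smul_ne_zero_iff_ne _).2 (Aplus_ne_zero _))
    (fun p => (smul_ne_zero_iff_ne _).2 (Aminus_ne_zero _))
    (fun i hi => ?_) (fun i hi => ?_) (fun i hi => ?_) a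
  · have h1 := gtHom_E_mem_imageFiltration (k := k) (n := n) ⟨i, by omega⟩ ⟨i + 1, hi⟩
    rw [gtHom_raising ⟨i, by omega⟩ hi] at h1
    exact wordSpan_mono (Nat.le_add_left 1 d) h1
  · have h1 := gtHom_E_mem_imageFiltration (k := k) (n := n) ⟨i + 1, hi⟩ ⟨i, by omega⟩
    rw [gtHom_lowering ⟨i, by omega⟩ hi] at h1
    exact wordSpan_mono (Nat.le_add_left 1 d) h1
  · exact wordSpan_mono (Nat.le_add_right d 1) (hd ⟨i, by omega⟩)

/-- The polynomial ring is finite over the invariants, so that multiplication by a variable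
changes the subspaces `∑ b_j R_d` only by a bounded shift of `d`. -/
theorem exists_mulSpan_stable [CharZero k] : ∃ (s c : ℕ) (b : Fin s → ShiftRing k n),
    (∀ d, imageFiltration k n d ≤ mulSpan b (imageFiltration k n (c + d))) ∧
    ∀ p d, ∀ z ∈ mulSpan b (imageFiltration k n d),
      cf k n (x k p) * z ∈ mulSpan b (imageFiltration k n (c + d)) := by
  have hnoeth := (setting k n).noetherian
  obtain ⟨s, b, hb⟩ := Module.Finite.exists_fin
    (R := FixedPoints.subring (PolyRing k n) (permGroup k n)) (M := PolyRing k n)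
  have key : ∀ f : PolyRing k n, ∃ γ : Fin s → FractionRing (PolyRing k n),
      (∀ j, γ j ∈ gammaAlg k n) ∧
        algebraMap _ _ f = ∑ j, algebraMap (PolyRing k n) _ (b j) * γ j := by
    intro f
    obtain ⟨γ, hγ⟩ := (Submodule.mem_span_range_iff_exists_fun _).1
      (show f ∈ Submodule.span _ (Set.range b) by rw [hb]; trivial)
    refine ⟨fun j => algebraMap _ _ (γ j : PolyRing k n),
      fun j => mem_gammaAlg.2 ⟨_, (γ j).2, rfl⟩, ?_⟩
    rw [← hγ, _root_.map_sum]
    refine Finset.sum_congr rfl fun j _ => ?_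
    rw [Subring.smul_def, smul_eq_mul, map_mul, mul_comm]
  choose γ₁ h₁ h₁' using key 1
  choose γ₂ h₂ h₂' using fun z : Pos n × Fin s => key (X z.1 * b z.2)
  obtain ⟨c₁, hc₁⟩ := exists_forall_mem_imageFiltration (k := k) (n := n)
    (z := fun j => cf k n (γ₁ j)) fun j => gammaAlg_le_cornerFun (h₁ j)
  obtain ⟨c₂, hc₂⟩ := exists_forall_mem_imageFiltration (k := k) (n := n)
    (z := fun z : (Pos n × Fin s) × Fin s => cf k n (γ₂ z.1 z.2))
    fun z => gammaAlg_le_cornerFun (h₂ z.1 z.2)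
  refine ⟨s, max c₁ c₂, fun j => cf k n (algebraMap _ _ (b j)), fun d r hr => ?_,
    fun p d z hz => ?_⟩
  · have h3 : r = ∑ j, cf k n (algebraMap _ _ (b j)) * (cf k n (γ₁ j) * r) := by
      simp only [← mul_assoc, ← map_mul]
      rw [← Finset.sum_mul, ← _root_.map_sum, ← h₁', map_one, map_one, one_mul]
    rw [h3]
    refine sum_mem fun j _ => mul_mem_mulSpan _ j (mul_mem_wordSpan ?_ hr)
    exact wordSpan_mono (le_max_left _ _) (hc₁ j)
  · obtain ⟨r, hr, rfl⟩ := exists_sum_of_mem_mulSpan _ hz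
    rw [Finset.mul_sum]
    refine sum_mem fun i _ => ?_
    have h3 : cf k n (x k p) * (cf k n (algebraMap _ _ (b i)) * r i) =
        ∑ j, cf k n (algebraMap _ _ (b j)) * (cf k n (γ₂ (p, i) j) * r i) := by
      simp only [← mul_assoc, ← map_mul]
      rw [← Finset.sum_mul, ← _root_.map_sum, ← h₂']
      exact congrArg (fun t => cf k n t * r i) (map_mul (algebraMap _ _) (X p) (b i)).symm
    rw [h3]
    refine sum_mem fun j _ => mul_mem_mulSpan _ j (mul_mem_wordSpan ?_ (hr i))
    exact wordSpan_mono (le_max_right _ _) (hc₂ ((p, i), j))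

theorem linearIndependent_monomials (d : ℕ) : LinearIndependent k fun g : Pos n → Fin (d + 1) =>
    algebraMap (PolyRing k n) (FractionRing (PolyRing k n)) (∏ p, X p ^ (g p : ℕ)) := by
  have h1 := (basisMonomials (Pos n) k).linearIndependent.comp
    (fun g : Pos n → Fin (d + 1) => Finsupp.equivFunOnFinite.symm fun p => (g p : ℕ))
    fun g h hgh => funext fun p => Fin.ext (DFunLike.congr_fun hgh p)
  have h2 := h1.map' (IsScalarTower.toAlgHom k (PolyRing k n)
    (FractionRing (PolyRing k n))).toLinearMap
    (LinearMap.ker_eq_bot.2 (IsFractionRing.injective (PolyRing k n) (FractionRing (PolyRing k n))))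
  have h3 : (fun g : Pos n → Fin (d + 1) =>
      algebraMap (PolyRing k n) (FractionRing (PolyRing k n)) (∏ p, X p ^ (g p : ℕ))) =
      fun g => algebraMap (PolyRing k n) (FractionRing (PolyRing k n))
        (monomial (Finsupp.equivFunOnFinite.symm fun p => (g p : ℕ)) 1) := by
    funext g
    simp [monomial_eq, Finsupp.prod_fintype]
  rw [h3]
  rw [coe_basisMonomials] at h2
  exact h2

/-- The image of `U(gl_n)` grows at least like a polynomial ring in `n²` variables. -/
theorem exists_pow_le_finrank [CharZero k] : ∃ s c e : ℕ, ∀ d : ℕ,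
    (d + 1) ^ (n * n) ≤ s * Module.finrank k (imageFiltration k n (c * d + e)) := by
  obtain ⟨c₁, h₁⟩ := exists_single_mem_span_imageFiltration (k := k) (n := n)
  obtain ⟨s, c₂, b, hb, hx⟩ := exists_mulSpan_stable (k := k) (n := n)
  set N := Fintype.card (Inner n) with hN
  set P := Fintype.card (Pos n) with hP
  refine ⟨s, c₂ * P + N * c₁, c₂, fun d => ?_⟩
  refine le_trans ?_ (finrank_mulSpan_le b _)
  have hpow : ∀ p m e z, z ∈ mulSpan b (imageFiltration k n e) →
      cf k n (x k p ^ m) * z ∈ mulSpan b (imageFiltration k n (c₂ * m + e)) := by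
    intro p m e z hz
    induction m with
    | zero => rwa [pow_zero, map_one, one_mul, mul_zero, zero_add]
    | succ m ih =>
      have h2 := hx p _ _ ih
      rwa [← mul_assoc, ← map_mul, ← pow_succ', ← add_assoc, add_comm c₂, ← mul_add_one] at h2
  have hprod : ∀ (S : Finset (Pos n)) (g : Pos n → ℕ) e z, z ∈ mulSpan b (imageFiltration k n e) →
      cf k n (∏ p ∈ S, x k p ^ g p) * z ∈
        mulSpan b (imageFiltration k n (c₂ * ∑ p ∈ S, g p + e)) := by
    classical
    intro S g e z hz
    induction S using Finset.induction_on with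
    | empty => rwa [Finset.prod_empty, map_one, one_mul, Finset.sum_empty, mul_zero, zero_add]
    | insert p S hp ih =>
      rw [Finset.prod_insert hp, Finset.sum_insert hp, map_mul, mul_assoc, mul_add, add_assoc]
      exact hpow _ _ _ _ ih
  have hmono : ∀ {d e}, d ≤ e → mulSpan b (imageFiltration k n d) ≤
      mulSpan b (imageFiltration k n e) := by
    intro d e hde z hz
    obtain ⟨r, hr, rfl⟩ := exists_sum_of_mem_mulSpan _ hz
    exact sum_mem fun j _ => mul_mem_mulSpan _ j (wordSpan_mono hde (hr j))
  -- the shifts with exponents in `[0, d]` and the monomials with exponents in `[0, d]` are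
  -- independent over `L` and over `k`; together there are `(d + 1) ^ (N + P)` products
  have h2 := SkewMonoidAlgebra.card_mul_card_le_finrank (imageFiltration k n (N * d * c₁))
    (mulSpan b (imageFiltration k n ((c₂ * P + N * c₁) * d + c₂)))
    (v := fun a : Inner n → Fin (d + 1) =>
      shiftEquiv k n (Multiplicative.ofAdd fun p => ((a p : ℕ) : ℤ)))
    (fun a a' h => ?_) (fun a => ?_) (linearIndependent_monomials d) (fun g r hr => ?_)
  · rw [Fintype.card_fun, Fintype.card_fun, Fintype.card_fin, ← pow_add,
      card_pos_add_card_inner] at h2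
    exact h2
  · have h3 := congrFun (Multiplicative.ofAdd.injective ((shiftEquiv k n).injective h))
    exact funext fun p => Fin.ext (Nat.cast_injective (h3 p))
  · refine Submodule.span_mono (fun z hz => wordSpan_mono ?_ hz) (h₁ _)
    refine Nat.mul_le_mul_right _ ?_
    refine (Finset.sum_le_card_nsmul _ _ d fun p _ => ?_).trans (by simp [hN])
    rw [Int.natAbs_natCast]
    exact Nat.lt_succ_iff.1 (a p).2
  · have h3 := hprod Finset.univ (fun p => (g p : ℕ)) _ _ (hb _ hr)
    have h4 : algebraMap (PolyRing k n) (FractionRing (PolyRing k n)) (∏ p, X p ^ (g p : ℕ)) =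
        ∏ p, x k p ^ (g p : ℕ) := by
      simp [x]
    rw [h4]
    refine hmono ?_ h3
    have h5 : ∑ p, (g p : ℕ) ≤ P * d := by
      refine (Finset.sum_le_card_nsmul _ _ d fun p _ => Nat.lt_succ_iff.1 (g p).2).trans ?_
      simp [hP]
    nlinarith [Nat.mul_le_mul_left c₂ h5]

/-- The Gelfand-Tsetlin homomorphism is injective: a relation between the ordered monomials would
bound the growth of its image by a polynomial of degree less than `n²`. -/
theorem gtHom_injective [CharZero k] : Function.Injective (gtHom k n) := by
  rw [injective_iff_map_eq_zero]
  intro u hu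
  by_contra hu0
  obtain ⟨d, hd⟩ := exists_mem_wordSpan (k := k) (y := gen k n) (a := u)
    (by rw [adjoin_gen]; trivial)
  have h1 : u ∈ Submodule.span k (Set.range (orderedMonomial (gen k n))) := by
    refine Submodule.span_mono ?_ (wordSpan_le_span_orderedMonomial gen_commutator d hd)
    rintro _ ⟨a, -, rfl⟩
    exact ⟨a, rfl⟩
  obtain ⟨p, rfl⟩ := Finsupp.mem_span_range_iff_exists_finsupp.1 h1
  have hp : p ≠ 0 := by
    rintro rfl
    exact hu0 Finsupp.sum_zero_index
  have hrel : ∑ a ∈ p.support, p a • orderedMonomial (fun s => gtHom k n (gen k n s)) a = 0 := by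
    rw [Finsupp.sum, _root_.map_sum] at hu
    rw [← hu]
    refine Finset.sum_congr rfl fun a _ => ?_
    rw [map_smul, orderedMonomial, orderedMonomial, map_list_prod, List.map_map]
    rfl
  -- the relation bounds the dimensions by `C` times a power of degree less than `n * n`
  obtain ⟨C, hC⟩ := finrank_wordSpan_le_of_relation image_gen_commutator
    (p := AddMonoidAlgebra.ofCoeff p)
    (fun h => hp (congrArg AddMonoidAlgebra.coeff h)) hrel
  obtain ⟨s, c, e, h2⟩ := exists_pow_le_finrank (k := k) (n := n)
  rcases Nat.eq_zero_or_pos (n * n) with h0 | h0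
  · -- without generators the enveloping algebra is the ground field
    have : IsEmpty (Fin (n * n)) := by rw [h0]; infer_instance
    have h3 : (p.sum fun a c => c • orderedMonomial (gen k n) a) ∈ (⊥ : Subalgebra k (Ugl k n)) := by
      rw [← Algebra.adjoin_empty, ← Set.range_eq_empty (gen k n), adjoin_gen]
      trivial
    obtain ⟨a, ha⟩ := Algebra.mem_bot.1 h3
    rw [← ha, AlgHom.commutes, FaithfulSMul.algebraMap_eq_zero_iff] at hu
    rw [← ha, hu, map_zero] at hu0
    exact hu0 rfl
  · refine not_forall_pow_le (s * C) c e (n * n) h0 fun d => (h2 d).trans ?_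
    rw [mul_assoc]
    have h3 := hC (c * d + e)
    rw [Fintype.card_fin] at h3
    exact Nat.mul_le_mul_left _ h3

/-- The enveloping algebra is a domain, as a subring of the ring of shift operators, and it has
polynomial growth. -/
instance isOreDomain_ugl [CharZero k] : IsOreDomain (Ugl k n) := by
  have hinj := gtHom_injective (k := k) (n := n)
  have : IsDomain (Ugl k n) := hinj.isDomain (gtHom k n : Ugl k n →+* ShiftRing k n)
  exact isOreDomain_of_wordSpan gen_commutator adjoin_gen

end GelfandTsetlin

/-! ### Algebras generated by Weyl pairs -/

section Weyl

variable {F B σ : Type*} [Field F] [Ring B] [Algebra F B] [DecidableEq σ]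

/-- Every element of an algebra generated by Weyl pairs is a sum of products of a polynomial in the
`x i` and a monomial in the `d i`: such sums are stable under left multiplication by generators. -/
theorem normal_form_surjective (x d : σ → B)
    (hdx : ∀ i j, d i * x j - x j * d i = if i = j then 1 else 0)
    (hgen : Algebra.adjoin F (Set.range x ∪ Set.range d) = ⊤)
    (X : MvPolynomial σ F →ₐ[F] B) (hX : ∀ i, X (MvPolynomial.X i) = x i)
    (Y : MvPolynomial σ F →ₐ[F] B) (hY : ∀ i, Y (MvPolynomial.X i) = d i)
    (N : MvPolynomial σ (MvPolynomial σ F) →+ B)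
    (hN : ∀ b c, N (MvPolynomial.monomial b c) = X c * Y (MvPolynomial.monomial b 1)) :
    Function.Surjective N := by
  have hC : ∀ c q, N (MvPolynomial.C c * q) = X c * N q := by
    intro c q
    induction q using MvPolynomial.induction_on' with
    | add p q hp hq => rw [mul_add, map_add, map_add, mul_add, hp, hq]
    | monomial b a => rw [MvPolynomial.C_mul_monomial, hN, hN, map_mul, mul_assoc]
  have hd : ∀ i q, ∃ q', N q' = d i * N q := by
    intro i q
    induction q using MvPolynomial.induction_on' with
    | add p q hp hq =>
      obtain ⟨p', hp'⟩ := hp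
      obtain ⟨q', hq'⟩ := hq
      exact ⟨p' + q', by rw [map_add, map_add, mul_add, hp', hq']⟩
    | monomial b c =>
      refine ⟨MvPolynomial.monomial (Finsupp.single i 1 + b) c +
        MvPolynomial.monomial b (MvPolynomial.pderiv i c), ?_⟩
      have h1 : d i * X c - X c * d i = X (MvPolynomial.pderiv i c) := by
        refine commutator_eq_derivation X (MvPolynomial.pderiv i) (d i) (fun j => ?_) c
        rw [hX, hdx, MvPolynomial.pderiv_X, Pi.single_apply]
        simp only [eq_comm]
        split_ifs <;> simp
      have h2 : MvPolynomial.monomial (Finsupp.single i 1 + b) (1 : F) =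
          MvPolynomial.X i * MvPolynomial.monomial b 1 := by
        rw [MvPolynomial.X, MvPolynomial.monomial_mul, one_mul]
      rw [map_add, hN, hN, hN, h2, map_mul, hY, ← h1]
      noncomm_ring
  let S : Subalgebra F B :=
    { carrier := {z | ∀ q, ∃ q', N q' = z * N q}
      mul_mem' := fun {z w} hz hw q => by
        obtain ⟨q', h⟩ := hw q
        obtain ⟨q'', h'⟩ := hz q'
        exact ⟨q'', by rw [h', h, mul_assoc]⟩
      add_mem' := fun {z w} hz hw q => by
        obtain ⟨q', h⟩ := hz q
        obtain ⟨q'', h'⟩ := hw q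
        exact ⟨q' + q'', by rw [map_add, h, h', add_mul]⟩
      algebraMap_mem' := fun a q => ⟨MvPolynomial.C (MvPolynomial.C a) * q, by
        rw [hC, ← MvPolynomial.algebraMap_eq, AlgHom.commutes]⟩ }
  have hS : S = ⊤ := by
    rw [eq_top_iff, ← hgen, Algebra.adjoin_le_iff]
    rintro _ (⟨i, rfl⟩ | ⟨i, rfl⟩)
    · exact fun q => ⟨_, by rw [hC, hX]⟩
    · exact hd i
  intro z
  have hz : z ∈ S := by rw [hS]; trivial
  obtain ⟨q, hq⟩ := hz 1
  refine ⟨q, ?_⟩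
  have h1 : N 1 = 1 := by
    have h2 := hN 0 1
    rw [MvPolynomial.monomial_zero', MvPolynomial.monomial_zero', MvPolynomial.C_1,
      MvPolynomial.C_1, map_one X, map_one Y, mul_one] at h2
    exact h2
  rw [hq, h1, mul_one]

/-- The normal forms are linearly independent in the image, which satisfies the same relations, and
they exhaust the source. -/
theorem injective_of_surjective_of_weyl [CharZero F] {A : Type*} [Ring A] [Nontrivial A]
    (x d : σ → B) (hxx : ∀ i j, x i * x j = x j * x i) (hdd : ∀ i j, d i * d j = d j * d i)
    (hdx : ∀ i j, d i * x j - x j * d i = if i = j then 1 else 0)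
    (hgen : Algebra.adjoin F (Set.range x ∪ Set.range d) = ⊤) (ψ : B →+* A)
    (hψ : Function.Surjective ψ) : Function.Injective ψ := by
  obtain ⟨X, hX⟩ := exists_algHom_of_commute (k := F) x hxx
  obtain ⟨Y, hY⟩ := exists_algHom_of_commute (k := F) d hdd
  obtain ⟨N, hN⟩ := exists_normal_form X Y
  have hsurj := normal_form_surjective x d hdx hgen X hX Y hY N hN
  let : Algebra F A := RingHom.toAlgebra' (ψ.comp (algebraMap F B)) fun c a => by
    obtain ⟨b, rfl⟩ := hψ a
    rw [RingHom.comp_apply, ← map_mul, ← map_mul, Algebra.commutes]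
  let ψ' : B →ₐ[F] A := { ψ with commutes' := fun _ => rfl }
  have hinj := injective_of_weyl_relations (F := F) (fun i => ψ (x i)) (fun i => ψ (d i))
    (fun i j => by
      rw [← map_mul, ← map_mul, ← map_sub, hdx]
      split_ifs
      · exact map_one ψ
      · exact map_zero ψ)
    (ψ'.comp X) (fun i => congrArg ψ (hX i)) (ψ'.comp Y) (fun i => congrArg ψ (hY i))
    ((ψ : B →+ A).comp N) (fun b c => (congrArg ψ (hN b c)).trans (map_mul ψ _ _))
  intro z w h
  obtain ⟨p, rfl⟩ := hsurj z
  obtain ⟨q, rfl⟩ := hsurj w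
  exact congrArg N (hinj h)

/-- An algebra over a field of characteristic zero that is generated by Weyl pairs is simple. -/
theorem injective_of_weyl_generators [CharZero F] {A : Type*} [Ring A] [Nontrivial A]
    (x d : σ → B) (hxx : ∀ i j, x i * x j = x j * x i) (hdd : ∀ i j, d i * d j = d j * d i)
    (hdx : ∀ i j, d i * x j - x j * d i = if i = j then 1 else 0)
    (hgen : Algebra.adjoin F (Set.range x ∪ Set.range d) = ⊤) (ψ : B →+* A) :
    Function.Injective ψ := by
  have h1 := injective_of_surjective_of_weyl x d hxx hdd hdx hgen ψ.rangeRestrict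
    ψ.rangeRestrict_surjective
  exact fun z w h => h1 (Subtype.ext h)

/-- A domain that is generated over a field by finitely many Weyl pairs is an Ore domain. -/
theorem isOreDomain_of_weyl_generators {m : ℕ} [IsDomain B] (x d : Fin m → B)
    (hxx : ∀ i j, x i * x j = x j * x i) (hdd : ∀ i j, d i * d j = d j * d i)
    (hdx : ∀ i j, d i * x j - x j * d i = if i = j then 1 else 0)
    (hgen : Algebra.adjoin F (Set.range x ∪ Set.range d) = ⊤) : IsOreDomain B := by
  let y : Fin (m + m) → B := Fin.append x d
  have hy : ∀ i j, y i * y j - y j * y i ∈ wordSpan F y 1 := by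
    have h0 : ∀ i j, d i * x j - x j * d i ∈ wordSpan F y 1 := fun i j => by
      rw [hdx]
      split_ifs
      · exact one_mem_wordSpan 1
      · exact zero_mem _
    intro i j
    induction i using Fin.addCases with
    | left i =>
      induction j using Fin.addCases with
      | left j => simp only [y, Fin.append_left, hxx i j, sub_self]; exact zero_mem _
      | right j =>
        simp only [y, Fin.append_left, Fin.append_right]
        rw [← neg_sub]
        exact neg_mem (h0 j i)
    | right i =>
      induction j using Fin.addCases with
      | left j => simp only [y, Fin.append_left, Fin.append_right]; exact h0 i j
      | right j => simp only [y, Fin.append_right, hdd i j, sub_self]; exact zero_mem _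
  refine isOreDomain_of_wordSpan (y := y) hy (top_le_iff.1 ?_)
  rw [← hgen]
  refine Algebra.adjoin_mono ?_
  rintro _ (⟨i, rfl⟩ | ⟨i, rfl⟩)
  · exact ⟨Fin.castAdd m i, Fin.append_left x d i⟩
  · exact ⟨Fin.natAdd m i, Fin.append_right x d i⟩

end Weyl

/-! ### Dual coordinates -/

section DualCoordinates

/-- Commuting elements `x_p` of a ring act by commutators on a subfield by derivations `E_p`.
If the matrix `E_p(P_s)` has the inverse `c`, then `∑_p c_ps x_p` and the `P_s` are Weyl pairs. -/
structure DualCoordinates {L Q I : Type*} [Field L] [Ring Q] [Fintype I] [DecidableEq I]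
    (χ : L →+* Q) (x : I → Q) (E : I → L → L) (P : I → L) (c : Matrix I I L) : Prop where
  comm (p q : I) : x p * x q = x q * x p
  deriv (p : I) (g : L) : x p * χ g - χ g * x p = χ (E p g)
  inv (s t : I) : ∑ p, c p s * E p (P t) = if s = t then 1 else 0
  inv' (p q : I) : ∑ s, c p s * E q (P s) = if p = q then 1 else 0

namespace DualCoordinates

variable {L Q I : Type*} [Field L] [Ring Q] [Fintype I] [DecidableEq I] {χ : L →+* Q} {x : I → Q}
  {E : I → L → L} {P : I → L} {c : Matrix I I L}

/-- The elements `∑_p c_ps x_p`. -/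
def dual (χ : L →+* Q) (x : I → Q) (c : Matrix I I L) (s : I) : Q := ∑ p, χ (c p s) * x p

theorem dual_commutator (h : DualCoordinates χ x E P c) (s : I) (g : L) :
    dual χ x c s * χ g - χ g * dual χ x c s = χ (∑ p, c p s * E p g) := by
  rw [dual, Finset.sum_mul, Finset.mul_sum, ← Finset.sum_sub_distrib, map_sum]
  refine Finset.sum_congr rfl fun p _ => ?_
  rw [map_mul, ← h.deriv, mul_sub, ← mul_assoc, ← mul_assoc, ← mul_assoc, ← map_mul, ← map_mul,
    mul_comm g]

theorem dual_weyl (h : DualCoordinates χ x E P c) (s t : I) :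
    dual χ x c s * χ (P t) - χ (P t) * dual χ x c s = if s = t then 1 else 0 := by
  rw [h.dual_commutator, h.inv]
  split_ifs
  · exact map_one χ
  · exact map_zero χ

theorem sum_dual (h : DualCoordinates χ x E P c) (q : I) :
    ∑ s, χ (E q (P s)) * dual χ x c s = x q := by
  simp only [dual, Finset.mul_sum, ← mul_assoc, ← map_mul]
  rw [Finset.sum_comm]
  simp only [← Finset.sum_mul, ← map_sum]
  rw [Finset.sum_eq_single q]
  · have h1 := h.inv' q q
    rw [if_pos rfl] at h1
    simp only [mul_comm (E q _), h1, map_one, one_mul]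
  · intro p _ hpq
    have h1 := h.inv' p q
    rw [if_neg hpq] at h1
    simp only [mul_comm (E q _), h1, map_zero, zero_mul]
  · exact fun hq => absurd (Finset.mem_univ _) hq

/-- The elements `∑_p c_ps x_p` commute: their commutator is a linear combination of the `x_p` that
commutes with all `P_t`. -/
theorem dual_comm [Nontrivial Q] (h : DualCoordinates χ x E P c) (s t : I) :
    dual χ x c s * dual χ x c t = dual χ x c t * dual χ x c s := by
  set u : I → L := fun p => ∑ q, (c q s * E q (c p t) - c q t * E q (c p s)) with hu
  have h1 : dual χ x c s * dual χ x c t - dual χ x c t * dual χ x c s = ∑ p, χ (u p) * x p := by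
    have h2 : ∀ s t, dual χ x c s * dual χ x c t =
        ∑ p, χ (∑ q, c q s * E q (c p t)) * x p + ∑ p, χ (c p t) * dual χ x c s * x p := by
      intro s t
      have h3 : ∀ p, dual χ x c s * (χ (c p t) * x p) =
          χ (∑ q, c q s * E q (c p t)) * x p + χ (c p t) * dual χ x c s * x p := fun p => by
        rw [← h.dual_commutator]
        noncomm_ring
      rw [dual, dual, Finset.mul_sum, ← Finset.sum_add_distrib]
      exact Finset.sum_congr rfl fun p _ => h3 p
    have h4 : ∑ p, χ (c p t) * dual χ x c s * x p = ∑ p, χ (c p s) * dual χ x c t * x p := by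
      simp only [dual, Finset.mul_sum, Finset.sum_mul]
      rw [Finset.sum_comm]
      refine Finset.sum_congr rfl fun p _ => Finset.sum_congr rfl fun q _ => ?_
      rw [← mul_assoc, ← mul_assoc, ← map_mul, ← map_mul, mul_assoc, mul_assoc, h.comm,
        mul_comm (c _ t)]
    rw [h2 s t, h2 t s, h4, add_sub_add_right_eq_sub, ← Finset.sum_sub_distrib]
    refine Finset.sum_congr rfl fun p _ => ?_
    rw [← sub_mul, ← map_sub, ← Finset.sum_sub_distrib]
  have h5 : ∀ r, ∑ p, u p * E p (P r) = 0 := by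
    intro r
    apply χ.injective
    rw [map_zero]
    have h6 : (∑ p, χ (u p) * x p) * χ (P r) - χ (P r) * ∑ p, χ (u p) * x p =
        χ (∑ p, u p * E p (P r)) := by
      rw [Finset.sum_mul, Finset.mul_sum, ← Finset.sum_sub_distrib, map_sum]
      refine Finset.sum_congr rfl fun p _ => ?_
      rw [map_mul, ← h.deriv, mul_sub, ← mul_assoc, ← mul_assoc, ← mul_assoc, ← map_mul, ← map_mul,
        mul_comm (P r)]
    have key : ∀ {a b z e f : Q}, a * z - z * a = e → b * z - z * b = f → e * b = b * e →
        e * a = a * e → f * a = a * f → f * b = b * f →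
        (a * b - b * a) * z - z * (a * b - b * a) = 0 := by
      intro a b z e f ha hb heb _ hfa _
      have h7 : (a * b - b * a) * z - z * (a * b - b * a) =
          a * (b * z - z * b) - (b * z - z * b) * a + ((a * z - z * a) * b - b * (a * z - z * a)) := by
        noncomm_ring
      rw [h7, ha, hb, hfa, heb]
      noncomm_ring
    have hone : ∀ (P : Prop) [Decidable P] (a : Q), (if P then (1 : Q) else 0) * a =
        a * if P then 1 else 0 := fun P _ a => by split_ifs <;> simp
    rw [← h6, ← h1]
    exact key (h.dual_weyl s r) (h.dual_weyl t r) (hone _ _) (hone _ _) (hone _ _) (hone _ _)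
  have h8 : ∀ p, u p = 0 := by
    intro p
    have h9 : ∑ r, c p r * ∑ q, u q * E q (P r) = u p := by
      simp only [Finset.mul_sum]
      rw [Finset.sum_comm, Finset.sum_eq_single p]
      · have h1 := h.inv' p p
        rw [if_pos rfl] at h1
        simp only [mul_left_comm (c p _), ← Finset.mul_sum, h1, mul_one]
      · intro q _ hqp
        have h1 := h.inv' p q
        rw [if_neg hqp.symm] at h1
        simp only [mul_left_comm (c p _), ← Finset.mul_sum, h1, mul_zero]
      · exact fun hq => absurd (Finset.mem_univ _) hq
    rw [← h9]
    simp only [h5, mul_zero, Finset.sum_const_zero]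
  rw [← sub_eq_zero, h1]
  simp only [h8, map_zero, zero_mul, Finset.sum_const_zero]

end DualCoordinates

end DualCoordinates

namespace GelfandTsetlin

open SkewMonoidAlgebra MvPolynomial

variable {k : Type*} [Field k] {n : ℕ}

/-! ### The skew field of the ring of shift operators -/

/-- The rational functions are finite over the invariant rational functions. -/
theorem exists_sum_invariant [CharZero k] : ∃ (s : ℕ) (b : Fin s → FractionRing (PolyRing k n)),
    ∀ f, ∃ κ : Fin s → FractionRing (PolyRing k n),
      (∀ j σ, permHom k n σ • κ j = κ j) ∧ f = ∑ j, κ j * b j := by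
  have hnoeth := (setting k n).noetherian
  obtain ⟨s, b, hb⟩ := Module.Finite.exists_fin
    (R := FixedPoints.subring (PolyRing k n) (permGroup k n)) (M := PolyRing k n)
  refine ⟨s, fun j => algebraMap _ _ (b j), fun f => ?_⟩
  obtain ⟨h, N, hN, -, rfl⟩ := exists_eq_div_fixedPoints f
  obtain ⟨γ, hγ⟩ := (Submodule.mem_span_range_iff_exists_fun _).1
    (show h ∈ Submodule.span _ (Set.range b) by rw [hb]; trivial)
  have hfix : ∀ g ∈ FixedPoints.subring (PolyRing k n) (permGroup k n), ∀ σ,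
      permHom k n σ • algebraMap (PolyRing k n) (FractionRing (PolyRing k n)) g =
        algebraMap _ _ g := fun g hg σ => by
    rw [ringAut_smul_algebraMap, mem_fixedPoints_iff.1 hg]
  refine ⟨fun j => algebraMap _ _ (γ j : PolyRing k n) / algebraMap _ _ N, fun j σ => ?_, ?_⟩
  · beta_reduce
    rw [div_eq_mul_inv, smul_mul', smul_inv'', hfix _ (γ j).2, hfix _ hN]
  · rw [← hγ, _root_.map_sum, Finset.sum_div]
    refine Finset.sum_congr rfl fun j _ => ?_
    rw [Subring.smul_def, smul_eq_mul, map_mul, div_mul_eq_mul_div]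

/-- A skew field of fractions of the ring of shift operators, with the action of the permutations
of the rows. -/
structure FractionModel (k : Type*) [Field k] [CharZero k] (n : ℕ) (Q : Type*) [DivisionRing Q]
    [Algebra k Q] where
  /-- The inclusion of the ring of shift operators. -/
  incl : ShiftRing k n →ₐ[k] Q
  incl_injective : Function.Injective incl
  closure_range : Subfield.closure (Set.range incl) = ⊤
  /-- The action of the permutations. -/
  perm : (∀ r : Fin n, Equiv.Perm (Fin (r.val + 1))) → Q →+* Q
  perm_incl (σ : ∀ r : Fin n, Equiv.Perm (Fin (r.val + 1))) (z : ShiftRing k n) :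
    perm σ (incl z) = incl (tw σ z)

theorem tw_injective [CharZero k] (σ : ∀ r : Fin n, Equiv.Perm (Fin (r.val + 1))) :
    Function.Injective (tw σ : ShiftRing k n →+* ShiftRing k n) := by
  have h1 : ∀ z : ShiftRing k n, tw σ⁻¹ (tw σ z) = z := by
    intro z
    induction z using SkewMonoidAlgebra.induction_on' with
    | add z w hz hw => rw [map_add, map_add, hz, hw]
    | single μ c =>
      rw [tw, tw, GaloisRing.twist_single, GaloisRing.twist_single]
      have h2 : permHom k n σ⁻¹ • permHom k n σ • c = c := by
        rw [map_inv, inv_smul_smul]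
      have h3 : GaloisRing.conjHom (setting k n) ⟨permHom k n σ⁻¹, σ⁻¹, rfl⟩
          (GaloisRing.conjHom (setting k n) ⟨permHom k n σ, σ, rfl⟩ μ) = μ := by
        apply Subtype.ext
        change permHom k n σ⁻¹ * (permHom k n σ * (μ : RingAut (PolyRing k n)) *
          (permHom k n σ)⁻¹) * (permHom k n σ⁻¹)⁻¹ = μ
        rw [map_inv]
        group
      rw [h2, h3]
  exact Function.LeftInverse.injective h1

/-- The ring of shift operators is an Ore domain, and the permutations extend to its skew field. -/
theorem nonempty_fractionModel [CharZero k] :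
    Nonempty (FractionModel k n (SkewFrac (ShiftRing k n))) := by
  have hinj : Function.Injective
      (OreLocalization.numeratorRingHom : ShiftRing k n →+* SkewFrac (ShiftRing k n)) :=
    OreLocalization.numeratorHom_inj inf_le_left
  exact ⟨{
    incl := { (OreLocalization.numeratorRingHom : ShiftRing k n →+* SkewFrac (ShiftRing k n)) with
      commutes' := fun _ => rfl }
    incl_injective := hinj
    closure_range := SkewFrac.closure_range_numerator
    perm := fun σ => SkewFrac.lift (OreLocalization.numeratorRingHom.comp (tw σ))
      (hinj.comp (tw_injective σ))
    perm_incl := fun σ z => SkewFrac.lift_numerator _ _ _ }⟩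

namespace FractionModel

variable [CharZero k] {Q : Type*} [DivisionRing Q] [Algebra k Q] (M : FractionModel k n Q)

/-- A criterion for a skew subfield `D` of invariants to contain all invariants: it contains the
symmetric elements of an equivariant copy of the rational functions, and the left `D`-span of this
copy is stable under left multiplication, by elements that generate the skew field. -/
theorem mem_of_perm_fixed (χ : FractionRing (PolyRing k n) →+* Q)
    (hχ : ∀ σ f, M.perm σ (χ f) = χ (permHom k n σ • f)) (D : Subfield Q)
    (hfix : ∀ d ∈ D, ∀ σ, M.perm σ d = d) (hk : ∀ c : k, χ (algebraMap k _ c) ∈ D)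
    (hD : ∀ (r : Fin n) l, χ (algebraMap (PolyRing k n) _ (rowPsum k r l)) ∈ D) (T : Set Q)
    (hT : Subfield.closure T = ⊤)
    (hTD : ∀ t ∈ T, ∀ f, χ f * t ∈ Submodule.span D (Set.range χ)) {q : Q}
    (hq : ∀ σ, M.perm σ q = q) : q ∈ D := by
  have hΓ : ∀ c ∈ gammaAlg k n, χ c ∈ D := by
    intro c hc
    induction hc using Algebra.adjoin_induction with
    | mem c hc =>
      obtain ⟨r, l, rfl⟩ := hc
      exact hD r l
    | algebraMap c => exact hk c
    | add a b _ _ ha hb => rw [map_add]; exact add_mem ha hb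
    | mul a b _ _ ha hb => rw [map_mul]; exact mul_mem ha hb
  have hK : ∀ c, (∀ σ, permHom k n σ • c = c) → χ c ∈ D := by
    intro c hc
    have h1 : Subfield.closure (algebraMap (PolyRing k n) (FractionRing (PolyRing k n)) ''
        (FixedPoints.subring (PolyRing k n) (permGroup k n))) ≤ D.comap χ := by
      rw [Subfield.closure_le]
      rintro _ ⟨f, hf, rfl⟩
      exact hΓ _ (mem_gammaAlg.2 ⟨f, hf, rfl⟩)
    exact h1 (mem_closure_of_permHom_smul hc)
  obtain ⟨s, b, hb⟩ := exists_sum_invariant (k := k) (n := n)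
  have : CharZero Q := charZero_of_injective_algebraMap (algebraMap k Q).injective
  refine mem_of_forall_fixed M.perm D hfix χ b (fun f => ?_) (fun f => ?_) T hT hTD hq
  · obtain ⟨κ, hκ, rfl⟩ := hb f
    rw [_root_.map_sum]
    refine sum_mem fun j _ => ?_
    rw [map_mul]
    exact Submodule.smul_mem _ (⟨_, hK _ (hκ j)⟩ : D) (Submodule.subset_span ⟨j, rfl⟩)
  · simp only [hχ]
    rw [← _root_.map_sum]
    exact hK _ (sum_permHom_smul f)

/-- The rational functions, inside the skew field. -/
noncomputable def coeff : FractionRing (PolyRing k n) →+* Q :=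
  (M.incl : ShiftRing k n →+* Q).comp (cf k n)

theorem perm_coeff (σ : ∀ r : Fin n, Equiv.Perm (Fin (r.val + 1)))
    (f : FractionRing (PolyRing k n)) : M.perm σ (M.coeff f) = M.coeff (permHom k n σ • f) := by
  change M.perm σ (M.incl (cf k n f)) = M.incl (cf k n _)
  rw [M.perm_incl, tw_cf]

theorem coeff_algebraMap (c : k) : M.coeff (algebraMap k _ c) = algebraMap k Q c :=
  M.incl.commutes c

/-- The skew field of fractions of `U(gl_n)`, inside the skew field of the ring of shift operators,
consists of all invariants. -/
theorem mem_closure_gtHom_iff {q : Q} :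
    q ∈ Subfield.closure (Set.range (M.incl.comp (gtHom k n))) ↔ ∀ σ, M.perm σ q = q := by
  set D := Subfield.closure (Set.range (M.incl.comp (gtHom k n))) with hDdef
  have hU : ∀ z ∈ cornerImage k n n, M.incl z ∈ D := by
    rintro _ ⟨u, -, rfl⟩
    exact Subfield.subset_closure ⟨u, rfl⟩
  have hfix : ∀ d ∈ D, ∀ σ, M.perm σ d = d := by
    intro d hd σ
    have h1 : D ≤ (M.perm σ).eqLocusField (RingHom.id Q) := by
      rw [hDdef, Subfield.closure_le]
      rintro _ ⟨u, rfl⟩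
      change M.perm σ (M.incl (gtHom k n u)) = M.incl (gtHom k n u)
      rw [M.perm_incl, mem_invariants.1 (gtHom_mem_invariants u)]
    exact h1 hd
  have hΓ : ∀ c ∈ gammaAlg k n, M.coeff c ∈ D := fun c hc => hU _ (gammaAlg_le_cornerFun hc)
  refine ⟨fun hq σ => hfix q hq σ, fun hq => ?_⟩
  have key : ∀ z : ShiftRing k n, M.incl z ∈ Submodule.span D (Set.range M.coeff) := by
    have h1 : ∀ w ∈ Submodule.span (FractionRing (PolyRing k n))
        (revSubring (cornerImage k n n).toSubring : Set (ShiftRing k n)),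
        ∀ c, M.incl (rev w * cf k n c) ∈ Submodule.span D (Set.range M.coeff) := by
      intro w hw
      induction hw using Submodule.span_induction with
      | mem w hw =>
        intro c
        obtain ⟨h, N, hN, hN0, rfl⟩ := exists_eq_div_fixedPoints c
        rw [map_mul]
        change _ * M.coeff _ ∈ _
        have h2 : (M.coeff (algebraMap (PolyRing k n) _ N))⁻¹ ∈ D :=
          inv_mem (hΓ _ (mem_gammaAlg.2 ⟨N, hN, rfl⟩))
        rw [div_eq_inv_mul, map_mul, map_inv₀, ← mul_assoc]
        exact Submodule.smul_mem _ (⟨_, mul_mem (hU _ hw) h2⟩ : D) (Submodule.subset_span ⟨_, rfl⟩)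
      | zero =>
        intro c
        rw [rev_zero, zero_mul, map_zero]
        exact zero_mem _
      | add a b _ _ ha hb =>
        intro c
        rw [rev_add, add_mul, map_add]
        exact add_mem (ha c) (hb c)
      | smul d w _ hw =>
        intro c
        have h2 : _ = cf k n d * w := smul_eq_single_mul d w
        have h3 := hw (d * c)
        rw [map_mul (cf k n), ← mul_assoc] at h3
        rw [h2, rev_mul, rev_cf]
        exact h3
    intro z
    have h2 := h1 (rev z) (by rw [span_revSubring_cornerImage]; trivial) 1
    rwa [rev_rev, map_one, mul_one] at h2
  refine M.mem_of_perm_fixed M.coeff M.perm_coeff D hfix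
    (fun c => hΓ _ (Subalgebra.algebraMap_mem _ c)) (fun r l => hΓ _ (rowPsum_mem_gammaAlg r l))
    (Set.range M.incl) M.closure_range ?_ hq
  rintro _ ⟨z, rfl⟩ f
  have h1 := key (cf k n f * z)
  rw [map_mul] at h1
  exact h1

end FractionModel

end GelfandTsetlin

/-! ### Homomorphisms from a field of fractions to a division ring -/

section FractionField

variable {A Q : Type*} [CommRing A] [IsDomain A] [DivisionRing Q]

/-- An injective homomorphism from a commutative domain to a division ring extends to the field of
fractions. -/
theorem exists_fractionRing_hom (f : A →+* Q) (hf : Function.Injective f) :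
    ∃ χ : FractionRing A →+* Q, ∀ a, χ (algebraMap A (FractionRing A) a) = f a := by
  let fS : A⁰ →* Qˣ := Units.liftRight ((f : A →* Q).comp A⁰.subtype)
    (fun s => Units.mk0 (f s) ((map_ne_zero_iff f hf).2 (nonZeroDivisors.ne_zero s.2)))
    (fun _ => rfl)
  exact ⟨OreLocalization.universalHom f fS fun _ => rfl, fun a =>
    OreLocalization.universalHom_commutes _ _ _⟩

theorem fractionRing_hom_ext {f g : FractionRing A →+* Q}
    (h : ∀ a, f (algebraMap A (FractionRing A) a) = g (algebraMap A (FractionRing A) a)) :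
    f = g := by
  ext c
  obtain ⟨a, b, -, rfl⟩ := IsFractionRing.div_surjective (A := A) c
  rw [map_div₀, map_div₀, h, h]

/-- If commutators with `u` map a commutative domain to its field of fractions, then they map the
field of fractions to itself. -/
theorem exists_commutator_eq (χ : FractionRing A →+* Q) (u : Q)
    (h : ∀ a, ∃ b, u * χ (algebraMap A (FractionRing A) a) - χ (algebraMap A (FractionRing A) a) * u
      = χ b) (c : FractionRing A) : ∃ b, u * χ c - χ c * u = χ b := by
  obtain ⟨a, s, hs, rfl⟩ := IsFractionRing.div_surjective (A := A) c
  obtain ⟨a', ha⟩ := h a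
  obtain ⟨s', hs'⟩ := h s
  set a₀ := algebraMap A (FractionRing A) a
  set s₀ := algebraMap A (FractionRing A) s with hs₀
  have h0 : χ s₀ ≠ 0 := (map_ne_zero χ).2
    ((map_ne_zero_iff _ (IsFractionRing.injective _ _)).2 (nonZeroDivisors.ne_zero hs))
  -- the quotient rule
  refine ⟨a' / s₀ - a₀ / s₀ * s' / s₀, ?_⟩
  have h1 : χ s₀ * (χ s₀)⁻¹ = 1 := mul_inv_cancel₀ h0
  have h2 : (χ s₀)⁻¹ * χ s₀ = 1 := inv_mul_cancel₀ h0
  simp only [map_sub, map_mul, ← ha, ← hs', div_eq_mul_inv, map_inv₀]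
  have h3 : χ a₀ * (χ s₀)⁻¹ * (u * χ s₀ - χ s₀ * u) * (χ s₀)⁻¹ =
      χ a₀ * (χ s₀)⁻¹ * u * (χ s₀ * (χ s₀)⁻¹) - χ a₀ * ((χ s₀)⁻¹ * χ s₀) * u * (χ s₀)⁻¹ := by
    noncomm_ring
  rw [h3, h1, h2]
  noncomm_ring

end FractionField

namespace GelfandTsetlin

open SkewMonoidAlgebra MvPolynomial

variable {k : Type*} [Field k] {n : ℕ}

/-! ### Polynomials in the shifts and the variables of the last row -/

/-- The shift at a position outside the last row, the variable at a position in the last row. -/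
noncomputable def shiftVar (k : Type*) [Field k] {n : ℕ} (p : Pos n) : ShiftRing k n :=
  if hp : p.1.val + 1 < n then single (sft k ⟨p, hp⟩) 1 else cf k n (x k p)

theorem shiftVar_inner (p : Inner n) : shiftVar k p.1 = single (sft k p) 1 := dif_pos p.2

theorem shiftVar_of_not {p : Pos n} (hp : ¬ p.1.val + 1 < n) : shiftVar k p = cf k n (x k p) :=
  dif_neg hp

theorem sft_smul_x_of_ne {p : Inner n} {q : Pos n} (h : q ≠ p.1) : sft k p • x k q = x k q := by
  rw [sft_smul_x, if_neg h, add_zero]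

theorem commute_single_cf {p : Inner n} {q : Pos n} (h : q ≠ p.1) :
    Commute (single (sft k p) 1 : ShiftRing k n) (cf k n (x k q)) := by
  change single _ _ * single 1 _ = single 1 _ * single _ _
  rw [single_mul_single, single_mul_single, one_smul, sft_smul_x_of_ne h, mul_one, one_mul, one_mul,
    mul_one]

theorem shiftVar_comm (p q : Pos n) : shiftVar k p * shiftVar k q = shiftVar k q * shiftVar k p := by
  by_cases hp : p.1.val + 1 < n
  · lift p to Inner n using hp
    rw [shiftVar_inner]
    by_cases hq : q.1.val + 1 < n
    · lift q to Inner n using hq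
      rw [shiftVar_inner, single_mul_single, single_mul_single, smul_one, smul_one, mul_comm]
    · rw [shiftVar_of_not hq]
      exact commute_single_cf fun h => hq (by rw [h]; exact p.2)
  · rw [shiftVar_of_not hp]
    by_cases hq : q.1.val + 1 < n
    · lift q to Inner n using hq
      rw [shiftVar_inner]
      exact (commute_single_cf fun h => hp (by rw [h]; exact q.2)).symm
    · rw [shiftVar_of_not hq, ← map_mul, ← map_mul, mul_comm]

/-- The homomorphism that maps the variable of a position outside the last row to its shift, and
fixes the variables of the last row. -/
noncomputable def shiftEval (k : Type*) [Field k] (n : ℕ) : PolyRing k n →ₐ[k] ShiftRing k n :=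
  (exists_algHom_of_commute (shiftVar k) shiftVar_comm).choose

theorem shiftEval_X (p : Pos n) : shiftEval k n (X p) = shiftVar k p :=
  (exists_algHom_of_commute (shiftVar k) shiftVar_comm).choose_spec p

theorem smul_algebraMap_monomial [CharZero k] (μ : shiftMonoid k n) {a : Pos n →₀ ℕ}
    (ha : ∀ p, p.1.val + 1 < n → a p = 0) :
    μ • algebraMap (PolyRing k n) (FractionRing (PolyRing k n)) (monomial a 1) =
      algebraMap (PolyRing k n) _ (monomial a 1) := by
  obtain ⟨b, rfl⟩ := (shiftEquiv k n).surjective μ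
  rw [monomial_eq, C_1, one_mul, Finsupp.prod, map_prod, Finset.smul_prod']
  refine Finset.prod_congr rfl fun p hp => ?_
  rw [map_pow, smul_pow']
  congr 1
  refine (shiftEquiv_smul_x b.toAdd p).trans ?_
  rw [extend_of_not _ fun h => (Finsupp.mem_support_iff.1 hp) (ha p h), Int.cast_zero, sub_zero]
  rfl

/-- The part of an exponent vector in the last row. -/
noncomputable def lastPart (a : Pos n →₀ ℕ) : Pos n →₀ ℕ := a.filter fun p => ¬ p.1.val + 1 < n

/-- The part of an exponent vector outside the last row, as a product of shifts. -/
noncomputable def innerPart (k : Type*) [Field k] [CharZero k] (a : Pos n →₀ ℕ) : shiftMonoid k n :=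
  shiftEquiv k n (Multiplicative.ofAdd fun p : Inner n => (a p.1 : ℤ))

/-- Monomials are mapped to single terms, because the shifts do not move the variables of the last
row. -/
theorem shiftEval_monomial [CharZero k] (a : Pos n →₀ ℕ) (c : k) :
    shiftEval k n (monomial a c) = single (innerPart k a)
      (algebraMap (PolyRing k n) (FractionRing (PolyRing k n)) (monomial (lastPart a) c)) := by
  have hadd : ∀ a b : Pos n →₀ ℕ,
      shiftEval k n (monomial a 1) = single (innerPart k a)
        (algebraMap (PolyRing k n) (FractionRing (PolyRing k n)) (monomial (lastPart a) 1)) →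
      shiftEval k n (monomial b 1) = single (innerPart k b)
        (algebraMap (PolyRing k n) (FractionRing (PolyRing k n)) (monomial (lastPart b) 1)) →
      shiftEval k n (monomial (a + b) 1) = single (innerPart k (a + b))
        (algebraMap (PolyRing k n) (FractionRing (PolyRing k n)) (monomial (lastPart (a + b)) 1)) := by
    intro a b ha hb
    have h1 : innerPart k (a + b) = innerPart k a * innerPart k b := by
      rw [innerPart, innerPart, innerPart, ← map_mul, ← ofAdd_add]
      congr 2
    have h2 : lastPart (a + b) = lastPart a + lastPart b := Finsupp.filter_add
    have h3 : (monomial (a + b) (1 : k)) = monomial a 1 * monomial b 1 := by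
      rw [monomial_mul, one_mul]
    have h4 : (monomial (lastPart a + lastPart b) (1 : k)) =
        monomial (lastPart a) 1 * monomial (lastPart b) 1 := by rw [monomial_mul, one_mul]
    rw [h1, h2, h3, h4, map_mul, ha, hb, single_mul_single, smul_algebraMap_monomial, ← map_mul]
    intro p hp
    rw [lastPart, Finsupp.filter_apply, if_neg (not_not.2 hp)]
  have hone : ∀ a : Pos n →₀ ℕ, shiftEval k n (monomial a 1) = single (innerPart k a)
      (algebraMap (PolyRing k n) (FractionRing (PolyRing k n)) (monomial (lastPart a) 1)) := by
    intro a
    have hzero : shiftEval k n (monomial 0 1) = single (innerPart k (0 : Pos n →₀ ℕ))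
        (algebraMap (PolyRing k n) (FractionRing (PolyRing k n)) (monomial (lastPart 0) 1)) := by
      have h1 : innerPart k (0 : Pos n →₀ ℕ) = 1 := by
        rw [innerPart, ← map_one (shiftEquiv k n), ← ofAdd_zero]
        congr 2
      have h2 : lastPart (0 : Pos n →₀ ℕ) = 0 := Finsupp.filter_zero _
      rw [h1, h2, monomial_zero', C_1, map_one, map_one]
      rfl
    induction a using Finsupp.induction_linear with
    | zero => exact hzero
    | add a b ha hb => exact hadd a b ha hb
    | single p e =>
      induction e with
      | zero => rw [Finsupp.single_zero]; exact hzero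
      | succ e ih =>
        rw [Finsupp.single_add]
        refine hadd _ _ ih ?_
        change shiftEval k n (X p) = _
        rw [shiftEval_X]
        by_cases hp : p.1.val + 1 < n
        · lift p to Inner n using hp
          have h1 : innerPart k (Finsupp.single p.1 1) = sft k p := by
            rw [sft, ← shiftEquiv_single, innerPart]
            congr 2
            funext q
            rw [Finsupp.single_apply, Pi.single_apply]
            simp only [Subtype.ext_iff, eq_comm (a := p.1)]
            split_ifs <;> rfl
          have h2 : lastPart (Finsupp.single p.1 1) = 0 := Finsupp.filter_single_of_neg _ (not_not.2 p.2)
          rw [shiftVar_inner, h1, h2, monomial_zero', C_1, map_one]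
        · have h1 : innerPart k (Finsupp.single p 1) = 1 := by
            rw [innerPart, ← map_one (shiftEquiv k n), ← ofAdd_zero]
            congr 2
            funext q
            rw [Finsupp.single_apply, if_neg fun h : p = q.1 => hp (by rw [h]; exact q.2)]
            rfl
          have h2 : lastPart (Finsupp.single p 1) = Finsupp.single p 1 :=
            Finsupp.filter_single_of_pos _ hp
          rw [shiftVar_of_not hp, h1, h2]
          rfl
  have h1 : monomial a c = c • monomial a (1 : k) := by rw [smul_monomial, smul_eq_mul, mul_one]
  have h2 : monomial (lastPart a) c = c • monomial (lastPart a) (1 : k) := by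
    rw [smul_monomial, smul_eq_mul, mul_one]
  rw [h1, h2, map_smul, hone, Algebra.smul_def, algebraMap_eq_cf, GaloisRing.coeffHom_apply,
    single_mul_single, one_mul, one_smul, Algebra.smul_def c, map_mul]
  rfl

/-- Monomials that differ outside the last row are mapped to distinct shifts, and those that differ
in the last row have distinct coefficients. -/
theorem shiftEval_injective [CharZero k] : Function.Injective (shiftEval k n) := by
  classical
  rw [injective_iff_map_eq_zero]
  intro f hf
  ext a₀
  rw [MvPolynomial.coeff_zero]
  have h1 : ∑ a ∈ f.support, (single (innerPart k a) (algebraMap (PolyRing k n)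
      (FractionRing (PolyRing k n)) (monomial (lastPart a) (f.coeff a))) : ShiftRing k n) = 0 := by
    rw [← hf]
    conv_rhs => rw [f.as_sum, _root_.map_sum]
    exact Finset.sum_congr rfl fun a _ => (shiftEval_monomial a _).symm
  have h2 : ∑ a ∈ f.support, Finsupp.single (innerPart k a) (algebraMap (PolyRing k n)
      (FractionRing (PolyRing k n)) (monomial (lastPart a) (f.coeff a))) = 0 := by
    have h3 := congrArg (coeffAddEquiv (k := FractionRing (PolyRing k n)) (G := shiftMonoid k n)) h1
    rw [_root_.map_sum, map_zero] at h3
    exact h3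
  have h3 := DFunLike.congr_fun h2 (innerPart k a₀)
  rw [Finsupp.finsetSum_apply, Finsupp.zero_apply] at h3
  have h4 : ∑ a ∈ f.support, (if innerPart k a = innerPart k a₀ then
      monomial (lastPart a) (f.coeff a) else 0) = 0 := by
    apply IsFractionRing.injective (PolyRing k n) (FractionRing (PolyRing k n))
    rw [map_zero, ← h3, _root_.map_sum]
    refine Finset.sum_congr rfl fun a _ => ?_
    rw [Finsupp.single_apply]
    split_ifs
    · rfl
    · exact map_zero _
  have h5 := congrArg (MvPolynomial.coeff (lastPart a₀)) h4
  rw [MvPolynomial.coeff_sum, MvPolynomial.coeff_zero] at h5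
  rw [← h5, Finset.sum_eq_single a₀]
  · rw [if_pos rfl, coeff_monomial, if_pos rfl]
  · intro a _ ha
    split_ifs with h6
    · rw [coeff_monomial, if_neg]
      intro h7
      apply ha
      ext p
      by_cases hp : p.1.val + 1 < n
      · have h8 := congrFun (Multiplicative.ofAdd.injective ((shiftEquiv k n).injective h6)) ⟨p, hp⟩
        exact_mod_cast h8
      · have h8 := DFunLike.congr_fun h7 p
        rwa [lastPart, lastPart, Finsupp.filter_apply, Finsupp.filter_apply, if_pos hp, if_pos hp]
          at h8
    · exact MvPolynomial.coeff_zero _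
  · intro ha
    rw [if_pos rfl, coeff_monomial, if_pos rfl]
    exact notMem_support_iff.1 ha

theorem tw_shiftVar [CharZero k] (σ : ∀ r : Fin n, Equiv.Perm (Fin (r.val + 1))) (p : Pos n) :
    tw σ (shiftVar k p) = shiftVar k (permPos σ p) := by
  by_cases hp : p.1.val + 1 < n
  · lift p to Inner n using hp
    have h1 : tw σ (single (sft k p) 1 : ShiftRing k n) = single (sft k (permInner σ p)) 1 := by
      rw [tw, GaloisRing.twist_single, smul_one]
      congr 1
      exact Subtype.ext (permHom_conj_shift σ p)
    rw [shiftVar_inner, h1, ← shiftVar_inner]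
    rfl
  · rw [shiftVar_of_not hp, shiftVar_of_not (by rwa [permPos_fst]), tw_cf, permHom_smul_x]

theorem tw_shiftEval [CharZero k] (σ : ∀ r : Fin n, Equiv.Perm (Fin (r.val + 1)))
    (f : PolyRing k n) : tw σ (shiftEval k n f) = shiftEval k n (permHom k n σ f) := by
  induction f using MvPolynomial.induction_on with
  | C c =>
    rw [permHom_C, ← MvPolynomial.algebraMap_eq, AlgHom.commutes, algebraMap_eq_cf, tw_cf,
      IsScalarTower.algebraMap_apply k (PolyRing k n) (FractionRing (PolyRing k n)),
      ringAut_smul_algebraMap, MvPolynomial.algebraMap_eq, permHom_C]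
  | add f g hf hg => rw [map_add, map_add, map_add, map_add, hf, hg]
  | mul_X f p hf =>
    rw [map_mul, map_mul, map_mul, map_mul, hf, shiftEval_X, tw_shiftVar, permHom_X, shiftEval_X]
    rfl

/-- The variables act on polynomials in the shifts by the derivations `X_p ∂/∂X_p`. -/
theorem cf_x_commutator [CharZero k] (p : Inner n) (f : PolyRing k n) :
    cf k n (x k p.1) * shiftEval k n f - shiftEval k n f * cf k n (x k p.1) =
      shiftEval k n (X p.1 * pderiv p.1 f) := by
  refine commutator_eq_derivation (shiftEval k n) ((X p.1 : PolyRing k n) • pderiv p.1) _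
    (fun q => ?_) f
  rw [Derivation.smul_apply, pderiv_X, smul_eq_mul, shiftEval_X]
  by_cases hqp : q = p.1
  · subst hqp
    rw [Pi.single_eq_same, mul_one, shiftEval_X, shiftVar_inner, sub_eq_iff_eq_add]
    have h1 : (single (sft k p) 1 : ShiftRing k n) * cf k n (x k p.1) =
        single (sft k p) (x k p.1 - 1) := by
      change single _ _ * single 1 _ = _
      rw [single_mul_single, sft_smul_x, if_pos rfl, one_mul, mul_one, Int.cast_neg, Int.cast_one,
        sub_eq_add_neg]
    have h2 : cf k n (x k p.1) * (single (sft k p) 1 : ShiftRing k n) =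
        single (sft k p) (x k p.1) := by
      change single 1 _ * single _ _ = _
      rw [single_mul_single, one_smul, one_mul, mul_one]
    rw [h1, h2, ← single_add, add_sub_cancel]
  · rw [Pi.single_eq_of_ne hqp, mul_zero, map_zero, sub_eq_zero]
    by_cases hq : q.1.val + 1 < n
    · lift q to Inner n using hq
      rw [shiftVar_inner]
      exact (commute_single_cf (Ne.symm hqp)).symm
    · rw [shiftVar_of_not hq, ← map_mul, ← map_mul, mul_comm]

end GelfandTsetlin

namespace GelfandTsetlin

open SkewMonoidAlgebra MvPolynomial

variable {k : Type*} [Field k] {n : ℕ}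

/-! ### Power sums as coordinates -/

/-- The power sums of degrees `1, …, m` of the row of length `m`, for `m < n`. -/
noncomputable def psumCoord (k : Type*) [Field k] {n : ℕ} (s : Inner n) : PolyRing k n :=
  rowPsum k s.1.1 (s.1.2.val + 1)

theorem X_mul_pderiv_rowPsum (p : Pos n) (r : Fin n) (l : ℕ) :
    X p * pderiv p (rowPsum k r (l + 1)) = if p.1 = r then ((l + 1 : ℕ) : PolyRing k n) * X p ^ (l + 1)
      else 0 := by
  have h1 : ∀ q : Pos n, X p * pderiv p ((X q : PolyRing k n) ^ (l + 1)) =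
      if q = p then ((l + 1 : ℕ) : PolyRing k n) * X p ^ (l + 1) else 0 := by
    intro q
    rw [pderiv_pow, pderiv_X]
    split_ifs with h
    · subst h
      rw [Pi.single_eq_same, Nat.add_sub_cancel, mul_one, pow_succ]
      ring
    · rw [Pi.single_eq_of_ne h, mul_zero, mul_zero]
  rw [rowPsum, _root_.map_sum, Finset.mul_sum]
  simp only [h1]
  obtain ⟨r', j⟩ := p
  by_cases hr : r' = r
  · subst hr
    rw [if_pos rfl, Finset.sum_eq_single j]
    · rw [if_pos rfl]
    · intro i _ hi
      rw [if_neg]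
      intro h
      exact hi (by simpa using h)
    · exact fun h => absurd (Finset.mem_univ _) h
  · rw [if_neg hr]
    refine Finset.sum_eq_zero fun i _ => ?_
    rw [if_neg]
    intro h
    exact hr (congrArg Sigma.fst h).symm

/-- The Jacobian matrix of the power sums, with respect to the derivations `X_p ∂/∂X_p`. -/
noncomputable def jacobian (k : Type*) [Field k] (n : ℕ) :
    Matrix (Inner n) (Inner n) (FractionRing (PolyRing k n)) :=
  Matrix.of fun p s => algebraMap (PolyRing k n) _ (X p.1 * pderiv p.1 (psumCoord k s))

/-- On each row the Jacobian matrix is a Vandermonde matrix, up to nonzero factors of the rows and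
the columns. -/
theorem isUnit_jacobian [CharZero k] : IsUnit (jacobian k n) := by
  classical
  rw [← Matrix.mulVec_injective_iff_isUnit]
  refine (injective_iff_map_eq_zero (Matrix.mulVecLin (jacobian k n))).2 fun v hv => ?_
  have h1 : ∀ (r : Fin n) (hr : r.val + 1 < n) (j : Fin (r.val + 1)), ∑ l : Fin (r.val + 1),
      (((l.val + 1 : ℕ) : FractionRing (PolyRing k n)) * v ⟨⟨r, l⟩, hr⟩) *
        x k (⟨r, j⟩ : Pos n) ^ (l : ℕ) = 0 := by
    intro r hr j
    have h2 := congrFun hv ⟨⟨r, j⟩, hr⟩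
    have h3 : ∑ s ∈ innerRow n r, (((s.1.2.val + 1 : ℕ) : FractionRing (PolyRing k n)) *
        x k (⟨r, j⟩ : Pos n) ^ (s.1.2.val + 1)) * v s = 0 := by
      rw [innerRow, Finset.sum_filter]
      refine Eq.trans (Finset.sum_congr rfl fun s _ => ?_) h2
      have h4 : jacobian k n ⟨⟨r, j⟩, hr⟩ s = algebraMap (PolyRing k n) _ (if r = s.1.1 then
          ((s.1.2.val + 1 : ℕ) : PolyRing k n) * X ⟨r, j⟩ ^ (s.1.2.val + 1) else 0) :=
        congrArg (algebraMap (PolyRing k n) _) (X_mul_pderiv_rowPsum _ _ _)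
      refine Eq.trans ?_ (congrArg (· * v s) h4.symm)
      by_cases h : r = s.1.1
      · rw [if_pos h, if_pos (congrArg Fin.val h).symm, map_mul, map_pow, map_natCast]
        rfl
      · rw [if_neg h, if_neg fun h' => h (Fin.ext h').symm, map_zero, zero_mul]
    rw [sum_innerRow_eq_sum_fin r hr] at h3
    have hx : x k (⟨r, j⟩ : Pos n) ≠ 0 :=
      (map_ne_zero_iff _ (IsFractionRing.injective _ _)).2 (X_ne_zero _)
    refine (mul_eq_zero.1 ?_).resolve_left hx
    rw [← h3, Finset.mul_sum]
    refine Finset.sum_congr rfl fun l _ => ?_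
    rw [pow_succ]
    ring
  funext s
  obtain ⟨⟨r, l⟩, hr⟩ := s
  have h2 := congrFun (Matrix.eq_zero_of_forall_index_sum_mul_pow_eq_zero
    (f := fun j : Fin (r.val + 1) => x k (⟨r, j⟩ : Pos n))
    (fun i j h => by simpa using x_injective h) (h1 r hr)) l
  refine (mul_eq_zero.1 h2).resolve_left ?_
  exact Nat.cast_ne_zero.2 (Nat.succ_ne_zero _)

theorem permHom_psumCoord (σ : ∀ r : Fin n, Equiv.Perm (Fin (r.val + 1))) (s : Inner n) :
    permHom k n σ (psumCoord k s) = psumCoord k s :=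
  mem_fixedPoints_iff.1 (rowPsum_mem_fixedPoints _ _) σ

namespace FractionModel

variable [CharZero k] {Q : Type*} [DivisionRing Q] [Algebra k Q] (M : FractionModel k n Q)

theorem exists_shiftFrac : ∃ χ : FractionRing (PolyRing k n) →+* Q,
    ∀ f, χ (algebraMap (PolyRing k n) _ f) = M.incl (shiftEval k n f) :=
  exists_fractionRing_hom (M.incl.comp (shiftEval k n) : PolyRing k n →+* Q)
    (M.incl_injective.comp shiftEval_injective)

/-- The rational functions in the shifts and the variables of the last row, inside the skew
field. -/
noncomputable def shiftFrac : FractionRing (PolyRing k n) →+* Q := M.exists_shiftFrac.choose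

theorem shiftFrac_algebraMap (f : PolyRing k n) :
    M.shiftFrac (algebraMap (PolyRing k n) _ f) = M.incl (shiftEval k n f) :=
  M.exists_shiftFrac.choose_spec f

theorem shiftFrac_x (p : Pos n) : M.shiftFrac (x k p) = M.incl (shiftVar k p) := by
  rw [x, shiftFrac_algebraMap, shiftEval_X]

theorem shiftFrac_algebraMap_field (c : k) :
    M.shiftFrac (algebraMap k _ c) = algebraMap k Q c := by
  rw [IsScalarTower.algebraMap_apply k (PolyRing k n) (FractionRing (PolyRing k n)),
    shiftFrac_algebraMap, AlgHom.commutes, AlgHom.commutes]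

theorem perm_shiftFrac (σ : ∀ r : Fin n, Equiv.Perm (Fin (r.val + 1)))
    (f : FractionRing (PolyRing k n)) :
    M.perm σ (M.shiftFrac f) = M.shiftFrac (permHom k n σ • f) := by
  have h1 : (M.perm σ).comp M.shiftFrac =
      M.shiftFrac.comp (MulSemiringAction.toRingHom (RingAut (PolyRing k n)) _ (permHom k n σ)) :=
    fractionRing_hom_ext fun g => by
      change M.perm σ (M.shiftFrac _) = M.shiftFrac (permHom k n σ • _)
      rw [ringAut_smul_algebraMap, shiftFrac_algebraMap, shiftFrac_algebraMap, perm_incl,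
        tw_shiftEval]
  exact DFunLike.congr_fun h1 f

theorem perm_coeff_x (σ : ∀ r : Fin n, Equiv.Perm (Fin (r.val + 1))) (p : Inner n) :
    M.perm σ (M.coeff (x k p.1)) = M.coeff (x k (permInner σ p).1) := by
  rw [perm_coeff, permHom_smul_x]
  rfl

theorem coeff_x_commutator (p : Inner n) (f : PolyRing k n) :
    M.coeff (x k p.1) * M.shiftFrac (algebraMap _ _ f) -
      M.shiftFrac (algebraMap _ _ f) * M.coeff (x k p.1) =
      M.shiftFrac (algebraMap _ _ (X p.1 * pderiv p.1 f)) := by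
  rw [shiftFrac_algebraMap, shiftFrac_algebraMap, ← cf_x_commutator, map_sub, map_mul, map_mul]
  rfl

/-- The variables outside the last row act on the rational functions in the shifts; together with
the power sums of the shifts they give dual coordinates. -/
theorem exists_dualCoordinates : ∃ (E : Inner n → FractionRing (PolyRing k n) →
      FractionRing (PolyRing k n)) (c : Matrix (Inner n) (Inner n) (FractionRing (PolyRing k n))),
    DualCoordinates M.shiftFrac (fun p => M.coeff (x k p.1)) E
      (fun s => algebraMap _ _ (psumCoord k s)) c ∧
    ∀ σ p s, permHom k n σ • c p s = c (permInner σ p) s := by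
  have h1 : ∀ (p : Inner n) (g : FractionRing (PolyRing k n)), ∃ b,
      M.coeff (x k p.1) * M.shiftFrac g - M.shiftFrac g * M.coeff (x k p.1) = M.shiftFrac b :=
    fun p g => exists_commutator_eq M.shiftFrac _ (fun a => ⟨_, M.coeff_x_commutator p a⟩) g
  choose E hE using h1
  have hEX : ∀ p s, E p (algebraMap _ _ (psumCoord k s)) = jacobian k n p s := fun p s =>
    M.shiftFrac.injective ((hE p _).symm.trans (M.coeff_x_commutator p _))
  have hu : IsUnit (jacobian k n).det := (Matrix.isUnit_iff_isUnit_det _).1 isUnit_jacobian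
  refine ⟨E, ((jacobian k n)⁻¹).transpose, ⟨fun p q => ?_, hE, fun s t => ?_, fun p q => ?_⟩, ?_⟩
  · rw [← map_mul, ← map_mul, mul_comm]
  · simp only [hEX, Matrix.transpose_apply]
    rw [← Matrix.mul_apply, Matrix.nonsing_inv_mul _ hu, Matrix.one_apply]
  · simp only [hEX, Matrix.transpose_apply]
    simp only [mul_comm _ (jacobian k n q _)]
    rw [← Matrix.mul_apply, Matrix.mul_nonsing_inv _ hu, Matrix.one_apply]
    simp only [eq_comm]
  · intro σ p s
    -- the Jacobian matrix is equivariant, because the power sums are invariant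
    have hJ : ∀ p s, permHom k n σ • jacobian k n p s = jacobian k n (permInner σ p) s := by
      intro p s
      apply M.shiftFrac.injective
      have h2 := congrArg (M.perm σ) (hE p (algebraMap _ _ (psumCoord k s)))
      rw [hEX, map_sub, map_mul, map_mul, perm_coeff_x, perm_shiftFrac, perm_shiftFrac,
        ringAut_smul_algebraMap, permHom_psumCoord, hE, hEX] at h2
      exact h2.symm
    have h2 : (Matrix.of fun s q => permHom k n σ • ((jacobian k n)⁻¹) s ((permInner σ).symm q)) *
        jacobian k n = 1 := by
      ext s t
      rw [Matrix.mul_apply, ← Equiv.sum_comp (permInner σ)]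
      have h3 := congrArg (permHom k n σ • ·)
        (congrFun (congrFun (Matrix.nonsing_inv_mul _ hu) s) t)
      simp only [Matrix.mul_apply, Finset.smul_sum, smul_mul', hJ] at h3
      simp only [Matrix.of_apply, Equiv.symm_apply_apply]
      rw [h3, Matrix.one_apply]
      split_ifs
      · exact smul_one _
      · exact smul_zero _
    have h3 := congrFun (congrFun (Matrix.inv_eq_left_inv h2) s) (permInner σ p)
    rw [Matrix.of_apply, Equiv.symm_apply_apply] at h3
    exact h3.symm

end FractionModel

end GelfandTsetlin

/-! ### Weyl algebras with extended scalars -/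

namespace WeylAlgebra

variable {k : Type*} [Field k] {N : ℕ}

/-- The generator of the Weyl algebra with the given index. -/
noncomputable def gen (k : Type*) [Field k] {N : ℕ} (i : Fin N ⊕ Fin N) : WeylAlgebra k N :=
  RingQuot.mkAlgHom k (WeylAlgebra.Rel k N) (FreeAlgebra.ι k i)

theorem gen_x_comm (i j : Fin N) : gen k (Sum.inl i) * gen k (Sum.inl j) =
    gen k (Sum.inl j) * gen k (Sum.inl i) := by
  simpa only [gen, map_mul] using RingQuot.mkAlgHom_rel k (Rel.x_comm (k := k) i j)

theorem gen_d_comm (i j : Fin N) : gen k (Sum.inr i) * gen k (Sum.inr j) =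
    gen k (Sum.inr j) * gen k (Sum.inr i) := by
  simpa only [gen, map_mul] using RingQuot.mkAlgHom_rel k (Rel.d_comm (k := k) i j)

theorem gen_d_x (i j : Fin N) : gen k (Sum.inr i) * gen k (Sum.inl j) -
    gen k (Sum.inl j) * gen k (Sum.inr i) = if i = j then 1 else 0 := by
  have h := RingQuot.mkAlgHom_rel k (Rel.d_x (k := k) i j)
  rw [map_add, map_mul, map_mul] at h
  rw [sub_eq_iff_eq_add']
  refine h.trans ?_
  congr 1
  split_ifs
  · exact map_one _
  · exact map_zero _

theorem adjoin_range_gen : Algebra.adjoin k (Set.range (gen k : Fin N ⊕ Fin N → _)) = ⊤ := by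
  have h1 : Set.range (gen k : Fin N ⊕ Fin N → _) =
      RingQuot.mkAlgHom k (WeylAlgebra.Rel k N) '' Set.range (FreeAlgebra.ι k) := by
    rw [← Set.range_comp]
    rfl
  rw [h1, ← AlgHom.map_adjoin, FreeAlgebra.adjoin_range_ι, Algebra.map_top,
    AlgHom.range_eq_top]
  exact RingQuot.mkAlgHom_surjective k _

theorem exists_hom {A : Type*} [Ring A] [Algebra k A] (x d : Fin N → A)
    (hxx : ∀ i j, x i * x j = x j * x i) (hdd : ∀ i j, d i * d j = d j * d i)
    (hdx : ∀ i j, d i * x j - x j * d i = if i = j then 1 else 0) :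
    ∃ f : WeylAlgebra k N →ₐ[k] A, ∀ i, f (gen k i) = Sum.elim x d i := by
  have h : ∀ ⦃a b⦄, WeylAlgebra.Rel k N a b →
      FreeAlgebra.lift k (Sum.elim x d) a = FreeAlgebra.lift k (Sum.elim x d) b := by
    intro a b hab
    induction hab with
    | x_comm i j => simpa using hxx i j
    | d_comm i j => simpa using hdd i j
    | d_x i j =>
      rw [map_add, map_mul, map_mul, FreeAlgebra.lift_ι_apply, FreeAlgebra.lift_ι_apply,
        Sum.elim_inl, Sum.elim_inr, ← sub_eq_iff_eq_add', hdx]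
      split_ifs
      · exact (map_one _).symm
      · exact (map_zero _).symm
  refine ⟨RingQuot.liftAlgHom k ⟨_, h⟩, fun i => ?_⟩
  rw [gen, RingQuot.liftAlgHom_mkAlgHom_apply, FreeAlgebra.lift_ι_apply]

variable {F : Type*} [Field F] [Algebra k F]

attribute [local instance] Algebra.TensorProduct.rightAlgebra in
/-- Over the field `F` the tensor product is generated by Weyl pairs again. -/
theorem adjoin_gen_tmul_one : Algebra.adjoin F
    (Set.range (fun i : Fin N => (gen k (Sum.inl i) ⊗ₜ[k] (1 : F) : WeylAlgebra k N ⊗[k] F)) ∪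
      Set.range fun i : Fin N => gen k (Sum.inr i) ⊗ₜ[k] (1 : F)) = ⊤ := by
  set S := Algebra.adjoin F
    (Set.range (fun i : Fin N => (gen k (Sum.inl i) ⊗ₜ[k] (1 : F) : WeylAlgebra k N ⊗[k] F)) ∪
      Set.range fun i : Fin N => gen k (Sum.inr i) ⊗ₜ[k] (1 : F)) with hS
  have hF : ∀ f : F, (1 : WeylAlgebra k N) ⊗ₜ[k] f ∈ S := fun f => Subalgebra.algebraMap_mem S f
  have hW : ∀ w : WeylAlgebra k N, w ⊗ₜ[k] (1 : F) ∈ S := by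
    intro w
    have hw : w ∈ Algebra.adjoin k (Set.range (gen k : Fin N ⊕ Fin N → _)) := by
      rw [adjoin_range_gen]; trivial
    induction hw using Algebra.adjoin_induction with
    | mem w hw =>
      obtain ⟨i | i, rfl⟩ := hw
      · exact Algebra.subset_adjoin (Or.inl ⟨i, rfl⟩)
      · exact Algebra.subset_adjoin (Or.inr ⟨i, rfl⟩)
    | algebraMap c =>
      rw [Algebra.algebraMap_eq_smul_one, TensorProduct.smul_tmul]
      exact hF _
    | add a b _ _ ha hb => rw [TensorProduct.add_tmul]; exact add_mem ha hb
    | mul a b _ _ ha hb =>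
      rw [← mul_one (1 : F), ← Algebra.TensorProduct.tmul_mul_tmul]
      exact mul_mem ha hb
  rw [eq_top_iff]
  intro z _
  induction z using TensorProduct.induction_on with
  | zero => exact zero_mem _
  | tmul w f =>
    rw [← mul_one w, ← one_mul f, ← Algebra.TensorProduct.tmul_mul_tmul]
    exact mul_mem (hW w) (hF f)
  | add a b ha hb => exact add_mem (ha trivial) (hb trivial)

theorem x_tmul_comm (i j : Fin N) : (gen k (Sum.inl i) ⊗ₜ[k] (1 : F)) * gen k (Sum.inl j) ⊗ₜ 1 =
    gen k (Sum.inl j) ⊗ₜ 1 * gen k (Sum.inl i) ⊗ₜ 1 := by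
  rw [Algebra.TensorProduct.tmul_mul_tmul, Algebra.TensorProduct.tmul_mul_tmul, gen_x_comm]

theorem d_tmul_comm (i j : Fin N) : (gen k (Sum.inr i) ⊗ₜ[k] (1 : F)) * gen k (Sum.inr j) ⊗ₜ 1 =
    gen k (Sum.inr j) ⊗ₜ 1 * gen k (Sum.inr i) ⊗ₜ 1 := by
  rw [Algebra.TensorProduct.tmul_mul_tmul, Algebra.TensorProduct.tmul_mul_tmul, gen_d_comm]

theorem d_x_tmul (i j : Fin N) : (gen k (Sum.inr i) ⊗ₜ[k] (1 : F)) * gen k (Sum.inl j) ⊗ₜ 1 -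
    gen k (Sum.inl j) ⊗ₜ 1 * gen k (Sum.inr i) ⊗ₜ 1 = if i = j then 1 else 0 := by
  rw [Algebra.TensorProduct.tmul_mul_tmul, Algebra.TensorProduct.tmul_mul_tmul,
    ← TensorProduct.sub_tmul, gen_d_x, one_mul]
  split_ifs
  · rfl
  · exact TensorProduct.zero_tmul _ _

attribute [local instance] Algebra.TensorProduct.rightAlgebra in
/-- A Weyl algebra with scalars extended to a field of characteristic zero is simple. -/
theorem tensor_hom_injective [CharZero F] {A : Type*} [Ring A] [Nontrivial A]
    (ψ : WeylAlgebra k N ⊗[k] F →+* A) : Function.Injective ψ :=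
  injective_of_weyl_generators (F := F)
    (fun i : Fin N => (gen k (Sum.inl i) ⊗ₜ[k] (1 : F) : WeylAlgebra k N ⊗[k] F))
    (fun i => gen k (Sum.inr i) ⊗ₜ[k] (1 : F)) x_tmul_comm d_tmul_comm d_x_tmul adjoin_gen_tmul_one ψ

attribute [local instance] Algebra.TensorProduct.rightAlgebra in
/-- The algebra is simple, hence a subring of any domain that it is mapped to, and it has polynomial
growth over `F`. -/
theorem isOreDomain_tensor [CharZero F] {A : Type*} [Ring A] [IsDomain A]
    (ψ : WeylAlgebra k N ⊗[k] F →+* A) : IsOreDomain (WeylAlgebra k N ⊗[k] F) := by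
  have : IsDomain (WeylAlgebra k N ⊗[k] F) := (tensor_hom_injective ψ).isDomain ψ
  exact isOreDomain_of_weyl_generators (F := F)
    (fun i : Fin N => (gen k (Sum.inl i) ⊗ₜ[k] (1 : F) : WeylAlgebra k N ⊗[k] F))
    (fun i => gen k (Sum.inr i) ⊗ₜ[k] (1 : F)) x_tmul_comm d_tmul_comm d_x_tmul
    adjoin_gen_tmul_one

end WeylAlgebra

namespace GelfandTsetlin

open MvPolynomial

variable {k : Type*} [Field k] {n : ℕ}

/-! ### Symmetric functions of the last row -/

/-- The positions in the last row. -/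
abbrev LastRow (n : ℕ) : Type := {p : Pos n // ¬ p.1.val + 1 < n}

theorem card_lastRow : Fintype.card (LastRow n) = n := by
  rw [Fintype.card_subtype]
  refine Eq.trans (congrArg Finset.card (Finset.ext fun p => ?_)) (card_row (le_refl n))
  rw [Finset.mem_filter, mem_row]
  have := p.1.2
  simp only [Finset.mem_univ, true_and]
  omega

/-- The elementary symmetric polynomials of the last row. -/
noncomputable def lastHom (k : Type*) [Field k] (n : ℕ) : MvPolynomial (Fin n) k →ₐ[k] PolyRing k n :=
  (rename Subtype.val).comp
    ((symmetricSubalgebra (LastRow n) k).val.comp (esymmAlgHom (LastRow n) k n))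

theorem lastHom_injective : Function.Injective (lastHom k n) :=
  (rename_injective _ Subtype.val_injective).comp
    (Subtype.val_injective.comp (esymmAlgHom_injective k card_lastRow.ge))

theorem permHom_lastHom (σ : ∀ r : Fin n, Equiv.Perm (Fin (r.val + 1)))
    (f : MvPolynomial (Fin n) k) : permHom k n σ (lastHom k n f) = lastHom k n f := by
  have h1 := (esymmAlgHom (LastRow n) k n f).2
  have h2 := (mem_symmetricSubalgebra _).1 h1
    ((permPos σ).subtypeEquiv fun p => by rw [permPos_fst])
  change rename _ (rename _ (esymmAlgHom (LastRow n) k n f : MvPolynomial (LastRow n) k)) =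
    rename _ (esymmAlgHom (LastRow n) k n f : MvPolynomial (LastRow n) k)
  conv_rhs => rw [← h2]
  rw [rename_rename, rename_rename]
  rfl

theorem rename_psum_lastRow {r : Fin n} (hr : ¬ r.val + 1 < n) (l : ℕ) :
    rename Subtype.val (psum (LastRow n) k l) = rowPsum k r l := by
  have h1 : rename Subtype.val (psum (LastRow n) k l) = ∑ p : LastRow n, (X p.1 : PolyRing k n) ^ l := by
    simp [psum]
  rw [h1, rowPsum]
  refine (Fintype.sum_bijective
    (fun j : Fin (r.val + 1) => (⟨⟨r, j⟩, hr⟩ : LastRow n)) ⟨fun i j h => ?_, ?_⟩ _ _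
    fun _ => rfl).symm
  · simpa using h
  · rintro ⟨⟨r', j⟩, hr'⟩
    have h : r' = r := by
      have h1 := r.2
      have h2 := r'.2
      have h3 : ¬ r'.val + 1 < n := hr'
      apply Fin.ext
      omega
    subst h
    exact ⟨j, rfl⟩

/-- The fundamental theorem on symmetric polynomials for the last row, which `lastHom` parametrizes
by its elementary symmetric polynomials. -/
theorem exists_lastHom_eq_rowPsum {r : Fin n} (hr : ¬ r.val + 1 < n) (l : ℕ) :
    ∃ f, lastHom k n f = rowPsum k r l := by
  obtain ⟨f, hf⟩ := esymmAlgHom_surjective (σ := LastRow n) k (n := n) card_lastRow.le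
    ⟨psum (LastRow n) k l, psum_isSymmetric _ _ _⟩
  exact ⟨f, (congrArg (fun q : symmetricSubalgebra (LastRow n) k => rename Subtype.val q.1) hf).trans
    (rename_psum_lastRow hr l)⟩

namespace FractionModel

variable [CharZero k] {Q : Type*} [DivisionRing Q] [Algebra k Q] (M : FractionModel k n Q)

theorem exists_lastFrac : ∃ g : FractionRing (MvPolynomial (Fin n) k) →ₐ[k] Q,
    (∀ f, g (algebraMap _ _ f) = M.shiftFrac (algebraMap _ _ (lastHom k n f))) ∧
    ∀ f, ∃ f', g f = M.shiftFrac f' := by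
  have hinj : Function.Injective
      ((IsScalarTower.toAlgHom k (PolyRing k n) (FractionRing (PolyRing k n))).comp (lastHom k n)) :=
    (IsFractionRing.injective _ _).comp lastHom_injective
  let θ : FractionRing (MvPolynomial (Fin n) k) →ₐ[k] FractionRing (PolyRing k n) :=
    IsFractionRing.liftAlgHom hinj
  exact ⟨{ M.shiftFrac.comp (θ : _ →+* FractionRing (PolyRing k n)) with
    commutes' := fun c => by
      change M.shiftFrac (θ (algebraMap k _ c)) = _
      rw [θ.commutes, shiftFrac_algebraMap_field] },
    fun f => congrArg M.shiftFrac (IsFractionRing.lift_algebraMap hinj f), fun f => ⟨θ f, rfl⟩⟩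

theorem commute_coeff_x_lastHom (p : Inner n) (f : MvPolynomial (Fin n) k) :
    Commute (M.coeff (x k p.1)) (M.shiftFrac (algebraMap _ _ (lastHom k n f))) := by
  have h1 : ∀ q : MvPolynomial (LastRow n) k,
      Commute (M.coeff (x k p.1)) (M.shiftFrac (algebraMap _ _ (rename Subtype.val q))) := by
    intro q
    rw [shiftFrac_algebraMap]
    induction q using MvPolynomial.induction_on with
    | C c =>
      rw [rename_C, ← MvPolynomial.algebraMap_eq, AlgHom.commutes, AlgHom.commutes]
      exact (Algebra.commutes c _).symm
    | add a b ha hb => rw [map_add, map_add, map_add]; exact ha.add_right hb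
    | mul_X a q ha =>
      rw [map_mul, map_mul, map_mul, rename_X, shiftEval_X, shiftVar_of_not q.2]
      refine ha.mul_right ?_
      change M.coeff _ * M.coeff _ = M.coeff _ * M.coeff _
      rw [← map_mul, ← map_mul, mul_comm]
  exact h1 _

end FractionModel

end GelfandTsetlin

namespace GelfandTsetlin

open SkewMonoidAlgebra MvPolynomial

variable {k : Type*} [Field k] {n : ℕ}

/-! ### The invariants as the skew field of a Weyl algebra -/

namespace FractionModel

variable [CharZero k] {Q : Type*} [DivisionRing Q] [Algebra k Q] (M : FractionModel k n Q)

theorem single_one_mem {C : Subfield Q} (hC : ∀ p : Inner n, M.incl (single (sft k p) 1) ∈ C)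
    (μ : shiftMonoid k n) : M.incl (single μ 1) ∈ C := by
  obtain ⟨μ, hμ⟩ := μ
  induction hμ using Subgroup.closure_induction with
  | mem μ hμ =>
    obtain ⟨p, hp, rfl⟩ := hμ
    exact hC ⟨p, hp⟩
  | one =>
    have h1 : M.incl (single 1 1) = 1 := map_one M.incl
    change M.incl (single 1 1) ∈ C
    rw [h1]
    exact one_mem C
  | mul μ ν hμ hν h1 h2 =>
    have h3 : (single (⟨μ * ν, mul_mem hμ hν⟩ : shiftMonoid k n) 1 : ShiftRing k n) =
        single ⟨μ, hμ⟩ 1 * single ⟨ν, hν⟩ 1 := by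
      rw [single_mul_single, smul_one, mul_one]
      rfl
    rw [h3, map_mul]
    exact mul_mem h1 h2
  | inv μ hμ h1 =>
    have h2 : (single (⟨μ⁻¹, Subgroup.inv_mem _ hμ⟩ : shiftMonoid k n) 1 : ShiftRing k n) *
        single ⟨μ, hμ⟩ 1 = 1 := by
      rw [single_mul_single, smul_one, mul_one]
      have h3 : (⟨μ⁻¹, Subgroup.inv_mem _ hμ⟩ : shiftMonoid k n) * ⟨μ, hμ⟩ = 1 :=
        Subtype.ext (inv_mul_cancel μ)
      rw [h3]
      rfl
    have h3 := congrArg M.incl h2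
    rw [map_mul, map_one] at h3
    rw [eq_inv_of_mul_eq_one_left h3]
    exact inv_mem h1

/-- The rational functions in the shifts and the last row, together with the variables of the other
rows, contain all shifts and all variables. -/
theorem closure_shiftFrac_coeff : Subfield.closure
    (Set.range M.shiftFrac ∪ Set.range fun p : Inner n => M.coeff (x k p.1)) = ⊤ := by
  set C := Subfield.closure
    (Set.range M.shiftFrac ∪ Set.range fun p : Inner n => M.coeff (x k p.1)) with hCdef
  have hχ : ∀ f, M.shiftFrac f ∈ C := fun f => Subfield.subset_closure (Or.inl ⟨f, rfl⟩)
  have hx : ∀ p : Pos n, M.coeff (x k p) ∈ C := by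
    intro p
    by_cases hp : p.1.val + 1 < n
    · exact Subfield.subset_closure (Or.inr ⟨⟨p, hp⟩, rfl⟩)
    · have h1 := hχ (x k p)
      rwa [shiftFrac_x, shiftVar_of_not hp] at h1
  have hpoly : ∀ f : PolyRing k n, M.coeff (algebraMap _ _ f) ∈ C := by
    intro f
    induction f using MvPolynomial.induction_on with
    | C c =>
      rw [← MvPolynomial.algebraMap_eq, ← IsScalarTower.algebraMap_apply, coeff_algebraMap,
        ← shiftFrac_algebraMap_field]
      exact hχ _
    | add f g hf hg => rw [map_add, map_add]; exact add_mem hf hg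
    | mul_X f p hf => rw [map_mul, map_mul]; exact mul_mem hf (hx p)
  have hcoeff : ∀ c, M.coeff c ∈ C := by
    intro c
    obtain ⟨f, g, -, rfl⟩ := IsFractionRing.div_surjective (A := PolyRing k n) c
    rw [map_div₀]
    exact div_mem (hpoly f) (hpoly g)
  rw [eq_top_iff, ← M.closure_range, Subfield.closure_le]
  rintro _ ⟨z, rfl⟩
  change M.incl z ∈ C
  induction z using SkewMonoidAlgebra.induction_on' with
  | add z w hz hw => rw [map_add]; exact add_mem hz hw
  | single μ c =>
    have h1 : (single μ c : ShiftRing k n) = cf k n c * single μ 1 := by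
      rw [GaloisRing.coeffHom_apply, single_mul_single, one_mul, one_smul, mul_one]
    rw [h1, map_mul]
    refine mul_mem (hcoeff c) (M.single_one_mem (fun p => ?_) μ)
    have h2 := hχ (x k p.1)
    rwa [shiftFrac_x, shiftVar_inner] at h2

/-- The invariants in the skew field of the ring of shift operators are generated by a Weyl algebra
with coefficients in the symmetric rational functions of the last row: the coordinates are the
power sums of the shifts of each row, which are invariant, and the dual coordinates are therefore
invariant as well. -/
theorem exists_weylHom :
    ∃ ψ : WeylAlgebra k (n * (n - 1) / 2) ⊗[k] FractionRing (MvPolynomial (Fin n) k) →ₐ[k] Q,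
      ∀ q, q ∈ Subfield.closure (Set.range ψ) ↔ ∀ σ, M.perm σ q = q := by
  classical
  obtain ⟨E, c, hdual, hc⟩ := M.exists_dualCoordinates
  obtain ⟨g, hg, hg'⟩ := M.exists_lastFrac
  set P : Inner n → Q := fun s => M.shiftFrac (algebraMap _ _ (psumCoord k s)) with hP
  set d : Inner n → Q :=
    DualCoordinates.dual M.shiftFrac (fun p : Inner n => M.coeff (x k p.1)) c with hd
  have hPP : ∀ s t, P s * P t = P t * P s := fun s t => by
    change M.shiftFrac _ * M.shiftFrac _ = M.shiftFrac _ * M.shiftFrac _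
    exact (Commute.all _ _).map M.shiftFrac
  have hdfix : ∀ σ s, M.perm σ (d s) = d s := by
    intro σ s
    simp only [hd, DualCoordinates.dual, _root_.map_sum, map_mul, perm_shiftFrac, hc, perm_coeff_x]
    exact Equiv.sum_comp (permInner σ) fun p => M.shiftFrac (c p s) * M.coeff (x k p.1)
  have hPfix : ∀ σ s, M.perm σ (P s) = P s := fun σ s => by
    rw [hP, perm_shiftFrac, ringAut_smul_algebraMap, permHom_psumCoord]
  have hgfix : ∀ σ f, M.perm σ (g f) = g f := by
    intro σ f
    have h1 : (M.perm σ).comp (g : _ →+* Q) = (g : _ →+* Q) := fractionRing_hom_ext fun a => by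
      change M.perm σ (g _) = g _
      rw [hg, perm_shiftFrac, ringAut_smul_algebraMap, permHom_lastHom]
    exact DFunLike.congr_fun h1 f
  have hdg : ∀ s f, Commute (d s) (g f) := by
    intro s f
    obtain ⟨a, b, -, rfl⟩ := IsFractionRing.div_surjective (A := MvPolynomial (Fin n) k) f
    have h1 : ∀ a, Commute (d s) (g (algebraMap (MvPolynomial (Fin n) k) _ a)) := by
      intro a
      rw [hg]
      refine Commute.sum_left _ _ _ fun p _ => Commute.mul_left ?_ (M.commute_coeff_x_lastHom p a)
      change _ * _ = _ * _
      rw [← map_mul, ← map_mul, mul_comm]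
    rw [div_eq_mul_inv, map_mul, map_inv₀]
    exact (h1 a).mul_right (h1 b).inv_right₀
  have hPg : ∀ s f, Commute (P s) (g f) := by
    intro s f
    obtain ⟨f', hf'⟩ := hg' f
    rw [hf']
    change _ * _ = _ * _
    rw [hP, ← map_mul, ← map_mul, mul_comm]
  let e : Fin (n * (n - 1) / 2) ≃ Inner n := (Fintype.equivFinOfCardEq card_inner).symm
  obtain ⟨W, hW⟩ := WeylAlgebra.exists_hom (k := k) (fun i => P (e i)) (fun i => d (e i))
    (fun i j => hPP _ _) (fun i j => hdual.dual_comm _ _) (fun i j => by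
      rw [hdual.dual_weyl]
      simp only [e.injective.eq_iff])
  -- properties of the image of the Weyl algebra are checked on its generators
  have hWind : ∀ S : Subalgebra k Q, (∀ s, P s ∈ S) → (∀ s, d s ∈ S) → ∀ w, W w ∈ S := by
    intro S hS hS' w
    have h1 : (Algebra.adjoin k (Set.range (WeylAlgebra.gen k))).map W ≤ S := by
      rw [AlgHom.map_adjoin, Algebra.adjoin_le_iff]
      rintro _ ⟨_, ⟨i | i, rfl⟩, rfl⟩
      · rw [hW]; exact hS _
      · rw [hW]; exact hS' _
    exact h1 ⟨w, by rw [WeylAlgebra.adjoin_range_gen]; trivial, rfl⟩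
  have hWg : ∀ w f, Commute (W w) (g f) := by
    intro w f
    have h1 := hWind (Subalgebra.centralizer k {g f})
      (fun s => Subalgebra.mem_centralizer_iff _ |>.2 fun y hy => by
        rw [Set.mem_singleton_iff.1 hy]; exact (hPg s f).symm)
      (fun s => Subalgebra.mem_centralizer_iff _ |>.2 fun y hy => by
        rw [Set.mem_singleton_iff.1 hy]; exact (hdg s f).symm) w
    exact ((Subalgebra.mem_centralizer_iff _).1 h1 _ rfl).symm
  have hWfix : ∀ σ w, M.perm σ (W w) = W w := by
    intro σ w
    let S : Subalgebra k Q :=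
      { (M.perm σ).eqLocus (RingHom.id Q) with
        algebraMap_mem' := fun a => by
          change M.perm σ (algebraMap k Q a) = algebraMap k Q a
          rw [← coeff_algebraMap M, perm_coeff,
            IsScalarTower.algebraMap_apply k (PolyRing k n) (FractionRing (PolyRing k n)),
            ringAut_smul_algebraMap, MvPolynomial.algebraMap_eq, permHom_C] }
    exact hWind S (hPfix σ) (hdfix σ) w
  let ψ : WeylAlgebra k (n * (n - 1) / 2) ⊗[k] FractionRing (MvPolynomial (Fin n) k) →ₐ[k] Q :=
    Algebra.TensorProduct.lift W g hWg
  have hψ : ∀ w f, ψ (w ⊗ₜ f) = W w * g f := fun w f => Algebra.TensorProduct.lift_tmul _ _ _ _ _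
  refine ⟨ψ, fun q => ?_⟩
  set D := Subfield.closure (Set.range ψ) with hD
  have hfix : ∀ z ∈ D, ∀ σ, M.perm σ z = z := by
    intro z hz σ
    have h1 : D ≤ (M.perm σ).eqLocusField (RingHom.id Q) := by
      rw [hD, Subfield.closure_le]
      rintro _ ⟨z, rfl⟩
      change M.perm σ (ψ z) = ψ z
      induction z using TensorProduct.induction_on with
      | zero => rw [map_zero, map_zero]
      | tmul w f => rw [hψ, map_mul, hWfix, hgfix]
      | add a b ha hb => rw [map_add, map_add, ha, hb]
    exact h1 hz
  have hWD : ∀ w, W w ∈ D := fun w =>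
    Subfield.subset_closure ⟨w ⊗ₜ 1, by rw [hψ, map_one, mul_one]⟩
  have hgD : ∀ f, g f ∈ D := fun f =>
    Subfield.subset_closure ⟨1 ⊗ₜ f, by rw [hψ, map_one, one_mul]⟩
  have hPD : ∀ s, P s ∈ D := fun s => by
    have h1 := hWD (WeylAlgebra.gen k (Sum.inl (e.symm s)))
    rwa [hW, Sum.elim_inl, e.apply_symm_apply] at h1
  have hdD : ∀ s, d s ∈ D := fun s => by
    have h1 := hWD (WeylAlgebra.gen k (Sum.inr (e.symm s)))
    rwa [hW, Sum.elim_inr, e.apply_symm_apply] at h1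
  have hkD : ∀ a : k, M.shiftFrac (algebraMap k _ a) ∈ D := fun a => by
    rw [shiftFrac_algebraMap_field, ← g.commutes]
    exact hgD _
  refine ⟨fun hq σ => hfix q hq σ, fun hq => ?_⟩
  refine M.mem_of_perm_fixed M.shiftFrac M.perm_shiftFrac D hfix hkD (fun r l => ?_) _
    M.closure_shiftFrac_coeff ?_ hq
  · by_cases hr : r.val + 1 < n
    · have h1 : (Algebra.adjoin k (Set.range fun l : Fin (r.val + 1) =>
          psum (Fin (r.val + 1)) k (l.val + 1))).map
            ((IsScalarTower.toAlgHom k (PolyRing k n) (FractionRing (PolyRing k n))).comp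
              (rowHom k r)) ≤
          ({ D.toSubring.comap M.shiftFrac with algebraMap_mem' := hkD } :
            Subalgebra k (FractionRing (PolyRing k n))) := by
        rw [AlgHom.map_adjoin, Algebra.adjoin_le_iff]
        rintro _ ⟨_, ⟨l, rfl⟩, rfl⟩
        have h2 := hPD ⟨⟨r, l⟩, hr⟩
        change M.shiftFrac (algebraMap _ _ (rowPsum k r (l.val + 1))) ∈ D at h2
        rw [← rowHom_psum] at h2
        exact h2
      have h2 := h1 ⟨_, symmetric_mem_adjoin_psum (psum_isSymmetric _ k l), rfl⟩
      rw [← rowHom_psum]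
      exact h2
    · obtain ⟨f, hf⟩ := exists_lastHom_eq_rowPsum (k := k) hr l
      rw [← hf, ← hg]
      exact hgD _
  · rintro _ (⟨f', rfl⟩ | ⟨p, rfl⟩) f
    · rw [← map_mul]
      exact Submodule.subset_span ⟨_, rfl⟩
    · have h1 := hdual.sum_dual p
      beta_reduce at h1 ⊢
      rw [← h1, Finset.mul_sum]
      refine sum_mem fun s _ => ?_
      rw [← mul_assoc, ← map_mul]
      have h2 : ∀ h, M.shiftFrac h * d s = d s * M.shiftFrac h -
          M.shiftFrac (∑ p, c p s * E p h) := fun h => by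
        rw [← hdual.dual_commutator, sub_sub_cancel]
      rw [h2]
      exact sub_mem (Submodule.smul_mem _ (⟨_, hdD s⟩ : D) (Submodule.subset_span ⟨_, rfl⟩))
        (Submodule.subset_span ⟨_, rfl⟩)

end FractionModel

/-- The Gelfand-Kirillov conjecture for `gl_n`: both skew fields are the invariants in the skew
field of the ring of shift operators. -/
theorem gelfandKirillov [CharZero k] :
    ∃ (_ : IsOreDomain
        (WeylAlgebra k (n * (n - 1) / 2) ⊗[k] FractionRing (MvPolynomial (Fin n) k))),
      Nonempty (SkewFrac (Ugl k n) ≃ₐ[k]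
        SkewFrac (WeylAlgebra k (n * (n - 1) / 2) ⊗[k] FractionRing (MvPolynomial (Fin n) k))) := by
  obtain ⟨M⟩ := nonempty_fractionModel (k := k) (n := n)
  obtain ⟨ψ, hψ⟩ := M.exists_weylHom
  have : CharZero (FractionRing (MvPolynomial (Fin n) k)) :=
    charZero_of_injective_algebraMap (FaithfulSMul.algebraMap_injective k _)
  have hore := WeylAlgebra.isOreDomain_tensor (k := k) ψ.toRingHom
  refine ⟨hore, SkewFrac.nonempty_algEquiv (M.incl.comp (gtHom k n))
    (M.incl_injective.comp gtHom_injective) ψ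
    (WeylAlgebra.tensor_hom_injective (k := k) ψ.toRingHom) ?_⟩
  ext q
  rw [M.mem_closure_gtHom_iff, hψ]

end GelfandTsetlin

theorem mainTheorem5 (k : Type*) [Field k] [CharZero k] (n : ℕ) :
    (∃ (h : GaloisRing.Setting (GelfandTsetlin.permGroup k n) (GelfandTsetlin.shiftMonoid k n))
        (φ : GelfandTsetlin.Ugl k n →+* GelfandTsetlin.ShiftRing k n),
      Function.Injective φ ∧
      (∀ c : k, φ (algebraMap k (GelfandTsetlin.Ugl k n) c) =
        GaloisRing.coeffHom (GelfandTsetlin.shiftMonoid k n)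
          (algebraMap k (FractionRing (GelfandTsetlin.PolyRing k n)) c)) ∧
      GelfandTsetlin.GTFormulas k n φ ∧
      (GelfandTsetlin.gtSubalgebra k n).toSubring.map φ =
        GaloisRing.baseRing (GelfandTsetlin.permGroup k n) (GelfandTsetlin.shiftMonoid k n) ∧
      GaloisRing.IsGaloisRing h φ.range) ∧
    ∃ (_ : IsOreDomain (GelfandTsetlin.Ugl k n))
      (_ : IsOreDomain
        (WeylAlgebra k (n * (n - 1) / 2) ⊗[k] FractionRing (MvPolynomial (Fin n) k))),
      Nonempty (SkewFrac (GelfandTsetlin.Ugl k n) ≃ₐ[k]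
        SkewFrac (WeylAlgebra k (n * (n - 1) / 2) ⊗[k] FractionRing (MvPolynomial (Fin n) k))) := by
  refine ⟨⟨GelfandTsetlin.setting k n, (GelfandTsetlin.gtHom k n : _ →+* _),
    GelfandTsetlin.gtHom_injective,
    fun c => ((GelfandTsetlin.gtHom k n).commutes c).trans (GelfandTsetlin.algebraMap_eq_cf c),
    GelfandTsetlin.gtFormulas, GelfandTsetlin.map_gtSubalgebra GelfandTsetlin.gtHom_injective, ?_⟩,
    GelfandTsetlin.isOreDomain_ugl, GelfandTsetlin.gelfandKirillov⟩
  rw [← GelfandTsetlin.toSubring_cornerImage]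
  exact GelfandTsetlin.isGaloisRing_cornerImage
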